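/- **Quantum sets.** A *quantum set* $\mathcal X$ is a set $\mathrm{At}(\mathcal X)$ of nonzero finite-dimensional complex Hilbert spaces (its *atoms*), possibly given as an indexed family. Let $\mathbf 1$ have the single atom $\mathbb C$, let $\mathcal X\times\mathcal Y$ have the atoms $X\otimes Y$, and let $\mathcal X^*$ have the atoms $X^*=L(X,\mathbb C)$, for $X\in\mathrm{At}(\mathcal X)$, $Y\in\mathrm{At}(\mathcal Y)$. Put $\ell(\mathcal X)=\prod_{X}L(X)$, and let $c_c(\mathcal X)\subseteq\ell(\mathcal X)$ be the $*$-algebra of all $a$ with $a(X)=0$ for all but finitely many atoms $X$. **Binary relations and functions.** A *binary relation* $R$ from $\mathcal X$ to $\mathcal Y$ is a choice of subspaces $R(X,Y)\subseteq L(X,Y)$, ordered atomwise. Put $(S\circ R)(X,Z)=\sum_Y \mathrm{span}\,S(Y,Z)R(X,Y)$, $R^\dagger(Y,X)=\{r^\dagger : r\in R(X,Y)\}$ and $(R\times S)(X\otimes X',Y\otimes Y')=R(X,Y)\otimes S(X',Y')$; $I_{\mathcal X}(X,X)=\mathbb C 1_X$, and $I_{\mathcal X}(X,X')=0$ for $X\ne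 X'$. For $F$ from $\mathcal X\times\mathcal Y$ to $\mathcal Z$ (or from $\mathbf 1$ to $\mathcal Z$), the conjugate $F_*$ from $\mathcal X^*\times\mathcal Y^*$ to $\mathcal Z^*$ (from $\mathbf 1$ to $\mathcal Z^*$) consists of the operators $t_*=(t^\dagger)^*\colon\xi\mapsto\xi\circ t^\dagger$ with $t$ in $F$. A binary relation $F$ is a *function* $F\colon\mathcal X\to\mathcal Y$ if $F^\dagger\circ F\ge I_{\mathcal X}$ and $F\circ F^\dagger\le I_{\mathcal Y}$. Then $F^\star\colon\ell(\mathcal Y)\to\ell(\mathcal X)$ denotes the unital $*$-homomorphism determined by $b(Y)\,t=t\,F^\star(b)(X)$ for all $t\in F(X,Y)$. **Quantum predicate logic.** A *relation of arity* $(\mathcal X_1,\dots,\mathcal X_n)$ is a choice of a subspace $R(X_1,\dots,X_n)\subseteq L(X_1\otimes\cdots\otimes X_n,\mathbb C)$ for all atoms $X_i\in\mathrm{At}(\mathcal X_i)$; $\top$ is the largest one and $\neg R$ is the atomwise orthogonal complement. A formula with free variables $x_1\in\mathcal X_1,\dots,x_n\in\mathcal X_n$ is interpreted as a relation of arity $(\mathcal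 X_1,\dots,\mathcal X_n)$: an atomic formula $R(x_{\pi(1)},\dots,x_{\pi(m)})$ in distinct variables is interpreted as the tensor product of $R$ with $\top$ in the remaining variables; $\neg$ and $\wedge$ are interpreted as $\neg$ and atomwise intersection; and $(\forall x\in\mathcal X)\,\varphi$ is interpreted as the largest $R$ such that $\top_{\mathcal X}\times R$ is below the interpretation of $\varphi$. One abbreviates $\varphi\vee\psi=\neg(\neg\varphi\wedge\neg\psi)$, $\varphi\to\psi=\neg\varphi\vee(\varphi\wedge\psi)$ and $(\exists x)\varphi=\neg(\forall x)\neg\varphi$. A sentence is *true* if its interpretation is $\top$. The *equality relation* $E_{\mathcal X}$ of arity $(\mathcal X,\mathcal X^*)$ is spanned on $X\otimes X^*$ by $x\otimes\xi\mapsto\xi(x)$ and vanishes on $X_1\otimes X_2^*$ for $X_1\neq X_2$. The diagonal quantifiers are $$(\forall (x=x_*)\in\mathcal X\times\mathcal X^*)\,\varphi\;=\;(\forall x_*\in\mathcal X^*)(\forall x\in\mathcal X)(E_{\mathcal X}(x,x_*)\to\varphi),$$ and $(\exists (x=x_*)\in\mathcal X\times\mathcal X^*)\,\varphi=\neg(\forall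 (x=x_*)\in\mathcal X\times\mathcal X^*)\,\neg\varphi$. For a function $F$ from $\mathcal X_1\times\cdots\times\mathcal X_m$ to $\mathcal Y$ (from $\mathbf 1$ if $m=0$), its *graph* $\hat F$ is the relation of arity $(\mathcal X_1,\dots,\mathcal X_m,\mathcal Y^*)$ consisting of the functionals $x_1\otimes\cdots\otimes x_m\otimes\eta\mapsto\eta(t(x_1\otimes\cdots\otimes x_m))$ with $t$ in $F$. If $t_1,\dots,t_n$ are terms built from variables and functions and are not all variables, then $R(t_1,\dots,t_n)$ abbreviates $$(\exists(y_n=y_{n*}))\cdots(\exists(y_1=y_{1*}))\,\bigl(R(y_1,\dots,y_n)\wedge t_1\!\curvearrowright\! y_{1*}\wedge\cdots\wedge t_n\!\curvearrowright\! y_{n*}\bigr),$$ where $t\curvearrowright y_*$ stands for $E(t,y_*)$ if $t$ is a variable, and for $\hat F(s_1,\dots,s_m,y_*)$ if $t=F(s_1,\dots,s_m)$. **Discrete quantum groups.** For an algebra $A$, $\mathrm{Mult}(A)$ is the algebra of pairs $m=(l,r)$ of linear maps $A\to A$, written $l(a)=ma$, $r(a)=am$, such that $m(ab)=(ma)b$,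 $(ab)m=a(bm)$ and $(am)b=a(mb)$. Let $A=c_c(\mathcal X)$, and let $\odot$ be the algebraic tensor product. Elements of $\ell(\mathcal X\times\mathcal X)$ are multipliers of its two-sided ideal $A\odot A$. For a $*$-homomorphism $\Delta\colon A\to\mathrm{Mult}(A\odot A)$, the pair $(A,\Delta)$ is a *discrete quantum group* (in the sense of Van Daele) if it is a multiplier Hopf $*$-algebra, i.e. if for all $a,b,c\in A$: $\Delta(a)(1\otimes b)$ and $(a\otimes1)\Delta(b)$ belong to $A\odot A$; $(a\otimes1\otimes1)(\Delta\otimes\iota)(\Delta(b)(1\otimes c))=(\iota\otimes\Delta)((a\otimes1)\Delta(b))(1\otimes1\otimes c)$; and the linear maps $T_1(a\otimes b)=\Delta(a)(1\otimes b)$ and $T_2(a\otimes b)=(a\otimes1)\Delta(b)$ are bijections of $A\odot A$. A *counit* of $(A,\Delta)$ is a homomorphism $\varepsilon\colon A\to\mathbb C$ such that $(\varepsilon\otimes\iota)(\Delta(a)(1\otimes b))=ab$ and $(\iota\otimes\varepsilon)((a\otimes1)\Delta(b))=ab$ for all $a,b\in A$. **Theorem.** Let $\mathcal X$ be a quantum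 set with at least one atom. (A) Let $F\colon\mathcal X\times\mathcal X\to\mathcal X$ and $C\colon\mathbf 1\to\mathcal X$ be functions such that, up to the canonical isomorphisms $(\mathcal X\times\mathcal X)\times\mathcal X\cong\mathcal X\times(\mathcal X\times\mathcal X)$ and $\mathbf 1\times\mathcal X\cong\mathcal X\cong\mathcal X\times\mathbf 1$, one has $F\circ(F\times I_{\mathcal X})=F\circ(I_{\mathcal X}\times F)$ and $F\circ(C\times I_{\mathcal X})=I_{\mathcal X}=F\circ(I_{\mathcal X}\times C)$, and such that the sentences (4) and (5) below are true. Then $\Delta=F^\star|_{c_c(\mathcal X)}$ is a $*$-homomorphism $c_c(\mathcal X)\to\mathrm{Mult}(c_c(\mathcal X)\odot c_c(\mathcal X))$, and $(c_c(\mathcal X),\Delta)$ is a discrete quantum group. (B) There is a one-to-one correspondence between the pairs $(F,C)$ of functions $F\colon\mathcal X\times\mathcal X\to\mathcal X$ and $C\colon\mathbf 1\to\mathcal X$ for which the sentences 1. $(\forall(x_1=x_{1*})\in\mathcal X\times\mathcal X^*)(\forall(x_2=x_{2*})\in\mathcal X\times\mathcal X^*)(\forall(x_3=x_{3*})\in\mathcal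 X\times\mathcal X^*)\; E_{\mathcal X}\bigl(F(F(x_1,x_2),x_3),\,F_*(x_{1*},F_*(x_{2*},x_{3*}))\bigr)$, 2. $(\forall(x=x_*)\in\mathcal X\times\mathcal X^*)\; E_{\mathcal X}(F(x,C),x_*)$, 3. $(\forall(x=x_*)\in\mathcal X\times\mathcal X^*)\; E_{\mathcal X}(F(C,x),x_*)$, 4. $(\forall x_1\in\mathcal X)(\exists x_2\in\mathcal X)\; E_{\mathcal X}(F(x_1,x_2),C_*)$, 5. $(\forall x_2\in\mathcal X)(\exists x_1\in\mathcal X)\; E_{\mathcal X}(F(x_1,x_2),C_*)$ are all true, and the $*$-homomorphisms $\Delta\colon c_c(\mathcal X)\to\mathrm{Mult}(c_c(\mathcal X)\odot c_c(\mathcal X))$ for which $(c_c(\mathcal X),\Delta)$ is a discrete quantum group. The correspondence is given by $\Delta=F^\star|_{c_c(\mathcal X)}$ and $\varepsilon=C^\star|_{c_c(\mathcal X)}$, where $\varepsilon$ is the (unique) counit of $(c_c(\mathcal X),\Delta)$. -/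

import Mathlib

open scoped TensorProduct ComplexConjugate

universe u v u' v' u'' v'' w

noncomputable section

/-! ## Duals of finite-dimensional Hilbert spaces -/

/-- The dual `H* = L(H, ℂ)` of a finite-dimensional Hilbert space is a Hilbert space: its inner
product is transported from `H` along the conjugate-linear Riesz isometry. -/
instance strongDualInnerProductSpace (H : Type*) [NormedAddCommGroup H] [InnerProductSpace ℂ H]
    [FiniteDimensional ℂ H] : InnerProductSpace ℂ (StrongDual ℂ H) :=
  haveI := FiniteDimensional.complete ℂ H
  { inner := fun ξ η =>
      inner ℂ ((InnerProductSpace.toDual ℂ H).symm η) ((InnerProductSpace.toDual ℂ H).symm ξ)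
    norm_sq_eq_re_inner := fun ξ => by
      rw [← norm_sq_eq_re_inner, LinearIsometryEquiv.norm_map]
    conj_inner_symm := fun ξ η => inner_conj_symm _ _
    add_left := fun ξ η ζ => by rw [map_add, inner_add_right]
    smul_left := fun ξ η c => by rw [map_smulₛₗ, inner_smul_right] }

/-! ## Quantum sets, their products, duals and binary relations -/

set_option linter.checkUnivs false in
/-- A quantum set: a set of nonzero finite-dimensional Hilbert spaces, its atoms.  The atoms are
given as a family indexed by the type `At`. -/
structure QSet : Type (max u v + 1) where
  /-- the (index set of) atoms -/
  At : Type u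
  /-- the atoms as Hilbert spaces -/
  H : At → Type v
  [normed : ∀ i, NormedAddCommGroup (H i)]
  [innerProd : ∀ i, InnerProductSpace ℂ (H i)]
  [finDim : ∀ i, FiniteDimensional ℂ (H i)]
  [nontriv : ∀ i, Nontrivial (H i)]

attribute [instance] QSet.normed QSet.innerProd QSet.finDim QSet.nontriv

namespace QSet

/-- The quantum set `𝟏`, whose only atom is `ℂ`. -/
abbrev one : QSet.{0, 0} where
  At := Unit
  H := fun _ => ℂ

/-- The Cartesian product: its atoms are the tensor products of atoms. -/
abbrev prod (X : QSet.{u, v}) (Y : QSet.{u', v'}) : QSet.{max u u', max v v'} where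
  At := X.At × Y.At
  H := fun p => X.H p.1 ⊗[ℂ] Y.H p.2
  nontriv := fun _ => inferInstance

/-- The dual quantum set: its atoms are the duals of the atoms. -/
abbrev dual (X : QSet.{u, v}) : QSet.{u, v} where
  At := X.At
  H := fun i => StrongDual ℂ (X.H i)
  nontriv := fun _ => inferInstance

/-- The algebra `ℓ(X) = ∏ L(X)` of all (not necessarily bounded) functions on a quantum set. -/
abbrev Ell (X : QSet.{u, v}) : Type (max u v) := ∀ i : X.At, X.H i →ₗ[ℂ] X.H i

/-- The functions that vanish at all but finitely many atoms, as a `*`-subalgebra of `ℓ(X)`. -/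
def finSupp (X : QSet.{u, v}) : NonUnitalStarSubalgebra ℂ X.Ell where
  carrier := {a | {i | a i ≠ 0}.Finite}
  add_mem' := fun {a b} ha hb => (ha.union hb).subset fun i hi => by
    by_contra h
    simp only [Set.mem_union, Set.mem_ofPred_eq, not_or, not_not] at h
    exact hi (by simp [h.1, h.2])
  zero_mem' := by simp
  mul_mem' := fun {a b} ha _ => ha.subset fun i hi h => hi (by simp [h])
  smul_mem' := fun c a ha => ha.subset fun i hi h => hi (by simp [h])
  star_mem' := fun {a} ha => ha.subset fun i hi h => hi (by simp [h])

/-- The `*`-algebra `c_c(X)` of functions that vanish at all but finitely many atoms. -/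
def cc (X : QSet.{u, v}) : Type (max u v) := X.finSupp

namespace cc

variable {X : QSet.{u, v}}

/-- An element of `c_c(X)` as an element of `ℓ(X)`. -/
def val (a : X.cc) : X.Ell := a.1

instance : NonUnitalRing X.cc := inferInstanceAs (NonUnitalRing X.finSupp)
instance : StarRing X.cc := inferInstanceAs (StarRing X.finSupp)
instance : Module ℂ X.cc := inferInstanceAs (Module ℂ X.finSupp)
instance : StarModule ℂ X.cc := inferInstanceAs (StarModule ℂ X.finSupp)
instance : SMulCommClass ℂ X.cc X.cc := inferInstanceAs (SMulCommClass ℂ X.finSupp X.finSupp)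
instance : IsScalarTower ℂ X.cc X.cc := inferInstanceAs (IsScalarTower ℂ X.finSupp X.finSupp)

end cc

end QSet

/-- A binary relation from `X` to `Y`: subspaces of `L(X, Y)` for all pairs of atoms. -/
abbrev BinRel (X : QSet.{u, v}) (Y : QSet.{u', v'}) :=
  ∀ (i : X.At) (j : Y.At), Submodule ℂ (X.H i →ₗ[ℂ] Y.H j)

namespace BinRel

variable {X : QSet.{u, v}} {Y : QSet.{u', v'}} {Z : QSet.{u'', v''}}

/-- The relation spanned, on each atom `i` of `X`, by a single operator to the atom `e i`
of `Y`, with all other components zero. -/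
def ofMap (e : X.At → Y.At) (t : ∀ i, X.H i →ₗ[ℂ] Y.H (e i)) : BinRel X Y :=
  fun i j => Submodule.span ℂ {s | ∃ h : e i = j, s = h ▸ t i}

variable (X) in
/-- The identity relation `I_X`. -/
def id : BinRel X X := ofMap (fun i => i) fun _ => LinearMap.id

/-- Composition: `(S ∘ R)(X, Z)` is the sum over `Y` of the spans of the products `S(Y, Z) R(X, Y)`. -/
def comp (S : BinRel Y Z) (R : BinRel X Y) : BinRel X Z :=
  fun i k => Submodule.span ℂ {t | ∃ j, ∃ s ∈ S j k, ∃ r ∈ R i j, t = s ∘ₗ r}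

/-- The adjoint relation, consisting of the Hermitian adjoints. -/
def dagger (R : BinRel X Y) : BinRel Y X :=
  fun j i => (R i j).map (LinearMap.adjoint : (X.H i →ₗ[ℂ] Y.H j) ≃ₗ⋆[ℂ] _).toLinearMap

/-- The product of two binary relations. -/
def prod {X' Y' : QSet} (R : BinRel X Y) (S : BinRel X' Y') : BinRel (X.prod X') (Y.prod Y') :=
  fun p q => Submodule.span ℂ {t | ∃ r ∈ R p.1 q.1, ∃ s ∈ S p.2 q.2, t = TensorProduct.map r s}

/-- The associator `(X × Y) × Z → X × (Y × Z)`. -/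
def assoc (X Y Z : QSet) : BinRel ((X.prod Y).prod Z) (X.prod (Y.prod Z)) :=
  ofMap (fun p => (p.1.1, (p.1.2, p.2)))
    fun p => (TensorProduct.assoc ℂ (X.H p.1.1) (Y.H p.1.2) (Z.H p.2)).toLinearMap

/-- The left unitor `𝟏 × X → X`. -/
def lunit (X : QSet) : BinRel (QSet.one.prod X) X :=
  ofMap (fun p => p.2) fun p => (TensorProduct.lid ℂ (X.H p.2)).toLinearMap

/-- The right unitor `X × 𝟏 → X`. -/
def runit (X : QSet) : BinRel (X.prod QSet.one) X :=
  ofMap (fun p => p.1) fun p => (TensorProduct.rid ℂ (X.H p.1)).toLinearMap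

/-- A binary relation `F` is a function if `F† ∘ F ≥ I` and `F ∘ F† ≤ I`. -/
structure IsFunction (F : BinRel X Y) : Prop where
  total : id X ≤ F.dagger.comp F
  univalent : F.comp F.dagger ≤ id Y

end BinRel

/-- Functions between quantum sets. -/
def QFun (X : QSet.{u, v}) (Y : QSet.{u', v'}) := {F : BinRel X Y // F.IsFunction}

namespace QFun

variable {X : QSet.{u, v}} {Y : QSet.{u', v'}}

theorem id_comm {j k : Y.At} {c : Y.H j →ₗ[ℂ] Y.H k} (hc : c ∈ BinRel.id Y j k) (b : Y.Ell) :
    c ∘ₗ b j = b k ∘ₗ c := by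
  induction hc using Submodule.span_induction with
  | mem t ht =>
    obtain ⟨h, rfl⟩ := ht
    cases h
    rfl
  | zero => simp
  | add s t _ _ hs ht => rw [LinearMap.add_comp, LinearMap.comp_add, hs, ht]
  | smul c t _ ht => rw [LinearMap.smul_comp, LinearMap.comp_smul, ht]

theorem id_mem (F : QFun X Y) (i : X.At) :
    LinearMap.id ∈ F.1.dagger.comp F.1 i i :=
  F.2.total i i (Submodule.subset_span ⟨rfl, rfl⟩)

theorem exists_pullback (F : QFun X Y) (b : Y.Ell) (i : X.At) :
    ∃ a : X.H i →ₗ[ℂ] X.H i, ∀ j, ∀ t ∈ F.1 i j, b j ∘ₗ t = t ∘ₗ a := by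
  suffices h : ∀ s ∈ F.1.dagger.comp F.1 i i, ∃ a : X.H i →ₗ[ℂ] X.H i,
      ∀ j, ∀ t ∈ F.1 i j, b j ∘ₗ t ∘ₗ s = t ∘ₗ a from h _ (id_mem F i)
  intro s hs
  induction hs using Submodule.span_induction with
  | mem s hs =>
    obtain ⟨k, s, hs, r, hr, rfl⟩ := hs
    refine ⟨s ∘ₗ b k ∘ₗ r, fun j t ht => ?_⟩
    have := id_comm (F.2.univalent k j (Submodule.subset_span ⟨i, t, ht, s, hs, rfl⟩)) b
    exact (congrArg (· ∘ₗ r) this).symm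
  | zero => exact ⟨0, by simp⟩
  | add s s' _ _ hs hs' =>
    obtain ⟨a, ha⟩ := hs
    obtain ⟨a', ha'⟩ := hs'
    exact ⟨a + a', fun j t ht => by
      rw [LinearMap.comp_add, LinearMap.comp_add, LinearMap.comp_add, ha j t ht, ha' j t ht]⟩
  | smul c s _ hs =>
    obtain ⟨a, ha⟩ := hs
    exact ⟨c • a, fun j t ht => by
      rw [LinearMap.comp_smul, LinearMap.comp_smul, LinearMap.comp_smul, ha j t ht]⟩

/-- The operator `F⋆(b)(X)` is determined by `b(Y) t = t F⋆(b)(X)` for all `Y` and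
all `t ∈ F(X, Y)`. -/
def pullbackFun (F : QFun X Y) (b : Y.Ell) : X.Ell :=
  fun i => (exists_pullback F b i).choose

theorem pullbackFun_spec (F : QFun X Y) (b : Y.Ell) (i : X.At) (j : Y.At)
    {t : X.H i →ₗ[ℂ] Y.H j} (ht : t ∈ F.1 i j) : b j ∘ₗ t = t ∘ₗ F.pullbackFun b i :=
  (exists_pullback F b i).choose_spec j t ht

theorem ext_of_comp (F : QFun X Y) (i : X.At) {a a' : X.H i →ₗ[ℂ] X.H i}
    (h : ∀ j, ∀ t ∈ F.1 i j, t ∘ₗ a = t ∘ₗ a') : a = a' := by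
  suffices h : ∀ s ∈ F.1.dagger.comp F.1 i i, s ∘ₗ a = s ∘ₗ a' from h _ (id_mem F i)
  intro s hs
  induction hs using Submodule.span_induction with
  | mem s hs =>
    obtain ⟨k, s, hs, r, hr, rfl⟩ := hs
    rw [LinearMap.comp_assoc, LinearMap.comp_assoc, h k r hr]
  | zero => simp
  | add s s' _ _ hs hs' => rw [LinearMap.add_comp, LinearMap.add_comp, hs, hs']
  | smul c s _ hs => rw [LinearMap.smul_comp, LinearMap.smul_comp, hs]

theorem pullbackFun_eq (F : QFun X Y) (b : Y.Ell) (a : X.Ell)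
    (h : ∀ i j, ∀ t ∈ F.1 i j, b j ∘ₗ t = t ∘ₗ a i) : F.pullbackFun b = a :=
  funext fun i => ext_of_comp F i fun j t ht => by
    rw [← pullbackFun_spec F b i j ht, h i j t ht]

theorem pullbackFun_star (F : QFun X Y) (b : Y.Ell) :
    F.pullbackFun (star b) = star (F.pullbackFun b) := by
  funext i
  suffices h : ∀ s ∈ F.1.dagger.comp F.1 i i,
      s ∘ₗ F.pullbackFun (star b) i = LinearMap.adjoint (F.pullbackFun b i) ∘ₗ s from
    h _ (id_mem F i)
  intro s hs
  induction hs using Submodule.span_induction with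
  | mem s hs =>
    obtain ⟨k, s, ⟨w, hw, rfl⟩, r, hr, rfl⟩ := hs
    have h₁ := pullbackFun_spec F (star b) i k hr
    have h₂ := congrArg LinearMap.adjoint (pullbackFun_spec F b i k hw)
    rw [LinearMap.adjoint_comp, LinearMap.adjoint_comp] at h₂
    rw [LinearMap.comp_assoc, ← h₁, ← LinearMap.comp_assoc]
    change (LinearMap.adjoint w ∘ₗ LinearMap.adjoint (b k)) ∘ₗ r = _
    rw [h₂]
    rfl
  | zero => simp
  | add s s' _ _ hs hs' => rw [LinearMap.add_comp, LinearMap.comp_add, hs, hs']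
  | smul c s _ hs => rw [LinearMap.smul_comp, LinearMap.comp_smul, hs]

/-- The unital `*`-homomorphism `F⋆ : ℓ(Y) → ℓ(X)` dual to a function `F : X → Y`.  It restricts to
the unital normal `*`-homomorphism between the algebras of bounded functions. -/
def pullback (F : QFun X Y) : Y.Ell →⋆ₐ[ℂ] X.Ell where
  toFun := F.pullbackFun
  map_one' := pullbackFun_eq F _ _ fun _ _ _ _ => rfl
  map_mul' := fun b c => pullbackFun_eq F _ _ fun i j t ht => by
    change (b j ∘ₗ c j) ∘ₗ t = t ∘ₗ (F.pullbackFun b i ∘ₗ F.pullbackFun c i)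
    rw [LinearMap.comp_assoc, pullbackFun_spec F c i j ht, ← LinearMap.comp_assoc,
      pullbackFun_spec F b i j ht, LinearMap.comp_assoc]
  map_zero' := pullbackFun_eq F _ _ fun _ _ _ _ => by simp
  map_add' := fun b c => pullbackFun_eq F _ _ fun i j t ht => by
    change (b j + c j) ∘ₗ t = t ∘ₗ (F.pullbackFun b i + F.pullbackFun c i)
    rw [LinearMap.add_comp, LinearMap.comp_add, pullbackFun_spec F b i j ht,
      pullbackFun_spec F c i j ht]
  commutes' := fun c => pullbackFun_eq F _ _ fun _ _ t _ => by
    ext x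
    simp [Algebra.algebraMap_eq_smul_one]
  map_star' := F.pullbackFun_star

/-- The restriction `C⋆|c_c(X) : c_c(X) → ℂ` for a function `C : 𝟏 → X`; an operator
in `ℓ(𝟏) = L(ℂ)` is identified with a scalar. -/
def pullbackScalar (C : QFun QSet.one X) : X.cc →ₙₐ[ℂ] ℂ where
  toFun := fun a => C.pullback a.val () 1
  map_smul' := fun c a => by
    change C.pullback (c • a.val) () 1 = _
    simp
  map_zero' := by
    change C.pullback 0 () 1 = _
    simp
  map_add' := fun a b => by
    change C.pullback (a.val + b.val) () 1 = _
    simp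
  map_mul' := fun a b => by
    have h : ∀ (f : ℂ →ₗ[ℂ] ℂ) (z : ℂ), f z = f 1 * z := fun f z => by
      rw [mul_comm, ← smul_eq_mul, ← map_smul, smul_eq_mul, mul_one]
    change C.pullback (a.val * b.val) () 1 = _
    rw [map_mul]
    exact h (C.pullback a.val ()) (C.pullback b.val () 1)

end QFun

/-! ## Quantum predicate logic: relations of many arguments -/

/-- A choice of one atom from each quantum set in a list. -/
abbrev Atoms (Γ : List QSet.{u, v}) := ∀ i : Fin Γ.length, (Γ.get i).At

/-- Multilinear functionals `X₁ × ⋯ × Xₙ → ℂ`, i.e. functionals on `X₁ ⊗ ⋯ ⊗ Xₙ`. -/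
abbrev Functional {Γ : List QSet.{u, v}} (a : Atoms Γ) :=
  MultilinearMap ℂ (fun i => (Γ.get i).H (a i)) ℂ

/-- The inner product of `L(X₁ ⊗ ⋯ ⊗ Xₙ, ℂ)`, computed in orthonormal bases of the factors
(it does not depend on their choice). -/
def functionalInner {Γ : List QSet.{u, v}} {a : Atoms Γ} (ξ η : Functional a) : ℂ :=
  ∑ k : (∀ i, Fin (Module.finrank ℂ ((Γ.get i).H (a i)))),
    conj (ξ fun i => stdOrthonormalBasis ℂ _ (k i)) * η fun i => stdOrthonormalBasis ℂ _ (k i)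

/-- A relation of arity `(X₁, …, Xₙ)`: a subspace of `L(X₁ ⊗ ⋯ ⊗ Xₙ, ℂ)` for each choice of atoms.
Meets, joins and the order are atomwise. -/
abbrev QRel (Γ : List QSet.{u, v}) := ∀ a : Atoms Γ, Submodule ℂ (Functional a)

/-- The orthocomplement `¬R`. -/
def QRel.neg {Γ : List QSet.{u, v}} (R : QRel Γ) : QRel Γ := fun a =>
  { carrier := {η | ∀ ξ ∈ R a, functionalInner ξ η = 0}
    add_mem' := fun {η η'} h h' ξ hξ => by
      have := h ξ hξ
      have := h' ξ hξ
      simp_all [functionalInner, mul_add, Finset.sum_add_distrib]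
    zero_mem' := fun ξ _ => by simp [functionalInner]
    smul_mem' := fun c η h ξ hξ => by
      have h := h ξ hξ
      simp only [functionalInner] at h ⊢
      simp only [smul_apply, smul_eq_mul, mul_left_comm _ c, ← Finset.mul_sum, h,
        mul_zero] }

/-- Variables of sort `X` in a context. -/
inductive Var : List QSet.{u, v} → QSet.{u, v} → Type (max u v + 1)
  | zero {X : QSet.{u, v}} {Γ : List QSet.{u, v}} : Var (X :: Γ) X
  | succ {X Y : QSet.{u, v}} {Γ : List QSet.{u, v}} : Var Γ X → Var (Y :: Γ) X

namespace Var

/-- The position of a variable. -/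
def idx {X : QSet.{u, v}} : {Γ : List QSet.{u, v}} → Var Γ X → Fin Γ.length
  | _, zero => 0
  | _, succ v => v.idx.succ

/-- The atom that is chosen for a variable. -/
def atom {X : QSet.{u, v}} : {Γ : List QSet.{u, v}} → Var Γ X → Atoms Γ → X.At
  | _, zero, a => a 0
  | _, succ v, a => v.atom fun i => a i.succ

/-- The vector that is chosen for a variable. -/
def vec {X : QSet.{u, v}} : {Γ : List QSet.{u, v}} → (v : Var Γ X) → {a : Atoms Γ} →
    (∀ i, (Γ.get i).H (a i)) → X.H (v.atom a)
  | _, zero, _, x => x 0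
  | _, succ v, _, x => v.vec fun i => x i.succ

/-- The variable at a given position. -/
def ofFin : (Δ : List QSet.{u, v}) → (j : Fin Δ.length) → Var Δ (Δ.get j)
  | _ :: _, ⟨0, _⟩ => zero
  | _ :: Δ, ⟨j + 1, h⟩ => succ (ofFin Δ ⟨j, Nat.lt_of_succ_lt_succ h⟩)

/-- The last variable of a context. -/
def last {Z : QSet.{u, v}} : (Δ : List QSet.{u, v}) → Var (Δ ++ [Z]) Z
  | [] => zero
  | _ :: Δ => succ (last Δ)

/-- A variable of `Δ` as a variable of `Δ, Z`. -/
def init {X Z : QSet.{u, v}} : {Δ : List QSet.{u, v}} → Var Δ X → Var (Δ ++ [Z]) X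
  | _, zero => zero
  | _, succ v => succ v.init

end Var

/-- The relation `⊤_X × R` of arity `(X, X₁, …, Xₙ)`. -/
def QRel.topProd {Γ : List QSet.{u, v}} (X : QSet.{u, v}) (R : QRel Γ) : QRel (X :: Γ) := fun a =>
  let x : Var (X :: Γ) X := .zero
  Submodule.span ℂ {ζ | ∃ η : X.H (x.atom a) →ₗ[ℂ] ℂ, ∃ ξ ∈ R (fun i => a i.succ),
    ∀ h, ζ h = η (x.vec h) * ξ fun i => h i.succ}

/-- The equality relation `E_X` of arity `(X, X*)`: the span of the evaluation functional on
`X ⊗ X*`, and zero on `X₁ ⊗ X₂*` for distinct atoms. -/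
def eqRel (X : QSet.{u, v}) : QRel [X, X.dual] := fun a =>
  let x : Var [X, X.dual] X := .zero
  let y : Var [X, X.dual] X.dual := .succ .zero
  Submodule.span ℂ {ζ | ∃ e : x.atom a = y.atom a, ∀ h, ζ h = y.vec h (e ▸ x.vec h)}

/-- The graph `E_Z ∘ (F × I)`, of arity `(X, Y, Z*)`, of a binary relation `F` from `X × Y`
to `Z`. -/
def BinRel.graph₂ {X Y Z : QSet.{u, v}} (F : BinRel (X.prod Y) Z) : QRel [X, Y, Z.dual] := fun a =>
  let x : Var [X, Y, Z.dual] X := .zero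
  let y : Var [X, Y, Z.dual] Y := .succ .zero
  let z : Var [X, Y, Z.dual] Z.dual := .succ (.succ .zero)
  Submodule.span ℂ {ζ | ∃ t ∈ F (x.atom a, y.atom a) (z.atom a), ∀ h,
    ζ h = z.vec h (t (x.vec h ⊗ₜ[ℂ] y.vec h))}

/-- The graph, of arity `(X*)`, of a binary relation `C` from `𝟏` to `X`. -/
def BinRel.graph₀ {X : QSet.{u, v}} (C : BinRel QSet.one X) : QRel [X.dual] := fun a =>
  let x : Var [X.dual] X.dual := .zero
  Submodule.span ℂ {ζ | ∃ t ∈ C () (x.atom a), ∀ h, ζ h = x.vec h (t (1 : ℂ))}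

/-- The conjugate `F_* : X* × Y* → Z*`; it consists of the operators `t_* = (t†)^*`, so that
`t_*(ξ ⊗ η) = (ξ ⊗ η) ∘ t†`. -/
def BinRel.conj₂ {X Y Z : QSet.{u, v}} (F : BinRel (X.prod Y) Z) :
    BinRel (X.dual.prod Y.dual) Z.dual := fun p k =>
  Submodule.span ℂ {s | ∃ t ∈ F p k, ∀ (ξ : StrongDual ℂ (X.H p.1)) (η : StrongDual ℂ (Y.H p.2))
    (z : Z.H k), (s (ξ ⊗ₜ[ℂ] η) : StrongDual ℂ (Z.H k)) z =
      TensorProduct.dualDistrib ℂ (X.H p.1) (Y.H p.2)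
        ((ξ : X.H p.1 →ₗ[ℂ] ℂ) ⊗ₜ[ℂ] (η : Y.H p.2 →ₗ[ℂ] ℂ)) (LinearMap.adjoint t z)}

/-- The conjugate `C_* : 𝟏 → X*`, where `ℂ*` is identified with `ℂ`. -/
def BinRel.conj₀ {X : QSet.{u, v}} (C : BinRel QSet.one X) : BinRel QSet.one X.dual := fun i k =>
  Submodule.span ℂ {s | ∃ t ∈ C i k, ∀ z : X.H k,
    (s (1 : ℂ) : StrongDual ℂ (X.H k)) z = (LinearMap.adjoint t z : ℂ)}

/-! ## Quantum predicate logic: formulas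

The context of a formula is the list of the sorts of its free variables; a quantifier binds the
first variable of the context. -/

/-- A tuple of variables of the context `Γ`, of the sorts listed in `Δ`. -/
def Vars (Γ Δ : List QSet.{u, v}) := ∀ ⦃X : QSet.{u, v}⦄, Var Δ X → Var Γ X

namespace Vars

/-- The empty tuple of variables. -/
def nil {Γ : List QSet.{u, v}} : Vars Γ [] := fun _ v => nomatch v

/-- The tuple `(v, ρ₁, …, ρₘ)`. -/
def cons {Γ Δ : List QSet.{u, v}} {X : QSet.{u, v}} (v : Var Γ X) (ρ : Vars Γ Δ) :
    Vars Γ (X :: Δ)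
  | _, .zero => v
  | _, .succ w => ρ w

/-- The tuple `(ρ₁, …, ρₘ, y)`. -/
def snoc {Γ : List QSet.{u, v}} {Z : QSet.{u, v}} :
    {Δ : List QSet.{u, v}} → Vars Γ Δ → Var Γ Z → Vars Γ (Δ ++ [Z])
  | [], _, y => cons y nil
  | _ :: _, ρ, y => cons (ρ .zero) (snoc (fun _ w => ρ w.succ) y)

end Vars

/-- The interpretation of `R(x_{π(1)}, …, x_{π(m)})` in the context `x₁, …, xₙ`: the product of `R`
with the maximal relation in the remaining variables, that is, the span of the functionals
`ξ(x_{π(1)}, …, x_{π(m)}) η(remaining variables)` with `ξ` in `R`.  The variables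
`x_{π(1)}, …, x_{π(m)}` are meant to be distinct. -/
def QRel.atomic {Γ Δ : List QSet.{u, v}} (R : QRel Δ) (ρ : Vars Γ Δ) : QRel Γ := fun a =>
  Submodule.span ℂ {ζ | ∃ ξ ∈ R (fun j => (ρ (Var.ofFin Δ j)).atom a),
    ∃ η : MultilinearMap ℂ (fun i : {i : Fin Γ.length // ∀ j, (ρ (Var.ofFin Δ j)).idx ≠ i} =>
      (Γ.get i).H (a i)) ℂ,
    ∀ x, ζ x = (ξ fun j => (ρ (Var.ofFin Δ j)).vec x) * η fun i => x i}

/-- Primitive formulas in a context. -/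
inductive Formula : List QSet.{u, v} → Type (max u v + 1)
  | rel {Γ Δ : List QSet.{u, v}} (R : QRel Δ) (ρ : Vars Γ Δ) : Formula Γ
  | neg {Γ : List QSet.{u, v}} (φ : Formula Γ) : Formula Γ
  | and {Γ : List QSet.{u, v}} (φ ψ : Formula Γ) : Formula Γ
  | all {Γ : List QSet.{u, v}} (X : QSet.{u, v}) (φ : Formula (X :: Γ)) : Formula Γ

namespace Formula

/-- The interpretation of a primitive formula as a relation.  The universal quantifier yields the
largest `R` such that `⊤_X × R` is below the interpretation of the quantified formula. -/
def interp : {Γ : List QSet.{u, v}} → Formula Γ → QRel Γ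
  | _, rel R ρ => R.atomic ρ
  | _, neg φ => φ.interp.neg
  | _, and φ ψ => φ.interp ⊓ ψ.interp
  | _, all X φ => sSup {R | R.topProd X ≤ φ.interp}

/-- A sentence is true if its interpretation is the maximal relation of arity `()`. -/
def IsTrue (φ : Formula.{u, v} []) : Prop := φ.interp = ⊤

variable {Γ : List QSet.{u, v}}

/-- Disjunction. -/
def or (φ ψ : Formula Γ) : Formula Γ := neg (and (neg φ) (neg ψ))

/-- Implication: the Sasaki arrow `¬φ ∨ (φ ∧ ψ)`. -/
def imp (φ ψ : Formula Γ) : Formula Γ := or (neg φ) (and φ ψ)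

/-- The existential quantifier. -/
def ex (X : QSet.{u, v}) (φ : Formula (X :: Γ)) : Formula Γ := neg (all X (neg φ))

/-- The formula `E_X(x, y)` for variables `x` of sort `X` and `y` of sort `X*`. -/
def eq {X : QSet.{u, v}} (x : Var Γ X) (y : Var Γ X.dual) : Formula Γ :=
  rel (eqRel X) (.cons x (.cons y .nil))

/-- The diagonal quantifier `(∀ (x = x_*) ∈ X × X*) φ`, which abbreviates
`(∀ x_* ∈ X*) (∀ x ∈ X) (E_X(x, x_*) → φ)`. -/
def allDiag (X : QSet.{u, v}) (φ : Formula (X :: X.dual :: Γ)) : Formula Γ :=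
  all X.dual (all X (imp (eq .zero (.succ .zero)) φ))

/-- The diagonal quantifier `(∃ (x = x_*) ∈ X × X*) φ`. -/
def exDiag (X : QSet.{u, v}) (φ : Formula (X :: X.dual :: Γ)) : Formula Γ :=
  neg (allDiag X (neg φ))

end Formula

/-! ## Quantum predicate logic: terms -/

mutual

/-- Terms of a given sort in a context.  A function symbol with arguments of the sorts listed in
`Δ` and values in `Y` is given by its graph, a relation of arity `(Δ, Y*)`. -/
inductive Term (Γ : List QSet.{u, v}) : QSet.{u, v} → Type (max u v + 1)
  | var {X : QSet.{u, v}} (x : Var Γ X) : Term Γ X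
  | app {Δ : List QSet.{u, v}} {Y : QSet.{u, v}} (G : QRel (Δ ++ [Y.dual])) (s : Terms Γ Δ) :
      Term Γ Y

/-- Tuples of terms of the sorts listed. -/
inductive Terms (Γ : List QSet.{u, v}) : List QSet.{u, v} → Type (max u v + 1)
  | nil : Terms Γ []
  | cons {X : QSet.{u, v}} {Δ : List QSet.{u, v}} (t : Term Γ X) (s : Terms Γ Δ) :
      Terms Γ (X :: Δ)

end

/-- If all the terms of a tuple are variables, the tuple of these variables. -/
def Terms.vars? {Γ : List QSet.{u, v}} : {Δ : List QSet.{u, v}} → Terms Γ Δ → Option (Vars Γ Δ)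
  | _, .nil => some .nil
  | _, .cons (.var x) s => s.vars?.map (Vars.cons x)
  | _, .cons (.app _ _) _ => none

/-- The context `y₁, y₁_*, …, yₙ, yₙ_*, Γ`, where `y₁, …, yₙ` have the sorts listed in `Δ`. -/
def pairCtx : List QSet.{u, v} → List QSet.{u, v} → List QSet.{u, v}
  | [], Γ => Γ
  | Y :: Δ, Γ => Y :: Y.dual :: pairCtx Δ Γ

/-- The variables of `Γ` in the extended context. -/
def Var.wk : (Δ : List QSet.{u, v}) → {Γ : List QSet.{u, v}} → {X : QSet.{u, v}} → Var Γ X →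
    Var (pairCtx Δ Γ) X
  | [], _, _, x => x
  | _ :: Δ, _, _, x => .succ (.succ (x.wk Δ))

/-- The new variables `y₁, …, yₙ`. -/
def Var.new (Γ : List QSet.{u, v}) : {Δ : List QSet.{u, v}} → {X : QSet.{u, v}} → Var Δ X →
    Var (pairCtx Δ Γ) X
  | _, _, .zero => .zero
  | _, _, .succ w => .succ (.succ (w.new Γ))

/-- The new variables `y₁_*, …, yₙ_*`. -/
def Var.newStar (Γ : List QSet.{u, v}) : {Δ : List QSet.{u, v}} → {X : QSet.{u, v}} → Var Δ X →
    Var (pairCtx Δ Γ) X.dual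
  | _, _, .zero => .succ .zero
  | _, _, .succ w => .succ (.succ (w.newStar Γ))

/-- The formula `(∃ (yₙ = yₙ_*) ∈ Yₙ × Yₙ*) ⋯ (∃ (y₁ = y₁_*) ∈ Y₁ × Y₁*) φ`. -/
def Formula.exDiags : (Δ : List QSet.{u, v}) → {Γ : List QSet.{u, v}} →
    Formula (pairCtx Δ Γ) → Formula Γ
  | [], _, φ => φ
  | Y :: Δ, _, φ => exDiags Δ (exDiag Y φ)

mutual

/-- The formula `t ↷ y_*`, in a context that contains the variables of `t` via `ρ`.  It is `E_Y(t, y_*)`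
if `t` is a variable, and `G(s₁, …, sₘ, y_*)` if `t` is `Ğ(s₁, …, sₘ)`.  Unless all of the
`sᵢ` are variables, the latter formula is expanded to
`(∃ (zₘ₊₁ = zₘ₊₁_*)) ⋯ (∃ (z₁ = z₁_*)) (G(z₁, …, zₘ₊₁) ∧ s₁ ↷ z₁_* ∧ ⋯ ∧ sₘ ↷ zₘ_* ∧ y_* ↷ zₘ₊₁_*)`. -/
def Term.graph {Γ : List QSet.{u, v}} : {Y : QSet.{u, v}} → Term Γ Y → {Γ' : List QSet.{u, v}} →
    Vars Γ' Γ → Var Γ' Y.dual → Formula Γ'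
  | _, .var x, _, ρ, y => .eq (ρ x) y
  | Y, .app (Δ := Δ) G s, Γ', ρ, y =>
    match s.vars? with
    | some σ => .rel G (.snoc (fun _ w => ρ (σ w)) y)
    | none => .exDiags (Δ ++ [Y.dual])
        (.and (s.graphs (.rel G fun _ w => w.new Γ') (fun _ w => (ρ w).wk _)
            fun _ w => w.init.newStar Γ')
          (.eq (y.wk _) ((Var.last Δ).newStar Γ')))

/-- The formula `φ ∧ t₁ ↷ y₁_* ∧ ⋯ ∧ tₙ ↷ yₙ_*`. -/
def Terms.graphs {Γ : List QSet.{u, v}} : {Δ : List QSet.{u, v}} → Terms Γ Δ →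
    {Γ' : List QSet.{u, v}} → (φ : Formula Γ') → Vars Γ' Γ →
    (∀ ⦃X : QSet.{u, v}⦄, Var Δ X → Var Γ' X.dual) → Formula Γ'
  | _, .nil, _, φ, _, _ => φ
  | _, .cons t s, _, φ, ρ, y => s.graphs (.and φ (t.graph ρ (y .zero))) ρ fun _ w => y w.succ

end

/-- The atomic formula `R(t₁, …, tₙ)`.  Unless all of the `tᵢ` are variables, it abbreviates
`(∃ (yₙ = yₙ_*)) ⋯ (∃ (y₁ = y₁_*)) (R(y₁, …, yₙ) ∧ t₁ ↷ y₁_* ∧ ⋯ ∧ tₙ ↷ yₙ_*)`. -/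
def Formula.atom {Γ Δ : List QSet.{u, v}} (R : QRel Δ) (t : Terms Γ Δ) : Formula Γ :=
  match t.vars? with
  | some σ => .rel R σ
  | none => .exDiags Δ (t.graphs (.rel R fun _ w => w.new Γ) (fun _ w => w.wk Δ)
      fun _ w => w.newStar Γ)

/-- The term `F(s, t)`. -/
def BinRel.app₂ {Γ : List QSet.{u, v}} {X Y Z : QSet.{u, v}} (F : BinRel (X.prod Y) Z)
    (s : Term Γ X) (t : Term Γ Y) : Term Γ Z :=
  .app (Δ := [X, Y]) F.graph₂ (.cons s (.cons t .nil))

/-- The constant term `C`. -/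
def BinRel.const {Γ : List QSet.{u, v}} {X : QSet.{u, v}} (C : BinRel QSet.one X) : Term Γ X :=
  .app (Δ := []) C.graph₀ .nil

/-- The formula `E_X(s, t)`. -/
def Formula.equal {Γ : List QSet.{u, v}} {X : QSet.{u, v}} (s : Term Γ X) (t : Term Γ X.dual) :
    Formula Γ :=
  .atom (eqRel X) (.cons s (.cons t .nil))

section Axioms

variable {X : QSet.{u, v}} (F : BinRel (X.prod X) X) (C : BinRel QSet.one X)

/-- `(∀ (x₁ = x₁_*)) (∀ (x₂ = x₂_*)) (∀ (x₃ = x₃_*)) E(F(F(x₁, x₂), x₃), F_*(x₁_*, F_*(x₂_*, x₃_*)))`. -/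
def assocSentence : Formula.{u, v} [] :=
  .allDiag X <| .allDiag X <| .allDiag X <|
    -- the context is `x₃, x₃_*, x₂, x₂_*, x₁, x₁_*`
    let x₃ := Term.var Var.zero
    let x₃s := Term.var Var.zero.succ
    let x₂ := Term.var Var.zero.succ.succ
    let x₂s := Term.var Var.zero.succ.succ.succ
    let x₁ := Term.var Var.zero.succ.succ.succ.succ
    let x₁s := Term.var Var.zero.succ.succ.succ.succ.succ
    .equal (F.app₂ (F.app₂ x₁ x₂) x₃) (F.conj₂.app₂ x₁s (F.conj₂.app₂ x₂s x₃s))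

/-- `(∀ (x = x_*)) E(F(x, C), x_*)`. -/
def rightUnitSentence : Formula.{u, v} [] :=
  .allDiag X <| .equal (F.app₂ (.var .zero) C.const) (.var (.succ .zero))

/-- `(∀ (x = x_*)) E(F(C, x), x_*)`. -/
def leftUnitSentence : Formula.{u, v} [] :=
  .allDiag X <| .equal (F.app₂ C.const (.var .zero)) (.var (.succ .zero))

/-- `(∀ x₁) (∃ x₂) E(F(x₁, x₂), C_*)`. -/
def rightInverseSentence : Formula.{u, v} [] :=
  .all X <| .ex X <| .equal (F.app₂ (.var (.succ .zero)) (.var .zero)) C.conj₀.const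

/-- `(∀ x₂) (∃ x₁) E(F(x₁, x₂), C_*)`. -/
def leftInverseSentence : Formula.{u, v} [] :=
  .all X <| .ex X <| .equal (F.app₂ (.var .zero) (.var (.succ .zero))) C.conj₀.const

end Axioms

/-! ## Multipliers and multiplier Hopf `*`-algebras -/

/-- Star operation on the algebraic tensor product of (nonunital) `*`-algebras. -/
instance tensorStarRing (A : Type w) [NonUnitalRing A] [StarRing A] [Module ℂ A] [StarModule ℂ A]
    [SMulCommClass ℂ A A] [IsScalarTower ℂ A A] : StarRing (A ⊗[ℂ] A) where
  star_mul := fun x y =>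
    x.induction_on (by simp)
      (fun _ _ => y.induction_on (by simp) (fun _ _ => by simp)
        fun _ _ h₁ h₂ => by simp [add_mul, mul_add, h₁, h₂])
      fun _ _ h₁ h₂ => by simp [add_mul, mul_add, h₁, h₂]
  star_add := by simp

section Multipliers

variable (A : Type w) [NonUnitalRing A] [Module ℂ A] [SMulCommClass ℂ A A] [IsScalarTower ℂ A A]

/-- The multiplier algebra `Mult(A)`: pairs `(l, r)` of linear maps such that `l(ab) = l(a)b`,
`r(ab) = a r(b)` and `r(a) b = a l(b)`; `l` and `r` are to be thought of as `a ↦ ma` and `a ↦ am`. -/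
def Mult : Subalgebra ℂ (Module.End ℂ A × (Module.End ℂ A)ᵐᵒᵖ) where
  carrier := {m | (∀ a b, m.1 (a * b) = m.1 a * b) ∧ (∀ a b, m.2.unop (a * b) = a * m.2.unop b) ∧
    ∀ a b, m.2.unop a * b = a * m.1 b}
  mul_mem' := fun {m n} hm hn => by
    obtain ⟨h₁, h₂, h₃⟩ := hm
    obtain ⟨k₁, k₂, k₃⟩ := hn
    exact ⟨fun a b => by simp [h₁, k₁], fun a b => by simp [h₂, k₂],
      fun a b => by simp [h₃, k₃]⟩
  add_mem' := fun {m n} hm hn => by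
    obtain ⟨h₁, h₂, h₃⟩ := hm
    obtain ⟨k₁, k₂, k₃⟩ := hn
    exact ⟨fun a b => by simp [h₁, k₁, add_mul], fun a b => by simp [h₂, k₂, mul_add],
      fun a b => by simp [h₃, k₃, add_mul, mul_add]⟩
  algebraMap_mem' := fun c => by
    refine ⟨fun a b => ?_, fun a b => ?_, fun a b => ?_⟩ <;>
      simp [Algebra.algebraMap_eq_smul_one, smul_mul_assoc, mul_smul_comm]

variable {A}

namespace Mult

/-- The product `m a` of a multiplier and an element of the algebra. -/
def left (m : Mult A) (a : A) : A := m.1.1 a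

/-- The product `a m` of an element of the algebra and a multiplier. -/
def right (m : Mult A) (a : A) : A := m.1.2.unop a

/-- An element of the algebra as a multiplier. -/
def of (a : A) : Mult A :=
  ⟨(LinearMap.mulLeft ℂ a, .op (LinearMap.mulRight ℂ a)),
    fun b c => by simp [mul_assoc], fun b c => by simp [mul_assoc],
    fun b c => by simp [mul_assoc]⟩

/-- The involution of the multiplier algebra: `m* a = (a* m)*` and `a m* = (m a*)*`. -/
instance [StarRing A] [StarModule ℂ A] : Star (Mult A) where
  star m :=
    ⟨((starLinearEquiv ℂ (A := A)).toLinearMap.comp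
        (m.1.2.unop.comp (starLinearEquiv ℂ (A := A)).toLinearMap),
      .op ((starLinearEquiv ℂ (A := A)).toLinearMap.comp
        (m.1.1.comp (starLinearEquiv ℂ (A := A)).toLinearMap))), by
      obtain ⟨h₁, h₂, h₃⟩ := m.2
      refine ⟨fun a b => by simp [h₂], fun a b => by simp [h₁], fun a b => ?_⟩
      apply star_injective
      simp [h₃]⟩

/-- The multiplier `m ⊗ n` of `A ⊗ A`. -/
def tensor (m n : Mult A) : Mult (A ⊗[ℂ] A) :=
  ⟨(TensorProduct.map m.1.1 n.1.1, .op (TensorProduct.map m.1.2.unop n.1.2.unop)), by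
    obtain ⟨h₁, h₂, h₃⟩ := m.2
    obtain ⟨k₁, k₂, k₃⟩ := n.2
    refine ⟨fun s t => ?_, fun s t => ?_, fun s t => ?_⟩ <;>
    · refine s.induction_on (by simp) (fun a b => ?_) fun _ _ e₁ e₂ => ?_
      · refine t.induction_on (by simp) (fun c d => ?_) fun _ _ e₁ e₂ => ?_
        · simp [h₁, h₂, h₃, k₁, k₂, k₃]
        · simp_all [mul_add]
      · simp_all [add_mul]⟩

end Mult

variable [StarRing A] [StarModule ℂ A]

variable (A) in
/-- The `*`-homomorphisms `A → Mult(A ⊙ A)`. -/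
abbrev Comult := A →⋆ₙₐ[ℂ] Mult (A ⊗[ℂ] A)

/-- `(A, Δ)` is a multiplier Hopf `*`-algebra: for all `a, b` the multipliers
`Δ(a)(1 ⊗ b)` and `(a ⊗ 1)Δ(b)` lie in `A ⊗ A`, the comultiplication is coassociative,
`(a ⊗ 1 ⊗ 1)(Δ ⊗ ι)(Δ(b)(1 ⊗ c)) = (ι ⊗ Δ)((a ⊗ 1)Δ(b))(1 ⊗ 1 ⊗ c)`,
and the linear maps `T₁(a ⊗ b) = Δ(a)(1 ⊗ b)` and `T₂(a ⊗ b) = (a ⊗ 1)Δ(b)` are bijections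
of `A ⊗ A`.  Both sides of the coassociativity equation are elements of `A ⊗ A ⊗ A`, because
`(a ⊗ 1 ⊗ 1)(Δ(p) ⊗ q) = T₂(a ⊗ p) ⊗ q` and `(p ⊗ Δ(q))(1 ⊗ 1 ⊗ c) = p ⊗ T₁(q ⊗ c)`. -/
def IsMultiplierHopfStar (Δ : Comult A) : Prop :=
  ∃ T₁ T₂ : A ⊗[ℂ] A →ₗ[ℂ] A ⊗[ℂ] A,
    (∀ a b, Mult.of (T₁ (a ⊗ₜ b)) = Δ a * Mult.tensor 1 (Mult.of b)) ∧
    (∀ a b, Mult.of (T₂ (a ⊗ₜ b)) = Mult.tensor (Mult.of a) 1 * Δ b) ∧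
    (∀ a b c : A,
      TensorProduct.assoc ℂ A A A
          (TensorProduct.map (T₂ ∘ₗ TensorProduct.mk ℂ A A a) LinearMap.id (T₁ (b ⊗ₜ c))) =
        TensorProduct.map LinearMap.id (T₁ ∘ₗ (TensorProduct.mk ℂ A A).flip c) (T₂ (a ⊗ₜ b))) ∧
    Function.Bijective T₁ ∧ Function.Bijective T₂

/-- `ε` is a counit: `(ε ⊗ ι)(Δ(a)(1 ⊗ b)) = ab` and `(ι ⊗ ε)((a ⊗ 1)Δ(b)) = ab`. -/
def IsCounit (Δ : Comult A) (ε : A →ₙₐ[ℂ] ℂ) : Prop :=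
  (∀ (a b : A) (t : A ⊗[ℂ] A), Mult.of t = Δ a * Mult.tensor 1 (Mult.of b) →
    TensorProduct.lid ℂ A (TensorProduct.map (ε : A →ₗ[ℂ] ℂ) LinearMap.id t) = a * b) ∧
  (∀ (a b : A) (t : A ⊗[ℂ] A), Mult.of t = Mult.tensor (Mult.of a) 1 * Δ b →
    TensorProduct.rid ℂ A (TensorProduct.map LinearMap.id (ε : A →ₗ[ℂ] ℂ) t) = a * b)

end Multipliers

/-! ## Discrete quantum groups -/

namespace QSet

variable {X : QSet.{u, v}}

/-- `(c_c(X), Δ)` is a discrete quantum group: a multiplier Hopf `*`-algebra whose underlying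
`*`-algebra is a direct sum of full matrix algebras, as `c_c(X)` always is. -/
def IsDiscreteQuantumGroup (Δ : Comult X.cc) : Prop := IsMultiplierHopfStar Δ

variable (X) in
/-- The inclusion `c_c(X) ⊙ c_c(X) → ℓ(X × X)`, given by `a ⊗ b ↦ ((X₁, X₂) ↦ a(X₁) ⊗ b(X₂))`. -/
def incl : X.cc ⊗[ℂ] X.cc →ₗ[ℂ] (X.prod X).Ell :=
  TensorProduct.lift <| LinearMap.mk₂ ℂ
    (fun a b => fun p => TensorProduct.map (a.val p.1) (b.val p.2))
    (fun _ _ _ => funext fun _ => TensorProduct.map_add_left _ _ _)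
    (fun _ _ _ => funext fun _ => TensorProduct.map_smul_left _ _ _)
    (fun _ _ _ => funext fun _ => TensorProduct.map_add_right _ _ _)
    (fun _ _ _ => funext fun _ => TensorProduct.map_smul_right _ _ _)

/-- The multiplier `m` of the ideal `c_c(X) ⊙ c_c(X)` of `ℓ(X × X)` is the one given
by multiplication by the element `f`. -/
def IsMultiplicationBy (m : Mult (X.cc ⊗[ℂ] X.cc)) (f : (X.prod X).Ell) : Prop :=
  ∀ t, incl X (Mult.left m t) = f * incl X t ∧ incl X (Mult.right m t) = incl X t * f

/-- `Δ = F⋆|c_c(X)`. -/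
def IsRestriction (Δ : Comult X.cc) (F : QFun (X.prod X) X) : Prop :=
  ∀ a : X.cc, IsMultiplicationBy (Δ a) (F.pullback a.val)

/-- Functions `F : X × X → X` and `C : 𝟏 → X` that satisfy the five axioms. -/
structure SatisfiesGroupAxioms (F : QFun (X.prod X) X) (C : QFun QSet.one X) : Prop where
  assoc : (assocSentence F.1).IsTrue
  right_unit : (rightUnitSentence F.1 C.1).IsTrue
  left_unit : (leftUnitSentence F.1 C.1).IsTrue
  right_inverse : (rightInverseSentence F.1 C.1).IsTrue
  left_inverse : (leftInverseSentence F.1 C.1).IsTrue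

end QSet

end

noncomputable section

/-! ## Finitely supported functions -/

namespace QSet

namespace cc

variable {X : QSet.{u, v}}

-- The proof connects three descriptions of the same data: sentences of the predicate logic,
-- equations between functions of quantum sets, and identities for the dual homomorphism Δ = F⋆.
--
-- Logic. A relation is regarded as a space of functions on tuples of vectors, inside a commutative
-- algebra. An atomic formula in distinct variables is then the product of a space of functions of
-- its own variables with all multilinear functions of the other ones (`Vars.fn_atomic`).
-- Conjunction of formulas in disjoint sets of variables is multiplication (`mul_multilin_inf`), and
-- a diagonal existential quantifier is the contraction of a pair of variables
-- (`Formula.fn_exDiag`). Hence the auxiliary quantifiers that expand a nested term carry out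
-- exactly the substitution of the inner values (`Term.denotes_app₂`, `Formula.fn_equal`). If the
-- terms s and t have the values of relations R and S, then E(s, t) consists of the functionals
-- given by S† ∘ R (`span_pairing`). A diagonal universal quantifier tests a formula at the
-- evaluation functional (`Formula.mem_allDiag`). So sentences 1 to 3 say that a unitary structure
-- map lies in a composite relation, which for functions amounts to associativity and the unit laws
-- (`QFun.eq_comp_ofUnitary_iff`, `QFun.eq_ofUnitary_iff`). Sentences 4 and 5 say that the
-- functionals τ in C† ∘ F, with one argument fixed, span the dual of the atom of the other
-- argument.
--
-- Duality. By Schur's lemma and totality a function consists of all operators that intertwine its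
-- pullback (`QFun.mem_iff`), so it is determined by its pullback. Conversely the intertwiners of a
-- nondegenerate *-homomorphism form a function (`QFun.isFunction_homRel`). Thus associativity is
-- coassociativity, and the unit laws are the counit laws.
--
-- From the axioms to a quantum group. The point is the bijectivity of T₁. For τ in C† ∘ F,
-- associativity and the unit law give (ι ⊗ τ)(Δ ⊗ ι)Δ(a) = a(ι ⊗ τ), the quantum form of "(x y) y'
-- = x if y y' = 1"; this is `QFun.HasInverter`. Together with sentence 5 it recovers t from T₁(t),
-- which is injectivity. With sentence 4 it shows that "x y = z" holds, for given atoms of y and z,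
-- at finitely many atoms of x only, so Δ(a)(1 ⊗ b) has finite support. The adjoint identity
-- produces explicit preimages, which suffice by sentence 4, and this is surjectivity. The map T₂ is
-- T₁ of the opposite operation, conjugated by the flip and the involution.
--
-- From a quantum group to the axioms. Surjectivity of T₁ makes Δ nondegenerate, so Δ = F⋆ for some
-- F. The counit comes from the identity p ⊗ μT₁⁻¹(q ⊗ b) = μT₂⁻¹(p ⊗ q) ⊗ b, where μ is the
-- multiplication (`IsHopf.tmul_mul_inverse`). It is a character, every character of c_c(X)
-- preserves the involution, and so it is dual to a function C. If sentence 4 or 5 failed, a nonzero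
-- vector y would be annihilated by all the corresponding functionals, and T₂ or T₁ would annihilate
-- a nonzero element built from the rank-one operator |y⟩⟨y| and the unit of an atom at which C
-- lives. Since the counit is unique, Δ determines both F and C.

theorem val_injective : Function.Injective (val : X.cc → X.Ell) := Subtype.val_injective

theorem ext {a b : X.cc} (h : ∀ i, a.val i = b.val i) : a = b := val_injective (funext h)

@[simp] theorem val_add (a b : X.cc) : (a + b).val = a.val + b.val := rfl
@[simp] theorem val_zero : (0 : X.cc).val = 0 := rfl
@[simp] theorem val_mul (a b : X.cc) : (a * b).val = a.val * b.val := rfl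
@[simp] theorem val_smul (c : ℂ) (a : X.cc) : (c • a).val = c • a.val := rfl
@[simp] theorem val_star (a : X.cc) : (star a).val = star a.val := rfl

theorem finite_support (a : X.cc) : {i | a.val i ≠ 0}.Finite := a.2

/-- The inclusion `c_c(X) → ℓ(X)` as a linear map. -/
def valₗ : X.cc →ₗ[ℂ] X.Ell where
  toFun := val
  map_add' := fun _ _ => rfl
  map_smul' := fun _ _ => rfl

@[simp] theorem val_sum {ι : Type*} (s : Finset ι) (f : ι → X.cc) :
    (∑ n ∈ s, f n).val = ∑ n ∈ s, (f n).val := map_sum valₗ f s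

/-- A function with finite support as an element of `c_c(X)`. -/
def mk (a : X.Ell) (h : {i | a i ≠ 0}.Finite) : X.cc := ⟨a, h⟩

@[simp] theorem val_mk (a : X.Ell) (h : {i | a i ≠ 0}.Finite) : (mk a h).val = a := rfl

end cc

variable (X : QSet.{u, v})

open Classical in
/-- The function that is equal to a given operator at one atom, and zero at all others. -/
def single (i : X.At) : (X.H i →ₗ[ℂ] X.H i) →ₗ[ℂ] X.cc where
  toFun a := cc.mk (LinearMap.single ℂ (fun i => X.H i →ₗ[ℂ] X.H i) i a)
    ((Set.finite_singleton i).subset fun j hj => by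
      by_contra h
      exact hj (Pi.single_eq_of_ne (M := fun i => X.H i →ₗ[ℂ] X.H i) h a))
  map_add' a b := cc.val_injective (map_add (LinearMap.single ℂ (fun i => X.H i →ₗ[ℂ] X.H i) i) a b)
  map_smul' c a := cc.val_injective (map_smul (LinearMap.single ℂ (fun i => X.H i →ₗ[ℂ] X.H i) i) c a)

variable {X}

@[simp] theorem single_val_same (i : X.At) (a : X.H i →ₗ[ℂ] X.H i) : (X.single i a).val i = a := by
  classical exact Pi.single_eq_same (M := fun i => X.H i →ₗ[ℂ] X.H i) i a

theorem single_val_of_ne {i j : X.At} (h : j ≠ i) (a : X.H i →ₗ[ℂ] X.H i) :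
    (X.single i a).val j = 0 := by
  classical exact Pi.single_eq_of_ne (M := fun i => X.H i →ₗ[ℂ] X.H i) h a

theorem single_mul (i : X.At) (a : X.H i →ₗ[ℂ] X.H i) (b : X.cc) :
    X.single i a * b = X.single i (a ∘ₗ b.val i) := by
  refine cc.ext fun j => ?_
  by_cases h : j = i
  · subst h
    simp only [cc.val_mul, Pi.mul_apply, single_val_same]
    rfl
  · simp [single_val_of_ne h]

theorem single_star (i : X.At) (a : X.H i →ₗ[ℂ] X.H i) :
    star (X.single i a) = X.single i (LinearMap.adjoint a) := by
  refine cc.ext fun j => ?_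
  by_cases h : j = i
  · subst h
    simp only [cc.val_star, Pi.star_apply, single_val_same]
    rfl
  · simp [single_val_of_ne h]

theorem cc.eq_sum_single (a : X.cc) {S : Finset X.At} (h : ∀ i, i ∉ S → a.val i = 0) :
    a = ∑ i ∈ S, X.single i (a.val i) := by
  refine cc.ext fun j => ?_
  rw [cc.val_sum, Finset.sum_apply]
  by_cases hj : j ∈ S
  · rw [Finset.sum_eq_single j]
    · simp
    · intro i _ hij
      exact single_val_of_ne hij.symm _
    · exact fun h => absurd hj h
  · rw [h j hj, Finset.sum_eq_zero]
    intro i hi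
    exact single_val_of_ne (ne_of_mem_of_not_mem hi hj).symm _

theorem cc.exists_finset (a : X.cc) : ∃ S : Finset X.At, ∀ i, i ∉ S → a.val i = 0 :=
  ⟨a.finite_support.toFinset, fun i hi => by simpa using hi⟩

/-- The characteristic function of a finite set of atoms. -/
def indicator (S : Finset X.At) : X.cc := ∑ i ∈ S, X.single i LinearMap.id

theorem indicator_val_of_mem {S : Finset X.At} {i : X.At} (h : i ∈ S) :
    (indicator S).val i = LinearMap.id := by
  rw [indicator, cc.val_sum, Finset.sum_apply, Finset.sum_eq_single i]
  · simp
  · intro j _ hij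
    exact single_val_of_ne hij.symm _
  · exact fun h' => absurd h h'

theorem indicator_mul {S : Finset X.At} {a : X.cc} (h : ∀ i, i ∉ S → a.val i = 0) :
    indicator S * a = a := by
  refine cc.ext fun i => ?_
  by_cases hi : i ∈ S
  · rw [cc.val_mul, Pi.mul_apply, indicator_val_of_mem hi]
    rfl
  · simp [h i hi]

end QSet

/-! ## The calculus of binary relations and functions -/

/-- The rank-one operator `x ↦ ⟨w, x⟩ y`. -/
def ketBra {H K : Type*} [NormedAddCommGroup H] [InnerProductSpace ℂ H] [NormedAddCommGroup K]
    [InnerProductSpace ℂ K] (y : K) (w : H) : H →ₗ[ℂ] K :=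
  (innerₛₗ ℂ w).smulRight y

@[simp] theorem ketBra_apply {H K : Type*} [NormedAddCommGroup H] [InnerProductSpace ℂ H]
    [NormedAddCommGroup K] [InnerProductSpace ℂ K] (y : K) (w x : H) :
    ketBra y w x = inner ℂ w x • y := rfl

namespace BinRel

variable {X : QSet.{u, v}} {Y : QSet.{u', v'}} {Z : QSet.{u'', v''}}

theorem adjoint_mem_dagger {R : BinRel X Y} {i : X.At} {j : Y.At} {t : X.H i →ₗ[ℂ] Y.H j}
    (ht : t ∈ R i j) : LinearMap.adjoint t ∈ R.dagger j i :=
  ⟨t, ht, rfl⟩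

theorem comp_mem_comp {S : BinRel Y Z} {R : BinRel X Y} {i : X.At} {j : Y.At} {k : Z.At}
    {s : Y.H j →ₗ[ℂ] Z.H k} {r : X.H i →ₗ[ℂ] Y.H j} (hs : s ∈ S j k) (hr : r ∈ R i j) :
    s ∘ₗ r ∈ S.comp R i k :=
  Submodule.subset_span ⟨j, s, hs, r, hr, rfl⟩

theorem map_mem_prod {X' Y' : QSet} {R : BinRel X Y} {S : BinRel X' Y'}
    {i : X.At} {j : Y.At} {i' : X'.At} {j' : Y'.At} {r : X.H i →ₗ[ℂ] Y.H j}
    {s : X'.H i' →ₗ[ℂ] Y'.H j'} (hr : r ∈ R i j) (hs : s ∈ S i' j') :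
    TensorProduct.map r s ∈ R.prod S (i, i') (j, j') :=
  Submodule.subset_span ⟨r, hr, s, hs, rfl⟩

theorem id_mem_id (i : X.At) : LinearMap.id ∈ BinRel.id X i i :=
  Submodule.subset_span ⟨rfl, rfl⟩

theorem comp_mem_of_mem_id {R : BinRel X Y} {i : X.At} {j k : Y.At} {c : Y.H j →ₗ[ℂ] Y.H k}
    (hc : c ∈ BinRel.id Y j k) {t : X.H i →ₗ[ℂ] Y.H j} (ht : t ∈ R i j) : c ∘ₗ t ∈ R i k := by
  induction hc using Submodule.span_induction with
  | mem c hc =>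
    obtain ⟨h, rfl⟩ := hc
    cases h
    exact ht
  | zero => simp
  | add s t _ _ hs ht => rw [LinearMap.add_comp]; exact add_mem hs ht
  | smul c t _ ht => rw [LinearMap.smul_comp]; exact Submodule.smul_mem _ _ ht

/-- Schur's lemma: an operator between atoms that commutes with `c_c(Y)` is a scalar. -/
theorem mem_id_of_comm {j k : Y.At} {c : Y.H j →ₗ[ℂ] Y.H k}
    (hc : ∀ b : Y.cc, c ∘ₗ b.val j = b.val k ∘ₗ c) : c ∈ BinRel.id Y j k := by
  by_cases h : k = j
  · subst h
    obtain ⟨y, hy⟩ := exists_ne (0 : Y.H k)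
    -- Commutation with the rank-one operator `ketBra z y`, evaluated at `y`, reads ⟨y, y⟩ c(z) =
    -- ⟨y, c(y)⟩ z, with a scalar that does not depend on z.
    have key : ∀ z, c z = ((inner ℂ y y)⁻¹ * inner ℂ y (c y)) • z := fun z => by
      have := LinearMap.congr_fun (hc (Y.single k (ketBra z y))) y
      simp only [QSet.single_val_same, LinearMap.comp_apply, ketBra_apply, map_smul] at this
      rw [mul_smul, ← this, smul_smul, inv_mul_cancel₀ (by simpa using hy), one_smul]
    have : c = ((inner ℂ y y)⁻¹ * inner ℂ y (c y)) • LinearMap.id := LinearMap.ext key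
    rw [this]
    exact Submodule.smul_mem _ _ (id_mem_id k)
  -- Between different atoms, the unit of the atom `j` acts as the identity on the source and as
  -- zero on the target.
  · have := hc (Y.single j LinearMap.id)
    rw [QSet.single_val_same, QSet.single_val_of_ne h, LinearMap.comp_id, LinearMap.zero_comp]
      at this
    rw [this]
    exact zero_mem _

/-- A binary relation is a function if it satisfies the two inequalities on generators. -/
theorem IsFunction.mk' {F : BinRel X Y}
    (h₁ : ∀ i, LinearMap.id ∈ F.dagger.comp F i i)
    (h₂ : ∀ i j k, ∀ t ∈ F i j, ∀ s ∈ F i k, t ∘ₗ LinearMap.adjoint s ∈ BinRel.id Y k j) :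
    F.IsFunction where
  total := fun i j => by
    refine Submodule.span_le.2 ?_
    rintro _ ⟨rfl, rfl⟩
    exact h₁ i
  univalent := fun k j => by
    refine Submodule.span_le.2 ?_
    rintro _ ⟨i, t, ht, _, ⟨s, hs, rfl⟩, rfl⟩
    exact h₂ i j k t ht s hs

end BinRel

namespace QFun

variable {X : QSet.{u, v}} {Y : QSet.{u', v'}} {Z : QSet.{u'', v''}}

theorem ext {F G : QFun X Y} (h : ∀ i j, F.1 i j = G.1 i j) : F = G :=
  Subtype.ext (funext fun i => funext fun j => h i j)

theorem pullback_spec (F : QFun X Y) (b : Y.Ell) {i : X.At} {j : Y.At}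
    {t : X.H i →ₗ[ℂ] Y.H j} (ht : t ∈ F.1 i j) : b j ∘ₗ t = t ∘ₗ F.pullback b i :=
  F.pullbackFun_spec b i j ht

theorem pullback_eq (F : QFun X Y) (b : Y.Ell) (a : X.Ell)
    (h : ∀ i j, ∀ t ∈ F.1 i j, b j ∘ₗ t = t ∘ₗ a i) : F.pullback b = a :=
  F.pullbackFun_eq b a h

/-- This is the adjoint of the intertwining relation for b*, because F⋆ preserves the involution. -/
theorem pullback_adjoint (F : QFun X Y) (b : Y.Ell) {i : X.At} {j : Y.At}
    {t : X.H i →ₗ[ℂ] Y.H j} (ht : t ∈ F.1 i j) :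
    F.pullback b i ∘ₗ LinearMap.adjoint t = LinearMap.adjoint t ∘ₗ b j := by
  have h := congrArg LinearMap.adjoint (F.pullback_spec (star b) ht)
  rw [map_star, LinearMap.adjoint_comp, LinearMap.adjoint_comp] at h
  have e₁ : LinearMap.adjoint ((star b) j) = b j := star_star (b j)
  have e₂ : LinearMap.adjoint ((star (F.pullback b)) i) = F.pullback b i :=
    star_star (F.pullback b i)
  rw [e₁, e₂] at h
  exact h.symm

theorem comp_adjoint_mem_id (F : QFun X Y) {i : X.At} {j k : Y.At} {t : X.H i →ₗ[ℂ] Y.H j}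
    {s : X.H i →ₗ[ℂ] Y.H k} (ht : t ∈ F.1 i j) (hs : s ∈ F.1 i k) :
    t ∘ₗ LinearMap.adjoint s ∈ BinRel.id Y k j :=
  F.2.univalent k j (BinRel.comp_mem_comp ht (BinRel.adjoint_mem_dagger hs))

/-- A function consists of all operators that intertwine its pullback. -/
theorem mem_iff (F : QFun X Y) {i : X.At} {j : Y.At} {t : X.H i →ₗ[ℂ] Y.H j} :
    t ∈ F.1 i j ↔ ∀ b : Y.cc, b.val j ∘ₗ t = t ∘ₗ F.pullback b.val i := by
  refine ⟨fun ht b => F.pullback_spec b.val ht, fun h => ?_⟩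
  -- By totality the identity is a sum of operators s†r with s, r in F, so t is a sum of (t s†)r.
  -- Each t s† commutes with c_c(Y), is a scalar by Schur's lemma, and therefore keeps r in F.
  suffices h : ∀ s ∈ F.1.dagger.comp F.1 i i, t ∘ₗ s ∈ F.1 i j from h _ (id_mem F i)
  intro s hs
  induction hs using Submodule.span_induction with
  | mem s hs =>
    obtain ⟨k, _, ⟨s, hs, rfl⟩, r, hr, rfl⟩ := hs
    change t ∘ₗ LinearMap.adjoint s ∘ₗ r ∈ _
    rw [← LinearMap.comp_assoc]
    refine BinRel.comp_mem_of_mem_id (BinRel.mem_id_of_comm fun b => ?_) hr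
    rw [LinearMap.comp_assoc, ← F.pullback_adjoint b.val hs, ← LinearMap.comp_assoc, ← h b,
      LinearMap.comp_assoc]
  | zero => simp
  | add s t _ _ hs ht => rw [LinearMap.comp_add]; exact add_mem hs ht
  | smul c t _ ht => rw [LinearMap.comp_smul]; exact Submodule.smul_mem _ _ ht

/-- `mem_iff` recovers a function from its pullback on finitely supported elements. All equations
between functions are later derived from identities in ℓ(X) in this way. -/
theorem ext_of_pullback {F G : QFun X Y}
    (h : ∀ (b : Y.cc) i, F.pullback b.val i = G.pullback b.val i) : F = G :=
  ext fun i j => Submodule.ext fun t => by simp only [mem_iff, h]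

/-- The operators of the smaller function satisfy the intertwining relation of the larger one, and
totality of the smaller one makes this relation determine the pullback. -/
theorem eq_of_le {F G : QFun X Y} (h : F.1 ≤ G.1) : F = G :=
  ext_of_pullback fun _ => congrFun <| F.pullback_eq _ _ fun _ _ _ ht =>
    G.pullback_spec _ (h _ _ ht)

/-- An operator s†r with s in G and r in F intertwines F⋆(b) with G⋆(b). If the identity is a sum of
such operators, the pullbacks agree. -/
theorem eq_of_id_le {F G : QFun X Y} (h : BinRel.id X ≤ G.1.dagger.comp F.1) : F = G := by
  refine ext_of_pullback fun b i => ?_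
  suffices h' : ∀ s ∈ G.1.dagger.comp F.1 i i,
      s ∘ₗ F.pullback b.val i = G.pullback b.val i ∘ₗ s from
    h' LinearMap.id (h i i (BinRel.id_mem_id i))
  intro s hs
  induction hs using Submodule.span_induction with
  | mem s hs =>
    obtain ⟨k, _, ⟨s, hs, rfl⟩, r, hr, rfl⟩ := hs
    change (LinearMap.adjoint s ∘ₗ r) ∘ₗ _ = _ ∘ₗ (LinearMap.adjoint s ∘ₗ r)
    rw [LinearMap.comp_assoc, ← F.pullback_spec b.val hr, ← LinearMap.comp_assoc,
      ← G.pullback_adjoint b.val hs, LinearMap.comp_assoc]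
  | zero => simp
  | add s t _ _ hs ht => rw [LinearMap.comp_add, LinearMap.add_comp, hs, ht]
  | smul c t _ ht => rw [LinearMap.comp_smul, LinearMap.smul_comp, ht]

/-- At each atom, the pullback depends on the values at finitely many atoms only. -/
theorem exists_finset_pullback (F : QFun X Y) (i : X.At) :
    ∃ M : Finset Y.At, ∀ b : Y.Ell, (∀ j ∈ M, b j = 0) → F.pullback b i = 0 := by
  classical
  -- Each generator of F† ∘ F factors through a single atom of `Y`, and the identity is a finite
  -- combination of generators.
  suffices h : ∀ s ∈ F.1.dagger.comp F.1 i i, ∃ M : Finset Y.At, ∀ b : Y.Ell,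
      (∀ j ∈ M, b j = 0) → s ∘ₗ F.pullback b i = 0 from h _ (id_mem F i)
  intro s hs
  induction hs using Submodule.span_induction with
  | mem s hs =>
    obtain ⟨k, s, hs, r, hr, rfl⟩ := hs
    refine ⟨{k}, fun b hb => ?_⟩
    rw [LinearMap.comp_assoc, ← F.pullback_spec b hr, hb k (Finset.mem_singleton_self k),
      LinearMap.zero_comp, LinearMap.comp_zero]
  | zero => exact ⟨∅, by simp⟩
  | add s t _ _ hs ht =>
    obtain ⟨M, hM⟩ := hs
    obtain ⟨N, hN⟩ := ht
    exact ⟨M ∪ N, fun b hb => by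
      rw [LinearMap.add_comp, hM b fun j hj => hb j (Finset.mem_union_left _ hj),
        hN b fun j hj => hb j (Finset.mem_union_right _ hj), add_zero]⟩
  | smul c t _ ht =>
    obtain ⟨M, hM⟩ := ht
    exact ⟨M, fun b hb => by rw [LinearMap.smul_comp, hM b hb, smul_zero]⟩

theorem comp_spec (G : QFun Y Z) (F : QFun X Y) (b : Z.Ell) {i : X.At} {k : Z.At}
    {t : X.H i →ₗ[ℂ] Z.H k} (ht : t ∈ G.1.comp F.1 i k) :
    b k ∘ₗ t = t ∘ₗ F.pullback (G.pullback b) i := by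
  induction ht using Submodule.span_induction with
  | mem t ht =>
    obtain ⟨l, g, hg, f, hf, rfl⟩ := ht
    rw [LinearMap.comp_assoc, ← F.pullback_spec _ hf, ← LinearMap.comp_assoc,
      G.pullback_spec _ hg, LinearMap.comp_assoc]
  | zero => simp
  | add s t _ _ hs ht => rw [LinearMap.comp_add, LinearMap.add_comp, hs, ht]
  | smul c t _ ht => rw [LinearMap.comp_smul, LinearMap.smul_comp, ht]

theorem comp_spec_adjoint (G : QFun Y Z) (F : QFun X Y) (b : Z.Ell) {i : X.At} {k : Z.At}
    {t : X.H i →ₗ[ℂ] Z.H k} (ht : t ∈ G.1.comp F.1 i k) :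
    LinearMap.adjoint t ∘ₗ b k = F.pullback (G.pullback b) i ∘ₗ LinearMap.adjoint t := by
  induction ht using Submodule.span_induction with
  | mem t ht =>
    obtain ⟨l, g, hg, f, hf, rfl⟩ := ht
    rw [LinearMap.adjoint_comp, LinearMap.comp_assoc, ← G.pullback_adjoint _ hg,
      ← LinearMap.comp_assoc, ← F.pullback_adjoint _ hf, LinearMap.comp_assoc]
  | zero => simp
  | add s t _ _ hs ht => rw [map_add, LinearMap.comp_add, LinearMap.add_comp, hs, ht]
  | smul c t _ ht => rw [map_smulₛₗ, LinearMap.comp_smul, LinearMap.smul_comp, ht]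

/-- Used with c = 1, which is available by totality of `G`: any s†r in F† ∘ F is then seen to lie in
(G ∘ F)† ∘ (G ∘ F). -/
theorem comp_total_aux (G : QFun Y Z) (F : QFun X Y) {i : X.At} {k : Y.At}
    {s r : X.H i →ₗ[ℂ] Y.H k} (hs : s ∈ F.1 i k) (hr : r ∈ F.1 i k) {c : Y.H k →ₗ[ℂ] Y.H k}
    (hc : c ∈ G.1.dagger.comp G.1 k k) :
    LinearMap.adjoint s ∘ₗ c ∘ₗ r ∈ (G.1.comp F.1).dagger.comp (G.1.comp F.1) i i := by
  induction hc using Submodule.span_induction with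
  | mem c hc =>
    obtain ⟨l, _, ⟨g, hg, rfl⟩, g', hg', rfl⟩ := hc
    have h := BinRel.comp_mem_comp (BinRel.adjoint_mem_dagger (BinRel.comp_mem_comp hg hs))
      (BinRel.comp_mem_comp hg' hr)
    rw [LinearMap.adjoint_comp, LinearMap.comp_assoc] at h
    rw [LinearMap.comp_assoc]
    exact h
  | zero => simp
  | add s t _ _ hs ht => rw [LinearMap.add_comp, LinearMap.comp_add]; exact add_mem hs ht
  | smul c t _ ht =>
    rw [LinearMap.smul_comp, LinearMap.comp_smul]; exact Submodule.smul_mem _ _ ht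

theorem isFunction_comp (G : QFun Y Z) (F : QFun X Y) : (G.1.comp F.1).IsFunction := by
  refine BinRel.IsFunction.mk' (fun i => ?_) fun i j k t ht s hs => ?_
  · have h : F.1.dagger.comp F.1 i i ≤ (G.1.comp F.1).dagger.comp (G.1.comp F.1) i i := by
      refine Submodule.span_le.2 ?_
      rintro _ ⟨k, _, ⟨s, hs, rfl⟩, r, hr, rfl⟩
      have := comp_total_aux G F hs hr (id_mem G k)
      rw [LinearMap.id_comp] at this
      exact this
    exact h (id_mem F i)
  · refine BinRel.mem_id_of_comm fun b => ?_
    rw [LinearMap.comp_assoc, comp_spec_adjoint G F b.val hs, ← LinearMap.comp_assoc,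
      ← comp_spec G F b.val ht, LinearMap.comp_assoc]

/-- The composition of functions. -/
def comp (G : QFun Y Z) (F : QFun X Y) : QFun X Z := ⟨G.1.comp F.1, isFunction_comp G F⟩

theorem pullback_comp (G : QFun Y Z) (F : QFun X Y) (b : Z.Ell) :
    (G.comp F).pullback b = F.pullback (G.pullback b) :=
  (G.comp F).pullback_eq _ _ fun _ _ _ ht => comp_spec G F b ht

theorem adjoint_comp_unitary {H K : Type*} [NormedAddCommGroup H] [InnerProductSpace ℂ H]
    [FiniteDimensional ℂ H] [NormedAddCommGroup K] [InnerProductSpace ℂ K] [FiniteDimensional ℂ K]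
    (t : H ≃ₗᵢ[ℂ] K) :
    LinearMap.adjoint t.toLinearEquiv.toLinearMap ∘ₗ t.toLinearEquiv.toLinearMap = LinearMap.id := by
  ext x
  refine ext_inner_left ℂ fun y => ?_
  simp [LinearMap.adjoint_inner_right]

theorem unitary_comp_adjoint {H K : Type*} [NormedAddCommGroup H] [InnerProductSpace ℂ H]
    [FiniteDimensional ℂ H] [NormedAddCommGroup K] [InnerProductSpace ℂ K] [FiniteDimensional ℂ K]
    (t : H ≃ₗᵢ[ℂ] K) :
    t.toLinearEquiv.toLinearMap ∘ₗ LinearMap.adjoint t.toLinearEquiv.toLinearMap = LinearMap.id := by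
  ext x
  obtain ⟨x, rfl⟩ := t.surjective x
  exact congrArg t (LinearMap.congr_fun (adjoint_comp_unitary t) x)

theorem ofMap_mem (e : X.At → Y.At) (t : ∀ i, X.H i →ₗ[ℂ] Y.H (e i)) (i : X.At) :
    t i ∈ BinRel.ofMap e t i (e i) :=
  Submodule.subset_span ⟨rfl, rfl⟩

/-- The span has at most one generator. The case distinction exposes the equation between atoms, so
that substituting it removes the transport. -/
theorem ofMap_mem_cases {e : X.At → Y.At} {t : ∀ i, X.H i →ₗ[ℂ] Y.H (e i)} {i : X.At} {j : Y.At}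
    {s : X.H i →ₗ[ℂ] Y.H j} (hs : s ∈ BinRel.ofMap e t i j) :
    s = 0 ∨ ∃ h : e i = j, ∃ c : ℂ, s = c • (h ▸ t i) := by
  by_cases h : e i = j
  · subst h
    right
    have : {s | ∃ h : e i = e i, s = h ▸ t i} = {t i} := by
      ext s
      exact ⟨fun ⟨_, h⟩ => h, fun h => ⟨rfl, h⟩⟩
    rw [BinRel.ofMap, this, Submodule.mem_span_singleton] at hs
    obtain ⟨c, rfl⟩ := hs
    exact ⟨rfl, c, rfl⟩
  · left
    have : {s | ∃ h : e i = j, s = h ▸ t i} = ∅ := by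
      ext s
      exact ⟨fun ⟨h', _⟩ => h h', fun h => h.elim⟩
    rw [BinRel.ofMap, this, Submodule.span_empty] at hs
    exact hs

/-- A map of atoms together with unitary operators is a function. -/
def ofUnitary (e : X.At → Y.At) (t : ∀ i, X.H i ≃ₗᵢ[ℂ] Y.H (e i)) : QFun X Y :=
  ⟨BinRel.ofMap e fun i => (t i).toLinearEquiv.toLinearMap, BinRel.IsFunction.mk'
    (fun i => by
      rw [← adjoint_comp_unitary (t i)]
      exact BinRel.comp_mem_comp (BinRel.adjoint_mem_dagger (ofMap_mem e _ i)) (ofMap_mem e _ i))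
    (fun i j k a ha b hb => by
      obtain rfl | ⟨rfl, c, rfl⟩ := ofMap_mem_cases ha
      · simp
      obtain rfl | ⟨rfl, d, rfl⟩ := ofMap_mem_cases hb
      · simp
      rw [map_smulₛₗ, LinearMap.smul_comp, LinearMap.comp_smul, unitary_comp_adjoint (t i)]
      exact Submodule.smul_mem _ _ (Submodule.smul_mem _ _ (BinRel.id_mem_id _)))⟩

theorem ofUnitary_mem (e : X.At → Y.At) (t : ∀ i, X.H i ≃ₗᵢ[ℂ] Y.H (e i)) (i : X.At) :
    (t i).toLinearEquiv.toLinearMap ∈ (ofUnitary e t).1 i (e i) :=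
  ofMap_mem e _ i

variable (X) in
/-- The identity function. -/
def id : QFun X X := ofUnitary (fun i => i) fun i => LinearIsometryEquiv.refl ℂ (X.H i)

@[simp] theorem pullback_id (b : X.Ell) : (id X).pullback b = b :=
  (id X).pullback_eq _ _ fun _ _ _ ht => (id_comm ht b).symm

/-- The associator as a function. -/
def assoc (X : QSet.{u, v}) (Y : QSet.{u', v'}) (Z : QSet.{u'', v''}) :
    QFun ((X.prod Y).prod Z) (X.prod (Y.prod Z)) :=
  ofUnitary (fun p => (p.1.1, (p.1.2, p.2)))
    fun p => TensorProduct.assocIsometry ℂ (X.H p.1.1) (Y.H p.1.2) (Z.H p.2)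

/-- The left unitor as a function. -/
def lunit (X : QSet.{u, v}) : QFun (QSet.one.prod X) X :=
  ofUnitary (fun p => p.2) fun p => TensorProduct.lidIsometry ℂ (X.H p.2)

/-- The right unitor as a function. -/
def runit (X : QSet.{u, v}) : QFun (X.prod QSet.one) X :=
  ofUnitary (fun p => p.1) fun p => TensorProduct.ridIsometry ℂ (X.H p.1)

end QFun

/-! ## Products of functions -/

namespace QFun

variable {X : QSet.{u, v}} {Y : QSet.{u', v'}} {X' Y' : QSet}

theorem map_mem_id {j k : Y.At} {j' k' : Y'.At} {c : Y.H j →ₗ[ℂ] Y.H k}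
    {d : Y'.H j' →ₗ[ℂ] Y'.H k'} (hc : c ∈ BinRel.id Y j k) (hd : d ∈ BinRel.id Y' j' k') :
    TensorProduct.map c d ∈ BinRel.id (Y.prod Y') (j, j') (k, k') := by
  obtain rfl | ⟨rfl, c, rfl⟩ := ofMap_mem_cases hc
  · simp
  obtain rfl | ⟨rfl, d, rfl⟩ := ofMap_mem_cases hd
  · simp
  rw [TensorProduct.map_smul_left, TensorProduct.map_smul_right]
  refine Submodule.smul_mem _ _ (Submodule.smul_mem _ _ ?_)
  rw [TensorProduct.map_id]
  exact BinRel.id_mem_id (X := Y.prod Y') (j, j')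

theorem map_mem_prod_total (F : QFun X Y) (G : QFun X' Y') {i : X.At} {i' : X'.At}
    {s : X.H i →ₗ[ℂ] X.H i} {s' : X'.H i' →ₗ[ℂ] X'.H i'} (hs : s ∈ F.1.dagger.comp F.1 i i)
    (hs' : s' ∈ G.1.dagger.comp G.1 i' i') :
    TensorProduct.map s s' ∈ (F.1.prod G.1).dagger.comp (F.1.prod G.1) (i, i') (i, i') := by
  induction hs using Submodule.span_induction with
  | mem s hs =>
    induction hs' using Submodule.span_induction with
    | mem s' hs' =>
      obtain ⟨k, _, ⟨s, hs, rfl⟩, r, hr, rfl⟩ := hs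
      obtain ⟨k', _, ⟨s', hs', rfl⟩, r', hr', rfl⟩ := hs'
      have h := BinRel.comp_mem_comp (X := X.prod X') (Y := Y.prod Y') (Z := X.prod X')
        (R := F.1.prod G.1) (S := (F.1.prod G.1).dagger)
        (BinRel.adjoint_mem_dagger (X := X.prod X') (Y := Y.prod Y') (BinRel.map_mem_prod hs hs'))
        (BinRel.map_mem_prod hr hr')
      rw [TensorProduct.map_comp]
      rw [TensorProduct.adjoint_map] at h
      exact h
    | zero => simp
    | add s t _ _ hs ht => rw [TensorProduct.map_add_right]; exact add_mem hs ht
    | smul c t _ ht => rw [TensorProduct.map_smul_right]; exact Submodule.smul_mem _ _ ht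
  | zero => simp
  | add s t _ _ hs ht => rw [TensorProduct.map_add_left]; exact add_mem hs ht
  | smul c t _ ht => rw [TensorProduct.map_smul_left]; exact Submodule.smul_mem _ _ ht

theorem isFunction_prod (F : QFun X Y) (G : QFun X' Y') : (F.1.prod G.1).IsFunction := by
  refine BinRel.IsFunction.mk' (fun i => ?_) fun i j k t ht s hs => ?_
  · have := map_mem_prod_total F G (id_mem F i.1) (id_mem G i.2)
    rw [TensorProduct.map_id] at this
    exact this
  · induction ht using Submodule.span_induction with
    | mem t ht =>
      induction hs using Submodule.span_induction with
      | mem s hs =>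
        obtain ⟨t, ht, t', ht', rfl⟩ := ht
        obtain ⟨s, hs, s', hs', rfl⟩ := hs
        rw [TensorProduct.adjoint_map, ← TensorProduct.map_comp]
        exact map_mem_id (F.comp_adjoint_mem_id ht hs) (G.comp_adjoint_mem_id ht' hs')
      | zero => simp
      | add s t _ _ hs ht => rw [map_add, LinearMap.comp_add]; exact add_mem hs ht
      | smul c t _ ht => rw [map_smulₛₗ, LinearMap.comp_smul]; exact Submodule.smul_mem _ _ ht
    | zero => simp
    | add s t _ _ hs ht => rw [LinearMap.add_comp]; exact add_mem hs ht
    | smul c t _ ht => rw [LinearMap.smul_comp]; exact Submodule.smul_mem _ _ ht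

/-- The product of functions. -/
def prod (F : QFun X Y) (G : QFun X' Y') : QFun (X.prod X') (Y.prod Y') :=
  ⟨F.1.prod G.1, isFunction_prod F G⟩

theorem pullback_prod (F : QFun X Y) (G : QFun X' Y') (b : Y.Ell) (b' : Y'.Ell)
    (p : (X.prod X').At) :
    (F.prod G).pullback (fun q => TensorProduct.map (b q.1) (b' q.2)) p =
      TensorProduct.map (F.pullback b p.1) (G.pullback b' p.2) := by
  refine congrFun ((F.prod G).pullback_eq _
    (fun p => TensorProduct.map (F.pullback b p.1) (G.pullback b' p.2)) fun i j t ht => ?_) p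
  induction ht using Submodule.span_induction with
  | mem t ht =>
    obtain ⟨t, ht, t', ht', rfl⟩ := ht
    dsimp only
    rw [← TensorProduct.map_comp, ← TensorProduct.map_comp, F.pullback_spec b ht,
      G.pullback_spec b' ht']
  | zero => simp
  | add s t _ _ hs ht => rw [LinearMap.comp_add, LinearMap.add_comp, hs, ht]
  | smul c t _ ht => rw [LinearMap.comp_smul, LinearMap.smul_comp, ht]

end QFun

/-! ## Functions that are multilinear in some of their arguments

Relations of arity `(X₁, …, Xₙ)` consist of multilinear functionals.  They are studied inside the
commutative algebra of all functions on tuples of vectors, where products of submodules are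
available. -/

section PartialMultilinear

variable {ι : Type*} [dec : DecidableEq ι] {M : ι → Type*}
  [∀ i, AddCommGroup (M i)] [∀ i, Module ℂ (M i)]

variable (M) in
/-- The functions that depend on the arguments in `S` only, and are linear in each of these. -/
def multilin (S : Finset ι) : Submodule ℂ ((∀ i, M i) → ℂ) where
  carrier := {f | (∀ x y, (∀ i ∈ S, x i = y i) → f x = f y) ∧
    (∀ i ∈ S, ∀ x u v, f (Function.update x i (u + v)) =
      f (Function.update x i u) + f (Function.update x i v)) ∧
    ∀ i ∈ S, ∀ x (c : ℂ) u, f (Function.update x i (c • u)) = c * f (Function.update x i u)}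
  add_mem' := fun {f g} hf hg => by
    refine ⟨fun x y h => ?_, fun i hi x u v => ?_, fun i hi x c u => ?_⟩
    · simp [hf.1 x y h, hg.1 x y h]
    · simp only [Pi.add_apply, hf.2.1 i hi, hg.2.1 i hi]; ring
    · simp only [Pi.add_apply, hf.2.2 i hi, hg.2.2 i hi]; ring
  zero_mem' := by simp
  smul_mem' := fun c f hf => by
    refine ⟨fun x y h => ?_, fun i hi x u v => ?_, fun i hi x c u => ?_⟩
    · simp [hf.1 x y h]
    · simp only [Pi.smul_apply, hf.2.1 i hi, smul_eq_mul]; ring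
    · simp only [Pi.smul_apply, hf.2.2 i hi, smul_eq_mul]; ring

theorem multilin_update {S : Finset ι} {f : (∀ i, M i) → ℂ} (hf : f ∈ multilin M S) {i : ι}
    (hi : i ∉ S) (x : ∀ i, M i) (u : M i) : f (Function.update x i u) = f x :=
  hf.1 _ _ fun _ hj => Function.update_of_ne (ne_of_mem_of_not_mem hj hi) _ _

theorem mul_mem_multilin {S T : Finset ι} (h : Disjoint S T) {f g : (∀ i, M i) → ℂ}
    (hf : f ∈ multilin M S) (hg : g ∈ multilin M T) : f * g ∈ multilin M (S ∪ T) := by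
  refine ⟨fun x y h => ?_, fun i hi x u v => ?_, fun i hi x c u => ?_⟩
  · rw [Pi.mul_apply, Pi.mul_apply, hf.1 x y fun i hi => h i (Finset.mem_union_left _ hi),
      hg.1 x y fun i hi => h i (Finset.mem_union_right _ hi)]
  · simp only [Pi.mul_apply]
    obtain hi | hi := Finset.mem_union.1 hi
    · have hi' := Finset.disjoint_left.1 h hi
      simp only [multilin_update hg hi', hf.2.1 i hi, add_mul]
    · have hi' := Finset.disjoint_right.1 h hi
      simp only [multilin_update hf hi', hg.2.1 i hi, mul_add]
  · simp only [Pi.mul_apply]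
    obtain hi | hi := Finset.mem_union.1 hi
    · have hi' := Finset.disjoint_left.1 h hi
      simp only [multilin_update hg hi', hf.2.2 i hi, mul_assoc]
    · have hi' := Finset.disjoint_right.1 h hi
      simp only [multilin_update hf hi', hg.2.2 i hi, mul_left_comm]

theorem multilin_mul_le {S T U : Finset ι} (h : Disjoint S T) (hU : S ∪ T = U) :
    multilin M S * multilin M T ≤ multilin M U :=
  Submodule.mul_le.2 fun _ hf _ hg => hU ▸ mul_mem_multilin h hf hg

theorem mem_multilin_univ [Fintype ι] {f : (∀ i, M i) → ℂ} :
    f ∈ multilin M Finset.univ ↔ ∃ ζ : MultilinearMap ℂ M ℂ, ⇑ζ = f := by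
  constructor
  · intro hf
    refine ⟨{ toFun := f, map_update_add' := ?_, map_update_smul' := ?_ }, rfl⟩
    · intro inst x i u v
      rw [Subsingleton.elim inst dec]
      exact hf.2.1 i (Finset.mem_univ i) x u v
    · intro inst x i c u
      rw [Subsingleton.elim inst dec]
      exact hf.2.2 i (Finset.mem_univ i) x c u
  · rintro ⟨ζ, rfl⟩
    refine ⟨fun x y h => ?_, fun i _ x u v => ζ.map_update_add x i u v,
      fun i _ x c u => ζ.map_update_smul x i c u⟩
    rw [show x = y from funext fun i => h i (Finset.mem_univ i)]

theorem restrict_mem_multilin {T : Finset ι} {P : ι → Prop} (hP : ∀ i, i ∈ T ↔ P i)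
    (η : MultilinearMap ℂ (fun i : {i // P i} => M i) ℂ) :
    (fun x : ∀ i, M i => η fun i => x i) ∈ multilin M T := by
  have e : ∀ i (hi : i ∈ T) (x : ∀ i, M i) u, (fun k : {i // P i} => Function.update x i u k) =
      Function.update (fun k : {i // P i} => x k) ⟨i, (hP i).1 hi⟩ u := fun i hi x u => by
    funext k
    by_cases h : k = ⟨i, (hP i).1 hi⟩
    · subst h; simp
    · rw [Function.update_of_ne h, Function.update_of_ne fun e => h (Subtype.ext e)]
  refine ⟨fun x y h => ?_, fun i hi x u w => ?_, fun i hi x c u => ?_⟩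
  · exact congrArg η (funext fun i => h i ((hP i).2 i.2))
  · simp only [e i hi]
    exact η.map_update_add _ _ _ _
  · simp only [e i hi]
    exact η.map_update_smul _ _ _ _

theorem exists_restrict_of_mem_multilin {T : Finset ι} {P : ι → Prop} (hP : ∀ i, i ∈ T ↔ P i)
    {g : (∀ i, M i) → ℂ} (hg : g ∈ multilin M T) :
    ∃ η : MultilinearMap ℂ (fun i : {i // P i} => M i) ℂ, ∀ x, g x = η fun i => x i := by
  classical
  -- The arguments outside of `P` are filled with zero; the value is immaterial, since `g` does not
  -- depend on them.
  let ext : (∀ i : {i // P i}, M i) → ∀ i, M i := fun y i => if h : P i then y ⟨i, h⟩ else 0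
  have hext : ∀ [DecidableEq {i // P i}] y i u,
      ext (Function.update y i u) = Function.update (ext y) i u := by
    intro _ y i u
    funext k
    by_cases h : k = i
    · subst h
      simp [ext, i.2]
    · rw [Function.update_of_ne h]
      by_cases hk : P k
      · simp only [ext, dif_pos hk]
        rw [Function.update_of_ne fun e => h (congrArg Subtype.val e)]
      · simp only [ext, dif_neg hk]
  refine ⟨{ toFun := fun y => g (ext y)
            map_update_add' := fun y i u w => ?_
            map_update_smul' := fun y i c u => ?_ }, fun x => ?_⟩
  · simp only [hext]
    exact hg.2.1 i ((hP i).2 i.2) _ _ _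
  · simp only [hext]
    exact hg.2.2 i ((hP i).2 i.2) _ _ _
  · refine hg.1 _ _ fun i hi => ?_
    simp only [ext, dif_pos ((hP i).1 hi)]

/-- Fixing the arguments in `S` of a function. -/
def sliceHom (S : Finset ι) (x : ∀ i, M i) : ((∀ i, M i) → ℂ) →ₐ[ℂ] ((∀ i, M i) → ℂ) where
  toFun f := fun y => f (S.piecewise x y)
  map_one' := rfl
  map_mul' _ _ := rfl
  map_zero' := rfl
  map_add' _ _ := rfl
  commutes' _ := rfl

set_option linter.unusedSectionVars false in
theorem sliceHom_apply (S : Finset ι) (x y : ∀ i, M i) (f : (∀ i, M i) → ℂ) :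
    sliceHom S x f y = f (S.piecewise x y) := rfl

theorem sliceHom_of_disjoint {S T : Finset ι} (h : Disjoint S T) (x : ∀ i, M i)
    {f : (∀ i, M i) → ℂ} (hf : f ∈ multilin M T) : sliceHom S x f = f :=
  funext fun _ => hf.1 _ _ fun _ hi =>
    Finset.piecewise_eq_of_notMem _ _ _ (Finset.disjoint_right.1 h hi)

theorem sliceHom_mem {S T : Finset ι} (x : ∀ i, M i) {f : (∀ i, M i) → ℂ}
    (hf : f ∈ multilin M T) : sliceHom S x f ∈ multilin M (T \ S) := by
  have key : ∀ i ∈ T \ S, ∀ (y : ∀ i, M i) u, S.piecewise x (Function.update y i u) =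
      Function.update (S.piecewise x y) i u := fun i hi y u => by
    rw [Finset.update_piecewise_of_notMem _ _ _ (Finset.mem_sdiff.1 hi).2]
  refine ⟨fun y z h => ?_, fun i hi y u v => ?_, fun i hi y c u => ?_⟩
  · refine hf.1 _ _ fun i hi => ?_
    by_cases hS : i ∈ S
    · simp [hS]
    · simpa [hS] using h i (Finset.mem_sdiff.2 ⟨hi, hS⟩)
  · simp only [sliceHom_apply, key i hi]
    exact hf.2.1 i (Finset.mem_sdiff.1 hi).1 _ u v
  · simp only [sliceHom_apply, key i hi]
    exact hf.2.2 i (Finset.mem_sdiff.1 hi).1 _ c u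

/-- The first factor of a product of submodules may be expanded in a fixed basis, with the
coefficients collected in the second factor. No uniqueness of the coefficients is claimed. -/
theorem exists_finsupp_of_mem_mul {A : Type*} [CommRing A] [Algebra ℂ A] {R G : Submodule ℂ A}
    {κ : Type*} (b : Module.Basis κ ℂ R) {f : A} (hf : f ∈ R * G) :
    ∃ g : κ →₀ A, (∀ k, g k ∈ G) ∧ f = g.sum fun k a => (b k : A) * a := by
  classical
  induction hf using Submodule.mul_induction_on' with
  | mem_mul_mem r hr g hg =>
    refine ⟨(b.repr ⟨r, hr⟩).mapRange (fun c => c • g) (zero_smul _ _), fun k => ?_, ?_⟩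
    · rw [Finsupp.mapRange_apply]
      exact G.smul_mem _ hg
    · rw [Finsupp.sum_mapRange_index (by simp)]
      conv_lhs => rw [show r = ((⟨r, hr⟩ : R) : A) from rfl, ← b.linearCombination_repr ⟨r, hr⟩]
      rw [Finsupp.linearCombination_apply, Finsupp.sum, AddSubmonoidClass.coe_finsetSum, Finset.sum_mul,
        Finsupp.sum]
      refine Finset.sum_congr rfl fun k _ => ?_
      simp
  | add x _ y _ hx hy =>
    obtain ⟨g, hg, rfl⟩ := hx
    obtain ⟨g', hg', rfl⟩ := hy
    refine ⟨g + g', fun k => add_mem (hg k) (hg' k), ?_⟩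
    rw [Finsupp.sum_add_index' (by simp) (by simp [mul_add])]

/-- The intersection of relations in disjoint sets of variables is their product. -/
theorem mul_multilin_inf [Fintype ι] {S T : Finset ι} (h : Disjoint S T)
    {R Q : Submodule ℂ ((∀ i, M i) → ℂ)} (hR : R ≤ multilin M S) (hQ : Q ≤ multilin M T) :
    R * multilin M Sᶜ ⊓ Q * multilin M Tᶜ = R * Q * multilin M (S ∪ T)ᶜ := by
  apply le_antisymm
  · rintro f ⟨hf, hf'⟩
    rw [mul_assoc]
    set N := Q * multilin M (S ∪ T)ᶜ with hN
    -- Freezing the arguments in `S` leaves the factor from `Q` alone, because it depends on `T`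
    -- only, and turns the other factor into a function of the variables outside of S ∪ T.
    have hslice : ∀ x, sliceHom S x f ∈ N := fun x => by
      have : (Q * multilin M Tᶜ).map (sliceHom S x).toLinearMap ≤ N := by
        rw [Submodule.map_mul]
        refine mul_le_mul' ?_ ?_
        · rintro _ ⟨q, hq, rfl⟩
          have := sliceHom_of_disjoint h x (hQ hq)
          rw [AlgHom.toLinearMap_apply, this]
          exact hq
        · rintro _ ⟨g, hg, rfl⟩
          have := sliceHom_mem (S := S) x hg
          rw [show Tᶜ \ S = (S ∪ T)ᶜ by ext; simp [and_comm]] at this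
          exact this
      exact this ⟨f, hf', rfl⟩
    -- Write f = Σ bₖgₖ with bₖ a basis of `R` and gₖ functions of the variables outside of `S`. It
    -- suffices that every gₖ lies in `N`.
    let b := Module.Basis.ofVectorSpace ℂ R
    obtain ⟨g, hg, hfg⟩ := exists_finsupp_of_mem_mul b hf
    have hgN : ∀ k, g k ∈ N := by
      intro k
      by_contra hk
      -- A functional that vanishes on `N` but not at gₖ kills all slices Σ bₖ(x)gₖ of `f`, so Σ
      -- φ(gₖ)bₖ = 0. This contradicts the linear independence of the basis.
      obtain ⟨φ, hφ, hφN⟩ := Submodule.exists_le_ker_of_notMem hk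
      have hsum : ∑ k ∈ g.support, φ (g k) • b k = 0 := by
        apply Subtype.ext
        funext x
        have h₁ : φ (sliceHom S x f) = 0 := hφN (hslice x)
        have h₂ : sliceHom S x f = ∑ k ∈ g.support, (b k : (∀ i, M i) → ℂ) x • g k := by
          rw [hfg, Finsupp.sum, map_sum]
          refine Finset.sum_congr rfl fun k _ => funext fun y => ?_
          rw [map_mul, sliceHom_of_disjoint disjoint_compl_right x (hg k), Pi.mul_apply,
            sliceHom_apply, Pi.smul_apply, smul_eq_mul]
          congr 1
          exact (hR (b k).2).1 _ _ fun i hi => Finset.piecewise_eq_of_mem _ _ _ hi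
        rw [h₂, map_sum] at h₁
        rw [AddSubmonoidClass.coe_finsetSum, Finset.sum_apply]
        simpa [mul_comm] using h₁
      have := linearIndependent_iff'.1 b.linearIndependent _ _ hsum k (by
        rw [Finsupp.mem_support_iff]
        rintro h0
        exact hk (h0 ▸ zero_mem N))
      exact hφ this
    rw [hfg]
    exact Submodule.sum_mem _ fun k _ => Submodule.mul_mem_mul (b k).2 (hgN k)
  · refine le_inf ?_ ?_
    · rw [mul_assoc]
      refine mul_le_mul' le_rfl ((mul_le_mul' hQ le_rfl).trans
        (multilin_mul_le ?_ ?_))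
      · exact disjoint_compl_right.mono_left Finset.subset_union_right
      · ext i
        have hi : i ∈ S → i ∉ T := fun hi => Finset.disjoint_left.1 h hi
        simp only [Finset.mem_union, Finset.mem_compl]
        tauto
    · rw [mul_comm R Q, mul_assoc]
      refine mul_le_mul' le_rfl ((mul_le_mul' hR le_rfl).trans
        (multilin_mul_le ?_ ?_))
      · exact disjoint_compl_right.mono_left Finset.subset_union_left
      · ext i
        have hi : i ∈ S → i ∉ T := fun hi => Finset.disjoint_left.1 h hi
        simp only [Finset.mem_union, Finset.mem_compl]
        tauto

end PartialMultilinear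

/-! ## Relations as spaces of functions -/

/-- Tuples of vectors in given atoms. -/
abbrev Vec {Γ : List QSet.{u, v}} (a : Atoms Γ) := ∀ i, (Γ.get i).H (a i)

/-- A multilinear functional as a function. -/
def functionalCoe {Γ : List QSet.{u, v}} (a : Atoms Γ) : Functional a →ₗ[ℂ] (Vec a → ℂ) where
  toFun ζ := ζ
  map_add' _ _ := rfl
  map_smul' _ _ := rfl

theorem functionalCoe_injective {Γ : List QSet.{u, v}} (a : Atoms Γ) :
    Function.Injective (functionalCoe a) := DFunLike.coe_injective

/-- A relation as a space of functions. -/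
def QRel.fn {Γ : List QSet.{u, v}} (R : QRel Γ) (a : Atoms Γ) : Submodule ℂ (Vec a → ℂ) :=
  (R a).map (functionalCoe a)

namespace QRel

variable {Γ Δ : List QSet.{u, v}}

theorem coe_mem_fn {R : QRel Γ} {a : Atoms Γ} {ζ : Functional a} : ⇑ζ ∈ R.fn a ↔ ζ ∈ R a :=
  ⟨fun ⟨_, h, e⟩ => functionalCoe_injective a e ▸ h, fun h => ⟨ζ, h, rfl⟩⟩

theorem fn_inf (R S : QRel Γ) (a : Atoms Γ) : (R ⊓ S).fn a = R.fn a ⊓ S.fn a :=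
  Submodule.map_inf _ (functionalCoe_injective a)

end QRel

namespace Var

variable {Γ : List QSet.{u, v}} {X : QSet.{u, v}}

/-- The vector chosen for a variable is the component of the tuple at its position. -/
def lin {X : QSet.{u, v}} : {Γ : List QSet.{u, v}} → (v : Var Γ X) → (a : Atoms Γ) →
    (Γ.get v.idx).H (a v.idx) →ₗ[ℂ] X.H (v.atom a)
  | _, zero, _ => LinearMap.id
  | _, succ v, a => v.lin fun i => a i.succ

theorem vec_eq_lin (v : Var Γ X) {a : Atoms Γ} (x : Vec a) : v.vec x = v.lin a (x v.idx) := by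
  induction v with
  | zero => rfl
  | succ v ih => exact ih _

theorem vec_congr (v : Var Γ X) {a : Atoms Γ} {x y : Vec a} (h : x v.idx = y v.idx) :
    v.vec x = v.vec y := by
  rw [vec_eq_lin, vec_eq_lin, h]

theorem vec_update_of_ne (v : Var Γ X) {a : Atoms Γ} (x : Vec a) {i : Fin Γ.length}
    (h : i ≠ v.idx) (u : (Γ.get i).H (a i)) : v.vec (Function.update x i u) = v.vec x :=
  v.vec_congr (Function.update_of_ne h.symm u x)

theorem vec_update_add (v : Var Γ X) {a : Atoms Γ} (x : Vec a) (u w : (Γ.get v.idx).H (a v.idx)) :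
    v.vec (Function.update x v.idx (u + w)) =
      v.vec (Function.update x v.idx u) + v.vec (Function.update x v.idx w) := by
  simp only [vec_eq_lin, Function.update_self, map_add]

theorem vec_update_smul (v : Var Γ X) {a : Atoms Γ} (x : Vec a) (c : ℂ)
    (u : (Γ.get v.idx).H (a v.idx)) :
    v.vec (Function.update x v.idx (c • u)) = c • v.vec (Function.update x v.idx u) := by
  simp only [vec_eq_lin, Function.update_self, map_smul]

end Var

namespace Vars

variable {Γ Δ : List QSet.{u, v}}

/-- A variable of a tuple. -/
def get (ρ : Vars Γ Δ) (j : Fin Δ.length) : Var Γ (Δ.get j) := ρ (Var.ofFin Δ j)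

/-- The atoms chosen for a tuple of variables. -/
def atoms (ρ : Vars Γ Δ) (a : Atoms Γ) : Atoms Δ := fun j => (ρ.get j).atom a

/-- The vectors chosen for a tuple of variables. -/
def vec (ρ : Vars Γ Δ) {a : Atoms Γ} (x : Vec a) : Vec (ρ.atoms a) := fun j => (ρ.get j).vec x

/-- The position of a variable in a tuple. -/
def pos (ρ : Vars Γ Δ) (j : Fin Δ.length) : Fin Γ.length := (ρ.get j).idx

/-- The set of positions of a tuple of variables. -/
def support (ρ : Vars Γ Δ) : Finset (Fin Γ.length) := Finset.univ.image ρ.pos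

theorem pos_mem_support (ρ : Vars Γ Δ) (j : Fin Δ.length) : ρ.pos j ∈ ρ.support :=
  Finset.mem_image_of_mem _ (Finset.mem_univ j)

theorem vec_update (ρ : Vars Γ Δ) (hρ : Function.Injective ρ.pos) {a : Atoms Γ} (x : Vec a)
    (j : Fin Δ.length) (u : (Γ.get (ρ.pos j)).H (a (ρ.pos j))) :
    ρ.vec (Function.update x (ρ.pos j) u) =
      Function.update (ρ.vec x) j ((ρ.get j).vec (Function.update x (ρ.pos j) u)) := by
  funext k
  by_cases h : k = j
  · subst h
    exact (Function.update_self k ((ρ.get k).vec (Function.update x (ρ.pos k) u))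
      (ρ.vec x)).symm
  · refine Eq.trans ?_ (Function.update_of_ne h _ (ρ.vec x)).symm
    exact Var.vec_update_of_ne _ x (fun e => h (hρ e.symm)) u

/-- The functions `ξ(x_{π(1)}, …, x_{π(m)})` with `ξ` in a relation. -/
def pull (ρ : Vars Γ Δ) (R : QRel Δ) (a : Atoms Γ) : Submodule ℂ (Vec a → ℂ) :=
  (R (ρ.atoms a)).map (σ₁₂ := RingHom.id ℂ)
    { toFun := fun ξ x => ξ (ρ.vec x), map_add' := fun _ _ => rfl, map_smul' := fun _ _ => rfl }

theorem pull_le (ρ : Vars Γ Δ) (hρ : Function.Injective ρ.pos) (R : QRel Δ) (a : Atoms Γ) :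
    ρ.pull R a ≤ multilin _ ρ.support := by
  rintro _ ⟨ξ, _, rfl⟩
  refine ⟨fun x y h => ?_, fun i hi x u w => ?_, fun i hi x c u => ?_⟩
  · exact congrArg ξ (funext fun j => Var.vec_congr _ (h _ (ρ.pos_mem_support j)))
  · obtain ⟨j, _, rfl⟩ := Finset.mem_image.1 hi
    change ξ _ = ξ _ + ξ _
    have e : (ρ.get j).vec (Function.update x (ρ.pos j) (u + w)) =
      (ρ.get j).vec (Function.update x (ρ.pos j) u) +
      (ρ.get j).vec (Function.update x (ρ.pos j) w) := Var.vec_update_add _ x u w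
    rw [vec_update ρ hρ, vec_update ρ hρ, vec_update ρ hρ, e]
    exact ξ.map_update_add _ _ _ _
  · obtain ⟨j, _, rfl⟩ := Finset.mem_image.1 hi
    change ξ _ = c * ξ _
    have e : (ρ.get j).vec (Function.update x (ρ.pos j) (c • u)) =
      c • (ρ.get j).vec (Function.update x (ρ.pos j) u) := Var.vec_update_smul _ x c u
    rw [vec_update ρ hρ, vec_update ρ hρ, e]
    exact ξ.map_update_smul _ _ _ _

/-- The interpretation of an atomic formula in distinct variables. -/
theorem fn_atomic (ρ : Vars Γ Δ) (hρ : Function.Injective ρ.pos) (R : QRel Δ) (a : Atoms Γ) :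
    (R.atomic ρ).fn a = ρ.pull R a * multilin _ ρ.supportᶜ := by
  have hS : ∀ i, i ∈ ρ.supportᶜ ↔ ∀ j, ρ.pos j ≠ i := fun i => by simp [support]
  apply le_antisymm
  · rw [QRel.fn, QRel.atomic, Submodule.map_span]
    refine Submodule.span_le.2 ?_
    rintro _ ⟨ζ, ⟨ξ, hξ, η, hζ⟩, rfl⟩
    have e : functionalCoe a ζ = (fun x => ξ (ρ.vec x)) * fun x => η fun i => x i := funext hζ
    rw [e]
    exact Submodule.mul_mem_mul ⟨ξ, hξ, rfl⟩ 
      (restrict_mem_multilin (M := fun i => (Γ.get i).H (a i))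
        (P := fun i => ∀ j, (ρ (Var.ofFin Δ j)).idx ≠ i) hS η)
  · refine Submodule.mul_le.2 fun f hf g hg => ?_
    have hfg : f * g ∈ multilin _ Finset.univ :=
      multilin_mul_le disjoint_compl_right (Finset.union_compl _)
        (Submodule.mul_mem_mul (pull_le ρ hρ R a hf) hg)
    obtain ⟨ζ, hζ⟩ := mem_multilin_univ.1 hfg
    obtain ⟨ξ, hξ, rfl⟩ := hf
    obtain ⟨η, hη⟩ := exists_restrict_of_mem_multilin hS hg
    rw [← hζ, QRel.coe_mem_fn]
    refine Submodule.subset_span ⟨ξ, hξ, η, fun x => ?_⟩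
    rw [hζ, Pi.mul_apply, hη]
    rfl

end Vars

/-! ## The interpretation of quantifiers -/

section Inner

variable {Γ : List QSet.{u, v}} {a : Atoms Γ}

/-- The inner product of functionals is positive definite. -/
@[reducible] def functionalCore (a : Atoms Γ) : InnerProductSpace.Core ℂ (Functional a) where
  inner := functionalInner
  conj_inner_symm ξ η := by simp [functionalInner, mul_comm]
  re_inner_nonneg ξ := by
    simp only [functionalInner, map_sum]
    refine Finset.sum_nonneg fun k _ => ?_
    rw [← Complex.normSq_eq_conj_mul_self]
    exact Complex.normSq_nonneg _
  add_left ξ η ζ := by simp [functionalInner, add_mul, Finset.sum_add_distrib]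
  smul_left ξ η c := by simp [functionalInner, Finset.mul_sum, mul_assoc]
  definite ξ h := by
    have h' : ∑ k : (∀ i, Fin (Module.finrank ℂ ((Γ.get i).H (a i)))),
        Complex.normSq (ξ fun i => stdOrthonormalBasis ℂ _ (k i)) = 0 := by
      have := congrArg Complex.re h
      simp only [functionalInner, Complex.re_sum, ← Complex.normSq_eq_conj_mul_self] at this
      simpa using this
    refine Module.Basis.ext_multilinear (fun i => (stdOrthonormalBasis ℂ ((Γ.get i).H (a i))).toBasis)
      fun k => ?_
    have := (Finset.sum_eq_zero_iff_of_nonneg fun k _ => Complex.normSq_nonneg _).1 h' k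
      (Finset.mem_univ k)
    simpa using this

/-- Functionals as a normed space. -/
@[reducible] def functionalNormed (a : Atoms Γ) : NormedAddCommGroup (Functional a) :=
  (functionalCore a).toNormedAddCommGroup

/-- Functionals as a Hilbert space. -/
@[reducible] def functionalHilbert (a : Atoms Γ) :
    @InnerProductSpace ℂ (Functional a) _ (functionalNormed a).toSeminormedAddCommGroup :=
  letI := functionalNormed a
  .ofCore (functionalCore a).toCore

attribute [local instance] functionalNormed functionalHilbert

theorem functionalInner_eq (ξ η : Functional a) : functionalInner ξ η = inner ℂ ξ η := rfl

namespace QRel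

theorem neg_apply (R : QRel Γ) (a : Atoms Γ) : R.neg a = (R a)ᗮ := by
  ext η
  rw [Submodule.mem_orthogonal]
  rfl

theorem neg_neg (R : QRel Γ) : R.neg.neg = R := by
  funext a
  rw [neg_apply, neg_apply, Submodule.orthogonal_orthogonal]

end QRel

namespace Formula

theorem interp_imp (φ ψ : Formula Γ) :
    (φ.imp ψ).interp = (φ.interp ⊓ (φ.interp ⊓ ψ.interp).neg).neg := by
  change (φ.interp.neg.neg ⊓ (φ.interp ⊓ ψ.interp).neg).neg = _
  rw [QRel.neg_neg]

/-- The Sasaki arrow costs nothing orthogonally to its premise. For the diagonal quantifiers this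
disposes of everything that is orthogonal to the equality relation. -/
theorem neg_le_imp (φ ψ : Formula Γ) (a : Atoms Γ) : φ.interp.neg a ≤ (φ.imp ψ).interp a := by
  rw [interp_imp, QRel.neg_apply, QRel.neg_apply]
  exact Submodule.orthogonal_le inf_le_left

/-- Modus ponens, in the form given by orthomodularity: the component of ζ orthogonal to φ ∧ ψ still
lies in φ, so the implication requires ζ to be orthogonal to it, and it vanishes. -/
theorem mem_imp_iff {φ ψ : Formula Γ} {ζ : Functional a} (h : ζ ∈ φ.interp a) :
    ζ ∈ (φ.imp ψ).interp a ↔ ζ ∈ ψ.interp a := by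
  rw [interp_imp, QRel.neg_apply]
  change ζ ∈ (φ.interp a ⊓ (φ.interp ⊓ ψ.interp).neg a)ᗮ ↔ _
  rw [QRel.neg_apply]
  change ζ ∈ (φ.interp a ⊓ (φ.interp a ⊓ ψ.interp a)ᗮ)ᗮ ↔ _
  set K := φ.interp a ⊓ ψ.interp a
  constructor
  · intro hζ
    have hp : K.starProjection ζ ∈ K := Submodule.starProjection_apply_mem K ζ
    have hq : ζ - K.starProjection ζ ∈ Kᗮ := Submodule.sub_starProjection_mem_orthogonal ζ
    have h₁ := (Submodule.mem_orthogonal _ _).1 hζ _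
      ⟨(φ.interp a).sub_mem h hp.1, hq⟩
    have h₂ := (Submodule.mem_orthogonal' _ _).1 hq _ hp
    have h₃ : inner ℂ (ζ - K.starProjection ζ) (ζ - K.starProjection ζ) = 0 := by
      rw [inner_sub_right, h₁, h₂, sub_zero]
    rw [inner_self_eq_zero, sub_eq_zero] at h₃
    rw [h₃]
    exact hp.2
  · intro hζ
    rw [Submodule.mem_orthogonal]
    intro η hη
    exact (Submodule.mem_orthogonal' _ _).1 hη.2 _ ⟨h, hζ⟩

end Formula

end Inner

/-- Adding an atom at the front. -/
def Atoms.cons {Γ : List QSet.{u, v}} {X : QSet.{u, v}} (j : X.At) (a : Atoms Γ) :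
    Atoms (X :: Γ) :=
  Fin.cons (α := fun i => ((X :: Γ).get i).At) j a

theorem Atoms.exists_cons {Γ : List QSet.{u, v}} {X : QSet.{u, v}} (b : Atoms (X :: Γ)) :
    ∃ (j : X.At) (a : Atoms Γ), b = Atoms.cons j a :=
  ⟨b 0, Fin.tail b, (Fin.cons_self_tail b).symm⟩

/-- Adding a vector at the front. -/
def Vec.cons {Γ : List QSet.{u, v}} {X : QSet.{u, v}} {j : X.At} {a : Atoms Γ} (y : X.H j)
    (x : Vec a) : Vec (Atoms.cons j a) :=
  Fin.cons (α := fun i => ((X :: Γ).get i).H (Atoms.cons j a i)) y x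

/-- The first vector of a tuple. -/
def Vec.head {Γ : List QSet.{u, v}} {X : QSet.{u, v}} {j : X.At} {a : Atoms Γ}
    (x : Vec (Atoms.cons j a)) : X.H j := x 0

/-- The other vectors of a tuple. -/
def Vec.tail {Γ : List QSet.{u, v}} {X : QSet.{u, v}} {j : X.At} {a : Atoms Γ}
    (x : Vec (Atoms.cons j a)) : Vec a := fun i => x i.succ

@[simp] theorem Vec.head_cons {Γ : List QSet.{u, v}} {X : QSet.{u, v}} {j : X.At} {a : Atoms Γ}
    (y : X.H j) (x : Vec a) : (Vec.cons y x).head = y := rfl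

@[simp] theorem Vec.tail_cons {Γ : List QSet.{u, v}} {X : QSet.{u, v}} {j : X.At} {a : Atoms Γ}
    (y : X.H j) (x : Vec a) : (Vec.cons y x).tail = x := rfl

section Quantifiers

variable {Γ : List QSet.{u, v}} {X : QSet.{u, v}} {a : Atoms Γ} {j : X.At}

/-- The functional `ζ(y, ·)`. -/
def Functional.slice (ζ : Functional (Atoms.cons j a)) : X.H j →ₗ[ℂ] Functional a :=
  MultilinearMap.curryLeft (n := Γ.length) ζ

/-- The functional with given slices. -/
def Functional.ofSlice (f : X.H j →ₗ[ℂ] Functional a) : Functional (Atoms.cons j a) :=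
  LinearMap.uncurryLeft (n := Γ.length) (M := fun i => ((X :: Γ).get i).H (Atoms.cons j a i)) f

theorem Functional.slice_ofSlice (f : X.H j →ₗ[ℂ] Functional a) :
    (Functional.ofSlice f).slice = f := LinearMap.curry_uncurryLeft _

theorem functionalInner_cons (ξ ζ : Functional (Atoms.cons j a)) :
    functionalInner ξ ζ = ∑ k, functionalInner (ξ.slice (stdOrthonormalBasis ℂ (X.H j) k))
      (ζ.slice (stdOrthonormalBasis ℂ (X.H j) k)) := by
  simp only [functionalInner]
  rw [← Fintype.sum_prod_type']
  refine (Fintype.sum_equiv (Fin.consEquiv fun i =>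
    Fin (Module.finrank ℂ (((X :: Γ).get i).H (Atoms.cons j a i)))) _ _ fun k => ?_).symm
  have e : (fun i => stdOrthonormalBasis ℂ _ (Fin.consEquiv (fun i =>
      Fin (Module.finrank ℂ (((X :: Γ).get i).H (Atoms.cons j a i)))) k i) :
      Vec (Atoms.cons j a)) =
      Vec.cons (stdOrthonormalBasis ℂ (X.H j) k.1) (fun i => stdOrthonormalBasis ℂ _ (k.2 i)) := by
    funext i
    induction i using Fin.cases with
    | zero => rfl
    | succ i => rfl
  exact congrArg₂ (fun p q => conj p * q) (congrArg ξ e.symm) (congrArg ζ e.symm)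

/-- The functional `η ⊗ ξ`. -/
def Functional.tmul (η : X.H j →ₗ[ℂ] ℂ) (ξ : Functional a) : Functional (Atoms.cons j a) :=
  Functional.ofSlice (η.smulRight ξ)

theorem Functional.tmul_apply (η : X.H j →ₗ[ℂ] ℂ) (ξ : Functional a) (x : Vec (Atoms.cons j a)) :
    Functional.tmul η ξ x = η x.head * ξ x.tail := rfl

namespace Formula

/-- The supremum that defines the quantifier is attained: the functionals ξ for which all η ⊗ ξ lie
in φ form a relation, which is itself a competitor and contains every other one. -/
theorem mem_all {φ : Formula (X :: Γ)} {ξ : Functional a} :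
    ξ ∈ (all X φ).interp a ↔
      ∀ (j : X.At) (η : X.H j →ₗ[ℂ] ℂ), Functional.tmul η ξ ∈ φ.interp (Atoms.cons j a) := by
  let R : QRel Γ := fun a =>
    { carrier := {ξ | ∀ (j : X.At) (η : X.H j →ₗ[ℂ] ℂ),
        Functional.tmul η ξ ∈ φ.interp (Atoms.cons j a)}
      add_mem' := fun {ξ ξ'} h h' j η => by
        convert add_mem (h j η) (h' j η) using 1
        ext x
        exact mul_add _ _ _
      zero_mem' := fun j η => by
        convert (φ.interp (Atoms.cons j a)).zero_mem using 1
        ext x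
        exact mul_zero _
      smul_mem' := fun c ξ h j η => by
        convert Submodule.smul_mem _ c (h j η) using 1
        ext x
        exact mul_left_comm _ _ _ }
  have hR : (all X φ).interp = R := by
    apply le_antisymm
    · refine sSup_le fun S hS a ξ hξ j η => hS _ ?_
      exact Submodule.subset_span ⟨η, ξ, hξ, fun h => rfl⟩
    · refine le_sSup fun b => ?_
      obtain ⟨j, a, rfl⟩ := Atoms.exists_cons b
      refine Submodule.span_le.2 ?_
      rintro ζ ⟨η, ξ, hξ, h⟩
      have : ζ = Functional.tmul η ξ := MultilinearMap.ext h
      rw [this]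
      exact hξ j η
  rw [hR]
  rfl

/-- In an orthonormal basis, ⟨ζ, η ⊗ ξ⟩ = Σ η(eₖ)⟨ζ(eₖ, ·), ξ⟩. Hence ∀¬φ is the orthogonal
complement of all slices of elements of φ, and the outer negation returns their span. -/
theorem fn_ex (φ : Formula (X :: Γ)) (a : Atoms Γ) :
    (ex X φ).interp.fn a = Submodule.span ℂ {f | ∃ (j : X.At) (y : X.H j),
      ∃ g ∈ φ.interp.fn (Atoms.cons j a), f = fun x => g (Vec.cons y x)} := by
  let := functionalNormed a
  let := functionalHilbert a
  set K : Submodule ℂ (Functional a) := Submodule.span ℂ {ξ | ∃ (j : X.At) (y : X.H j),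
    ∃ ζ ∈ φ.interp (Atoms.cons j a), ξ = ζ.slice y} with hK
  have h : (all X (neg φ)).interp a = Kᗮ := by
    ext ξ
    rw [mem_all, hK, Submodule.mem_orthogonal]
    have key : ∀ j (η : X.H j →ₗ[ℂ] ℂ) (ζ : Functional (Atoms.cons j a)),
        functionalInner ζ (Functional.tmul η ξ) =
          ∑ k, η (stdOrthonormalBasis ℂ (X.H j) k) *
            inner ℂ (ζ.slice (stdOrthonormalBasis ℂ (X.H j) k)) ξ := fun j η ζ => by
      rw [functionalInner_cons]
      refine Finset.sum_congr rfl fun k _ => ?_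
      rw [Functional.tmul, Functional.slice_ofSlice, functionalInner_eq, LinearMap.smulRight_apply,
        inner_smul_right]
    constructor
    · intro h u hu
      induction hu using Submodule.span_induction with
      | mem u hu =>
        obtain ⟨j, y, ζ, hζ, rfl⟩ := hu
        have h' : ∀ k, inner ℂ (ζ.slice (stdOrthonormalBasis ℂ (X.H j) k)) ξ = 0 := fun k => by
          -- The functional η = ⟨eₖ, ·⟩ isolates the slice at the basis vector eₖ.
          have := h j (innerₛₗ ℂ (stdOrthonormalBasis ℂ (X.H j) k)) ζ hζ
          rw [key, Finset.sum_eq_single k] at this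
          · simpa using this
          · intro l _ hl
            rw [innerₛₗ_apply_apply, orthonormal_iff_ite.1 (stdOrthonormalBasis ℂ (X.H j)).orthonormal,
              if_neg hl.symm, zero_mul]
          · simp
        rw [← (stdOrthonormalBasis ℂ (X.H j)).sum_repr y, map_sum, sum_inner]
        refine Finset.sum_eq_zero fun k _ => ?_
        rw [map_smul, inner_smul_left, h' k, mul_zero]
      | zero => exact inner_zero_left _
      | add u w _ _ hu hw => rw [inner_add_left, hu, hw, add_zero]
      | smul c u _ hu => rw [inner_smul_left, hu, mul_zero]
    · intro h j η ζ hζ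
      rw [key]
      refine Finset.sum_eq_zero fun k _ => ?_
      rw [h _ (Submodule.subset_span ⟨j, _, ζ, hζ, rfl⟩), mul_zero]
  have h' : (ex X φ).interp a = K := by
    change (all X (neg φ)).interp.neg a = K
    rw [QRel.neg_apply, h, Submodule.orthogonal_orthogonal]
  rw [QRel.fn, h', hK, Submodule.map_span]
  congr 1
  ext f
  constructor
  · rintro ⟨_, ⟨j, y, ζ, hζ, rfl⟩, rfl⟩
    exact ⟨j, y, ζ, ⟨ζ, hζ, rfl⟩, rfl⟩
  · rintro ⟨j, y, _, ⟨ζ, hζ, rfl⟩, rfl⟩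
    exact ⟨ζ.slice y, ⟨j, y, ζ, hζ, rfl⟩, rfl⟩

end Formula

end Quantifiers

/-! ## Atomic formulas for equality and graphs -/

section Lift

variable {Γ : List QSet.{u, v}} {X : QSet.{u, v}} {a : Atoms Γ} {j : X.At}

/-- Functions of the remaining variables as functions of all variables. -/
def liftFn (j : X.At) (a : Atoms Γ) : (Vec a → ℂ) →ₐ[ℂ] (Vec (Atoms.cons j a) → ℂ) where
  toFun f := fun x => f x.tail
  map_one' := rfl
  map_mul' _ _ := rfl
  map_zero' := rfl
  map_add' _ _ := rfl
  commutes' _ := rfl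

theorem Vec.tail_update (x : Vec (Atoms.cons j a)) (i : Fin Γ.length) (u : (Γ.get i).H (a i)) :
    Vec.tail (Function.update x i.succ u) = Function.update x.tail i u :=
  Fin.tail_update_succ (α := fun i => ((X :: Γ).get i).H (Atoms.cons j a i)) x i u

theorem Vec.cons_update (y : X.H j) (x : Vec a) (i : Fin Γ.length) (u : (Γ.get i).H (a i)) :
    Vec.cons y (Function.update x i u) = Function.update (Vec.cons y x) i.succ u :=
  Fin.cons_update (α := fun i => ((X :: Γ).get i).H (Atoms.cons j a i)) y x i u

/-- Moving a set of positions. -/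
abbrev shift {n : ℕ} (S : Finset (Fin n)) : Finset (Fin (n + 1)) := S.map (Fin.succEmb n)

theorem multilin_shift (S : Finset (Fin Γ.length)) :
    multilin (fun i => ((X :: Γ).get i).H (Atoms.cons j a i)) (shift S) =
      (multilin (fun i => (Γ.get i).H (a i)) S).map (liftFn j a).toLinearMap := by
  apply le_antisymm
  · intro f hf
    have hmem : ∀ {i}, i ∈ S → i.succ ∈ shift S := fun {i} hi =>
      Finset.mem_map_of_mem (Fin.succEmb _) hi
    -- The new argument is set to zero, which is harmless because `f` does not depend on it.
    refine ⟨fun x => f (Vec.cons 0 x), ⟨fun x y h => ?_, fun i hi x u w => ?_,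
      fun i hi x c u => ?_⟩, funext fun x => ?_⟩
    · refine hf.1 _ _ fun i hi => ?_
      obtain ⟨i, hi', rfl⟩ := Finset.mem_map.1 hi
      exact h i hi'
    · simp only [Vec.cons_update]
      exact hf.2.1 _ (hmem hi) _ _ _
    · simp only [Vec.cons_update]
      exact hf.2.2 _ (hmem hi) _ _ _
    · refine hf.1 _ _ fun i hi => ?_
      obtain ⟨i, hi, rfl⟩ := Finset.mem_map.1 hi
      rfl
  · rintro _ ⟨g, hg, rfl⟩
    refine ⟨fun x y h => ?_, fun i hi x u w => ?_, fun i hi x c u => ?_⟩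
    · exact hg.1 _ _ fun i hi => h i.succ (Finset.mem_map_of_mem (Fin.succEmb _) hi)
    · obtain ⟨i, hi', rfl⟩ := Finset.mem_map.1 hi
      have e := fun u => congrArg g (Vec.tail_update x i u)
      exact (e (u + w)).trans ((hg.2.1 i hi' _ u w).trans
        (congrArg₂ (· + ·) (e u).symm (e w).symm))
    · obtain ⟨i, hi', rfl⟩ := Finset.mem_map.1 hi
      have e := fun u => congrArg g (Vec.tail_update x i u)
      exact (e (c • u)).trans ((hg.2.2 i hi' _ c u).trans (congrArg (c * ·) (e u).symm))

end Lift

section Blocks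

variable {Γ : List QSet.{u, v}} {X Y Z : QSet.{u, v}} {a : Atoms Γ}

theorem linear_mem_multilin (x : Var Γ X) {f : X.H (x.atom a) → ℂ} (hf : IsLinearMap ℂ f) :
    (fun z : Vec a => f (x.vec z)) ∈ multilin (fun i => (Γ.get i).H (a i)) {x.idx} := by
  refine ⟨fun z z' h => ?_, fun i hi z u w => ?_, fun i hi z c u => ?_⟩
  · dsimp only
    rw [x.vec_congr (h _ (Finset.mem_singleton_self _))]
  · obtain rfl := Finset.mem_singleton.1 hi
    dsimp only
    rw [x.vec_update_add, hf.map_add]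
  · obtain rfl := Finset.mem_singleton.1 hi
    dsimp only
    rw [x.vec_update_smul, hf.map_smul, smul_eq_mul]

theorem bilinear_mem_multilin (x : Var Γ X) (y : Var Γ Y) (hxy : x.idx ≠ y.idx)
    {f : X.H (x.atom a) → Y.H (y.atom a) → ℂ} (h₁ : ∀ y, IsLinearMap ℂ fun x => f x y)
    (h₂ : ∀ x, IsLinearMap ℂ (f x)) :
    (fun z : Vec a => f (x.vec z) (y.vec z)) ∈
      multilin (fun i => (Γ.get i).H (a i)) {x.idx, y.idx} := by
  refine ⟨fun z z' h => ?_, fun i hi z u w => ?_, fun i hi z c u => ?_⟩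
  · dsimp only
    rw [x.vec_congr (h _ (by simp)), y.vec_congr (h _ (by simp))]
  · obtain rfl | hi := Finset.mem_insert.1 hi
    · simp only [x.vec_update_add, y.vec_update_of_ne _ hxy]
      exact (h₁ _).map_add _ _
    · obtain rfl := Finset.mem_singleton.1 hi
      simp only [y.vec_update_add, x.vec_update_of_ne _ hxy.symm]
      exact (h₂ _).map_add _ _
  · obtain rfl | hi := Finset.mem_insert.1 hi
    · simp only [x.vec_update_smul, y.vec_update_of_ne _ hxy]
      exact (h₁ _).map_smul _ _
    · obtain rfl := Finset.mem_singleton.1 hi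
      simp only [y.vec_update_smul, x.vec_update_of_ne _ hxy.symm]
      exact (h₂ _).map_smul _ _

theorem trilinear_mem_multilin (x : Var Γ X) (y : Var Γ Y) (z : Var Γ Z) (hxy : x.idx ≠ y.idx)
    (hxz : x.idx ≠ z.idx) (hyz : y.idx ≠ z.idx)
    {f : X.H (x.atom a) → Y.H (y.atom a) → Z.H (z.atom a) → ℂ}
    (h₁ : ∀ y z, IsLinearMap ℂ fun x => f x y z) (h₂ : ∀ x z, IsLinearMap ℂ fun y => f x y z)
    (h₃ : ∀ x y, IsLinearMap ℂ (f x y)) :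
    (fun s : Vec a => f (x.vec s) (y.vec s) (z.vec s)) ∈
      multilin (fun i => (Γ.get i).H (a i)) {x.idx, y.idx, z.idx} := by
  refine ⟨fun s s' h => ?_, fun i hi s u w => ?_, fun i hi s c u => ?_⟩
  · dsimp only
    rw [x.vec_congr (h _ (by simp)), y.vec_congr (h _ (by simp)), z.vec_congr (h _ (by simp))]
  · simp only [Finset.mem_insert, Finset.mem_singleton] at hi
    obtain rfl | rfl | rfl := hi
    · simp only [x.vec_update_add, y.vec_update_of_ne _ hxy, z.vec_update_of_ne _ hxz]
      exact (h₁ _ _).map_add _ _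
    · simp only [y.vec_update_add, x.vec_update_of_ne _ hxy.symm, z.vec_update_of_ne _ hyz]
      exact (h₂ _ _).map_add _ _
    · simp only [z.vec_update_add, x.vec_update_of_ne _ hxz.symm, y.vec_update_of_ne _ hyz.symm]
      exact (h₃ _ _).map_add _ _
  · simp only [Finset.mem_insert, Finset.mem_singleton] at hi
    obtain rfl | rfl | rfl := hi
    · simp only [x.vec_update_smul, y.vec_update_of_ne _ hxy, z.vec_update_of_ne _ hxz]
      exact (h₁ _ _).map_smul _ _
    · simp only [y.vec_update_smul, x.vec_update_of_ne _ hxy.symm, z.vec_update_of_ne _ hyz]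
      exact (h₂ _ _).map_smul _ _
    · simp only [z.vec_update_smul, x.vec_update_of_ne _ hxz.symm, y.vec_update_of_ne _ hyz.symm]
      exact (h₃ _ _).map_smul _ _

/-- The functions `x = (y ↷)` given by a variable, with values in a given atom. -/
def varBlock (x : Var Γ X) (a : Atoms Γ) (j : X.At) : Submodule ℂ (Vec a → X.H j) :=
  Submodule.span ℂ {w | ∃ e : x.atom a = j, w = fun z => e ▸ x.vec z}

/-- The values of `F(s, t)`, where the values of `s` and `t` are given. -/
def appBlock {V : Type*} (F : BinRel (X.prod Y) Z) (S : ∀ j, Submodule ℂ (V → X.H j))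
    (T : ∀ j, Submodule ℂ (V → Y.H j)) (k : Z.At) : Submodule ℂ (V → Z.H k) :=
  Submodule.span ℂ {w | ∃ i j, ∃ s ∈ S i, ∃ t ∈ T j, ∃ f ∈ F (i, j) k,
    w = fun z => f (s z ⊗ₜ[ℂ] t z)}

/-- The values of a constant. -/
def constBlock {V : Type*} (C : BinRel QSet.one X) (k : X.At) : Submodule ℂ (V → X.H k) :=
  Submodule.span ℂ {w | ∃ c ∈ C () k, w = fun _ => c (1 : ℂ)}

/-- The operator that maps a vector-valued function `w` to `z ↦ y_*(w(z))`. -/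
def pairing (y : Var Γ Y.dual) (a : Atoms Γ) : (Vec a → Y.H (y.atom a)) →ₗ[ℂ] (Vec a → ℂ) where
  toFun w := fun z => y.vec z (w z)
  map_add' _ _ := funext fun z => map_add (y.vec z) _ _
  map_smul' _ _ := funext fun z => map_smul (y.vec z) _ _

/-- The functions `z ↦ y_*(w(z))`, where `w` ranges over the values of a term. -/
def graphBlock (T : ∀ j, Submodule ℂ (Vec a → Y.H j)) (y : Var Γ Y.dual) :
    Submodule ℂ (Vec a → ℂ) :=
  (T (y.atom a)).map (pairing y a)

end Blocks

namespace Vars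

variable {Γ Δ : List QSet.{u, v}} {X : QSet.{u, v}}

/-- All variables of a tuple but the first. -/
def tail (ρ : Vars Γ (X :: Δ)) : Vars Γ Δ := fun _ w => ρ w.succ

theorem support_nil (ρ : Vars Γ []) : ρ.support = ∅ := rfl

theorem support_cons (ρ : Vars Γ (X :: Δ)) :
    ρ.support = insert (ρ Var.zero).idx ρ.tail.support := by
  ext i
  simp only [support, Finset.mem_insert, Finset.mem_image, Finset.mem_univ, true_and]
  constructor
  · rintro ⟨j, rfl⟩
    induction j using Fin.cases with
    | zero => exact Or.inl rfl
    | succ j => exact Or.inr ⟨j, rfl⟩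
  · rintro (rfl | ⟨j, rfl⟩)
    · exact ⟨0, rfl⟩
    · exact ⟨j.succ, rfl⟩

theorem injective_nil (ρ : Vars Γ []) : Function.Injective ρ.pos := fun i => i.elim0

theorem injective_cons {ρ : Vars Γ (X :: Δ)} (h : (ρ Var.zero).idx ∉ ρ.tail.support)
    (hρ : Function.Injective ρ.tail.pos) : Function.Injective ρ.pos := by
  intro i j hij
  induction i using Fin.cases with
  | zero =>
    induction j using Fin.cases with
    | zero => rfl
    | succ j => exact absurd (Finset.mem_image.2 ⟨j, Finset.mem_univ _, hij.symm⟩) h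
  | succ i =>
    induction j using Fin.cases with
    | zero => exact absurd (Finset.mem_image.2 ⟨i, Finset.mem_univ _, hij⟩) h
    | succ j => exact congrArg Fin.succ (hρ hij)

end Vars

section Pulls

variable {Γ : List QSet.{u, v}} {X Y Z : QSet.{u, v}} {a : Atoms Γ}

theorem mem_varBlock_self (x : Var Γ X) (a : Atoms Γ) : x.vec ∈ varBlock x a (x.atom a) :=
  Submodule.subset_span ⟨rfl, rfl⟩

theorem varBlock_self (x : Var Γ X) (a : Atoms Γ) :
    varBlock x a (x.atom a) = Submodule.span ℂ {fun z => x.vec z} := by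
  rw [varBlock]
  congr 1
  ext w
  exact ⟨fun ⟨_, h⟩ => h, fun h => ⟨rfl, h⟩⟩

theorem varBlock_of_ne (x : Var Γ X) {a : Atoms Γ} {j : X.At} (h : x.atom a ≠ j) :
    varBlock x a j = ⊥ := by
  rw [varBlock, Submodule.span_eq_bot]
  rintro w ⟨e, _⟩
  exact absurd e h

theorem mem_varBlock_cases {x : Var Γ X} {j : X.At} {w : Vec a → X.H j} (hw : w ∈ varBlock x a j) :
    w = 0 ∨ ∃ e : x.atom a = j, ∃ c : ℂ, w = c • fun z => e ▸ x.vec z := by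
  by_cases h : x.atom a = j
  · subst h
    rw [varBlock_self, Submodule.mem_span_singleton] at hw
    obtain ⟨c, rfl⟩ := hw
    exact Or.inr ⟨rfl, c, rfl⟩
  · rw [varBlock_of_ne x h] at hw
    exact Or.inl hw

theorem appBlock_var (F : BinRel (X.prod Y) Z) (x : Var Γ X) (y : Var Γ Y) (k : Z.At) :
    appBlock F (varBlock x a) (varBlock y a) k =
      Submodule.span ℂ {w | ∃ t ∈ F (x.atom a, y.atom a) k,
        w = fun z => t (x.vec z ⊗ₜ[ℂ] y.vec z)} := by
  apply le_antisymm
  · refine Submodule.span_le.2 ?_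
    rintro _ ⟨i, j, s, hs, t, ht, f, hf, rfl⟩
    obtain rfl | ⟨rfl, c, rfl⟩ := mem_varBlock_cases hs
    · rw [show (fun z => f ((0 : Vec a → X.H i) z ⊗ₜ[ℂ] t z)) = 0 from
        funext fun z => (congrArg f (TensorProduct.zero_tmul _ _)).trans (map_zero f)]
      exact Submodule.zero_mem _
    obtain rfl | ⟨rfl, d, rfl⟩ := mem_varBlock_cases ht
    · refine (congrArg (· ∈ _) (funext fun z => ?_)).mpr (Submodule.zero_mem _)
      exact (congrArg f (TensorProduct.tmul_zero _ _)).trans (map_zero f)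
    refine Submodule.subset_span ⟨(c * d) • f, Submodule.smul_mem _ _ hf, funext fun z => ?_⟩
    change f ((c • x.vec z) ⊗ₜ[ℂ] (d • y.vec z)) = (c * d) • f (x.vec z ⊗ₜ[ℂ] y.vec z)
    rw [TensorProduct.smul_tmul_smul, map_smul]
  · refine Submodule.span_mono ?_
    rintro _ ⟨t, ht, rfl⟩
    exact ⟨_, _, x.vec, mem_varBlock_self x a, y.vec, mem_varBlock_self y a, t, ht, rfl⟩

theorem isLinearMap_transport {i j : X.At} (e : i = j) (ξ : StrongDual ℂ (X.H j)) :
    IsLinearMap ℂ fun x : X.H i => ξ (e ▸ x) := by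
  subst e
  exact ⟨map_add ξ, map_smul ξ⟩

theorem isLinearMap_apply_tmul_left {H K L : Type*} [AddCommGroup H] [Module ℂ H] [AddCommGroup K]
    [Module ℂ K] [NormedAddCommGroup L] [InnerProductSpace ℂ L] (t : H ⊗[ℂ] K →ₗ[ℂ] L)
    (y : K) (ξ : StrongDual ℂ L) : IsLinearMap ℂ fun x => ξ (t (x ⊗ₜ[ℂ] y)) :=
  ⟨fun x x' => by rw [TensorProduct.add_tmul, map_add, map_add],
    fun c x => by rw [← TensorProduct.smul_tmul', map_smul, map_smul]⟩

theorem isLinearMap_apply_tmul_right {H K L : Type*} [AddCommGroup H] [Module ℂ H] [AddCommGroup K]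
    [Module ℂ K] [NormedAddCommGroup L] [InnerProductSpace ℂ L] (t : H ⊗[ℂ] K →ₗ[ℂ] L)
    (x : H) (ξ : StrongDual ℂ L) : IsLinearMap ℂ fun y => ξ (t (x ⊗ₜ[ℂ] y)) :=
  ⟨fun y y' => by rw [TensorProduct.tmul_add, map_add, map_add],
    fun c y => by rw [TensorProduct.tmul_smul, map_smul, map_smul]⟩

/-- Equality and the graphs are brought to one shape, z ↦ y_*(w(z)) with w in a space of
vector-valued functions. This shape is preserved by substitution of terms. -/
theorem pull_eqRel (ρ : Vars Γ [X, X.dual]) :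
    ρ.pull (eqRel X) a = graphBlock (varBlock (ρ .zero) a) (ρ (.succ .zero)) := by
  rw [Vars.pull, graphBlock, varBlock, eqRel, Submodule.map_span, Submodule.map_span]
  congr 1
  ext f
  constructor
  · rintro ⟨ζ, ⟨e, h⟩, rfl⟩
    exact ⟨_, ⟨e, rfl⟩, funext fun z => (h (ρ.vec z)).symm⟩
  · rintro ⟨_, ⟨e, rfl⟩, rfl⟩
    have hmem := bilinear_mem_multilin (a := ρ.atoms a) (Var.zero : Var [X, X.dual] X)
      (Var.succ Var.zero : Var [X, X.dual] X.dual) (fun h => nomatch h)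
      (f := fun x ξ => (ξ : StrongDual ℂ _) (e ▸ x)) (fun ξ => isLinearMap_transport e ξ)
      (fun x => ⟨fun _ _ => rfl, fun _ _ => rfl⟩)
    obtain ⟨ζ, hζ⟩ := mem_multilin_univ.1 (show _ ∈ multilin _ Finset.univ from hmem)
    exact ⟨ζ, ⟨e, fun h => congrFun hζ h⟩, funext fun z => congrFun hζ (ρ.vec z)⟩

theorem pull_graph₂ (F : BinRel (X.prod Y) Z) (ρ : Vars Γ [X, Y, Z.dual]) :
    ρ.pull F.graph₂ a = graphBlock (appBlock F (varBlock (ρ .zero) a)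
      (varBlock (ρ (.succ .zero)) a)) (ρ (.succ (.succ .zero))) := by
  rw [Vars.pull, graphBlock, appBlock_var, BinRel.graph₂, Submodule.map_span, Submodule.map_span]
  congr 1
  ext f
  constructor
  · rintro ⟨ζ, ⟨t, ht, h⟩, rfl⟩
    exact ⟨_, ⟨t, ht, rfl⟩, funext fun z => (h (ρ.vec z)).symm⟩
  · rintro ⟨_, ⟨t, ht, rfl⟩, rfl⟩
    have hmem := trilinear_mem_multilin (a := ρ.atoms a) (Var.zero : Var [X, Y, Z.dual] X)
      (Var.succ Var.zero : Var [X, Y, Z.dual] Y)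
      (Var.succ (Var.succ Var.zero) : Var [X, Y, Z.dual] Z.dual) (fun h => nomatch h)
      (fun h => nomatch h) (fun h => nomatch h)
      (f := fun x y ξ => (ξ : StrongDual ℂ _) (t (x ⊗ₜ[ℂ] y)))
      (fun y ξ => isLinearMap_apply_tmul_left t y ξ) (fun x ξ => isLinearMap_apply_tmul_right t x ξ)
      (fun x y => ⟨fun _ _ => rfl, fun _ _ => rfl⟩)
    obtain ⟨ζ, hζ⟩ := mem_multilin_univ.1 (show _ ∈ multilin _ Finset.univ from hmem)
    exact ⟨ζ, ⟨t, ht, fun h => congrFun hζ h⟩, funext fun z => congrFun hζ (ρ.vec z)⟩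

theorem pull_graph₀ (C : BinRel QSet.one X) (ρ : Vars Γ [X.dual]) :
    ρ.pull C.graph₀ a = graphBlock (constBlock C) (ρ .zero) := by
  rw [Vars.pull, graphBlock, constBlock, BinRel.graph₀, Submodule.map_span, Submodule.map_span]
  congr 1
  ext f
  constructor
  · rintro ⟨ζ, ⟨t, ht, h⟩, rfl⟩
    exact ⟨_, ⟨t, ht, rfl⟩, funext fun z => (h (ρ.vec z)).symm⟩
  · rintro ⟨_, ⟨t, ht, rfl⟩, rfl⟩
    have hmem := linear_mem_multilin (a := ρ.atoms a) (Var.zero : Var [X.dual] X.dual)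
      (f := fun ξ => (ξ : StrongDual ℂ _) (t (1 : ℂ))) ⟨fun _ _ => rfl, fun _ _ => rfl⟩
    obtain ⟨ζ, hζ⟩ := mem_multilin_univ.1 (show _ ∈ multilin _ Finset.univ from hmem)
    exact ⟨ζ, ⟨t, ht, fun h => congrFun hζ h⟩, funext fun z => congrFun hζ (ρ.vec z)⟩

end Pulls

/-! ## Diagonal quantifiers -/

attribute [local instance] functionalNormed functionalHilbert

/-- With the inner product of the dual transported by Riesz, ⟨ξ, ⟨v, ·⟩⟩ is the conjugate of ξ(v),
so this is the expansion of ⟨v, ·⟩ in the basis `f`. It lets the chosen basis of X* be exchanged for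
the dual basis of the chosen basis of X. -/
theorem sum_conj_apply_smul {H : Type*} [NormedAddCommGroup H] [InnerProductSpace ℂ H]
    [FiniteDimensional ℂ H] {ι : Type*} [Fintype ι] (f : OrthonormalBasis ι ℂ (StrongDual ℂ H))
    (v : H) : ∑ l, conj (f l v) • f l = innerSL ℂ v := by
  have := FiniteDimensional.complete ℂ H
  have key : ∀ ξ : StrongDual ℂ H, inner ℂ ξ (innerSL ℂ v) = conj (ξ v) := fun ξ => by
    change inner ℂ ((InnerProductSpace.toDual ℂ H).symm ((InnerProductSpace.toDual ℂ H) v))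
      ((InnerProductSpace.toDual ℂ H).symm ξ) = _
    rw [LinearIsometryEquiv.symm_apply_apply, ← inner_conj_symm,
      InnerProductSpace.toDual_symm_apply]
  rw [← f.sum_repr' (innerSL ℂ v)]
  exact Finset.sum_congr rfl fun l _ => by rw [key]

theorem graphBlock_varBlock {Γ : List QSet.{u, v}} {X : QSet.{u, v}} {a : Atoms Γ} (x : Var Γ X)
    (y : Var Γ X.dual) : graphBlock (varBlock x a) y = Submodule.span ℂ
      {f | ∃ e : x.atom a = y.atom a, f = fun z => y.vec z (e ▸ x.vec z)} := by
  rw [graphBlock, varBlock, Submodule.map_span]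
  congr 1
  ext f
  constructor
  · rintro ⟨_, ⟨e, rfl⟩, rfl⟩
    exact ⟨e, rfl⟩
  · rintro ⟨e, rfl⟩
    exact ⟨_, ⟨e, rfl⟩, rfl⟩

section Diagonal

variable {Γ : List QSet.{u, v}} {X : QSet.{u, v}} {j : X.At} {a : Atoms Γ}

/-- A choice of atoms with the atoms `j` and `j*` added at the front. -/
abbrev Atoms.diag (j : X.At) (a : Atoms Γ) : Atoms (X :: X.dual :: Γ) :=
  Atoms.cons (X := X) j (Atoms.cons (X := X.dual) j a)

/-- Adding the vectors `y` and `η` at the front. -/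
abbrev Vec.diag (y : X.H j) (η : StrongDual ℂ (X.H j)) (x : Vec a) : Vec (Atoms.diag j a) :=
  Vec.cons (X := X) y (Vec.cons (X := X.dual) (j := j) η x)

/-- The evaluation of functionals at a vector. -/
def evalAt {H : Type*} [NormedAddCommGroup H] [InnerProductSpace ℂ H] (y : H) :
    StrongDual ℂ H →ₗ[ℂ] ℂ where
  toFun η := η y
  map_add' _ _ := rfl
  map_smul' _ _ := rfl

/-- The functional `(y, η, x) ↦ η(y) ξ(x)`. -/
def Functional.evTmul (j : X.At) (a : Atoms Γ) : Functional a →ₗ[ℂ] Functional (Atoms.diag j a) where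
  toFun ξ := Functional.ofSlice
    { toFun := fun y => Functional.tmul (X := X.dual) (j := j) (evalAt y) ξ
      map_add' := fun y y' => MultilinearMap.ext fun (x : Vec (Atoms.cons (X := X.dual) j a)) =>
        (congrArg (· * ξ x.tail) (map_add (x.head : StrongDual ℂ (X.H j)) y y')).trans (add_mul _ _ _)
      map_smul' := fun c y => MultilinearMap.ext fun (x : Vec (Atoms.cons (X := X.dual) j a)) =>
        (congrArg (· * ξ x.tail) (map_smul (x.head : StrongDual ℂ (X.H j)) c y)).trans
          (mul_assoc _ _ _) }
  map_add' _ _ := MultilinearMap.ext fun _ => mul_add _ _ _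
  map_smul' _ _ := MultilinearMap.ext fun _ => mul_left_comm _ _ _

theorem Functional.evTmul_apply (ξ : Functional a) (x : Vec (Atoms.diag j a)) :
    Functional.evTmul j a ξ x = (x.tail.head : StrongDual ℂ (X.H j)) x.head * ξ x.tail.tail := rfl

/-- Contraction of the first two arguments. -/
def contract (j : X.At) (a : Atoms Γ) : (Vec (Atoms.diag j a) → ℂ) →ₗ[ℂ] (Vec a → ℂ) where
  toFun f := fun x => ∑ k, f (Vec.diag (stdOrthonormalBasis ℂ (X.H j) k)
    (innerSL ℂ (stdOrthonormalBasis ℂ (X.H j) k)) x)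
  map_add' _ _ := funext fun _ => Finset.sum_add_distrib
  map_smul' _ _ := funext fun _ => (Finset.mul_sum _ _ _).symm

/-- Contraction of the first two arguments of a functional. -/
def Functional.contract (ζ : Functional (Atoms.diag j a)) : Functional a :=
  ∑ k, (ζ.slice (stdOrthonormalBasis ℂ (X.H j) k)).slice (X := X.dual) (j := j)
    (innerSL ℂ (stdOrthonormalBasis ℂ (X.H j) k))

theorem Functional.coe_contract (ζ : Functional (Atoms.diag j a)) :
    ⇑ζ.contract = _root_.contract j a ⇑ζ := by
  funext x
  exact sum_apply _ _ _

/-- The adjoint of η ⊗ · is the slice at the vector that represents η. -/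
theorem functionalInner_tmul (η : X.H j →ₗ[ℂ] ℂ) (ξ : Functional a)
    (ζ : Functional (Atoms.cons j a)) : functionalInner (Functional.tmul η ξ) ζ =
      functionalInner ξ (ζ.slice (∑ l, conj (η (stdOrthonormalBasis ℂ (X.H j) l)) •
        stdOrthonormalBasis ℂ (X.H j) l)) := by
  rw [functionalInner_cons, functionalInner_eq ξ, map_sum, inner_sum]
  refine Finset.sum_congr rfl fun l _ => ?_
  rw [map_smul, inner_smul_right, Functional.tmul, Functional.slice_ofSlice,
    LinearMap.smulRight_apply, functionalInner_eq, inner_smul_left]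

/-- Multiplication by the evaluation functional and contraction are adjoint to each other.
Everything about diagonal quantifiers rests on this. -/
theorem functionalInner_evTmul (ξ : Functional a) (ζ : Functional (Atoms.diag j a)) :
    functionalInner (Functional.evTmul j a ξ) ζ = functionalInner ξ ζ.contract := by
  rw [functionalInner_cons, functionalInner_eq ξ, Functional.contract, inner_sum]
  refine Finset.sum_congr rfl fun k _ => ?_
  have h := functionalInner_tmul (X := X.dual) (j := j)
    (evalAt (stdOrthonormalBasis ℂ (X.H j) k)) ξ (ζ.slice (stdOrthonormalBasis ℂ (X.H j) k))
  refine Eq.trans h ?_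
  rw [← sum_conj_apply_smul (stdOrthonormalBasis ℂ (StrongDual ℂ (X.H j)))]
  rfl

/-- Expanding y in an orthonormal basis, η(y) = Σ ⟨eₖ, y⟩η(eₖ). So a condition on all simple tensors
passes to the evaluation functional. -/
theorem evTmul_eq_sum (ξ : Functional a) : Functional.evTmul j a ξ =
    ∑ k, Functional.tmul (innerₛₗ ℂ (stdOrthonormalBasis ℂ (X.H j) k))
      (Functional.tmul (X := X.dual) (j := j) (evalAt (stdOrthonormalBasis ℂ (X.H j) k)) ξ) := by
  refine MultilinearMap.ext fun (x : Vec (Atoms.diag j a)) => Eq.trans ?_ (sum_apply _ _ _).symm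
  change (x.tail.head : StrongDual ℂ (X.H j)) x.head * ξ x.tail.tail = ∑ k,
    inner ℂ (stdOrthonormalBasis ℂ (X.H j) k) x.head *
      ((x.tail.head : StrongDual ℂ (X.H j)) (stdOrthonormalBasis ℂ (X.H j) k) * ξ x.tail.tail)
  conv_lhs => rw [← (stdOrthonormalBasis ℂ (X.H j)).sum_repr' x.head, map_sum, Finset.sum_mul]
  refine Finset.sum_congr rfl fun k _ => ?_
  rw [map_smul, smul_eq_mul, mul_assoc]

/-- The contraction of the evaluation functional is the trace of the identity. -/
theorem contract_evTmul (ξ : Functional a) : (Functional.evTmul j a ξ).contract =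
    (Module.finrank ℂ (X.H j) : ℂ) • ξ := by
  refine MultilinearMap.ext fun x => (sum_apply _ _ _).trans ?_
  change ∑ k, inner ℂ (stdOrthonormalBasis ℂ (X.H j) k) (stdOrthonormalBasis ℂ (X.H j) k) * ξ x =
    (Module.finrank ℂ (X.H j) : ℂ) * ξ x
  simp

theorem contract_tmul_tmul (η : X.H j →ₗ[ℂ] ℂ) (η' : X.dual.H j →ₗ[ℂ] ℂ) (ξ : Functional a) :
    ∃ c : ℂ, (Functional.tmul η (Functional.tmul (X := X.dual) (j := j) η' ξ)).contract = c • ξ := by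
  refine ⟨∑ k, η (stdOrthonormalBasis ℂ (X.H j) k) *
    η' (innerSL ℂ (stdOrthonormalBasis ℂ (X.H j) k)),
    MultilinearMap.ext fun x => (sum_apply _ _ _).trans ?_⟩
  refine Eq.trans ?_ (Finset.sum_mul _ _ _).symm
  refine Finset.sum_congr rfl fun k _ => ?_
  exact (mul_assoc _ _ _).symm

theorem Functional.contract_sub (ζ ζ' : Functional (Atoms.diag j a)) :
    (ζ - ζ').contract = ζ.contract - ζ'.contract := by
  apply functionalCoe_injective
  rw [map_sub]
  refine (Functional.coe_contract _).trans ?_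
  refine (map_sub (_root_.contract j a) ⇑ζ ⇑ζ').trans ?_
  rw [← Functional.coe_contract, ← Functional.coe_contract]
  rfl

theorem Functional.contract_smul (c : ℂ) (ζ : Functional (Atoms.diag j a)) :
    (c • ζ).contract = c • ζ.contract := by
  apply functionalCoe_injective
  rw [map_smul]
  refine (Functional.coe_contract _).trans ?_
  refine (map_smul (_root_.contract j a) c ⇑ζ).trans ?_
  rw [← Functional.coe_contract]
  rfl

namespace Formula

theorem support_eq_zero_one {Y : QSet.{u, v}} (x : Vars (X :: Y :: Γ) [X, Y])
    (h₀ : x .zero = .zero) (h₁ : x (.succ .zero) = .succ .zero) :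
    Function.Injective x.pos ∧ x.supportᶜ = shift (shift Finset.univ) := by
  have hs : x.support = {0, 1} := by
    rw [Vars.support_cons, Vars.support_cons, Vars.support_nil, h₀]
    change insert _ (insert (x (.succ .zero)).idx ∅) = _
    rw [h₁]
    rfl
  constructor
  · refine Vars.injective_cons ?_ (Vars.injective_cons ?_ (Vars.injective_nil _))
    · rw [Vars.support_cons, Vars.support_nil, h₀]
      change _ ∉ insert (x (.succ .zero)).idx ∅
      rw [h₁]
      exact fun h => nomatch Finset.mem_singleton.1 h
    · exact Finset.notMem_empty _
  · rw [hs]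
    ext i
    rw [Finset.mem_compl]
    induction i using Fin.cases with
    | zero =>
      refine iff_of_false (fun h => h (Finset.mem_insert_self _ _)) fun h => ?_
      obtain ⟨i, _, hi⟩ := Finset.mem_map.1 h
      exact Fin.succ_ne_zero _ hi
    | succ i =>
      induction i using Fin.cases with
      | zero =>
        refine iff_of_false (fun h => h (Finset.mem_insert_of_mem (Finset.mem_singleton_self _)))
          fun h => ?_
        obtain ⟨i, hi', hi⟩ := Finset.mem_map.1 h
        obtain ⟨k, _, rfl⟩ := Finset.mem_map.1 hi'
        exact Fin.succ_ne_zero _ (Fin.succ_injective _ hi)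
      | succ i =>
        refine iff_of_true (fun h => ?_) (Finset.mem_map_of_mem (Fin.succEmb _)
          (Finset.mem_map_of_mem (Fin.succEmb _) (Finset.mem_univ i)))
        obtain h | h := Finset.mem_insert.1 h
        · exact Fin.succ_ne_zero _ h
        · exact Fin.succ_ne_zero _ (Fin.succ_injective _ (Finset.mem_singleton.1 h))

theorem fn_eq (j j' : X.At) (a : Atoms Γ) :
    (eq (Γ := X :: X.dual :: Γ) .zero (.succ .zero)).interp.fn
      (Atoms.cons (X := X) j (Atoms.cons (X := X.dual) j' a)) =
    graphBlock (varBlock (.zero : Var (X :: X.dual :: Γ) X) _) (.succ .zero) *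
      multilin _ (shift (shift Finset.univ)) := by
  obtain ⟨h, h'⟩ := support_eq_zero_one (Γ := Γ) (X := X) (Y := X.dual)
    (.cons .zero (.cons (.succ .zero) .nil)) rfl rfl
  refine (Vars.fn_atomic _ h _ _).trans ?_
  rw [h', pull_eqRel]
  rfl

theorem mem_eq_iff {ζ : Functional (Atoms.diag j a)} :
    ζ ∈ (eq (Γ := X :: X.dual :: Γ) .zero (.succ .zero)).interp (Atoms.diag j a) ↔
      ∃ ξ : Functional a, Functional.evTmul j a ξ = ζ := by
  have hev : graphBlock (varBlock (.zero : Var (X :: X.dual :: Γ) X) (Atoms.diag j a))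
      (.succ .zero) = Submodule.span ℂ
        {fun x : Vec (Atoms.diag j a) => (x.tail.head : StrongDual ℂ (X.H j)) x.head} := by
    refine (graphBlock_varBlock _ _).trans (congrArg _ (Set.ext fun f => ?_))
    exact ⟨fun ⟨_, h⟩ => h, fun h => ⟨rfl, h⟩⟩
  rw [← QRel.coe_mem_fn, fn_eq, hev, Submodule.mem_span_singleton_mul]
  have hM : ∀ g : Vec (Atoms.diag j a) → ℂ, g ∈ multilin _ (shift (shift Finset.univ)) ↔
      ∃ ξ : Functional a, g = fun x => ξ x.tail.tail := by
    intro g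
    have h1 := multilin_shift (X := X) (j := j) (a := Atoms.cons (X := X.dual) j a)
      (shift Finset.univ)
    have h2 := multilin_shift (X := X.dual) (j := j) (a := a) Finset.univ
    have h3 := h1.trans (congrArg _ h2)
    refine (iff_of_eq (congrArg (g ∈ ·) h3)).trans ?_
    constructor
    · rintro ⟨_, ⟨f, hf, rfl⟩, rfl⟩
      obtain ⟨ξ, rfl⟩ := mem_multilin_univ.1 hf
      exact ⟨ξ, rfl⟩
    · rintro ⟨ξ, rfl⟩
      exact ⟨_, ⟨ξ, mem_multilin_univ.2 ⟨ξ, rfl⟩, rfl⟩, rfl⟩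
  constructor
  · rintro ⟨g, hg, h⟩
    obtain ⟨ξ, rfl⟩ := (hM g).1 hg
    exact ⟨ξ, DFunLike.coe_injective h⟩
  · rintro ⟨ξ, rfl⟩
    exact ⟨_, (hM _).2 ⟨ξ, rfl⟩, rfl⟩

theorem eq_interp_of_ne {j j' : X.At} (h : j ≠ j') (a : Atoms Γ) :
    (eq (Γ := X :: X.dual :: Γ) .zero (.succ .zero)).interp
      (Atoms.cons (X := X) j (Atoms.cons (X := X.dual) j' a)) = ⊥ := by
  rw [eq_bot_iff]
  intro ζ hζ
  have hev : graphBlock (varBlock (.zero : Var (X :: X.dual :: Γ) X)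
      (Atoms.cons (X := X) j (Atoms.cons (X := X.dual) j' a))) (.succ .zero) = ⊥ := by
    refine (graphBlock_varBlock _ _).trans (Submodule.span_eq_bot.2 ?_)
    rintro f ⟨e, _⟩
    exact absurd e h
  rw [← QRel.coe_mem_fn, fn_eq, hev, Submodule.bot_mul] at hζ
  exact DFunLike.coe_injective hζ

/-- At atoms j and j*, the premise E consists of the evaluation functional times arbitrary ξ. A
simple tensor η ⊗ η' ⊗ ξ splits into a multiple of this and a part orthogonal to E; the latter lies
in the implication by `neg_le_imp`, and the former does if and only if it lies in φ, by
`mem_imp_iff`. -/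
theorem mem_allDiag {φ : Formula (X :: X.dual :: Γ)} {ξ : Functional a} :
    ξ ∈ (allDiag X φ).interp a ↔
      ∀ j : X.At, Functional.evTmul j a ξ ∈ φ.interp (Atoms.diag j a) := by
  have hall : ξ ∈ (allDiag X φ).interp a ↔ ∀ (j' : X.At) (η' : X.dual.H j' →ₗ[ℂ] ℂ) (j : X.At)
      (η : X.H j →ₗ[ℂ] ℂ), Functional.tmul η (Functional.tmul (X := X.dual) (j := j') η' ξ) ∈
        (imp (eq .zero (.succ .zero)) φ).interp
          (Atoms.cons (X := X) j (Atoms.cons (X := X.dual) j' a)) := by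
    refine mem_all.trans (forall_congr' fun j' => forall_congr' fun η' => mem_all)
  rw [hall]
  constructor
  · intro h j
    rw [← mem_imp_iff (mem_eq_iff.2 ⟨ξ, rfl⟩), evTmul_eq_sum]
    exact Submodule.sum_mem _ fun k _ => h j _ j _
  · intro h j' η' j η
    by_cases hj : j = j'
    · subst hj
      set ζ := Functional.tmul η (Functional.tmul (X := X.dual) (j := j) η' ξ)
      obtain ⟨c, hc⟩ := contract_tmul_tmul η η' ξ
      have hn : (Module.finrank ℂ (X.H j) : ℂ) ≠ 0 := Nat.cast_ne_zero.2 Module.finrank_pos.ne'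
      -- The coefficient is chosen such that the contraction of the difference vanishes, which by
      -- adjointness means orthogonality to the equality relation.
      set d := c / (Module.finrank ℂ (X.H j) : ℂ)
      have h₁ : (ζ - d • Functional.evTmul j a ξ).contract = 0 := by
        rw [Functional.contract_sub, Functional.contract_smul, contract_evTmul, hc, smul_smul,
          div_mul_cancel₀ _ hn, sub_self]
      rw [← sub_add_cancel ζ (d • Functional.evTmul j a ξ)]
      refine Submodule.add_mem _ (neg_le_imp _ _ _ ?_) (Submodule.smul_mem _ _ ?_)
      · intro ω hω
        obtain ⟨ξ', rfl⟩ := mem_eq_iff.1 hω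
        rw [functionalInner_evTmul, h₁]
        exact inner_zero_right (𝕜 := ℂ) ξ'
      · exact (mem_imp_iff (mem_eq_iff.2 ⟨ξ, rfl⟩)).2 (h j)
    -- At different atoms equality is zero, so its complement, and with it the implication, is
    -- everything.
    · refine neg_le_imp _ _ _ ?_
      rw [QRel.neg_apply, eq_interp_of_ne hj, Submodule.bot_orthogonal_eq_top]
      trivial

/-- By `mem_allDiag` and the adjointness of `evTmul` and contraction, the inner universal quantifier
is the complement of the contractions of elements of φ; a second complement gives their span. -/
theorem fn_exDiag (φ : Formula (X :: X.dual :: Γ)) (a : Atoms Γ) :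
    (exDiag X φ).interp.fn a =
      ⨆ j : X.At, (φ.interp.fn (Atoms.diag j a)).map (contract j a) := by
  set K : Submodule ℂ (Functional a) := Submodule.span ℂ {ξ | ∃ (j : X.At),
    ∃ ζ ∈ φ.interp (Atoms.diag j a), ξ = ζ.contract} with hK
  have h : (allDiag X (neg φ)).interp a = Kᗮ := by
    ext ξ
    rw [mem_allDiag, hK, Submodule.mem_orthogonal]
    have key : ∀ (j : X.At) (ζ : Functional (Atoms.diag j a)),
        functionalInner ζ (Functional.evTmul j a ξ) = inner ℂ ζ.contract ξ := fun j ζ => by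
      rw [functionalInner_eq, ← inner_conj_symm, ← functionalInner_eq, functionalInner_evTmul,
        functionalInner_eq, inner_conj_symm]
    constructor
    · intro h u hu
      induction hu using Submodule.span_induction with
      | mem u hu =>
        obtain ⟨j, ζ, hζ, rfl⟩ := hu
        rw [← key]
        exact h j ζ hζ
      | zero => exact inner_zero_left _
      | add u w _ _ hu hw => rw [inner_add_left, hu, hw, add_zero]
      | smul c u _ hu => rw [inner_smul_left, hu, mul_zero]
    · intro h j ζ hζ
      rw [key]
      exact h _ (Submodule.subset_span ⟨j, ζ, hζ, rfl⟩)
  have h' : (exDiag X φ).interp a = K := by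
    change (allDiag X (neg φ)).interp.neg a = K
    rw [QRel.neg_apply, h, Submodule.orthogonal_orthogonal]
  rw [QRel.fn, h', hK, Submodule.map_span]
  apply le_antisymm
  · refine Submodule.span_le.2 ?_
    rintro _ ⟨_, ⟨j, ζ, hζ, rfl⟩, rfl⟩
    refine Submodule.mem_iSup_of_mem j ⟨ζ, ⟨ζ, hζ, rfl⟩, ?_⟩
    exact (Functional.coe_contract ζ).symm
  · refine iSup_le fun j => ?_
    rintro _ ⟨_, ⟨ζ, hζ, rfl⟩, rfl⟩
    exact Submodule.subset_span ⟨_, ⟨j, ζ, hζ, rfl⟩, Functional.coe_contract ζ⟩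

end Formula

end Diagonal

/-! ## The values of terms -/

section Contraction

variable {Γ : List QSet.{u, v}} {X : QSet.{u, v}} {j : X.At} {a : Atoms Γ}

/-- A function as a function of two more arguments. -/
def weaken (j : X.At) (a : Atoms Γ) (K : Type*) [AddCommGroup K] [Module ℂ K] :
    (Vec a → K) →ₗ[ℂ] (Vec (Atoms.diag j a) → K) where
  toFun w := fun x => w x.tail.tail
  map_add' _ _ := rfl
  map_smul' _ _ := rfl

theorem multilin_shift_shift (S : Finset (Fin Γ.length)) :
    multilin (fun i => ((X :: X.dual :: Γ).get i).H (Atoms.diag j a i)) (shift (shift S)) =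
      (multilin (fun i => (Γ.get i).H (a i)) S).map (weaken j a ℂ) := by
  have h1 := multilin_shift (X := X) (j := j) (a := Atoms.cons (X := X.dual) j a) (shift S)
  have h2 := multilin_shift (X := X.dual) (j := j) (a := a) S
  refine (h1.trans (congrArg _ h2)).trans ?_
  exact (Submodule.map_comp _ _ _).symm

/-- Contraction performs substitution: Σ α(eₖ)⟨eₖ, w⟩ = α(w), so a variable whose partner is paired
with `w` is replaced by `w`. -/
theorem contract_eq {f : Vec (Atoms.diag j a) → ℂ} (α : X.H j → Vec a → ℂ)
    (hα : ∀ z, IsLinearMap ℂ fun y => α y z) (w : Vec a → X.H j) (c : Vec a → ℂ)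
    (h : ∀ y η z, f (Vec.diag y η z) = α y z * η (w z) * c z) :
    contract j a f = fun z => α (w z) z * c z := by
  funext z
  change ∑ k, f (Vec.diag (stdOrthonormalBasis ℂ (X.H j) k)
    (innerSL ℂ (stdOrthonormalBasis ℂ (X.H j) k)) z) = _
  simp only [h]
  rw [← Finset.sum_mul]
  congr 1
  let L : X.H j →ₗ[ℂ] ℂ := (hα z).mk' _
  change _ = L (w z)
  conv_rhs => rw [← (stdOrthonormalBasis ℂ (X.H j)).sum_repr' (w z), map_sum]
  refine Finset.sum_congr rfl fun k _ => ?_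
  rw [map_smul, smul_eq_mul, mul_comm]
  rfl

end Contraction

theorem Vars.idx_apply {Γ Γ' : List QSet.{u, v}} {X : QSet.{u, v}} (ρ : Vars Γ' Γ) (x : Var Γ X) :
    (ρ x).idx = ρ.pos x.idx := by
  induction x with
  | zero => rfl
  | succ x ih => exact ih (fun _ w => ρ w.succ)

theorem Vars.idx_mem_support {Γ Γ' : List QSet.{u, v}} {X : QSet.{u, v}} (ρ : Vars Γ' Γ)
    (x : Var Γ X) : (ρ x).idx ∈ ρ.support :=
  ρ.idx_apply x ▸ ρ.pos_mem_support _

/-- A tuple of variables in a context with two more variables. -/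
def Vars.weaken {Γ Γ' : List QSet.{u, v}} (Y : QSet.{u, v}) (ρ : Vars Γ' Γ) :
    Vars (Y :: Y.dual :: Γ') Γ := fun _ w => (ρ w).succ.succ

theorem Vars.weaken_injective {Γ Γ' : List QSet.{u, v}} (Y : QSet.{u, v}) {ρ : Vars Γ' Γ}
    (h : Function.Injective ρ.pos) : Function.Injective (ρ.weaken Y).pos := fun _ _ e =>
  h (Fin.succ_injective _ (Fin.succ_injective _ e))

theorem Vars.weaken_support {Γ Γ' : List QSet.{u, v}} (Y : QSet.{u, v}) (ρ : Vars Γ' Γ) :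
    (ρ.weaken Y).support = shift (shift ρ.support) := by
  simp only [Vars.support, shift, Finset.map_eq_image, Finset.image_image]
  rfl

/-- The space of vector-valued functions that a term stands for, in any context that contains the
variables of `Γ`, together with the positions of the variables that occur in the term. -/
structure TermValue (Γ : List QSet.{u, v}) (X : QSet.{u, v}) where
  /-- the positions of the variables of the term -/
  supp : ∀ {Γ' : List QSet.{u, v}}, Vars Γ' Γ → Finset (Fin Γ'.length)
  /-- the values of the term -/
  val : ∀ {Γ' : List QSet.{u, v}}, Vars Γ' Γ → ∀ (a : Atoms Γ') (j : X.At),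
    Submodule ℂ (Vec a → X.H j)
  supp_subset : ∀ {Γ' : List QSet.{u, v}} (ρ : Vars Γ' Γ), supp ρ ⊆ ρ.support
  supp_weaken : ∀ {Γ' : List QSet.{u, v}} (ρ : Vars Γ' Γ) (Y : QSet.{u, v}),
    supp (ρ.weaken Y) = shift (shift (supp ρ))
  val_weaken : ∀ {Γ' : List QSet.{u, v}} (ρ : Vars Γ' Γ) (Y : QSet.{u, v}) (a : Atoms Γ')
    (j : Y.At) (k : X.At),
    val (ρ.weaken Y) (Atoms.diag j a) k = (val ρ a k).map (weaken j a (X.H k))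
  multilin_mem : ∀ {Γ' : List QSet.{u, v}} (ρ : Vars Γ' Γ), Function.Injective ρ.pos →
    ∀ (a : Atoms Γ') (j : X.At), ∀ w ∈ val ρ a j, ∀ ξ : X.H j →ₗ[ℂ] ℂ,
      (fun z => ξ (w z)) ∈ multilin (fun i => (Γ'.get i).H (a i)) (supp ρ)

namespace TermValue

variable {Γ Γ' : List QSet.{u, v}} {X Y Z : QSet.{u, v}}

/-- Expanding the value w in an orthonormal basis writes y_*(w) as a sum of products of y_*(eₖ) with
coordinates of w, which involve disjoint sets of variables. -/
theorem graphBlock_le (t : TermValue Γ X) {ρ : Vars Γ' Γ} (hρ : Function.Injective ρ.pos)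
    {y : Var Γ' X.dual} (hy : y.idx ∉ ρ.support) (a : Atoms Γ') :
    graphBlock (t.val ρ a) y ≤ multilin _ (insert y.idx (t.supp ρ)) := by
  rintro _ ⟨w, hw, rfl⟩
  set e := stdOrthonormalBasis ℂ (X.H (y.atom a))
  have : pairing y a w = ∑ k, (fun z => (y.vec z : StrongDual ℂ _) (e k)) *
      fun z => innerₛₗ ℂ (e k) (w z) := by
    funext z
    change (y.vec z : StrongDual ℂ _) (w z) = _
    rw [Finset.sum_apply]
    conv_lhs => rw [← e.sum_repr' (w z), map_sum]
    refine Finset.sum_congr rfl fun k _ => ?_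
    rw [map_smul, smul_eq_mul, mul_comm]
    rfl
  rw [this, Finset.insert_eq]
  refine Submodule.sum_mem _ fun k _ => mul_mem_multilin ?_
    (linear_mem_multilin y (f := fun η => (η : StrongDual ℂ _) (e k))
      ⟨fun _ _ => rfl, fun _ _ => rfl⟩) (t.multilin_mem ρ hρ a _ w hw _)
  exact Finset.disjoint_singleton_left.2 fun h => hy (t.supp_subset ρ h)

theorem val_weaken_two (t : TermValue Γ X) (ρ : Vars Γ' Γ) {U V : QSet.{u, v}} (i : U.At)
    (j : V.At) (a : Atoms Γ') (k : X.At) :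
    t.val ((ρ.weaken V).weaken U) (Atoms.diag i (Atoms.diag j a)) k =
      (t.val ρ a k).map (_root_.weaken i (Atoms.diag j a) (X.H k) ∘ₗ _root_.weaken j a (X.H k)) := by
  rw [t.val_weaken, t.val_weaken, Submodule.map_comp]

theorem val_weaken_three (t : TermValue Γ X) (ρ : Vars Γ' Γ) {U V W : QSet.{u, v}} (i : U.At)
    (j : V.At) (l : W.At) (a : Atoms Γ') (k : X.At) :
    t.val (((ρ.weaken W).weaken V).weaken U) (Atoms.diag i (Atoms.diag j (Atoms.diag l a))) k =
      (t.val ρ a k).map (_root_.weaken i (Atoms.diag j (Atoms.diag l a)) (X.H k) ∘ₗ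
        _root_.weaken j (Atoms.diag l a) (X.H k) ∘ₗ _root_.weaken l a (X.H k)) := by
  rw [t.val_weaken, t.val_weaken, t.val_weaken, Submodule.map_comp, Submodule.map_comp]

/-- A variable. -/
def var (x : Var Γ X) : TermValue Γ X where
  supp ρ := {(ρ x).idx}
  val ρ a j := varBlock (ρ x) a j
  supp_subset ρ := Finset.singleton_subset_iff.2 (ρ.idx_mem_support x)
  supp_weaken ρ Y := by
    simp only [shift, Finset.map_singleton]
    rfl
  val_weaken ρ Y a j k := by
    rw [varBlock, varBlock, Submodule.map_span]
    congr 1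
    ext f
    constructor
    · rintro ⟨e, rfl⟩
      exact ⟨_, ⟨e, rfl⟩, rfl⟩
    · rintro ⟨_, ⟨e, rfl⟩, rfl⟩
      exact ⟨e, rfl⟩
  multilin_mem ρ _ a j w hw ξ := by
    obtain rfl | ⟨rfl, c, rfl⟩ := mem_varBlock_cases hw
    · rw [show (fun z => ξ ((0 : Vec a → X.H j) z)) = 0 from funext fun z => map_zero ξ]
      exact Submodule.zero_mem _
    · refine linear_mem_multilin (ρ x) (f := fun y => ξ (c • y)) ⟨fun y y' => ?_, fun d y => ?_⟩
      · rw [smul_add, map_add]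
      · rw [smul_comm, map_smul]

/-- A constant. -/
def const (C : BinRel QSet.one X) : TermValue Γ X where
  supp _ := ∅
  val _ _ j := constBlock C j
  supp_subset _ := Finset.empty_subset _
  supp_weaken _ _ := rfl
  val_weaken ρ Y a j k := by
    rw [constBlock, constBlock, Submodule.map_span]
    congr 1
    ext f
    constructor
    · rintro ⟨e, he, rfl⟩
      exact ⟨_, ⟨e, he, rfl⟩, rfl⟩
    · rintro ⟨_, ⟨e, he, rfl⟩, rfl⟩
      exact ⟨e, he, rfl⟩
  multilin_mem ρ _ a j w hw ξ := by
    have hc : ∃ c : X.H j, w = fun _ => c := by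
      induction hw using Submodule.span_induction with
      | mem w hw => obtain ⟨c, _, rfl⟩ := hw; exact ⟨_, rfl⟩
      | zero => exact ⟨0, rfl⟩
      | add w w' _ _ h h' => obtain ⟨c, rfl⟩ := h; obtain ⟨c', rfl⟩ := h'; exact ⟨c + c', rfl⟩
      | smul d w _ h => obtain ⟨c, rfl⟩ := h; exact ⟨d • c, rfl⟩
    obtain ⟨c, rfl⟩ := hc
    exact ⟨fun _ _ _ => rfl, fun i hi => absurd hi (Finset.notMem_empty i),
      fun i hi => absurd hi (Finset.notMem_empty i)⟩

theorem map_appBlock {V W : Type*} (φ : W → V) (F : BinRel (X.prod Y) Z)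
    (S : ∀ j, Submodule ℂ (V → X.H j)) (T : ∀ j, Submodule ℂ (V → Y.H j)) (k : Z.At) :
    (appBlock F S T k).map (LinearMap.funLeft ℂ (Z.H k) φ) =
      appBlock F (fun j => (S j).map (LinearMap.funLeft ℂ (X.H j) φ))
        (fun j => (T j).map (LinearMap.funLeft ℂ (Y.H j) φ)) k := by
  rw [appBlock, appBlock, Submodule.map_span]
  congr 1
  ext f
  constructor
  · rintro ⟨_, ⟨i, j, s, hs, t, ht, f, hf, rfl⟩, rfl⟩
    exact ⟨i, j, _, ⟨s, hs, rfl⟩, _, ⟨t, ht, rfl⟩, f, hf, rfl⟩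
  · rintro ⟨i, j, _, ⟨s, hs, rfl⟩, _, ⟨t, ht, rfl⟩, f, hf, rfl⟩
    exact ⟨_, ⟨i, j, s, hs, t, ht, f, hf, rfl⟩, rfl⟩

/-- The term `F(s, t)`, if `s` and `t` have no variables in common. -/
def app (F : BinRel (X.prod Y) Z) (s : TermValue Γ X) (t : TermValue Γ Y)
    (h : ∀ {Γ' : List QSet.{u, v}} (ρ : Vars Γ' Γ), Function.Injective ρ.pos →
      Disjoint (s.supp ρ) (t.supp ρ)) : TermValue Γ Z where
  supp ρ := s.supp ρ ∪ t.supp ρ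
  val ρ a := appBlock F (s.val ρ a) (t.val ρ a)
  supp_subset ρ := Finset.union_subset (s.supp_subset ρ) (t.supp_subset ρ)
  supp_weaken ρ Y := by
    rw [s.supp_weaken, t.supp_weaken, shift, shift, ← Finset.map_union, ← Finset.map_union]
  val_weaken ρ W a j k := by
    refine Eq.trans ?_ (map_appBlock (fun x : Vec (Atoms.diag j a) => x.tail.tail) F _ _ k).symm
    congr 1
    · funext i
      exact s.val_weaken ρ W a j i
    · funext i
      exact t.val_weaken ρ W a j i
  multilin_mem ρ hρ a k w hw ξ := by
    induction hw using Submodule.span_induction with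
    | mem w hw =>
      obtain ⟨i, j, x, hx, y, hy, f, hf, rfl⟩ := hw
      set e := stdOrthonormalBasis ℂ (X.H i)
      -- An orthonormal expansion of the first argument separates the variables of the two subterms
      -- into the factors of a product.
      have : (fun z => ξ (f (x z ⊗ₜ[ℂ] y z))) = ∑ k, (fun z => innerₛₗ ℂ (e k) (x z)) *
          fun z => (ξ ∘ₗ f ∘ₗ TensorProduct.mk ℂ (X.H i) (Y.H j) (e k)) (y z) := by
        funext z
        rw [Finset.sum_apply]
        conv_lhs => rw [← e.sum_repr' (x z), TensorProduct.sum_tmul, map_sum, map_sum]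
        refine Finset.sum_congr rfl fun k _ => ?_
        rw [← TensorProduct.smul_tmul', map_smul, map_smul, smul_eq_mul]
        rfl
      rw [this]
      exact Submodule.sum_mem _ fun k _ => mul_mem_multilin (h ρ hρ)
        (s.multilin_mem ρ hρ a i x hx _) (t.multilin_mem ρ hρ a j y hy _)
    | zero =>
      rw [show (fun z => ξ ((0 : Vec a → Z.H k) z)) = 0 from funext fun z => map_zero ξ]
      exact Submodule.zero_mem _
    | add w w' _ _ h h' =>
      rw [show (fun z => ξ ((w + w') z)) = (fun z => ξ (w z)) + fun z => ξ (w' z) from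
        funext fun z => map_add ξ _ _]
      exact Submodule.add_mem _ h h'
    | smul c w _ h =>
      rw [show (fun z => ξ ((c • w) z)) = c • fun z => ξ (w z) from funext fun z => map_smul ξ _ _]
      exact Submodule.smul_mem _ _ h

end TermValue

/-- The statement that a term has a given value. -/
def Term.Denotes {Γ : List QSet.{u, v}} {X : QSet.{u, v}} (t : Term Γ X) (T : TermValue Γ X) :
    Prop :=
  ∀ ⦃Γ' : List QSet.{u, v}⦄ (ρ : Vars Γ' Γ) (y : Var Γ' X.dual), Function.Injective ρ.pos →
    y.idx ∉ ρ.support → ∀ a : Atoms Γ', (t.graph ρ y).interp.fn a =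
      graphBlock (T.val ρ a) y * multilin _ (insert y.idx (T.supp ρ))ᶜ

section Denotes

variable {Γ Γ' : List QSet.{u, v}} {X Y Z : QSet.{u, v}}

theorem Formula.fn_rel_eqRel (σ : Vars Γ [X, X.dual])
    (h : (σ .zero).idx ≠ (σ (.succ .zero)).idx) (a : Atoms Γ) :
    (Formula.rel (eqRel X) σ).interp.fn a = graphBlock (varBlock (σ .zero) a) (σ (.succ .zero)) *
      multilin _ ({(σ .zero).idx, (σ (.succ .zero)).idx} : Finset _)ᶜ ∧
    graphBlock (varBlock (σ .zero) a) (σ (.succ .zero)) ≤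
      multilin _ ({(σ .zero).idx, (σ (.succ .zero)).idx} : Finset _) := by
  have hs : σ.support = {(σ .zero).idx, (σ (.succ .zero)).idx} := by
    rw [Vars.support_cons, Vars.support_cons, Vars.support_nil]
    rfl
  have hi : Function.Injective σ.pos := by
    refine Vars.injective_cons ?_ (Vars.injective_cons ?_ (Vars.injective_nil _))
    · rw [Vars.support_cons, Vars.support_nil]
      exact fun e => h (Finset.mem_singleton.1 e)
    · exact Finset.notMem_empty _
  rw [← hs, ← pull_eqRel]
  exact ⟨Vars.fn_atomic σ hi _ a, Vars.pull_le σ hi _ a⟩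

theorem Formula.fn_rel_graph₂ (F : BinRel (X.prod Y) Z) (σ : Vars Γ [X, Y, Z.dual])
    (h₁ : (σ .zero).idx ≠ (σ (.succ .zero)).idx) (h₂ : (σ .zero).idx ≠ (σ (.succ (.succ .zero))).idx)
    (h₃ : (σ (.succ .zero)).idx ≠ (σ (.succ (.succ .zero))).idx) (a : Atoms Γ) :
    (Formula.rel F.graph₂ σ).interp.fn a = graphBlock (appBlock F (varBlock (σ .zero) a)
      (varBlock (σ (.succ .zero)) a)) (σ (.succ (.succ .zero))) *
      multilin _ ({(σ .zero).idx, (σ (.succ .zero)).idx,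
        (σ (.succ (.succ .zero))).idx} : Finset _)ᶜ ∧
    graphBlock (appBlock F (varBlock (σ .zero) a)
      (varBlock (σ (.succ .zero)) a)) (σ (.succ (.succ .zero))) ≤
      multilin _ ({(σ .zero).idx, (σ (.succ .zero)).idx,
        (σ (.succ (.succ .zero))).idx} : Finset _) := by
  have hs : σ.support = {(σ .zero).idx, (σ (.succ .zero)).idx, (σ (.succ (.succ .zero))).idx} := by
    rw [Vars.support_cons, Vars.support_cons, Vars.support_cons, Vars.support_nil]
    rfl
  have hi : Function.Injective σ.pos := by
    refine Vars.injective_cons ?_ (Vars.injective_cons ?_ (Vars.injective_cons ?_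
      (Vars.injective_nil _)))
    · rw [Vars.support_cons, Vars.support_cons, Vars.support_nil]
      exact fun e => (Finset.mem_insert.1 e).elim h₁ fun e => h₂ (Finset.mem_singleton.1 e)
    · rw [Vars.support_cons, Vars.support_nil]
      exact fun e => h₃ (Finset.mem_singleton.1 e)
    · exact Finset.notMem_empty _
  rw [← hs, ← pull_graph₂]
  exact ⟨Vars.fn_atomic σ hi _ a, Vars.pull_le σ hi _ a⟩

theorem Formula.fn_rel_graph₀ (C : BinRel QSet.one X) (σ : Vars Γ [X.dual]) (a : Atoms Γ) :
    (Formula.rel C.graph₀ σ).interp.fn a = graphBlock (constBlock C) (σ .zero) *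
      multilin _ ({(σ .zero).idx} : Finset _)ᶜ := by
  refine (Vars.fn_atomic σ (Vars.injective_cons (Finset.notMem_empty _) (Vars.injective_nil _))
    _ a).trans ?_
  rw [pull_graph₀, Vars.support_cons, Vars.support_nil]
  rfl

theorem Term.denotes_var (x : Var Γ X) : (Term.var x).Denotes (.var x) := by
  intro Γ' ρ y _ hy a
  have h : (ρ x).idx ≠ y.idx := fun e => hy (e ▸ ρ.idx_mem_support x)
  refine (Formula.fn_rel_eqRel (.cons (ρ x) (.cons y .nil)) h a).1.trans ?_
  exact congrArg (fun S => graphBlock (varBlock (ρ x) a) y * multilin _ Sᶜ)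
    (Finset.pair_comm (ρ x).idx y.idx)

theorem Term.denotes_const (C : BinRel QSet.one X) :
    (C.const : Term Γ X).Denotes (.const C) := by
  intro Γ' ρ y _ hy a
  have : (C.const : Term Γ X).graph ρ y = .rel C.graph₀ (.cons y .nil) := by
    simp only [BinRel.const, Term.graph, Terms.vars?]
    rfl
  rw [this]
  exact Formula.fn_rel_graph₀ C _ a

theorem TermValue.disjoint_var {x : Var Γ X} {y : Var Γ Y} (h : x.idx ≠ y.idx) (ρ : Vars Γ' Γ)
    (hρ : Function.Injective ρ.pos) : Disjoint ((var x).supp ρ) ((var y).supp ρ) :=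
  Finset.disjoint_singleton.2 fun e => h (hρ (by rw [← ρ.idx_apply, ← ρ.idx_apply, e]))

theorem Term.denotes_app₂_var (F : BinRel (X.prod Y) Z) (x : Var Γ X) (y : Var Γ Y)
    (h : x.idx ≠ y.idx) : (F.app₂ (.var x) (.var y)).Denotes
      (.app F (.var x) (.var y) fun ρ hρ => TermValue.disjoint_var h ρ hρ) := by
  intro Γ' ρ z hρ hz a
  have : (F.app₂ (.var x) (.var y)).graph ρ z =
      .rel F.graph₂ (.cons (ρ x) (.cons (ρ y) (.cons z .nil))) := by
    simp only [BinRel.app₂, Term.graph, Terms.vars?]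
    rfl
  rw [this]
  refine (Formula.fn_rel_graph₂ F _ ?_ ?_ ?_ a).1.trans ?_
  · exact fun e => h (hρ ((ρ.idx_apply x).symm.trans (e.trans (ρ.idx_apply y))))
  · exact fun e => hz (e ▸ ρ.idx_mem_support x)
  · exact fun e => hz (e ▸ ρ.idx_mem_support y)
  · refine congrArg (fun S => graphBlock (appBlock F (varBlock (ρ x) a) (varBlock (ρ y) a)) z *
      multilin _ Sᶜ) ?_
    change ({(ρ x).idx, (ρ y).idx, z.idx} : Finset _) = {z.idx, (ρ x).idx, (ρ y).idx}
    ext i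
    simp only [Finset.mem_insert, Finset.mem_singleton]
    tauto

end Denotes

section ShiftedSets

theorem succ_mem_shift {n : ℕ} {S : Finset (Fin n)} {i : Fin n} : i.succ ∈ shift S ↔ i ∈ S :=
  Finset.mem_map' (Fin.succEmb _)

theorem zero_notMem_shift {n : ℕ} {S : Finset (Fin n)} : 0 ∉ shift S := fun h => by
  obtain ⟨i, _, hi⟩ := Finset.mem_map.1 h
  exact Fin.succ_ne_zero _ hi

theorem disjoint_shift {n : ℕ} {S T : Finset (Fin n)} (h : Disjoint S T) :
    Disjoint (shift S) (shift T) := (Finset.disjoint_map _).2 h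

end ShiftedSets

theorem Submodule.span_mul_le {A : Type*} [CommRing A] [Algebra ℂ A] {G : Set A}
    {M N : Submodule ℂ A} (h : ∀ g ∈ G, ∀ m ∈ M, g * m ∈ N) : Submodule.span ℂ G * M ≤ N := by
  refine Submodule.mul_le.2 fun g hg m hm => ?_
  have : Submodule.span ℂ G ≤ N.comap (LinearMap.mulRight ℂ m) :=
    Submodule.span_le.2 fun g hg => h g hg m hm
  exact this hg

theorem Submodule.mul_mul_le {A : Type*} [CommRing A] [Algebra ℂ A] {P Q R N : Submodule ℂ A}
    (h : ∀ p ∈ P, ∀ q ∈ Q, ∀ r ∈ R, p * q * r ∈ N) : P * Q * R ≤ N := by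
  rw [mul_assoc]
  refine Submodule.mul_le.2 fun p hp f hf => ?_
  have : Q * R ≤ N.comap (LinearMap.mulLeft ℂ p) := Submodule.mul_le.2 fun q hq r hr => by
    rw [Submodule.mem_comap, LinearMap.mulLeft_apply, ← mul_assoc]
    exact h p hp q hq r hr
  exact this hf

theorem Submodule.mul₄_le {A : Type*} [CommRing A] [Algebra ℂ A] {P Q R S N : Submodule ℂ A}
    (h : ∀ p ∈ P, ∀ q ∈ Q, ∀ r ∈ R, ∀ s ∈ S, p * q * r * s ∈ N) : P * Q * R * S ≤ N := by
  refine Submodule.mul_le.2 fun f hf s hs => ?_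
  have : P * Q * R ≤ N.comap (LinearMap.mulRight ℂ s) :=
    Submodule.mul_mul_le fun p hp q hq r hr => h p hp q hq r hr s hs
  exact this hf

theorem Submodule.mul₅_le {A : Type*} [CommRing A] [Algebra ℂ A] {P Q R S T N : Submodule ℂ A}
    (h : ∀ p ∈ P, ∀ q ∈ Q, ∀ r ∈ R, ∀ s ∈ S, ∀ t ∈ T, p * q * r * s * t ∈ N) :
    P * Q * R * S * T ≤ N := by
  refine Submodule.mul_le.2 fun f hf t ht => ?_
  have : P * Q * R * S ≤ N.comap (LinearMap.mulRight ℂ t) :=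
    Submodule.mul₄_le fun p hp q hq r hr s hs => h p hp q hq r hr s hs t ht
  exact this hf

-- Substitution of terms into function symbols

section Nested

variable {Γ Γ' : List QSet.{u, v}} {X Y Z : QSet.{u, v}}

theorem mem_appBlock_var {a : Atoms Γ} {F : BinRel (X.prod Y) Z} {x : Var Γ X} {y : Var Γ Y}
    {k : Z.At} {w : Vec a → Z.H k} (hw : w ∈ appBlock F (varBlock x a) (varBlock y a) k) :
    ∃ t ∈ F (x.atom a, y.atom a) k, w = fun z => t (x.vec z ⊗ₜ[ℂ] y.vec z) := by
  rw [appBlock_var] at hw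
  induction hw using Submodule.span_induction with
  | mem w hw => exact hw
  | zero => exact ⟨0, Submodule.zero_mem _, rfl⟩
  | add w w' _ _ h h' =>
    obtain ⟨t, ht, rfl⟩ := h
    obtain ⟨t', ht', rfl⟩ := h'
    exact ⟨t + t', Submodule.add_mem _ ht ht', rfl⟩
  | smul c w _ h =>
    obtain ⟨t, ht, rfl⟩ := h
    exact ⟨c • t, Submodule.smul_mem _ _ ht, rfl⟩

/-- Three substitutions by `contract_eq`: the arguments x and y are replaced by w₁ and w₂, and the
functional applied to the result is replaced by w. -/
theorem contract_three {i : X.At} {j : Y.At} {k : Z.At} {a : Atoms Γ}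
    (t : X.H i ⊗[ℂ] Y.H j →ₗ[ℂ] Z.H k) (w₁ : Vec a → X.H i) (w₂ : Vec a → Y.H j)
    (w : Vec a → StrongDual ℂ (Z.H k)) (m : Vec a → ℂ)
    (f : Vec (Atoms.diag i (Atoms.diag j (Atoms.diag (X := Z.dual) k a))) → ℂ)
    (hf : ∀ r, f r = (r.tail.tail.tail.tail.head : StrongDual ℂ (Z.H k))
        (t (r.head ⊗ₜ[ℂ] r.tail.tail.head)) *
      (r.tail.head : StrongDual ℂ (X.H i)) (w₁ r.tail.tail.tail.tail.tail.tail) *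
      (r.tail.tail.tail.head : StrongDual ℂ (Y.H j)) (w₂ r.tail.tail.tail.tail.tail.tail) *
      (r.tail.tail.tail.tail.tail.head : StrongDual ℂ (StrongDual ℂ (Z.H k)))
        (w r.tail.tail.tail.tail.tail.tail) * m r.tail.tail.tail.tail.tail.tail) :
    contract (X := Z.dual) k a (contract j _ (contract i _ f)) =
      fun s => w s (t (w₁ s ⊗ₜ[ℂ] w₂ s)) * m s := by
  have h₁ : contract i _ f = fun r : Vec (Atoms.diag j (Atoms.diag (X := Z.dual) k a)) =>
      (r.tail.tail.head : StrongDual ℂ (Z.H k)) (t (w₁ r.tail.tail.tail.tail ⊗ₜ[ℂ] r.head)) *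
        ((r.tail.head : StrongDual ℂ (Y.H j)) (w₂ r.tail.tail.tail.tail) *
        ((r.tail.tail.tail.head : StrongDual ℂ (StrongDual ℂ (Z.H k))) (w r.tail.tail.tail.tail) *
          m r.tail.tail.tail.tail)) := by
    refine contract_eq (fun x (r : Vec (Atoms.diag j (Atoms.diag (X := Z.dual) k a))) =>
        (r.tail.tail.head : StrongDual ℂ (Z.H k)) (t (x ⊗ₜ[ℂ] r.head)))
      (fun r => isLinearMap_apply_tmul_left t r.head r.tail.tail.head)
      (fun r => w₁ r.tail.tail.tail.tail) _ fun x ξ r => ?_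
    refine (hf (Vec.diag x ξ r)).trans ?_
    exact (mul_assoc _ _ _).trans (mul_assoc _ _ _)
  have h₂ : contract j _ (contract i _ f) = fun r : Vec (Atoms.diag (X := Z.dual) k a) =>
      (r.head : StrongDual ℂ (Z.H k)) (t (w₁ r.tail.tail ⊗ₜ[ℂ] w₂ r.tail.tail)) *
        ((r.tail.head : StrongDual ℂ (StrongDual ℂ (Z.H k))) (w r.tail.tail) *
          m r.tail.tail) := by
    rw [h₁]
    refine contract_eq (fun y (r : Vec (Atoms.diag (X := Z.dual) k a)) =>
        (r.head : StrongDual ℂ (Z.H k)) (t (w₁ r.tail.tail ⊗ₜ[ℂ] y)))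
      (fun r => isLinearMap_apply_tmul_right t (w₁ r.tail.tail) r.head)
      (fun r => w₂ r.tail.tail) _ fun y η r => ?_
    exact (mul_assoc _ _ _).symm
  rw [h₂]
  refine contract_eq (X := Z.dual) (j := k)
    (fun z r => (z : StrongDual ℂ (Z.H k)) (t (w₁ r ⊗ₜ[ℂ] w₂ r)))
    (fun r => ⟨fun _ _ => rfl, fun _ _ => rfl⟩) w _ fun z ζ r => ?_
  exact (mul_assoc _ _ _).symm

/-- Positions 0, 2 and 4 carry the arguments of the graph, positions 1 and 3 the partners at which
the two subterms are evaluated, and position 5 the partner identified with the outer variable. What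
remains comes from the outer context. -/
theorem nested_compl {n : ℕ} (S T : Finset (Fin n)) (y : Fin n) :
    (({0, Fin.succ (Fin.succ 0), Fin.succ (Fin.succ (Fin.succ (Fin.succ 0)))} ∪
      insert (Fin.succ 0) (shift (shift (shift (shift (shift (shift S)))))) ∪
      insert (Fin.succ (Fin.succ (Fin.succ 0)))
        (shift (shift (shift (shift (shift (shift T)))))) ∪
      {y.succ.succ.succ.succ.succ.succ, Fin.succ (Fin.succ (Fin.succ (Fin.succ (Fin.succ 0))))} :
        Finset (Fin (n + 1 + 1 + 1 + 1 + 1 + 1))))ᶜ =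
      shift (shift (shift (shift (shift (shift (insert y (S ∪ T))ᶜ))))) := by
  ext i
  rw [Finset.mem_compl, Finset.mem_union, Finset.mem_union, Finset.mem_union, Finset.mem_insert,
    Finset.mem_insert, Finset.mem_insert, Finset.mem_insert, Finset.mem_insert,
    Finset.mem_singleton, Finset.mem_singleton]
  induction i using Fin.cases with
  | zero => exact iff_of_false (by simp) zero_notMem_shift
  | succ i =>
  rw [succ_mem_shift, succ_mem_shift, succ_mem_shift]
  induction i using Fin.cases with
  | zero => exact iff_of_false (by simp) zero_notMem_shift
  | succ i =>
  rw [succ_mem_shift, succ_mem_shift, succ_mem_shift]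
  induction i using Fin.cases with
  | zero => exact iff_of_false (by simp) zero_notMem_shift
  | succ i =>
  rw [succ_mem_shift, succ_mem_shift, succ_mem_shift]
  induction i using Fin.cases with
  | zero => exact iff_of_false (by simp) zero_notMem_shift
  | succ i =>
  rw [succ_mem_shift, succ_mem_shift, succ_mem_shift]
  induction i using Fin.cases with
  | zero => exact iff_of_false (by simp) zero_notMem_shift
  | succ i =>
  rw [succ_mem_shift, succ_mem_shift, succ_mem_shift]
  induction i using Fin.cases with
  | zero => exact iff_of_false (by simp) zero_notMem_shift
  | succ i =>
  rw [succ_mem_shift, succ_mem_shift, succ_mem_shift]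
  simp only [Fin.succ_inj, Fin.succ_ne_zero, false_or, or_false, Finset.mem_compl,
    Finset.mem_insert, Finset.mem_union]
  tauto

theorem succ_ne_succ_zero {n : ℕ} (y : Fin n) : y.succ.succ.succ.succ.succ.succ ≠
    Fin.succ (Fin.succ (Fin.succ (Fin.succ (Fin.succ 0)))) := by
  simp only [ne_eq, Fin.succ_inj, Fin.succ_ne_zero, not_false_eq_true]

theorem nested_disjoint {n : ℕ} {S T : Finset (Fin n)} {y : Fin n} (h : Disjoint S T) (hS : y ∉ S)
    (hT : y ∉ T) :
    Disjoint {0, Fin.succ (Fin.succ 0), Fin.succ (Fin.succ (Fin.succ (Fin.succ 0)))}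
      (insert (Fin.succ 0) (shift (shift (shift (shift (shift (shift S))))))) ∧
    Disjoint ({0, Fin.succ (Fin.succ 0), Fin.succ (Fin.succ (Fin.succ (Fin.succ 0)))} ∪
      insert (Fin.succ 0) (shift (shift (shift (shift (shift (shift S)))))))
      (insert (Fin.succ (Fin.succ (Fin.succ 0)))
        (shift (shift (shift (shift (shift (shift T))))))) ∧
    Disjoint ({0, Fin.succ (Fin.succ 0), Fin.succ (Fin.succ (Fin.succ (Fin.succ 0)))} ∪
      insert (Fin.succ 0) (shift (shift (shift (shift (shift (shift S)))))) ∪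
      insert (Fin.succ (Fin.succ (Fin.succ 0)))
        (shift (shift (shift (shift (shift (shift T)))))))
      {y.succ.succ.succ.succ.succ.succ, Fin.succ (Fin.succ (Fin.succ (Fin.succ (Fin.succ 0))))} := by
  have h6 := disjoint_shift (disjoint_shift (disjoint_shift (disjoint_shift (disjoint_shift
    (disjoint_shift h)))))
  have n0 := @Fin.succ_ne_zero
  have n0' : ∀ {m : ℕ} (i : Fin m), 0 ≠ i.succ := fun i => (Fin.succ_ne_zero i).symm
  refine ⟨?_, ?_, ?_⟩
  all_goals
    simp only [Finset.disjoint_union_left, Finset.disjoint_insert_left,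
      Finset.disjoint_insert_right, Finset.disjoint_singleton_left, Finset.disjoint_singleton_right,
      Finset.mem_insert, Finset.mem_singleton, Finset.mem_union, succ_mem_shift, zero_notMem_shift,
      Fin.succ_inj, n0, n0', hS, hT, h6, or_false, not_false_eq_true, and_true]

/-- The four conjuncts of the expanded graph have disjoint variables, so their conjunction is a
product. The three diagonal quantifiers contract this product, and `contract_three` evaluates the
contraction as the substitution of the values of `s` and `t` into `F`. -/
theorem Term.denotes_app₂ (F : BinRel (X.prod Y) Z) {s : Term Γ X} {t : Term Γ Y}
    (hst : (Terms.cons s (Terms.cons t .nil)).vars? = none) {S : TermValue Γ X} {T : TermValue Γ Y}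
    (hs : s.Denotes S) (ht : t.Denotes T)
    (h : ∀ {Γ' : List QSet.{u, v}} (ρ : Vars Γ' Γ), Function.Injective ρ.pos →
      Disjoint (S.supp ρ) (T.supp ρ)) : (F.app₂ s t).Denotes (.app F S T h) := by
  intro Γ' ρ z hρ hz a
  have hgraph : (F.app₂ s t).graph ρ z = .exDiag Z.dual (.exDiag Y (.exDiag X
      (.and (.and (.and (.rel F.graph₂ fun _ w => w.new Γ')
        (s.graph (((ρ.weaken Z.dual).weaken Y).weaken X) (.succ .zero)))
        (t.graph (((ρ.weaken Z.dual).weaken Y).weaken X) (.succ (.succ (.succ .zero)))))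
        (.eq z.succ.succ.succ.succ.succ.succ (.succ (.succ (.succ (.succ (.succ .zero))))))))) := by
    simp only [BinRel.app₂, Term.graph, hst, Terms.graphs]
    rfl
  rw [hgraph]
  set ρ' := ((ρ.weaken Z.dual).weaken Y).weaken X with hρ'
  have hi : Function.Injective ρ'.pos :=
    Vars.weaken_injective _ (Vars.weaken_injective _ (Vars.weaken_injective _ hρ))
  have hsupp : ρ'.support = shift (shift (shift (shift (shift (shift ρ.support))))) := by
    rw [hρ', Vars.weaken_support, Vars.weaken_support, Vars.weaken_support]
    rfl
  have hS : S.supp ρ' = shift (shift (shift (shift (shift (shift (S.supp ρ)))))) := by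
    rw [hρ', S.supp_weaken, S.supp_weaken, S.supp_weaken]
    rfl
  have hT : T.supp ρ' = shift (shift (shift (shift (shift (shift (T.supp ρ)))))) := by
    rw [hρ', T.supp_weaken, T.supp_weaken, T.supp_weaken]
    rfl
  have hz' : z.idx ∉ S.supp ρ ∧ z.idx ∉ T.supp ρ :=
    ⟨fun e => hz (S.supp_subset ρ e), fun e => hz (T.supp_subset ρ e)⟩
  obtain ⟨hd₁, hd₂, hd₃⟩ := nested_disjoint (h ρ hρ) hz'.1 hz'.2
  set N := graphBlock ((TermValue.app F S T h).val ρ a) z *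
    multilin (fun i => (Γ'.get i).H (a i)) (insert z.idx (S.supp ρ ∪ T.supp ρ))ᶜ with hN
  set φ : Formula (X :: X.dual :: Y :: Y.dual :: Z.dual :: Z.dual.dual :: Γ') :=
    .and (.and (.and (.rel F.graph₂ fun _ w => w.new Γ') (s.graph ρ' (.succ .zero)))
      (t.graph ρ' (.succ (.succ (.succ .zero)))))
      (.eq z.succ.succ.succ.succ.succ.succ (.succ (.succ (.succ (.succ (.succ .zero))))))
  have hφ : ∀ (i : X.At) (j : Y.At) (k : Z.At),
      φ.interp.fn (Atoms.diag i (Atoms.diag j (Atoms.diag (X := Z.dual) k a))) =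
      graphBlock (appBlock F (varBlock .zero _) (varBlock (.succ (.succ .zero)) _))
        (.succ (.succ (.succ (.succ .zero)))) *
      graphBlock (S.val ρ' _) (.succ .zero) * graphBlock (T.val ρ' _) (.succ (.succ (.succ .zero))) *
      graphBlock (varBlock z.succ.succ.succ.succ.succ.succ _)
        (.succ (.succ (.succ (.succ (.succ .zero))))) *
      multilin _ (shift (shift (shift (shift (shift (shift
        (insert z.idx (S.supp ρ ∪ T.supp ρ))ᶜ)))))) := by
    intro i j k
    set b := Atoms.diag i (Atoms.diag j (Atoms.diag (X := Z.dual) k a))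
    let σ₀ : Vars (X :: X.dual :: Y :: Y.dual :: Z.dual :: Z.dual.dual :: Γ') [X, Y, Z.dual] :=
      fun _ w => w.new Γ'
    have h₁ := Formula.fn_rel_graph₂ (Γ := X :: X.dual :: Y :: Y.dual :: Z.dual :: Z.dual.dual :: Γ') F σ₀
      (fun e => nomatch e) (fun e => nomatch e) (fun e => nomatch e) b
    have hy₁ : (Var.succ Var.zero : Var (X :: X.dual :: Y :: Y.dual :: Z.dual :: Z.dual.dual :: Γ') X.dual).idx ∉ ρ'.support := by
      rw [hsupp]
      exact fun e => zero_notMem_shift (succ_mem_shift.1 e)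
    have hy₂ : (Var.succ (Var.succ (Var.succ Var.zero)) :
        Var (X :: X.dual :: Y :: Y.dual :: Z.dual :: Z.dual.dual :: Γ') Y.dual).idx ∉ ρ'.support := by
      rw [hsupp]
      exact fun e => zero_notMem_shift (succ_mem_shift.1 (succ_mem_shift.1 (succ_mem_shift.1 e)))
    have h₂ := hs ρ' (Var.succ Var.zero) hi hy₁ b
    have h₂' := S.graphBlock_le hi hy₁ b
    have h₃ := ht ρ' (Var.succ (Var.succ (Var.succ Var.zero))) hi hy₂ b
    have h₃' := T.graphBlock_le hi hy₂ b
    let σ : Vars (X :: X.dual :: Y :: Y.dual :: Z.dual :: Z.dual.dual :: Γ') [Z.dual, Z.dual.dual] :=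
      .cons z.succ.succ.succ.succ.succ.succ
        (.cons (.succ (.succ (.succ (.succ (.succ .zero))))) .nil)
    have h₄ := Formula.fn_rel_eqRel (X := Z.dual) σ
      (succ_ne_succ_zero z.idx) b
    rw [hS] at h₂ h₂'
    rw [hT] at h₃ h₃'
    -- Three applications of `mul_multilin_inf` turn the conjunction into a product; the
    -- containments between them record which variables have been used up.
    have e₁ := (congrArg₂ (· ⊓ ·) h₁.1 h₂).trans (mul_multilin_inf hd₁ h₁.2 h₂')
    have l₁ := (mul_le_mul' h₁.2 h₂').trans (multilin_mul_le hd₁ rfl)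
    have e₂ := (congrArg₂ (· ⊓ ·) e₁ h₃).trans (mul_multilin_inf hd₂ l₁ h₃')
    have l₂ := (mul_le_mul' l₁ h₃').trans (multilin_mul_le hd₂ rfl)
    have e₃ := (congrArg₂ (· ⊓ ·) e₂ h₄.1).trans (mul_multilin_inf hd₃ l₂ h₄.2)
    have hinf : φ.interp.fn b = _ := (QRel.fn_inf _ _ b).trans (congrArg (· ⊓ _)
      ((QRel.fn_inf _ _ b).trans (congrArg (· ⊓ _) (QRel.fn_inf _ _ b))))
    refine (hinf.trans e₃).trans ?_
    exact congrArg (fun M => _ * multilin _ M) (nested_compl (S.supp ρ) (T.supp ρ) z.idx)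
  have hM : ∀ (i : X.At) (j : Y.At) (k : Z.At),
      multilin (fun l => ((X :: X.dual :: Y :: Y.dual :: Z.dual :: Z.dual.dual :: Γ').get l).H
          (Atoms.diag i (Atoms.diag j (Atoms.diag (X := Z.dual) k a)) l))
        (shift (shift (shift (shift (shift (shift (insert z.idx (S.supp ρ ∪ T.supp ρ))ᶜ)))))) =
      (multilin (fun i => (Γ'.get i).H (a i)) (insert z.idx (S.supp ρ ∪ T.supp ρ))ᶜ).map
        (weaken i _ ℂ ∘ₗ weaken j _ ℂ ∘ₗ weaken (X := Z.dual) k a ℂ) := by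
    intro i j k
    rw [Submodule.map_comp, Submodule.map_comp, ← multilin_shift_shift, ← multilin_shift_shift]
    exact multilin_shift_shift _
  have hE : ∀ (i : X.At) (j : Y.At) (k l : Z.At),
      varBlock z.succ.succ.succ.succ.succ.succ
          (Atoms.diag i (Atoms.diag j (Atoms.diag (X := Z.dual) k a))) l =
        (varBlock z a l).map (weaken i _ (Z.dual.H l) ∘ₗ weaken j _ (Z.dual.H l) ∘ₗ
          weaken (X := Z.dual) k a (Z.dual.H l)) := fun i j k l =>
    (TermValue.var z).val_weaken_three (fun _ w => w) i j (W := Z.dual) k a l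
  have hfn : (Formula.exDiag Z.dual (.exDiag Y (.exDiag X φ))).interp.fn a = ⨆ k : Z.At, ⨆ j : Y.At,
      ⨆ i : X.At, (((φ.interp.fn (Atoms.diag i (Atoms.diag j (Atoms.diag (X := Z.dual) k a)))).map
        (contract i _)).map (contract j _)).map (contract (X := Z.dual) k a) := by
    refine (Formula.fn_exDiag _ a).trans (iSup_congr fun k => ?_)
    refine (congrArg (Submodule.map _) (Formula.fn_exDiag _ _)).trans ?_
    rw [Submodule.map_iSup]
    refine iSup_congr fun j => ?_
    refine (congrArg (fun f => Submodule.map _ (Submodule.map _ f)) (Formula.fn_exDiag _ _)).trans ?_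
    rw [Submodule.map_iSup, Submodule.map_iSup]
  rw [hfn]
  apply le_antisymm
  · refine iSup_le fun k => iSup_le fun j => iSup_le fun i => ?_
    rw [Submodule.map_le_iff_le_comap, Submodule.map_le_iff_le_comap,
      Submodule.map_le_iff_le_comap, hφ]
    refine Submodule.mul₅_le ?_
    rintro _ ⟨_, hp, rfl⟩ _ ⟨w₁, hw₁, rfl⟩ _ ⟨w₂, hw₂, rfl⟩ _ ⟨w, hw, rfl⟩ m hm
    obtain ⟨f, hf, rfl⟩ := mem_appBlock_var hp
    obtain ⟨w₁, hw₁', rfl⟩ := (S.val_weaken_three ρ i j (W := Z.dual) k a i).le hw₁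
    obtain ⟨w₂, hw₂', rfl⟩ := (T.val_weaken_three ρ i j (W := Z.dual) k a j).le hw₂
    obtain ⟨w, hw', rfl⟩ := (hE i j k k).le hw
    obtain ⟨m, hm', rfl⟩ := (hM i j k).le hm
    change contract (X := Z.dual) k a (contract j _ (contract i _ _)) ∈ N
    refine Eq.mpr (congrArg (· ∈ N) (contract_three (i := i) (j := j) (k := k) f w₁ w₂ w m _
      fun r => rfl)) ?_
    -- Only the atom chosen for `z` contributes, since equality vanishes between different atoms.
    -- The scalar left over is absorbed into the operator from `F`.
    obtain rfl | ⟨rfl, c, rfl⟩ := mem_varBlock_cases hw'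
    · exact Eq.mpr (congrArg (· ∈ N) (funext fun s => zero_mul (m s))) (Submodule.zero_mem N)
    · refine Submodule.mul_mem_mul ⟨fun s => (c • f) (w₁ s ⊗ₜ[ℂ] w₂ s), ?_, ?_⟩ hm'
      · exact Submodule.subset_span ⟨i, j, w₁, hw₁', w₂, hw₂', c • f, Submodule.smul_mem _ _ hf, rfl⟩
      · funext s
        exact map_smul (z.vec s : StrongDual ℂ (Z.H (z.atom a))) c (f (w₁ s ⊗ₜ[ℂ] w₂ s))
  · change Submodule.map (pairing z a) (appBlock F (S.val ρ a) (T.val ρ a) (z.atom a)) *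
      multilin (fun i => (Γ'.get i).H (a i)) (insert z.idx (S.supp ρ ∪ T.supp ρ))ᶜ ≤ _
    rw [appBlock, Submodule.map_span]
    refine Submodule.span_mul_le ?_
    rintro _ ⟨_, ⟨i, j, w₁, hw₁, w₂, hw₂, f, hf, rfl⟩, rfl⟩ m hm
    refine Submodule.mem_iSup_of_mem (z.atom a) (Submodule.mem_iSup_of_mem j
      (Submodule.mem_iSup_of_mem i ?_))
    set b := Atoms.diag i (Atoms.diag j (Atoms.diag (X := Z.dual) (z.atom a) a))
    have hp : (fun r : Vec b => f (r.head ⊗ₜ[ℂ] r.tail.tail.head)) ∈ appBlock F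
        (varBlock .zero b) (varBlock (.succ (.succ .zero)) b) (z.atom a) :=
      Submodule.subset_span ⟨i, j, _, mem_varBlock_self .zero b, _,
        mem_varBlock_self (.succ (.succ .zero)) b, f, hf, rfl⟩
    have hq₁ := (S.val_weaken_three ρ i j (W := Z.dual) (z.atom a) a i).ge ⟨w₁, hw₁, rfl⟩
    have hq₂ := (T.val_weaken_three ρ i j (W := Z.dual) (z.atom a) a j).ge ⟨w₂, hw₂, rfl⟩
    have he := (hE i j (z.atom a) (z.atom a)).ge ⟨_, mem_varBlock_self z a, rfl⟩
    have hm' := (hM i j (z.atom a)).ge ⟨m, hm, rfl⟩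
    -- Conversely a generator of the right-hand side is the threefold contraction of the product of
    -- its own constituents.
    refine ⟨_, ⟨_, ⟨_, (hφ i j (z.atom a)).ge (Submodule.mul_mem_mul (Submodule.mul_mem_mul
      (Submodule.mul_mem_mul (Submodule.mul_mem_mul ⟨_, hp, rfl⟩ ⟨_, hq₁, rfl⟩) ⟨_, hq₂, rfl⟩)
      ⟨_, he, rfl⟩) hm'), rfl⟩, rfl⟩, ?_⟩
    exact contract_three f w₁ w₂ (fun s => z.vec s) m _ fun r => rfl

end Nested

theorem Var.idx_ofFin : (Γ : List QSet.{u, v}) → (j : Fin Γ.length) → (Var.ofFin Γ j).idx = j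
  | _ :: _, ⟨0, _⟩ => rfl
  | _ :: Γ, ⟨j + 1, h⟩ => congrArg Fin.succ (Var.idx_ofFin Γ ⟨j, Nat.lt_of_succ_lt_succ h⟩)

/-- The tuple of all variables of a context. -/
def Vars.all (Γ : List QSet.{u, v}) : Vars Γ Γ := fun _ w => w

theorem Vars.all_injective (Γ : List QSet.{u, v}) : Function.Injective (Vars.all Γ).pos :=
  fun i j h => (Var.idx_ofFin Γ i).symm.trans (Eq.trans h (Var.idx_ofFin Γ j))

-- Equations between terms

section Equal

variable {Γ Γ' : List QSet.{u, v}} {X Y Z : QSet.{u, v}}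

/-- The analogue of `contract_three` for the equality relation: both of its arguments are replaced
by the values of terms. -/
theorem contract_two {i : X.At} {a : Atoms Γ} (w₁ : Vec a → X.H i)
    (w₂ : Vec a → StrongDual ℂ (X.H i)) (m : Vec a → ℂ)
    (f : Vec (Atoms.diag i (Atoms.diag (X := X.dual) i a)) → ℂ)
    (hf : ∀ r, f r = (r.tail.tail.head : StrongDual ℂ (X.H i)) r.head *
      (r.tail.head : StrongDual ℂ (X.H i)) (w₁ r.tail.tail.tail.tail) *
      (r.tail.tail.tail.head : StrongDual ℂ (StrongDual ℂ (X.H i)))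
        (w₂ r.tail.tail.tail.tail) * m r.tail.tail.tail.tail) :
    contract (X := X.dual) i a (contract i _ f) = fun s => w₂ s (w₁ s) * m s := by
  have h₁ : contract i _ f = fun r : Vec (Atoms.diag (X := X.dual) i a) =>
      (r.head : StrongDual ℂ (X.H i)) (w₁ r.tail.tail) *
        ((r.tail.head : StrongDual ℂ (StrongDual ℂ (X.H i))) (w₂ r.tail.tail) *
          m r.tail.tail) := by
    refine contract_eq (fun x (r : Vec (Atoms.diag (X := X.dual) i a)) =>
        (r.head : StrongDual ℂ (X.H i)) x)
      (fun r => ⟨map_add (r.head : StrongDual ℂ (X.H i)), map_smul (r.head : StrongDual ℂ (X.H i))⟩)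
      (fun r => w₁ r.tail.tail) _ fun x ξ r => ?_
    refine (hf (Vec.diag x ξ r)).trans ?_
    exact mul_assoc _ _ _
  rw [h₁]
  refine contract_eq (X := X.dual) (j := i)
    (fun z r => (z : StrongDual ℂ (X.H i)) (w₁ r))
    (fun r => ⟨fun _ _ => rfl, fun _ _ => rfl⟩) w₂ _ fun z ζ r => ?_
  exact (mul_assoc _ _ _).symm

theorem equal_compl {n : ℕ} (S T : Finset (Fin n)) :
    (({0, Fin.succ (Fin.succ 0)} ∪ insert (Fin.succ 0) (shift (shift (shift (shift S)))) ∪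
      insert (Fin.succ (Fin.succ (Fin.succ 0))) (shift (shift (shift (shift T)))) :
        Finset (Fin (n + 1 + 1 + 1 + 1))))ᶜ = shift (shift (shift (shift (S ∪ T)ᶜ))) := by
  ext i
  rw [Finset.mem_compl, Finset.mem_union, Finset.mem_union, Finset.mem_insert,
    Finset.mem_insert, Finset.mem_insert, Finset.mem_singleton]
  induction i using Fin.cases with
  | zero => exact iff_of_false (by simp) zero_notMem_shift
  | succ i =>
  rw [succ_mem_shift, succ_mem_shift, succ_mem_shift]
  induction i using Fin.cases with
  | zero => exact iff_of_false (by simp) zero_notMem_shift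
  | succ i =>
  rw [succ_mem_shift, succ_mem_shift, succ_mem_shift]
  induction i using Fin.cases with
  | zero => exact iff_of_false (by simp) zero_notMem_shift
  | succ i =>
  rw [succ_mem_shift, succ_mem_shift, succ_mem_shift]
  induction i using Fin.cases with
  | zero => exact iff_of_false (by simp) zero_notMem_shift
  | succ i =>
  rw [succ_mem_shift, succ_mem_shift, succ_mem_shift]
  simp only [Fin.succ_inj, Fin.succ_ne_zero, false_or, Finset.mem_compl, Finset.mem_union]

theorem equal_disjoint {n : ℕ} {S T : Finset (Fin n)} (h : Disjoint S T) :
    Disjoint {0, Fin.succ (Fin.succ 0)}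
      (insert (Fin.succ 0) (shift (shift (shift (shift S))))) ∧
    Disjoint ({0, Fin.succ (Fin.succ 0)} ∪
      insert (Fin.succ 0) (shift (shift (shift (shift S)))))
      (insert (Fin.succ (Fin.succ (Fin.succ 0))) (shift (shift (shift (shift T))))) := by
  have h4 := disjoint_shift (disjoint_shift (disjoint_shift (disjoint_shift h)))
  have n0 := @Fin.succ_ne_zero
  have n0' : ∀ {m : ℕ} (i : Fin m), 0 ≠ i.succ := fun i => (Fin.succ_ne_zero i).symm
  refine ⟨?_, ?_⟩
  all_goals
    simp only [Finset.disjoint_union_left, Finset.disjoint_insert_left,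
      Finset.disjoint_insert_right, Finset.disjoint_singleton_left, 
      Finset.mem_insert, Finset.mem_singleton, Finset.mem_union, succ_mem_shift, zero_notMem_shift,
      Fin.succ_inj, n0, n0', h4, or_false, not_false_eq_true, and_true]

/-- As for nested terms, the conjunction is a product and the two diagonal quantifiers substitute
the values. The outcome is the pairing of the value of `t` with that of `s`, at a common atom. -/
theorem Formula.fn_equal {s : Term Γ X} {t : Term Γ X.dual}
    (hst : (Terms.cons s (Terms.cons t .nil)).vars? = none) {S : TermValue Γ X}
    {T : TermValue Γ X.dual} (hs : s.Denotes S) (ht : t.Denotes T)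
    (h : Disjoint (S.supp (Vars.all Γ)) (T.supp (Vars.all Γ))) (a : Atoms Γ) :
    (Formula.equal s t).interp.fn a =
      Submodule.span ℂ {f | ∃ i, ∃ w₁ ∈ S.val (Vars.all Γ) a i, ∃ w₂ ∈ T.val (Vars.all Γ) a i,
        f = fun z => (w₂ z : StrongDual ℂ (X.H i)) (w₁ z)} *
      multilin _ (S.supp (Vars.all Γ) ∪ T.supp (Vars.all Γ))ᶜ := by
  set ρ := Vars.all Γ
  have hgraph : Formula.equal s t = .exDiag X.dual (.exDiag X
      (.and (.and (.rel (eqRel X) fun _ w => w.new Γ)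
        (s.graph ((ρ.weaken X.dual).weaken X) (.succ .zero)))
        (t.graph ((ρ.weaken X.dual).weaken X) (.succ (.succ (.succ .zero)))))) := by
    simp only [Formula.equal, Formula.atom, hst, Terms.graphs]
    rfl
  rw [hgraph]
  set ρ' := (ρ.weaken X.dual).weaken X with hρ'
  have hi : Function.Injective ρ'.pos :=
    Vars.weaken_injective _ (Vars.weaken_injective _ (Vars.all_injective Γ))
  have hsupp : ρ'.support = shift (shift (shift (shift ρ.support))) := by
    rw [hρ', Vars.weaken_support, Vars.weaken_support]
    rfl
  have hS : S.supp ρ' = shift (shift (shift (shift (S.supp ρ)))) := by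
    rw [hρ', S.supp_weaken, S.supp_weaken]
    rfl
  have hT : T.supp ρ' = shift (shift (shift (shift (T.supp ρ)))) := by
    rw [hρ', T.supp_weaken, T.supp_weaken]
    rfl
  obtain ⟨hd₁, hd₂⟩ := equal_disjoint h
  set N := Submodule.span ℂ {f | ∃ i, ∃ w₁ ∈ S.val ρ a i, ∃ w₂ ∈ T.val ρ a i,
      f = fun z => (w₂ z : StrongDual ℂ (X.H i)) (w₁ z)} *
    multilin (fun i => (Γ.get i).H (a i)) (S.supp ρ ∪ T.supp ρ)ᶜ with hN
  set φ : Formula (X :: X.dual :: X.dual :: X.dual.dual :: Γ) :=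
    .and (.and (.rel (eqRel X) fun _ w => w.new Γ) (s.graph ρ' (.succ .zero)))
      (t.graph ρ' (.succ (.succ (.succ .zero))))
  have hφ : ∀ i j : X.At,
      φ.interp.fn (Atoms.diag i (Atoms.diag (X := X.dual) j a)) =
      graphBlock (varBlock .zero _) (.succ (.succ .zero)) *
      graphBlock (S.val ρ' _) (.succ .zero) * graphBlock (T.val ρ' _) (.succ (.succ (.succ .zero))) *
      multilin _ (shift (shift (shift (shift (S.supp ρ ∪ T.supp ρ)ᶜ)))) := by
    intro i j
    set b := Atoms.diag i (Atoms.diag (X := X.dual) j a)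
    let σ₀ : Vars (X :: X.dual :: X.dual :: X.dual.dual :: Γ) [X, X.dual] := fun _ w => w.new Γ
    have h₁ := Formula.fn_rel_eqRel (Γ := X :: X.dual :: X.dual :: X.dual.dual :: Γ) σ₀
      (fun e => nomatch e) b
    have hy₁ : (Var.succ Var.zero : Var (X :: X.dual :: X.dual :: X.dual.dual :: Γ) X.dual).idx ∉
        ρ'.support := by
      rw [hsupp]
      exact fun e => zero_notMem_shift (succ_mem_shift.1 e)
    have hy₂ : (Var.succ (Var.succ (Var.succ Var.zero)) :
        Var (X :: X.dual :: X.dual :: X.dual.dual :: Γ) X.dual.dual).idx ∉ ρ'.support := by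
      rw [hsupp]
      exact fun e => zero_notMem_shift (succ_mem_shift.1 (succ_mem_shift.1 (succ_mem_shift.1 e)))
    have h₂ := hs ρ' (Var.succ Var.zero) hi hy₁ b
    have h₂' := S.graphBlock_le hi hy₁ b
    have h₃ := ht ρ' (Var.succ (Var.succ (Var.succ Var.zero))) hi hy₂ b
    have h₃' := T.graphBlock_le hi hy₂ b
    rw [hS] at h₂ h₂'
    rw [hT] at h₃ h₃'
    have e₁ := (congrArg₂ (· ⊓ ·) h₁.1 h₂).trans (mul_multilin_inf hd₁ h₁.2 h₂')
    have l₁ := (mul_le_mul' h₁.2 h₂').trans (multilin_mul_le hd₁ rfl)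
    have e₂ := (congrArg₂ (· ⊓ ·) e₁ h₃).trans (mul_multilin_inf hd₂ l₁ h₃')
    have hinf : φ.interp.fn b = _ :=
      (QRel.fn_inf _ _ b).trans (congrArg (· ⊓ _) (QRel.fn_inf _ _ b))
    refine (hinf.trans e₂).trans ?_
    exact congrArg (fun M => _ * multilin _ M) (equal_compl (S.supp ρ) (T.supp ρ))
  have hM : ∀ i j : X.At, multilin (fun l => ((X :: X.dual :: X.dual :: X.dual.dual :: Γ).get l).H
          (Atoms.diag i (Atoms.diag (X := X.dual) j a) l))
        (shift (shift (shift (shift (S.supp ρ ∪ T.supp ρ)ᶜ)))) =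
      (multilin (fun i => (Γ.get i).H (a i)) (S.supp ρ ∪ T.supp ρ)ᶜ).map
        (weaken i _ ℂ ∘ₗ weaken (X := X.dual) j a ℂ) := by
    intro i j
    rw [Submodule.map_comp, ← multilin_shift_shift]
    exact multilin_shift_shift _
  have hfn : (Formula.exDiag X.dual (.exDiag X φ)).interp.fn a = ⨆ j : X.At, ⨆ i : X.At,
      ((φ.interp.fn (Atoms.diag i (Atoms.diag (X := X.dual) j a))).map
        (contract i _)).map (contract (X := X.dual) j a) := by
    refine (Formula.fn_exDiag _ a).trans (iSup_congr fun k => ?_)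
    refine (congrArg (Submodule.map _) (Formula.fn_exDiag _ _)).trans ?_
    rw [Submodule.map_iSup]
  rw [hfn]
  apply le_antisymm
  · refine iSup_le fun j => iSup_le fun i => ?_
    rw [Submodule.map_le_iff_le_comap, Submodule.map_le_iff_le_comap, hφ]
    refine Submodule.mul₄_le ?_
    rintro _ ⟨w, hp, rfl⟩ _ ⟨w₁, hw₁, rfl⟩ _ ⟨w₂, hw₂, rfl⟩ m hm
    obtain ⟨w₁, hw₁', rfl⟩ := (S.val_weaken_two ρ i (V := X.dual) j a i).le hw₁
    obtain ⟨w₂, hw₂', rfl⟩ := (T.val_weaken_two ρ i (V := X.dual) j a j).le hw₂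
    obtain ⟨m, hm', rfl⟩ := (hM i j).le hm
    change contract (X := X.dual) j a (contract i _ _) ∈ N
    obtain rfl | ⟨e, c, rfl⟩ := mem_varBlock_cases hp
    · rw [map_zero, zero_mul, zero_mul, zero_mul, map_zero, map_zero]
      exact Submodule.zero_mem N
    · obtain rfl : i = j := e
      rw [map_smul, smul_mul_assoc, smul_mul_assoc, smul_mul_assoc, map_smul, map_smul]
      refine Submodule.smul_mem N c ?_
      refine Eq.mpr (congrArg (· ∈ N) (contract_two (i := i) w₁ w₂ m _ fun r => rfl)) ?_
      exact Submodule.mul_mem_mul (Submodule.subset_span ⟨i, w₁, hw₁', w₂, hw₂', rfl⟩) hm'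
  · refine Submodule.span_mul_le ?_
    rintro _ ⟨i, w₁, hw₁, w₂, hw₂, rfl⟩ m hm
    refine Submodule.mem_iSup_of_mem i (Submodule.mem_iSup_of_mem i ?_)
    set b := Atoms.diag i (Atoms.diag (X := X.dual) i a)
    have hp := mem_varBlock_self .zero b
    have hq₁ := (S.val_weaken_two ρ i (V := X.dual) i a i).ge ⟨w₁, hw₁, rfl⟩
    have hq₂ := (T.val_weaken_two ρ i (V := X.dual) i a i).ge ⟨w₂, hw₂, rfl⟩
    have hm' := (hM i i).ge ⟨m, hm, rfl⟩
    refine ⟨_, ⟨_, (hφ i i).ge (Submodule.mul_mem_mul 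
      (Submodule.mul_mem_mul (Submodule.mul_mem_mul ⟨_, hp, rfl⟩ ⟨_, hq₁, rfl⟩) ⟨_, hq₂, rfl⟩)
      hm'), rfl⟩, ?_⟩
    exact contract_two w₁ w₂ m _ fun r => rfl

end Equal

theorem multilin_empty {ι : Type*} [DecidableEq ι] {M : ι → Type*} [∀ i, AddCommGroup (M i)]
    [∀ i, Module ℂ (M i)] : multilin M ∅ = 1 := by
  ext f
  rw [Submodule.mem_one]
  constructor
  · intro hf
    refine ⟨f 0, funext fun x => ?_⟩
    exact hf.1 0 x fun i hi => absurd hi (Finset.notMem_empty i)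
  · rintro ⟨c, rfl⟩
    exact ⟨fun _ _ _ => rfl, fun i hi => absurd hi (Finset.notMem_empty i),
      fun i hi => absurd hi (Finset.notMem_empty i)⟩

-- Identity relations

namespace BinRel

variable {X : QSet.{u, v}} {Y : QSet.{u', v'}} {Z : QSet.{u'', v''}}

theorem comp_mem_of_mem_id_right {R : BinRel X Y} {i k : X.At} {j : Y.At}
    {c : X.H i →ₗ[ℂ] X.H k} (hc : c ∈ BinRel.id X i k) {t : X.H k →ₗ[ℂ] Y.H j} (ht : t ∈ R k j) :
    t ∘ₗ c ∈ R i j := by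
  induction hc using Submodule.span_induction with
  | mem c hc =>
    obtain ⟨h, rfl⟩ := hc
    cases h
    exact ht
  | zero => simp
  | add s t _ _ hs ht => rw [LinearMap.comp_add]; exact add_mem hs ht
  | smul c t _ ht => rw [LinearMap.comp_smul]; exact Submodule.smul_mem _ _ ht

theorem comp_id (F : BinRel X Y) : F.comp (id X) = F := by
  funext i j
  apply le_antisymm
  · refine Submodule.span_le.2 ?_
    rintro _ ⟨k, s, hs, r, hr, rfl⟩
    exact comp_mem_of_mem_id_right hr hs
  · intro t ht
    exact comp_mem_comp ht (id_mem_id i)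

theorem id_comp (F : BinRel X Y) : (id Y).comp F = F := by
  funext i j
  apply le_antisymm
  · refine Submodule.span_le.2 ?_
    rintro _ ⟨k, s, hs, r, hr, rfl⟩
    exact comp_mem_of_mem_id hs hr
  · intro t ht
    exact comp_mem_comp (id_mem_id j) ht

theorem id_prod_id : (id X).prod (id Y) = id (X.prod Y) := by
  funext p q
  apply le_antisymm
  · refine Submodule.span_le.2 ?_
    rintro _ ⟨r, hr, s, hs, rfl⟩
    exact QFun.map_mem_id hr hs
  · refine Submodule.span_le.2 ?_
    rintro _ ⟨rfl, rfl⟩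
    exact Submodule.subset_span ⟨_, id_mem_id _, _, id_mem_id _, TensorProduct.map_id.symm⟩

theorem dagger_id : (id X).dagger = id X := by
  have h : ∀ i j, ∀ c ∈ id X i j, LinearMap.adjoint c ∈ id X j i := fun i j c hc => by
    induction hc using Submodule.span_induction with
    | mem c hc =>
      obtain ⟨rfl, rfl⟩ := hc
      exact (LinearMap.adjoint_id (𝕜 := ℂ) (E := X.H i)).symm ▸ id_mem_id i
    | zero => rw [map_zero]; exact zero_mem _
    | add s t _ _ hs ht => rw [map_add]; exact add_mem hs ht
    | smul c t _ ht => rw [map_smulₛₗ]; exact Submodule.smul_mem _ _ ht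
  funext i j
  apply le_antisymm
  · rintro _ ⟨c, hc, rfl⟩
    exact h j i c hc
  · intro c hc
    exact ⟨_, h i j c hc, LinearMap.adjoint_adjoint c⟩

end BinRel

-- Values of terms as composites of relations

section Values

variable {P Q X Y Z : QSet} {V : Type*}

/-- The functions `z ↦ t(x(z))` with `t` in `R`. -/
def evalBlock (R : BinRel P X) (p : P.At) (x : V → P.H p) (j : X.At) : Submodule ℂ (V → X.H j) :=
  (R p j).map (σ₁₂ := RingHom.id ℂ)
    { toFun := fun t z => t (x z), map_add' := fun _ _ => rfl, map_smul' := fun _ _ => rfl }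

/-- The functions `z ↦ ξ(z) ∘ t†` with `t` in `R`. -/
def dualBlock (R : BinRel P X) (p : P.At) (ξ : V → P.H p →ₗ[ℂ] ℂ) (j : X.At) :
    Submodule ℂ (V → StrongDual ℂ (X.H j)) :=
  (R.dagger j p).map (σ₁₂ := RingHom.id ℂ)
    { toFun := fun t z => LinearMap.toContinuousLinearMap (ξ z ∘ₗ t)
      map_add' := fun _ _ => funext fun z => ContinuousLinearMap.ext fun _ => map_add (ξ z) _ _
      map_smul' := fun _ _ => funext fun z => ContinuousLinearMap.ext fun _ => map_smul (ξ z) _ _ }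

/-- Since f(r x ⊗ s y) = (f ∘ (r ⊗ s))(x ⊗ y), nesting of terms is composition with a product of
relations. -/
theorem appBlock_evalBlock (F : BinRel (X.prod Y) Z) (R : BinRel P X) (S : BinRel Q Y) {p : P.At}
    {q : Q.At} (x : V → P.H p) (y : V → Q.H q) (k : Z.At) :
    appBlock F (evalBlock R p x) (evalBlock S q y) k =
      evalBlock (F.comp (R.prod S)) (p, q) (fun z => x z ⊗ₜ[ℂ] y z) k := by
  apply le_antisymm
  · refine Submodule.span_le.2 ?_
    rintro _ ⟨i, j, _, ⟨r, hr, rfl⟩, _, ⟨s, hs, rfl⟩, f, hf, rfl⟩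
    exact ⟨_, BinRel.comp_mem_comp hf (BinRel.map_mem_prod hr hs), rfl⟩
  · rw [evalBlock, Submodule.map_le_iff_le_comap]
    refine Submodule.span_le.2 ?_
    rintro _ ⟨⟨i, j⟩, f, hf, r, hr, rfl⟩
    induction hr using Submodule.span_induction with
    | mem r hr =>
      obtain ⟨r, hr, s, hs, rfl⟩ := hr
      exact Submodule.subset_span ⟨i, j, _, ⟨r, hr, rfl⟩, _, ⟨s, hs, rfl⟩, f, hf, rfl⟩
    | zero => rw [LinearMap.comp_zero]; exact zero_mem _
    | add s t _ _ hs ht => rw [LinearMap.comp_add]; exact add_mem hs ht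
    | smul c t _ ht => rw [LinearMap.comp_smul]; exact Submodule.smul_mem _ _ ht

/-- The starred version of `appBlock_evalBlock`: f_* maps (ξ ∘ r†) ⊗ (η ∘ s†) to (ξ ⊗ η) ∘ (r† ⊗ s†)
∘ f†, and the operators on the right compose to (f ∘ (r ⊗ s))†. -/
theorem appBlock_dualBlock (F : BinRel (X.prod Y) Z) (R : BinRel P X) (S : BinRel Q Y) {p : P.At}
    {q : Q.At} (ξ : V → P.H p →ₗ[ℂ] ℂ) (η : V → Q.H q →ₗ[ℂ] ℂ) (k : Z.At) :
    appBlock (X := X.dual) (Y := Y.dual) (Z := Z.dual) F.conj₂ (dualBlock R p ξ)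
      (dualBlock S q η) k = dualBlock (F.comp (R.prod S)) (p, q)
        (fun z => TensorProduct.dualDistrib ℂ _ _ (ξ z ⊗ₜ[ℂ] η z)) k := by
  have key : ∀ i j, ∀ r ∈ R p i, ∀ s ∈ S q j, ∀ f ∈ F (i, j) k, ∀ g : StrongDual ℂ (X.H i) ⊗[ℂ]
      StrongDual ℂ (Y.H j) →ₗ[ℂ] StrongDual ℂ (Z.H k),
      (∀ (ξ : StrongDual ℂ (X.H i)) (η : StrongDual ℂ (Y.H j)) (z : Z.H k),
        (g (ξ ⊗ₜ[ℂ] η) : StrongDual ℂ (Z.H k)) z =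
        TensorProduct.dualDistrib ℂ (X.H i) (Y.H j)
          ((ξ : X.H i →ₗ[ℂ] ℂ) ⊗ₜ[ℂ] (η : Y.H j →ₗ[ℂ] ℂ)) (LinearMap.adjoint f z)) →
      ∀ z, g (LinearMap.toContinuousLinearMap (ξ z ∘ₗ LinearMap.adjoint r) ⊗ₜ[ℂ]
        LinearMap.toContinuousLinearMap (η z ∘ₗ LinearMap.adjoint s)) =
        LinearMap.toContinuousLinearMap (TensorProduct.dualDistrib ℂ _ _ (ξ z ⊗ₜ[ℂ] η z) ∘ₗ
          LinearMap.adjoint (f ∘ₗ TensorProduct.map r s)) := by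
    intro i j r _ s _ f _ g hg z
    refine ContinuousLinearMap.ext fun y => ?_
    rw [hg, LinearMap.adjoint_comp, TensorProduct.adjoint_map]
    change _ = TensorProduct.dualDistrib ℂ _ _ (ξ z ⊗ₜ[ℂ] η z)
      (TensorProduct.map (LinearMap.adjoint r) (LinearMap.adjoint s) (LinearMap.adjoint f y))
    induction LinearMap.adjoint f y using TensorProduct.induction_on with
    | zero => simp
    | tmul x y => rfl
    | add x y hx hy => rw [map_add, map_add, map_add, hx, hy]
  apply le_antisymm
  · refine Submodule.span_le.2 ?_
    rintro _ ⟨i, j, _, ⟨_, ⟨r, hr, rfl⟩, rfl⟩, _, ⟨_, ⟨s, hs, rfl⟩, rfl⟩, g, hg, rfl⟩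
    induction hg using Submodule.span_induction with
    | mem g hg =>
      obtain ⟨f, hf, hg⟩ := hg
      exact ⟨_, BinRel.adjoint_mem_dagger (BinRel.comp_mem_comp hf (BinRel.map_mem_prod hr hs)),
        funext fun z => (key i j r hr s hs f hf g hg z).symm⟩
    | zero => exact zero_mem _
    | add s t _ _ hs ht => exact add_mem hs ht
    | smul c t _ ht => exact Submodule.smul_mem _ c ht
  · rintro _ ⟨_, ⟨t, ht, rfl⟩, rfl⟩
    induction ht using Submodule.span_induction with
    | mem t ht =>
      obtain ⟨⟨i, j⟩, f, hf, r, hr, rfl⟩ := ht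
      induction hr using Submodule.span_induction with
      | mem r hr =>
        obtain ⟨r, hr, s, hs, rfl⟩ := hr
        -- The conjugate relation is described by a property of its generators, so the operator f_*
        -- has to be exhibited.
        let g : StrongDual ℂ (X.H i) ⊗[ℂ] StrongDual ℂ (Y.H j) →ₗ[ℂ] StrongDual ℂ (Z.H k) :=
          LinearMap.toContinuousLinearMap.toLinearMap ∘ₗ
            (LinearMap.lcomp ℂ ℂ (LinearMap.adjoint f)) ∘ₗ TensorProduct.dualDistrib ℂ _ _ ∘ₗ
            TensorProduct.map (ContinuousLinearMap.coeLM ℂ) (ContinuousLinearMap.coeLM ℂ)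
        have hg : ∀ (ξ : StrongDual ℂ (X.H i)) (η : StrongDual ℂ (Y.H j)) (z : Z.H k),
          (g (ξ ⊗ₜ[ℂ] η) : StrongDual ℂ (Z.H k)) z =
          TensorProduct.dualDistrib ℂ (X.H i) (Y.H j)
            ((ξ : X.H i →ₗ[ℂ] ℂ) ⊗ₜ[ℂ] (η : Y.H j →ₗ[ℂ] ℂ)) (LinearMap.adjoint f z) :=
          fun ξ η z => rfl
        refine Submodule.subset_span ⟨i, j, _, ⟨_, BinRel.adjoint_mem_dagger hr, rfl⟩, _,
          ⟨_, BinRel.adjoint_mem_dagger hs, rfl⟩, g, Submodule.subset_span ⟨f, hf, hg⟩, ?_⟩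
        exact funext fun z => (key i j r hr s hs f hf g hg z).symm
      | zero => rw [LinearMap.comp_zero, LinearEquiv.coe_coe, map_zero, map_zero]; exact zero_mem _
      | add s t _ _ hs ht =>
        rw [LinearMap.comp_add, LinearEquiv.coe_coe, map_add, map_add]; exact add_mem hs ht
      | smul c t _ ht =>
        rw [LinearMap.comp_smul, LinearEquiv.coe_coe, map_smulₛₗ, map_smul]
        exact Submodule.smul_mem _ _ ht
    | zero => rw [LinearEquiv.coe_coe, map_zero, map_zero]; exact zero_mem _
    | add s t _ _ hs ht => rw [LinearEquiv.coe_coe, map_add, map_add]; exact add_mem hs ht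
    | smul c t _ ht =>
      rw [LinearEquiv.coe_coe, map_smulₛₗ, map_smul]; exact Submodule.smul_mem _ _ ht

theorem constBlock_eq (C : BinRel QSet.one X) :
    constBlock C = evalBlock C () (fun _ : V => (1 : ℂ)) := by
  funext k
  apply le_antisymm
  · refine Submodule.span_le.2 ?_
    rintro _ ⟨c, hc, rfl⟩
    exact ⟨c, hc, rfl⟩
  · rintro _ ⟨c, hc, rfl⟩
    exact Submodule.subset_span ⟨c, hc, rfl⟩

theorem constBlock_conj₀ (C : BinRel QSet.one X) :
    constBlock (X := X.dual) C.conj₀ = dualBlock C () (fun _ : V => LinearMap.id) := by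
  funext k
  apply le_antisymm
  · refine Submodule.span_le.2 ?_
    rintro _ ⟨c, hc, rfl⟩
    induction hc using Submodule.span_induction with
    | mem c hc =>
      obtain ⟨t, ht, h⟩ := hc
      exact ⟨_, BinRel.adjoint_mem_dagger ht,
        funext fun z => ContinuousLinearMap.ext fun y => (h y).symm⟩
    | zero => exact zero_mem _
    | add s t _ _ hs ht => exact add_mem hs ht
    | smul c t _ ht => exact Submodule.smul_mem _ c ht
  · rintro _ ⟨_, ⟨t, ht, rfl⟩, rfl⟩
    let s : ℂ →ₗ[ℂ] StrongDual ℂ (X.H k) := LinearMap.toSpanSingleton ℂ _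
      (LinearMap.toContinuousLinearMap (LinearMap.adjoint t : X.H k →ₗ[ℂ] ℂ))
    have hs : s 1 = LinearMap.toContinuousLinearMap (LinearMap.adjoint t : X.H k →ₗ[ℂ] ℂ) :=
      LinearMap.toSpanSingleton_apply_one _ _ _
    refine Submodule.subset_span ⟨s, Submodule.subset_span ⟨t, ht, fun z => ?_⟩, ?_⟩
    · rw [hs]; rfl
    · funext z
      exact hs.symm

/-- Pairing the functional ξ ∘ s† with the vector r x gives ξ(s†r x). So an equation between an
unstarred term with relation R and a starred term with relation S is governed by S† ∘ R. -/
theorem span_pairing (R : BinRel P X) (S : BinRel Q X) {p : P.At} {q : Q.At} (x : V → P.H p)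
    (ξ : V → Q.H q →ₗ[ℂ] ℂ) :
    Submodule.span ℂ {f : V → ℂ | ∃ i, ∃ w₁ ∈ evalBlock R p x i, ∃ w₂ ∈ dualBlock S q ξ i,
      f = fun z => (w₂ z : StrongDual ℂ (X.H i)) (w₁ z)} =
    (S.dagger.comp R p q).map (σ₁₂ := RingHom.id ℂ)
      { toFun := fun t z => ξ z (t (x z))
        map_add' := fun _ _ => funext fun z => map_add (ξ z) _ _
        map_smul' := fun _ _ => funext fun z => map_smul (ξ z) _ _ } := by
  apply le_antisymm
  · refine Submodule.span_le.2 ?_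
    rintro _ ⟨i, _, ⟨r, hr, rfl⟩, _, ⟨s, hs, rfl⟩, rfl⟩
    exact ⟨_, BinRel.comp_mem_comp hs hr, rfl⟩
  · rw [Submodule.map_le_iff_le_comap]
    refine Submodule.span_le.2 ?_
    rintro _ ⟨i, s, hs, r, hr, rfl⟩
    exact Submodule.subset_span ⟨i, _, ⟨r, hr, rfl⟩, _, ⟨s, hs, rfl⟩, rfl⟩

end Values

section VarValues

variable {Γ : List QSet.{u, v}} {X : QSet.{u, v}} {a : Atoms Γ}

theorem varBlock_eq (x : Var Γ X) : varBlock x a = evalBlock (BinRel.id X) (x.atom a) x.vec := by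
  funext j
  apply le_antisymm
  · refine Submodule.span_le.2 ?_
    rintro _ ⟨rfl, rfl⟩
    exact ⟨_, BinRel.id_mem_id _, rfl⟩
  · rw [evalBlock, Submodule.map_le_iff_le_comap]
    refine Submodule.span_le.2 ?_
    rintro _ ⟨rfl, rfl⟩
    exact Submodule.subset_span ⟨rfl, rfl⟩

theorem varBlock_dual_eq (x : Var Γ X.dual) : varBlock x a = dualBlock (BinRel.id X) (x.atom a)
    (fun z => ((x.vec z : StrongDual ℂ (X.H (x.atom a))) : X.H (x.atom a) →ₗ[ℂ] ℂ)) := by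
  funext j
  apply le_antisymm
  · refine Submodule.span_le.2 ?_
    rintro _ ⟨rfl, rfl⟩
    refine ⟨LinearMap.id, ?_, rfl⟩
    rw [BinRel.dagger_id]
    exact BinRel.id_mem_id _
  · rw [dualBlock, BinRel.dagger_id, Submodule.map_le_iff_le_comap]
    refine Submodule.span_le.2 ?_
    rintro _ ⟨e, rfl⟩
    obtain rfl : j = x.atom a := e
    exact Submodule.subset_span ⟨rfl, rfl⟩

end VarValues

/-! ## The meaning of the axioms -/

section Slices

variable {H K : Type*} [NormedAddCommGroup H] [InnerProductSpace ℂ H] [AddCommGroup K] [Module ℂ K]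

/-- The slice map `x ⊗ y ↦ ξ(x) y`. -/
def sliceLeft (K : Type*) [AddCommGroup K] [Module ℂ K] (ξ : H →ₗ[ℂ] ℂ) : H ⊗[ℂ] K →ₗ[ℂ] K :=
  (TensorProduct.lid ℂ K).toLinearMap ∘ₗ TensorProduct.map ξ LinearMap.id

@[simp] theorem sliceLeft_tmul (ξ : H →ₗ[ℂ] ℂ) (x : H) (y : K) :
    sliceLeft K ξ (x ⊗ₜ[ℂ] y) = ξ x • y := by
  simp [sliceLeft]

theorem dualDistrib_apply_eq (ξ : H →ₗ[ℂ] ℂ) (η : K →ₗ[ℂ] ℂ) (y : H ⊗[ℂ] K) :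
    TensorProduct.dualDistrib ℂ H K (ξ ⊗ₜ[ℂ] η) y = η (sliceLeft K ξ y) := by
  induction y using TensorProduct.induction_on with
  | zero => simp
  | add v w hv hw => rw [map_add, map_add, map_add, hv, hw]
  | tmul x y => simp

theorem sum_tmul_sliceLeft [FiniteDimensional ℂ H] (y : H ⊗[ℂ] K) :
    ∑ k, stdOrthonormalBasis ℂ H k ⊗ₜ[ℂ] sliceLeft K (innerₛₗ ℂ (stdOrthonormalBasis ℂ H k)) y =
      y := by
  induction y using TensorProduct.induction_on with
  | zero => simp
  | add v w hv hw =>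
    simp only [map_add, TensorProduct.tmul_add, Finset.sum_add_distrib]
    rw [hv, hw]
  | tmul x y =>
    simp only [sliceLeft_tmul, TensorProduct.tmul_smul, TensorProduct.smul_tmul']
    rw [← TensorProduct.sum_tmul]
    congr 1
    exact (stdOrthonormalBasis ℂ H).sum_repr' x

theorem eq_of_sliceLeft [FiniteDimensional ℂ H] {y y' : H ⊗[ℂ] K}
    (h : ∀ ξ : StrongDual ℂ H, sliceLeft K (ξ : H →ₗ[ℂ] ℂ) y = sliceLeft K (ξ : H →ₗ[ℂ] ℂ) y') :
    y = y' := by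
  rw [← sum_tmul_sliceLeft y, ← sum_tmul_sliceLeft y']
  exact Finset.sum_congr rfl fun k _ => congrArg _ (h (innerSL ℂ (stdOrthonormalBasis ℂ H k)))

end Slices

theorem eq_of_strongDual {H : Type*} [NormedAddCommGroup H] [InnerProductSpace ℂ H] {x y : H}
    (h : ∀ ξ : StrongDual ℂ H, ξ x = ξ y) : x = y :=
  ext_inner_left ℂ fun v => h (innerSL ℂ v)

/-- Products of functionals separate the vectors of a tensor product, as two slices and the Riesz
vectors show. -/
theorem eq_of_dualDistrib_assoc {H₁ H₂ H₃ K₁ K₂ K₃ : Type*}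
    [NormedAddCommGroup H₁] [InnerProductSpace ℂ H₁] [NormedAddCommGroup H₂]
    [InnerProductSpace ℂ H₂] [NormedAddCommGroup H₃] [InnerProductSpace ℂ H₃]
    [NormedAddCommGroup K₁] [InnerProductSpace ℂ K₁] [NormedAddCommGroup K₂]
    [InnerProductSpace ℂ K₂] [NormedAddCommGroup K₃] [InnerProductSpace ℂ K₃]
    [FiniteDimensional ℂ K₁] [FiniteDimensional ℂ K₂]
    {s t : (H₁ ⊗[ℂ] H₂) ⊗[ℂ] H₃ →ₗ[ℂ] K₁ ⊗[ℂ] (K₂ ⊗[ℂ] K₃)}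
    (h : ∀ x y z (ξ : StrongDual ℂ K₁) (η : StrongDual ℂ K₂) (ζ : StrongDual ℂ K₃),
      TensorProduct.dualDistrib ℂ _ _ ((ξ : K₁ →ₗ[ℂ] ℂ) ⊗ₜ[ℂ] TensorProduct.dualDistrib ℂ _ _
        ((η : K₂ →ₗ[ℂ] ℂ) ⊗ₜ[ℂ] (ζ : K₃ →ₗ[ℂ] ℂ))) (s ((x ⊗ₜ[ℂ] y) ⊗ₜ[ℂ] z)) =
      TensorProduct.dualDistrib ℂ _ _ ((ξ : K₁ →ₗ[ℂ] ℂ) ⊗ₜ[ℂ] TensorProduct.dualDistrib ℂ _ _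
        ((η : K₂ →ₗ[ℂ] ℂ) ⊗ₜ[ℂ] (ζ : K₃ →ₗ[ℂ] ℂ))) (t ((x ⊗ₜ[ℂ] y) ⊗ₜ[ℂ] z))) : s = t := by
  refine TensorProduct.ext_threefold fun x y z => eq_of_sliceLeft fun ξ => eq_of_sliceLeft fun η =>
    eq_of_strongDual fun ζ => ?_
  have := h x y z ξ η ζ
  simp only [dualDistrib_apply_eq] at this
  exact this

theorem dualDistrib_smul_assoc {H₁ H₂ H₃ : Type*} [AddCommGroup H₁] [Module ℂ H₁]
    [AddCommGroup H₂] [Module ℂ H₂] [AddCommGroup H₃] [Module ℂ H₃] (α : H₁ →ₗ[ℂ] ℂ)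
    (β : H₂ →ₗ[ℂ] ℂ) (γ : H₃ →ₗ[ℂ] ℂ) (c : ℂ) (x : H₁) (y : H₂) (z : H₃) :
    TensorProduct.dualDistrib ℂ _ _ (α ⊗ₜ[ℂ] TensorProduct.dualDistrib ℂ _ _ (β ⊗ₜ[ℂ] γ))
      ((c • (TensorProduct.assoc ℂ H₁ H₂ H₃).toLinearMap) ((x ⊗ₜ[ℂ] y) ⊗ₜ[ℂ] z)) =
      c * (α x * (β y * γ z)) := by
  simp

theorem Formula.isTrue_iff {φ : Formula.{u, v} []} :
    φ.IsTrue ↔ ∀ (a : Atoms []) (ξ : Functional a), ξ ∈ φ.interp a := by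
  constructor
  · intro h a ξ
    rw [show φ.interp = ⊤ from h]
    trivial
  · intro h
    exact funext fun a => eq_top_iff.2 fun ξ _ => h a ξ

theorem mem_span_pairing {P Q X : QSet} {V : Type*} {R : BinRel P X} {S : BinRel Q X} {p : P.At}
    {q : Q.At} {x : V → P.H p} {ξ : V → Q.H q →ₗ[ℂ] ℂ} {T₁ : ∀ i, Submodule ℂ (V → X.H i)}
    {T₂ : ∀ i, Submodule ℂ (V → StrongDual ℂ (X.H i))} (h₁ : T₁ = evalBlock R p x)
    (h₂ : T₂ = dualBlock S q ξ) {f : V → ℂ} :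
    f ∈ Submodule.span ℂ {f : V → ℂ | ∃ i, ∃ w₁ ∈ T₁ i, ∃ w₂ ∈ T₂ i,
      f = fun z => (w₂ z : StrongDual ℂ (X.H i)) (w₁ z)} ↔
      ∃ t ∈ S.dagger.comp R p q, ∀ z, ξ z (t (x z)) = f z := by
  subst h₁ h₂
  rw [span_pairing]
  exact ⟨fun ⟨t, ht, h⟩ => ⟨t, ht, fun z => congrFun h z⟩, fun ⟨t, ht, h⟩ => ⟨t, ht, funext h⟩⟩

-- The associativity sentence

section Sentences

variable {X : QSet.{u, v}} (F : BinRel (X.prod X) X) (C : BinRel QSet.one X)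

theorem appBlock_evalBlock_id_left {V : Type*} {i j k : X.At} (x : V → X.H i) (y : V → X.H j)
    (z : V → X.H k) :
    appBlock F (appBlock F (evalBlock (BinRel.id X) i x) (evalBlock (BinRel.id X) j y))
      (evalBlock (BinRel.id X) k z) =
      evalBlock (F.comp (F.prod (BinRel.id X))) ((i, j), k)
        fun s => (x s ⊗ₜ[ℂ] y s) ⊗ₜ[ℂ] z s := by
  funext k
  rw [show appBlock F (evalBlock (BinRel.id X) i x) (evalBlock (BinRel.id X) j y) = _ from
    funext fun k => appBlock_evalBlock F _ _ _ _ k, appBlock_evalBlock, BinRel.id_prod_id,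
    BinRel.comp_id]

theorem appBlock_dualBlock_id_right {V : Type*} {i j k : X.At} (x : V → X.H i →ₗ[ℂ] ℂ)
    (y : V → X.H j →ₗ[ℂ] ℂ) (z : V → X.H k →ₗ[ℂ] ℂ) :
    appBlock (X := X.dual) (Y := X.dual) (Z := X.dual) F.conj₂ (dualBlock (BinRel.id X) i x)
      (appBlock (X := X.dual) (Y := X.dual) (Z := X.dual) F.conj₂ (dualBlock (BinRel.id X) j y)
        (dualBlock (BinRel.id X) k z)) =
      dualBlock (F.comp ((BinRel.id X).prod F)) (i, (j, k))
        fun s => TensorProduct.dualDistrib ℂ _ _ (x s ⊗ₜ[ℂ]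
          TensorProduct.dualDistrib ℂ _ _ (y s ⊗ₜ[ℂ] z s)) := by
  funext l
  have e := funext fun k' => appBlock_dualBlock F (BinRel.id X) (BinRel.id X) y z k'
  rw [BinRel.id_prod_id, BinRel.comp_id] at e
  refine (congrArg (fun T => appBlock (X := X.dual) (Y := X.dual) (Z := X.dual) F.conj₂ _ T l)
    e).trans ?_
  exact appBlock_dualBlock F _ _ _ _ l

/-- The unstarred variables x₁, x₂, x₃ sit at positions 4, 2, 0 and their partners at 5, 3, 1. All
positions occur, so the factor for the remaining variables consists of constants. -/
theorem fn_equal_assoc (b : Atoms [X, X.dual, X, X.dual, X, X.dual]) :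
    (Formula.equal (F.app₂ (F.app₂ (.var (.succ (.succ (.succ (.succ .zero)))))
      (.var (.succ (.succ .zero)))) (.var .zero))
      (F.conj₂.app₂ (.var (.succ (.succ (.succ (.succ (.succ .zero))))))
        (F.conj₂.app₂ (.var (.succ (.succ (.succ .zero)))) (.var (.succ .zero))))).interp.fn b =
    Submodule.span ℂ {f | ∃ i, ∃ w₁ ∈ appBlock F (appBlock F
      (varBlock (.succ (.succ (.succ (.succ .zero)))) b) (varBlock (.succ (.succ .zero)) b))
      (varBlock .zero b) i, ∃ w₂ ∈ appBlock F.conj₂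
      (varBlock (.succ (.succ (.succ (.succ (.succ .zero))))) b) (appBlock F.conj₂
        (varBlock (.succ (.succ (.succ .zero))) b) (varBlock (.succ .zero) b)) i,
      f = fun z => (w₂ z : StrongDual ℂ (X.H i)) (w₁ z)} := by
  let Γ : List QSet.{u, v} := [X, X.dual, X, X.dual, X, X.dual]
  let x₃ : Var Γ X := Var.zero
  let x₃s : Var Γ X.dual := Var.zero.succ
  let x₂ : Var Γ X := Var.zero.succ.succ
  let x₂s : Var Γ X.dual := Var.zero.succ.succ.succ
  let x₁ : Var Γ X := Var.zero.succ.succ.succ.succ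
  let x₁s : Var Γ X.dual := Var.zero.succ.succ.succ.succ.succ
  have n₁₂ : x₁.idx ≠ x₂.idx := fun e => nomatch e
  have n₁₃ : x₁.idx ≠ x₃.idx := fun e => nomatch e
  have n₂₃ : x₂.idx ≠ x₃.idx := fun e => nomatch e
  have s₁₂ : x₁s.idx ≠ x₂s.idx := fun e => nomatch e
  have s₁₃ : x₁s.idx ≠ x₃s.idx := fun e => nomatch e
  have s₂₃ : x₂s.idx ≠ x₃s.idx := fun e => nomatch e
  have hs := Term.denotes_app₂ F rfl (Term.denotes_app₂_var F x₁ x₂ n₁₂) (Term.denotes_var x₃)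
    fun ρ hρ => Finset.disjoint_union_left.2
      ⟨TermValue.disjoint_var n₁₃ ρ hρ, TermValue.disjoint_var n₂₃ ρ hρ⟩
  have ht := Term.denotes_app₂ F.conj₂ rfl (Term.denotes_var x₁s)
    (Term.denotes_app₂_var F.conj₂ x₂s x₃s s₂₃)
    fun ρ hρ => Finset.disjoint_union_right.2
      ⟨TermValue.disjoint_var s₁₂ ρ hρ, TermValue.disjoint_var s₁₃ ρ hρ⟩
  have hd : Disjoint ({4} ∪ {2} ∪ {0} : Finset (Fin 6)) ({5} ∪ ({3} ∪ {1})) := by decide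
  have hc : (({4} ∪ {2} ∪ {0} : Finset (Fin 6)) ∪ ({5} ∪ ({3} ∪ {1})))ᶜ = ∅ := by decide
  refine (Formula.fn_equal rfl hs ht hd b).trans ?_
  refine (congrArg (fun S => _ * multilin _ S) hc).trans ?_
  rw [multilin_empty, mul_one]
  rfl

theorem mem_interp_assoc {Γ : List QSet.{u, v}} {x₁ x₂ x₃ : Var Γ X} {y₁ y₂ y₃ : Var Γ X.dual}
    {b : Atoms Γ} {φ : Formula Γ}
    (hN : φ.interp.fn b = Submodule.span ℂ {f | ∃ i, ∃ w₁ ∈ appBlock F (appBlock F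
      (varBlock x₁ b) (varBlock x₂ b)) (varBlock x₃ b) i, ∃ w₂ ∈ appBlock F.conj₂
      (varBlock y₁ b) (appBlock F.conj₂ (varBlock y₂ b) (varBlock y₃ b)) i,
      f = fun z => (w₂ z : StrongDual ℂ (X.H i)) (w₁ z)})
    {i j k i' j' k' : X.At} {x : Vec b → X.H i} {y : Vec b → X.H j} {z : Vec b → X.H k}
    {ξ : Vec b → X.H i' →ₗ[ℂ] ℂ} {η : Vec b → X.H j' →ₗ[ℂ] ℂ} {θ : Vec b → X.H k' →ₗ[ℂ] ℂ}
    (hx : varBlock x₁ b = evalBlock (BinRel.id X) i x)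
    (hy : varBlock x₂ b = evalBlock (BinRel.id X) j y)
    (hz : varBlock x₃ b = evalBlock (BinRel.id X) k z)
    (hξ : varBlock y₁ b = dualBlock (BinRel.id X) i' ξ)
    (hη : varBlock y₂ b = dualBlock (BinRel.id X) j' η)
    (hθ : varBlock y₃ b = dualBlock (BinRel.id X) k' θ) {ζ : Functional b} :
    ζ ∈ φ.interp b ↔
      ∃ t ∈ (F.comp ((BinRel.id X).prod F)).dagger.comp (F.comp (F.prod (BinRel.id X)))
        ((i, j), k) (i', (j', k')), ∀ s : Vec b,
      TensorProduct.dualDistrib ℂ _ _ (ξ s ⊗ₜ[ℂ] TensorProduct.dualDistrib ℂ _ _ (η s ⊗ₜ[ℂ] θ s))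
        (t ((x s ⊗ₜ[ℂ] y s) ⊗ₜ[ℂ] z s)) = ζ s := by
  rw [← QRel.coe_mem_fn, hN, hx, hy, hz, hξ, hη, hθ]
  exact mem_span_pairing (appBlock_evalBlock_id_left F x y z)
    (appBlock_dualBlock_id_right F ξ η θ)

-- Three applications of `mem_allDiag` reduce the sentence to this iterated evaluation functional.
-- The relation on the right represents it by an operator t between the two bracketings.
set_option maxRecDepth 8000 in
theorem evTmul_mem_equal_assoc (a : Atoms []) (ξ : Functional a) (i j k : X.At) :
    Functional.evTmul k _ (Functional.evTmul j _ (Functional.evTmul i a ξ)) ∈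
      (Formula.equal (F.app₂ (F.app₂ (.var (.succ (.succ (.succ (.succ .zero)))))
        (.var (.succ (.succ .zero)))) (.var .zero))
        (F.conj₂.app₂ (.var (.succ (.succ (.succ (.succ (.succ .zero))))))
        (F.conj₂.app₂ (.var (.succ (.succ (.succ .zero)))) (.var (.succ .zero))))).interp
        (Atoms.diag k (Atoms.diag j (Atoms.diag i a))) ↔
    ∃ t ∈ (F.comp ((BinRel.id X).prod F)).dagger.comp (F.comp (F.prod (BinRel.id X)))
        ((i, j), k) (i, (j, k)), ∀ (x : X.H i) (y : X.H j) (z : X.H k) (α : StrongDual ℂ (X.H i))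
        (β : StrongDual ℂ (X.H j)) (γ : StrongDual ℂ (X.H k)),
        TensorProduct.dualDistrib ℂ _ _ ((α : X.H i →ₗ[ℂ] ℂ) ⊗ₜ[ℂ] TensorProduct.dualDistrib ℂ _ _
        ((β : X.H j →ₗ[ℂ] ℂ) ⊗ₜ[ℂ] (γ : X.H k →ₗ[ℂ] ℂ))) (t ((x ⊗ₜ[ℂ] y) ⊗ₜ[ℂ] z)) =
        γ z * (β y * (α x * ξ fun l => l.elim0)) := by
  let b := Atoms.diag k (Atoms.diag j (Atoms.diag i a))
  have h := mem_interp_assoc F (fn_equal_assoc F b)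
    (x := fun s : Vec b => s.tail.tail.tail.tail.head) (y := fun s : Vec b => s.tail.tail.head)
    (z := fun s : Vec b => s.head)
    (ξ := fun s : Vec b => ((s.tail.tail.tail.tail.tail.head : StrongDual ℂ (X.H i)) : X.H i →ₗ[ℂ] ℂ))
    (η := fun s : Vec b => ((s.tail.tail.tail.head : StrongDual ℂ (X.H j)) : X.H j →ₗ[ℂ] ℂ))
    (θ := fun s : Vec b => ((s.tail.head : StrongDual ℂ (X.H k)) : X.H k →ₗ[ℂ] ℂ))
    (varBlock_eq _) (varBlock_eq _) (varBlock_eq _) (varBlock_dual_eq _) (varBlock_dual_eq _)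
    (varBlock_dual_eq _) (ζ := Functional.evTmul k _ (Functional.evTmul j _ (Functional.evTmul i a ξ)))
  refine h.trans ?_
  refine exists_congr fun t => and_congr_right fun _ => ⟨fun h x y z α β γ => ?_, fun h s => ?_⟩
  · exact h (Vec.diag z γ (Vec.diag y β (Vec.diag x α fun l => l.elim0)))
  · have e : s.tail.tail.tail.tail.tail.tail = fun l => l.elim0 := funext fun l => l.elim0
    refine (h s.tail.tail.tail.tail.head s.tail.tail.head s.head s.tail.tail.tail.tail.tail.head
      s.tail.tail.tail.head s.tail.head).trans ?_
    rw [← e]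
    rfl

-- The product of the three evaluations is the pairing with the associator, and such pairings
-- determine an operator. So the operator provided by the interpretation can only be the associator.
set_option maxRecDepth 8000 in
theorem assocSentence_iff : (assocSentence F).IsTrue ↔ ∀ i j k : X.At,
    (TensorProduct.assoc ℂ (X.H i) (X.H j) (X.H k)).toLinearMap ∈
      (F.comp ((BinRel.id X).prod F)).dagger.comp (F.comp (F.prod (BinRel.id X)))
        ((i, j), k) (i, (j, k)) := by
  have hiff : ∀ (a : Atoms []) (ξ : Functional a), ξ ∈ (assocSentence F).interp a ↔ _ := fun a ξ =>
    Formula.mem_allDiag.trans (forall_congr' fun i => Formula.mem_allDiag.trans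
      (forall_congr' fun j => Formula.mem_allDiag.trans (forall_congr' fun k =>
        evTmul_mem_equal_assoc F a ξ i j k)))
  rw [Formula.isTrue_iff]
  constructor
  · intro h i j k
    -- In the empty context the functionals are the scalars; the functional with value 1 is the test
    -- case.
    let a : Atoms ([] : List QSet.{u, v}) := fun l => l.elim0
    let ξ : Functional a := ⟨fun _ => 1, fun _ l => l.elim0, fun _ l => l.elim0⟩
    obtain ⟨t, ht, h⟩ := (hiff a ξ).1 (h a ξ) i j k
    suffices e : t = (TensorProduct.assoc ℂ (X.H i) (X.H j) (X.H k)).toLinearMap from e ▸ ht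
    refine eq_of_dualDistrib_assoc fun x y z ξ η ζ => (h x y z ξ η ζ).trans ?_
    change ζ z * (η y * (ξ x * 1)) = ξ x * (η y * ζ z)
    ring
  · intro h a ξ
    refine (hiff a ξ).2 fun i j k => ⟨_, Submodule.smul_mem _ (ξ fun l => l.elim0) (h i j k),
      fun x y z α β γ => ?_⟩
    refine (dualDistrib_smul_assoc _ _ _ _ _ _ _).trans ?_
    rw [mul_comm (ξ _)]
    change α x * (β y * γ z) * ξ _ = _
    ring

end Sentences

-- The unit sentences

section UnitSentences

variable {X : QSet.{u, v}} (F : BinRel (X.prod X) X) (C : BinRel QSet.one X)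

theorem fn_equal_right_unit (b : Atoms [X, X.dual]) :
    (Formula.equal (F.app₂ (.var .zero) C.const) (.var (.succ .zero))).interp.fn b =
    Submodule.span ℂ {f | ∃ i, ∃ w₁ ∈ appBlock F (varBlock .zero b) (constBlock C) i,
      ∃ w₂ ∈ varBlock (.succ .zero) b i,
      f = fun z => (w₂ z : StrongDual ℂ (X.H i)) (w₁ z)} := by
  let Γ : List QSet.{u, v} := [X, X.dual]
  let x : Var Γ X := Var.zero
  let y : Var Γ X.dual := Var.zero.succ
  have hs := Term.denotes_app₂ F rfl (Term.denotes_var x) (Term.denotes_const C)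
    fun ρ hρ => Finset.disjoint_empty_right _
  have hd : Disjoint ({0} ∪ ∅ : Finset (Fin 2)) {1} := by decide
  have hc : (({0} ∪ ∅ : Finset (Fin 2)) ∪ {1})ᶜ = ∅ := by decide
  refine (Formula.fn_equal rfl hs (Term.denotes_var y) hd b).trans ?_
  refine (congrArg (fun S => _ * multilin _ S) hc).trans ?_
  rw [multilin_empty, mul_one]
  rfl

theorem fn_equal_left_unit (b : Atoms [X, X.dual]) :
    (Formula.equal (F.app₂ C.const (.var .zero)) (.var (.succ .zero))).interp.fn b =
    Submodule.span ℂ {f | ∃ i, ∃ w₁ ∈ appBlock F (constBlock C) (varBlock .zero b) i,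
      ∃ w₂ ∈ varBlock (.succ .zero) b i,
      f = fun z => (w₂ z : StrongDual ℂ (X.H i)) (w₁ z)} := by
  let Γ : List QSet.{u, v} := [X, X.dual]
  let x : Var Γ X := Var.zero
  let y : Var Γ X.dual := Var.zero.succ
  have hs := Term.denotes_app₂ F rfl (Term.denotes_const C) (Term.denotes_var x)
    fun ρ hρ => Finset.disjoint_empty_left _
  have hd : Disjoint (∅ ∪ {0} : Finset (Fin 2)) {1} := by decide
  have hc : ((∅ ∪ {0} : Finset (Fin 2)) ∪ {1})ᶜ = ∅ := by decide
  refine (Formula.fn_equal rfl hs (Term.denotes_var y) hd b).trans ?_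
  refine (congrArg (fun S => _ * multilin _ S) hc).trans ?_
  rw [multilin_empty, mul_one]
  rfl

theorem mem_interp_right_unit {a : Atoms []} {j : X.At} {ζ : Functional (Atoms.diag j a)} :
    ζ ∈ (Formula.equal (F.app₂ (.var .zero) C.const) (.var (.succ .zero))).interp
      (Atoms.diag j a) ↔ ∃ t ∈ F.comp ((BinRel.id X).prod C) (j, ()) j,
        ∀ s : Vec (Atoms.diag j a),
          (s.tail.head : StrongDual ℂ (X.H j)) (t (s.head ⊗ₜ[ℂ] (1 : ℂ))) = ζ s := by
  have h₁ : appBlock F (varBlock .zero (Atoms.diag j a)) (constBlock C) =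
      evalBlock (F.comp ((BinRel.id X).prod C)) (j, ()) (fun s : Vec (Atoms.diag j a) =>
        s.head ⊗ₜ[ℂ] (1 : ℂ)) := by
    rw [constBlock_eq]
    refine (congrArg (fun T => appBlock F T _) (varBlock_eq _)).trans ?_
    exact funext fun k => appBlock_evalBlock F (BinRel.id X) C (fun s : Vec (Atoms.diag j a) =>
      s.head) _ k
  have h₂ : varBlock (.succ .zero) (Atoms.diag j a) = dualBlock (BinRel.id X) j
      (fun s : Vec (Atoms.diag j a) => ((s.tail.head : StrongDual ℂ (X.H j)) : X.H j →ₗ[ℂ] ℂ)) :=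
    varBlock_dual_eq _
  have h := mem_span_pairing h₁ h₂ (f := ⇑ζ)
  rw [BinRel.dagger_id, BinRel.id_comp] at h
  refine Iff.trans ?_ h
  rw [← QRel.coe_mem_fn]
  exact Eq.to_iff (congrArg (⇑ζ ∈ ·) (fn_equal_right_unit F C (Atoms.diag j a)))

theorem mem_interp_left_unit {a : Atoms []} {j : X.At} {ζ : Functional (Atoms.diag j a)} :
    ζ ∈ (Formula.equal (F.app₂ C.const (.var .zero)) (.var (.succ .zero))).interp
      (Atoms.diag j a) ↔ ∃ t ∈ F.comp (C.prod (BinRel.id X)) ((), j) j,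
        ∀ s : Vec (Atoms.diag j a),
          (s.tail.head : StrongDual ℂ (X.H j)) (t ((1 : ℂ) ⊗ₜ[ℂ] s.head)) = ζ s := by
  have h₁ : appBlock F (constBlock C) (varBlock .zero (Atoms.diag j a)) =
      evalBlock (F.comp (C.prod (BinRel.id X))) ((), j) (fun s : Vec (Atoms.diag j a) =>
        (1 : ℂ) ⊗ₜ[ℂ] s.head) := by
    rw [constBlock_eq]
    refine (congrArg (fun T => appBlock F _ T) (varBlock_eq _)).trans ?_
    exact funext fun k => appBlock_evalBlock F C (BinRel.id X) _ (fun s : Vec (Atoms.diag j a) =>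
      s.head) k
  have h₂ : varBlock (.succ .zero) (Atoms.diag j a) = dualBlock (BinRel.id X) j
      (fun s : Vec (Atoms.diag j a) => ((s.tail.head : StrongDual ℂ (X.H j)) : X.H j →ₗ[ℂ] ℂ)) :=
    varBlock_dual_eq _
  have h := mem_span_pairing h₁ h₂ (f := ⇑ζ)
  rw [BinRel.dagger_id, BinRel.id_comp] at h
  refine Iff.trans ?_ h
  rw [← QRel.coe_mem_fn]
  exact Eq.to_iff (congrArg (⇑ζ ∈ ·) (fn_equal_left_unit F C (Atoms.diag j a)))

-- The evaluation x_*(x) equals x_*(t(x ⊗ 1)) for the unitor t only, because functionals separate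
-- vectors.
set_option maxRecDepth 4000 in
theorem rightUnitSentence_iff : (rightUnitSentence F C).IsTrue ↔ ∀ j : X.At,
    (TensorProduct.rid ℂ (X.H j)).toLinearMap ∈ F.comp ((BinRel.id X).prod C) (j, ()) j := by
  have hiff : ∀ (a : Atoms []) (ξ : Functional a), ξ ∈ (rightUnitSentence F C).interp a ↔ _ :=
    fun a ξ => Formula.mem_allDiag.trans (forall_congr' fun j => mem_interp_right_unit F C)
  rw [Formula.isTrue_iff]
  constructor
  · intro h j
    let a : Atoms ([] : List QSet.{u, v}) := fun l => l.elim0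
    let ξ : Functional a := ⟨fun _ => 1, fun _ l => l.elim0, fun _ l => l.elim0⟩
    obtain ⟨t, ht, h⟩ := (hiff a ξ).1 (h a ξ) j
    suffices e : t = (TensorProduct.rid ℂ (X.H j)).toLinearMap from e ▸ ht
    refine TensorProduct.ext' fun x c => ?_
    have hc : x ⊗ₜ[ℂ] c = c • (x ⊗ₜ[ℂ] (1 : ℂ)) := by
      rw [← TensorProduct.tmul_smul, smul_eq_mul, mul_one]
    have h1 : t (x ⊗ₜ[ℂ] (1 : ℂ)) = x :=
      eq_of_strongDual fun η => (h (Vec.diag x η fun l => l.elim0)).trans (mul_one (η x))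
    rw [hc, map_smul, h1, map_smul]
    simp
  · intro h a ξ
    refine (hiff a ξ).2 fun j => ⟨_, Submodule.smul_mem _ (ξ fun l => l.elim0) (h j), fun s => ?_⟩
    have e : s.tail.tail = fun l => l.elim0 := funext fun l => l.elim0
    rw [Functional.evTmul_apply, e, LinearMap.smul_apply, map_smul, mul_comm, smul_eq_mul]
    simp

set_option maxRecDepth 4000 in
theorem leftUnitSentence_iff : (leftUnitSentence F C).IsTrue ↔ ∀ j : X.At,
    (TensorProduct.lid ℂ (X.H j)).toLinearMap ∈ F.comp (C.prod (BinRel.id X)) ((), j) j := by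
  have hiff : ∀ (a : Atoms []) (ξ : Functional a), ξ ∈ (leftUnitSentence F C).interp a ↔ _ :=
    fun a ξ => Formula.mem_allDiag.trans (forall_congr' fun j => mem_interp_left_unit F C)
  rw [Formula.isTrue_iff]
  constructor
  · intro h j
    let a : Atoms ([] : List QSet.{u, v}) := fun l => l.elim0
    let ξ : Functional a := ⟨fun _ => 1, fun _ l => l.elim0, fun _ l => l.elim0⟩
    obtain ⟨t, ht, h⟩ := (hiff a ξ).1 (h a ξ) j
    suffices e : t = (TensorProduct.lid ℂ (X.H j)).toLinearMap from e ▸ ht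
    refine TensorProduct.ext' fun c x => ?_
    have hc : c ⊗ₜ[ℂ] x = c • ((1 : ℂ) ⊗ₜ[ℂ] x) := by
      rw [TensorProduct.smul_tmul', smul_eq_mul, mul_one]
    have h1 : t ((1 : ℂ) ⊗ₜ[ℂ] x) = x :=
      eq_of_strongDual fun η => (h (Vec.diag x η fun l => l.elim0)).trans (mul_one (η x))
    rw [hc, map_smul, h1, map_smul]
    simp
  · intro h a ξ
    refine (hiff a ξ).2 fun j => ⟨_, Submodule.smul_mem _ (ξ fun l => l.elim0) (h j), fun s => ?_⟩
    have e : s.tail.tail = fun l => l.elim0 := funext fun l => l.elim0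
    rw [Functional.evTmul_apply, e, LinearMap.smul_apply, map_smul, mul_comm, smul_eq_mul]
    simp

end UnitSentences

-- The inverse sentences

section InverseSentences

variable {X : QSet.{u, v}}

/-- The existential quantifier spans the functionals obtained by inserting vectors for the inner
variable, by `fn_ex`. The universal one asks that every functional on the outer atom be among them,
by `mem_all`. -/
theorem isTrue_all_ex_iff {φ : Formula [X, X]} (T : ∀ i j : X.At, Set (X.H i → X.H j → ℂ))
    (hφ : ∀ (a : Atoms []) (i j : X.At) (f : Vec (Atoms.cons j (Atoms.cons i a)) → ℂ),
      f ∈ φ.interp.fn (Atoms.cons j (Atoms.cons i a)) ↔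
        ∃ t ∈ T i j, ∀ z : Vec (Atoms.cons j (Atoms.cons i a)), t z.tail.head z.head = f z) :
    (Formula.all X (Formula.ex X φ)).IsTrue ↔ ∀ (i : X.At) (η : X.H i →ₗ[ℂ] ℂ),
      η ∈ Submodule.span ℂ {η : X.H i →ₗ[ℂ] ℂ | ∃ (j : X.At) (y : X.H j), ∃ t ∈ T i j,
        ∀ x, η x = t x y} := by
  let L (a : Atoms []) (i : X.At) : (X.H i →ₗ[ℂ] ℂ) →ₗ[ℂ] (Vec (Atoms.cons i a) → ℂ) :=
    { toFun := fun η x => η x.head, map_add' := fun _ _ => rfl, map_smul' := fun _ _ => rfl }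
  have hL (a : Atoms []) (i : X.At) : Function.Injective (L a i) := fun η η' h =>
    LinearMap.ext fun x => congrFun h (Vec.cons x fun l => l.elim0)
  have hspan (a : Atoms []) (i : X.At) : (Formula.ex X φ).interp.fn (Atoms.cons i a) =
      (Submodule.span ℂ {η : X.H i →ₗ[ℂ] ℂ | ∃ (j : X.At) (y : X.H j), ∃ t ∈ T i j,
        ∀ x, η x = t x y}).map (L a i) := by
    rw [Formula.fn_ex, Submodule.map_span]
    congr 1
    ext f
    constructor
    · rintro ⟨j, y, g, hg, rfl⟩
      obtain ⟨ζ, hζ, rfl⟩ := hg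
      obtain ⟨t, ht, h⟩ := (hφ a i j ζ).1 (QRel.coe_mem_fn.2 hζ)
      let η : X.H i →ₗ[ℂ] ℂ :=
        { toFun := fun x => Functional.slice (ζ.slice y) x fun l => l.elim0
          map_add' := fun x x' => by rw [map_add]; rfl
          map_smul' := fun c x => by rw [map_smul]; rfl }
      refine ⟨η, ⟨j, y, t, ht, fun x => ?_⟩, funext fun x => ?_⟩
      · exact (h (Vec.cons y (Vec.cons x fun l => l.elim0))).symm
      · refine (h (Vec.cons y (Vec.cons x.head fun l => l.elim0))).symm.trans ?_
        exact h (Vec.cons y x)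
    · rintro ⟨η, ⟨j, y, t, ht, h⟩, rfl⟩
      refine ⟨j, y, fun z => t z.tail.head z.head, (hφ a i j _).2 ⟨t, ht, fun _ => rfl⟩,
        funext fun x => h x.head⟩
  have hiff : ∀ (a : Atoms []) (ξ : Functional a),
      ξ ∈ (Formula.all X (Formula.ex X φ)).interp a ↔ ∀ (i : X.At) (η : X.H i →ₗ[ℂ] ℂ),
        (ξ fun l => l.elim0) • η ∈ Submodule.span ℂ {η : X.H i →ₗ[ℂ] ℂ | ∃ (j : X.At) (y : X.H j),
          ∃ t ∈ T i j, ∀ x, η x = t x y} := by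
    refine fun a ξ => Formula.mem_all.trans (forall₂_congr fun i η => ?_)
    have e : ⇑(Functional.tmul η ξ) = L a i ((ξ fun l => l.elim0) • η) := by
      refine funext fun x : Vec (Atoms.cons i a) => ?_
      have e : Vec.tail x = fun l => l.elim0 := funext fun l => l.elim0
      rw [Functional.tmul_apply, e, mul_comm]
      rfl
    rw [← QRel.coe_mem_fn, hspan, e]
    exact (hL a i).mem_set_image
  rw [Formula.isTrue_iff]
  constructor
  · intro h i η
    let a : Atoms ([] : List QSet.{u, v}) := fun l => l.elim0
    let ξ : Functional a := ⟨fun _ => 1, fun _ l => l.elim0, fun _ l => l.elim0⟩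
    have := (hiff a ξ).1 (h a ξ) i η
    rwa [show (ξ fun l => l.elim0) = 1 from rfl, one_smul] at this
  · exact fun h a ξ => (hiff a ξ).2 fun i η => Submodule.smul_mem _ _ (h i η)

variable (F : BinRel (X.prod X) X) (C : BinRel QSet.one X)

theorem fn_equal_right_inverse (b : Atoms [X, X]) :
    (Formula.equal (F.app₂ (.var (.succ .zero)) (.var .zero)) C.conj₀.const).interp.fn b =
    Submodule.span ℂ {f | ∃ i, ∃ w₁ ∈ appBlock F (varBlock (.succ .zero) b) (varBlock .zero b) i,
      ∃ w₂ ∈ constBlock (X := X.dual) C.conj₀ i,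
      f = fun z => (w₂ z : StrongDual ℂ (X.H i)) (w₁ z)} := by
  let Γ : List QSet.{u, v} := [X, X]
  let x : Var Γ X := Var.zero.succ
  let y : Var Γ X := Var.zero
  have n : x.idx ≠ y.idx := fun e => nomatch e
  have hd : Disjoint ({1} ∪ {0} : Finset (Fin 2)) ∅ := by decide
  have hc : (({1} ∪ {0} : Finset (Fin 2)) ∪ ∅)ᶜ = ∅ := by decide
  refine (Formula.fn_equal rfl (Term.denotes_app₂_var F x y n) (Term.denotes_const C.conj₀) hd
    b).trans ?_
  refine (congrArg (fun S => _ * multilin _ S) hc).trans ?_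
  rw [multilin_empty, mul_one]
  rfl

theorem fn_equal_left_inverse (b : Atoms [X, X]) :
    (Formula.equal (F.app₂ (.var .zero) (.var (.succ .zero))) C.conj₀.const).interp.fn b =
    Submodule.span ℂ {f | ∃ i, ∃ w₁ ∈ appBlock F (varBlock .zero b) (varBlock (.succ .zero) b) i,
      ∃ w₂ ∈ constBlock (X := X.dual) C.conj₀ i,
      f = fun z => (w₂ z : StrongDual ℂ (X.H i)) (w₁ z)} := by
  let Γ : List QSet.{u, v} := [X, X]
  let x : Var Γ X := Var.zero
  let y : Var Γ X := Var.zero.succ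
  have n : x.idx ≠ y.idx := fun e => nomatch e
  have hd : Disjoint ({0} ∪ {1} : Finset (Fin 2)) ∅ := by decide
  have hc : (({0} ∪ {1} : Finset (Fin 2)) ∪ ∅)ᶜ = ∅ := by decide
  refine (Formula.fn_equal rfl (Term.denotes_app₂_var F x y n) (Term.denotes_const C.conj₀) hd
    b).trans ?_
  refine (congrArg (fun S => _ * multilin _ S) hc).trans ?_
  rw [multilin_empty, mul_one]
  rfl

theorem appBlock_evalBlock_id {V : Type*} {i j : X.At} (x : V → X.H i) (y : V → X.H j) :
    appBlock F (evalBlock (BinRel.id X) i x) (evalBlock (BinRel.id X) j y) =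
      evalBlock F (i, j) fun s => x s ⊗ₜ[ℂ] y s := by
  funext k
  rw [appBlock_evalBlock, BinRel.id_prod_id, BinRel.comp_id]

/-- The equation F(x, y) = C stands for the functionals in C† ∘ F. Solvability in y means that their
restrictions x ↦ τ(x ⊗ y) span the dual of each atom. -/
theorem rightInverseSentence_iff : (rightInverseSentence F C).IsTrue ↔
    ∀ (i : X.At) (η : X.H i →ₗ[ℂ] ℂ), η ∈ Submodule.span ℂ {η : X.H i →ₗ[ℂ] ℂ |
      ∃ (j : X.At) (y : X.H j), ∃ t ∈ C.dagger.comp F (i, j) (), ∀ x, η x = t (x ⊗ₜ[ℂ] y)} := by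
  refine (isTrue_all_ex_iff (X := X)
    (fun i j => {f | ∃ t ∈ C.dagger.comp F (i, j) (), ∀ x y, f x y = t (x ⊗ₜ[ℂ] y)})
    fun a i j f => ?_).trans ?_
  · have h₁ : appBlock F (varBlock (.succ .zero) (Atoms.cons j (Atoms.cons i a)))
        (varBlock .zero (Atoms.cons j (Atoms.cons i a))) = evalBlock F (i, j)
          fun s : Vec (Atoms.cons (X := X) j (Atoms.cons (X := X) i a)) =>
            s.tail.head ⊗ₜ[ℂ] s.head :=
      (congrArg₂ (fun T T' => appBlock F T T') (varBlock_eq _) (varBlock_eq _)).trans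
        (appBlock_evalBlock_id F (fun s : Vec (Atoms.cons j (Atoms.cons i a)) => s.tail.head)
          fun s => s.head)
    refine (Eq.to_iff (congrArg (f ∈ ·) (fn_equal_right_inverse F C _))).trans
      ((mem_span_pairing h₁ (constBlock_conj₀ C)).trans ?_)
    constructor
    · exact fun ⟨t, ht, h⟩ => ⟨fun x y => t (x ⊗ₜ[ℂ] y), ⟨t, ht, fun _ _ => rfl⟩, h⟩
    · exact fun ⟨f', ⟨t, ht, h'⟩, h⟩ => ⟨t, ht, fun z => (h' _ _).symm.trans (h z)⟩
  · refine forall₂_congr fun i η => ?_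
    have : {η : X.H i →ₗ[ℂ] ℂ | ∃ (j : X.At) (y : X.H j), ∃ f ∈ {f : X.H i → X.H j → ℂ |
        ∃ t ∈ C.dagger.comp F (i, j) (), ∀ x y, f x y = t (x ⊗ₜ[ℂ] y)}, ∀ x, η x = f x y} =
        {η : X.H i →ₗ[ℂ] ℂ | ∃ (j : X.At) (y : X.H j), ∃ t ∈ C.dagger.comp F (i, j) (),
          ∀ x, η x = t (x ⊗ₜ[ℂ] y)} := by
      ext η
      constructor
      · exact fun ⟨j, y, f, ⟨t, ht, h'⟩, h⟩ => ⟨j, y, t, ht, fun x => (h x).trans (h' x y)⟩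
      · exact fun ⟨j, y, t, ht, h⟩ => ⟨j, y, _, ⟨t, ht, fun _ _ => rfl⟩, h⟩
    rw [this]

theorem leftInverseSentence_iff : (leftInverseSentence F C).IsTrue ↔
    ∀ (j : X.At) (η : X.H j →ₗ[ℂ] ℂ), η ∈ Submodule.span ℂ {η : X.H j →ₗ[ℂ] ℂ |
      ∃ (i : X.At) (x : X.H i), ∃ t ∈ C.dagger.comp F (i, j) (), ∀ y, η y = t (x ⊗ₜ[ℂ] y)} := by
  refine (isTrue_all_ex_iff (X := X)
    (fun i j => {f | ∃ t ∈ C.dagger.comp F (j, i) (), ∀ x y, f x y = t (y ⊗ₜ[ℂ] x)})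
    fun a i j f => ?_).trans ?_
  · have h₁ : appBlock F (varBlock .zero (Atoms.cons j (Atoms.cons i a)))
        (varBlock (.succ .zero) (Atoms.cons j (Atoms.cons i a))) = evalBlock F (j, i)
          fun s : Vec (Atoms.cons (X := X) j (Atoms.cons (X := X) i a)) =>
            s.head ⊗ₜ[ℂ] s.tail.head :=
      (congrArg₂ (fun T T' => appBlock F T T') (varBlock_eq _) (varBlock_eq _)).trans
        (appBlock_evalBlock_id F (fun s : Vec (Atoms.cons j (Atoms.cons i a)) => s.head)
          fun s => s.tail.head)
    refine (Eq.to_iff (congrArg (f ∈ ·) (fn_equal_left_inverse F C _))).trans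
      ((mem_span_pairing h₁ (constBlock_conj₀ C)).trans ?_)
    constructor
    · exact fun ⟨t, ht, h⟩ => ⟨fun x y => t (y ⊗ₜ[ℂ] x), ⟨t, ht, fun _ _ => rfl⟩, h⟩
    · exact fun ⟨f', ⟨t, ht, h'⟩, h⟩ => ⟨t, ht, fun z => (h' _ _).symm.trans (h z)⟩
  · refine forall₂_congr fun i η => ?_
    have : {η : X.H i →ₗ[ℂ] ℂ | ∃ (j : X.At) (y : X.H j), ∃ f ∈ {f : X.H i → X.H j → ℂ |
        ∃ t ∈ C.dagger.comp F (j, i) (), ∀ x y, f x y = t (y ⊗ₜ[ℂ] x)}, ∀ x, η x = f x y} =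
        {η : X.H i →ₗ[ℂ] ℂ | ∃ (j : X.At) (y : X.H j), ∃ t ∈ C.dagger.comp F (j, i) (),
          ∀ x, η x = t (y ⊗ₜ[ℂ] x)} := by
      ext η
      constructor
      · exact fun ⟨j, y, f, ⟨t, ht, h'⟩, h⟩ => ⟨j, y, t, ht, fun x => (h x).trans (h' x y)⟩
      · exact fun ⟨j, y, t, ht, h⟩ => ⟨j, y, _, ⟨t, ht, fun _ _ => rfl⟩, h⟩
    rw [this]

end InverseSentences

-- Sentences as equations between functions

section FunctionAxioms

theorem BinRel.mem_comp_ofMap {X Y Z : QSet} {K : BinRel Y Z} {e : X.At → Y.At}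
    {t : ∀ i, X.H i →ₗ[ℂ] Y.H (e i)} {i : X.At} {l : Z.At} {s : X.H i →ₗ[ℂ] Z.H l} :
    s ∈ K.comp (BinRel.ofMap e t) i l ↔ ∃ k ∈ K (e i) l, s = k ∘ₗ t i := by
  constructor
  · intro hs
    induction hs using Submodule.span_induction with
    | mem s hs =>
      obtain ⟨j, k, hk, r, hr, rfl⟩ := hs
      obtain rfl | ⟨rfl, c, rfl⟩ := QFun.ofMap_mem_cases hr
      · exact ⟨0, zero_mem _, by simp⟩
      · exact ⟨c • k, Submodule.smul_mem _ _ hk, by simp [LinearMap.comp_smul, LinearMap.smul_comp]⟩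
    | zero => exact ⟨0, zero_mem _, by simp⟩
    | add s r _ _ hs hr =>
      obtain ⟨k, hk, rfl⟩ := hs
      obtain ⟨l, hl, rfl⟩ := hr
      exact ⟨k + l, add_mem hk hl, by rw [LinearMap.add_comp]⟩
    | smul c s _ hs =>
      obtain ⟨k, hk, rfl⟩ := hs
      exact ⟨c • k, Submodule.smul_mem _ _ hk, by rw [LinearMap.smul_comp]⟩
  · rintro ⟨k, hk, rfl⟩
    exact BinRel.comp_mem_comp hk (QFun.ofMap_mem e t i)

theorem BinRel.id_le {X : QSet} {R : BinRel X X} (h : ∀ i, LinearMap.id ∈ R i i) :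
    BinRel.id X ≤ R := by
  intro i j
  refine Submodule.span_le.2 ?_
  rintro _ ⟨rfl, rfl⟩
  exact h i

namespace QFun

variable {X : QSet.{u, v}} {Y : QSet.{u', v'}} {Z : QSet.{u'', v''}}

/-- The sentences only yield that a unitary lies in K† ∘ G. Between functions this is as strong as
equality, since composing with the adjoint of the unitary puts the identity into the relation of
`eq_of_id_le`. -/
theorem eq_comp_ofUnitary_iff (e : X.At → Y.At) (t : ∀ i, X.H i ≃ₗᵢ[ℂ] Y.H (e i)) (G : QFun X Z)
    (K : QFun Y Z) : G = K.comp (ofUnitary e t) ↔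
      ∀ i, (t i).toLinearEquiv.toLinearMap ∈ K.1.dagger.comp G.1 i (e i) := by
  constructor
  · intro hG i
    have h' : ∀ (l : Z.At), ∀ r ∈ G.1 i l, ∃ k ∈ K.1 (e i) l,
        r = k ∘ₗ (t i).toLinearEquiv.toLinearMap := by
      rw [hG]
      intro l r hr
      have hr : r ∈ K.1.comp (BinRel.ofMap e fun i => (t i).toLinearEquiv.toLinearMap) i l := hr
      exact BinRel.mem_comp_ofMap.1 hr
    suffices h : ∀ s ∈ G.1.dagger.comp G.1 i i,
        (t i).toLinearEquiv.toLinearMap ∘ₗ s ∈ K.1.dagger.comp G.1 i (e i) from h _ (id_mem G i)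
    intro s hs
    induction hs using Submodule.span_induction with
    | mem s hs =>
      obtain ⟨l, _, ⟨r, hr, rfl⟩, g, hg, rfl⟩ := hs
      obtain ⟨k, hk, rfl⟩ := h' l r hr
      have := BinRel.comp_mem_comp (BinRel.adjoint_mem_dagger hk) hg
      change (t i).toLinearEquiv.toLinearMap ∘ₗ LinearMap.adjoint _ ∘ₗ g ∈ _
      rw [LinearMap.adjoint_comp, ← LinearMap.comp_assoc, ← LinearMap.comp_assoc,
        unitary_comp_adjoint (t i), LinearMap.id_comp]
      exact this
    | zero => simp
    | add s t _ _ hs ht => rw [LinearMap.comp_add]; exact add_mem hs ht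
    | smul c t _ ht => rw [LinearMap.comp_smul]; exact Submodule.smul_mem _ _ ht
  · intro h
    refine eq_of_id_le (BinRel.id_le fun i => ?_)
    rw [← adjoint_comp_unitary (t i)]
    suffices h' : ∀ s ∈ K.1.dagger.comp G.1 i (e i),
        LinearMap.adjoint (t i).toLinearEquiv.toLinearMap ∘ₗ s ∈
          (K.comp (ofUnitary e t)).1.dagger.comp G.1 i i from h' _ (h i)
    intro s hs
    induction hs using Submodule.span_induction with
    | mem s hs =>
      obtain ⟨l, _, ⟨k, hk, rfl⟩, g, hg, rfl⟩ := hs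
      have := BinRel.comp_mem_comp (BinRel.adjoint_mem_dagger
        (BinRel.comp_mem_comp hk (ofUnitary_mem e t i))) hg
      rw [LinearMap.adjoint_comp, LinearMap.comp_assoc] at this
      exact this
    | zero => simp
    | add s t _ _ hs ht => rw [LinearMap.comp_add]; exact add_mem hs ht
    | smul c t _ ht => rw [LinearMap.comp_smul]; exact Submodule.smul_mem _ _ ht

/-- Containing the unitaries means being larger than the function they generate, and comparable
functions are equal. -/
theorem eq_ofUnitary_iff (e : X.At → Y.At) (t : ∀ i, X.H i ≃ₗᵢ[ℂ] Y.H (e i)) (G : QFun X Y) :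
    G = ofUnitary e t ↔ ∀ i, (t i).toLinearEquiv.toLinearMap ∈ G.1 i (e i) := by
  constructor
  · rintro rfl
    exact ofUnitary_mem e t
  · intro h
    refine (eq_of_le fun i j => Submodule.span_le.2 ?_).symm
    rintro _ ⟨rfl, rfl⟩
    exact h i

variable (F : QFun (X.prod X) X) (C : QFun QSet.one X)

theorem assocSentence_iff : (assocSentence F.1).IsTrue ↔
    F.comp (F.prod (id X)) = (F.comp ((id X).prod F)).comp (assoc X X X) := by
  rw [_root_.assocSentence_iff, assoc, eq_comp_ofUnitary_iff]
  exact ⟨fun h p => h p.1.1 p.1.2 p.2, fun h i j k => h ((i, j), k)⟩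

theorem rightUnitSentence_iff : (rightUnitSentence F.1 C.1).IsTrue ↔
    F.comp ((id X).prod C) = runit X := by
  rw [_root_.rightUnitSentence_iff, runit, eq_ofUnitary_iff]
  exact ⟨fun h p => h p.1, fun h i => h (i, ())⟩

theorem leftUnitSentence_iff : (leftUnitSentence F.1 C.1).IsTrue ↔
    F.comp (C.prod (id X)) = lunit X := by
  rw [_root_.leftUnitSentence_iff, lunit, eq_ofUnitary_iff]
  exact ⟨fun h p => h p.2, fun h i => h ((), i)⟩

end QFun

end FunctionAxioms

/-! ## The tensor square of `c_c(X)` and its multipliers -/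

namespace QSet

variable {X : QSet.{u, v}} {Y : QSet.{u', v'}} {V : Type*} [AddCommGroup V] [Module ℂ V]

/-- The matrix coefficient `a ↦ ⟨w, a(i) x⟩`. -/
def coeff (i : X.At) (w x : X.H i) : X.cc →ₗ[ℂ] ℂ where
  toFun a := inner ℂ w (a.val i x)
  map_add' a b := by simp
  map_smul' c a := by simp

@[simp] theorem coeff_apply (i : X.At) (w x : X.H i) (a : X.cc) :
    coeff i w x a = inner ℂ w (a.val i x) := rfl

/-- The slice map `a ⊗ v ↦ φ(a) v`. -/
def sliceFst (V : Type*) [AddCommGroup V] [Module ℂ V] (φ : X.cc →ₗ[ℂ] ℂ) : X.cc ⊗[ℂ] V →ₗ[ℂ] V :=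
  TensorProduct.lift ((LinearMap.lsmul ℂ V : ℂ →ₗ[ℂ] V →ₗ[ℂ] V) ∘ₗ φ)

@[simp] theorem sliceFst_tmul (φ : X.cc →ₗ[ℂ] ℂ) (a : X.cc) (z : V) :
    sliceFst V φ (a ⊗ₜ[ℂ] z) = φ a • z := by
  simp [sliceFst]

theorem eq_sum_ketBra {H : Type*} [NormedAddCommGroup H] [InnerProductSpace ℂ H]
    [FiniteDimensional ℂ H] (t : H →ₗ[ℂ] H) :
    t = ∑ k, ∑ l, (inner ℂ (stdOrthonormalBasis ℂ H k) (t (stdOrthonormalBasis ℂ H l)) : ℂ) •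
      ketBra (stdOrthonormalBasis ℂ H k) (stdOrthonormalBasis ℂ H l) := by
  refine (stdOrthonormalBasis ℂ H).toBasis.ext fun m => ?_
  simp only [OrthonormalBasis.coe_toBasis, LinearMap.sum_apply, LinearMap.smul_apply, ketBra_apply,
    OrthonormalBasis.inner_eq_ite]
  simp only [ite_smul, one_smul, zero_smul, smul_ite, smul_zero, Finset.sum_ite_eq',
    Finset.mem_univ, if_true]
  exact ((stdOrthonormalBasis ℂ H).sum_repr' _).symm

/-- A resolution by matrix units in the first factor. It is stated for all larger finite sets so
that two resolutions can be added over a common set. -/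
theorem exists_eq_sum_tmul_sliceFst (z : X.cc ⊗[ℂ] V) : ∃ S : Finset X.At, ∀ S', S ⊆ S' →
    z = ∑ i ∈ S', ∑ k, ∑ l,
      X.single i (ketBra (stdOrthonormalBasis ℂ (X.H i) k) (stdOrthonormalBasis ℂ (X.H i) l)) ⊗ₜ[ℂ]
        sliceFst V (coeff i (stdOrthonormalBasis ℂ (X.H i) k) (stdOrthonormalBasis ℂ (X.H i) l)) z := by
  classical
  induction z using TensorProduct.induction_on with
  | zero => exact ⟨∅, by simp⟩
  | add y z hy hz =>
    obtain ⟨S, hS⟩ := hy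
    obtain ⟨T, hT⟩ := hz
    refine ⟨S ∪ T, fun S' hS' => ?_⟩
    simp only [map_add, TensorProduct.tmul_add, Finset.sum_add_distrib]
    rw [← hS S' (Finset.union_subset_left hS'), ← hT S' (Finset.union_subset_right hS')]
  | tmul a y =>
    obtain ⟨S, hS⟩ := a.exists_finset
    refine ⟨S, fun S' hS' => ?_⟩
    simp only [sliceFst_tmul, coeff_apply, TensorProduct.tmul_smul, TensorProduct.smul_tmul']
    simp only [← TensorProduct.sum_tmul]
    congr 1
    refine (cc.eq_sum_single a fun i hi => hS i fun h => hi (hS' h)).trans ?_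
    refine Finset.sum_congr rfl fun i _ => ?_
    conv_lhs => rw [eq_sum_ketBra (a.val i)]
    simp only [map_sum, map_smul]

theorem eq_zero_of_sliceFst {z : X.cc ⊗[ℂ] V}
    (h : ∀ (i : X.At) (w x : X.H i), sliceFst V (coeff i w x) z = 0) : z = 0 := by
  obtain ⟨S, hS⟩ := exists_eq_sum_tmul_sliceFst z
  rw [hS S subset_rfl]
  simp [h]

/-- The map `c_c(X) ⊙ V → ℓ(X × Y)` induced by a map `V → ℓ(Y)`. -/
def inclOf (ι : V →ₗ[ℂ] Y.Ell) : X.cc ⊗[ℂ] V →ₗ[ℂ] (X.prod Y).Ell :=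
  TensorProduct.lift <| LinearMap.mk₂ ℂ
    (fun a b => fun p => TensorProduct.map (a.val p.1) (ι b p.2))
    (fun _ _ _ => funext fun _ => TensorProduct.map_add_left _ _ _)
    (fun _ _ _ => funext fun _ => TensorProduct.map_smul_left _ _ _)
    (fun _ _ _ => funext fun _ => by rw [map_add]; exact TensorProduct.map_add_right _ _ _)
    (fun _ _ _ => funext fun _ => by rw [map_smul]; exact TensorProduct.map_smul_right _ _ _)

@[simp] theorem inclOf_tmul (ι : V →ₗ[ℂ] Y.Ell) (a : X.cc) (b : V) (p : (X.prod Y).At) :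
    inclOf ι (a ⊗ₜ[ℂ] b) p = TensorProduct.map (a.val p.1) (ι b p.2) := rfl

@[simp] theorem incl_tmul (a b : X.cc) (p : (X.prod X).At) :
    incl X (a ⊗ₜ[ℂ] b) p = TensorProduct.map (a.val p.1) (b.val p.2) := rfl

theorem incl_eq_inclOf : incl X = inclOf cc.valₗ := TensorProduct.ext' fun _ _ => rfl

theorem inner_inclOf (ι : V →ₗ[ℂ] Y.Ell) (z : X.cc ⊗[ℂ] V) (i : X.At) (j : Y.At) (w x : X.H i)
    (w' x' : Y.H j) : inner ℂ (w ⊗ₜ[ℂ] w') (inclOf ι z (i, j) (x ⊗ₜ[ℂ] x')) =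
      inner ℂ w' (ι (sliceFst V (coeff i w x) z) j x') := by
  induction z using TensorProduct.induction_on with
  | zero => simp
  | add y z hy hz =>
    simp only [map_add, Pi.add_apply, LinearMap.add_apply, inner_add_right]
    rw [hy, hz]
  | tmul a y => simp [TensorProduct.inner_tmul]

/-- If the image vanishes, so do all slices by matrix coefficients in the first factor, and these
determine a tensor. The target is left general so that the argument also covers threefold products.
-/
theorem inclOf_injective {ι : V →ₗ[ℂ] Y.Ell} (hι : Function.Injective ι) :
    Function.Injective (inclOf (X := X) ι) := by
  refine (injective_iff_map_eq_zero _).2 fun z hz => eq_zero_of_sliceFst fun i w x => ?_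
  refine hι ?_
  rw [map_zero]
  refine funext fun j => LinearMap.ext fun x' => ext_inner_left ℂ fun w' => ?_
  rw [← inner_inclOf, hz]
  simp

theorem incl_injective : Function.Injective (incl X) := by
  rw [incl_eq_inclOf]
  exact inclOf_injective cc.val_injective

theorem finite_support_incl (z : X.cc ⊗[ℂ] X.cc) : {p | incl X z p ≠ 0}.Finite := by
  induction z using TensorProduct.induction_on with
  | zero => simp
  | add y z hy hz =>
    refine (hy.union hz).subset fun p hp => ?_
    by_contra h
    simp only [Set.mem_union, Set.mem_ofPred_eq, not_or, not_not] at h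
    exact hp (by simp [h.1, h.2])
  | tmul a b =>
    refine (a.finite_support.prod b.finite_support).subset fun p hp => ⟨fun h => hp ?_, fun h => hp ?_⟩
    · rw [incl_tmul, h, TensorProduct.map_zero_left]
    · rw [incl_tmul, h, TensorProduct.map_zero_right]

theorem incl_single_tmul_single (i j : X.At) (a : X.H i →ₗ[ℂ] X.H i) (b : X.H j →ₗ[ℂ] X.H j) :
    incl X (X.single i a ⊗ₜ[ℂ] X.single j b) =
      ((X.prod X).single (i, j) (TensorProduct.map a b)).val := by
  funext p
  rw [incl_tmul]
  by_cases h : p = (i, j)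
  · subst h
    rw [single_val_same, single_val_same]
    exact (single_val_same (X := X.prod X) (i, j) (TensorProduct.map a b)).symm
  · rw [single_val_of_ne h]
    by_cases h' : p.1 = i
    · have h'' : p.2 ≠ j := fun h'' => h (Prod.ext h' h'')
      rw [single_val_of_ne h'', TensorProduct.map_zero_right]
    · rw [single_val_of_ne h', TensorProduct.map_zero_left]

/-- One atom at a time: for finite-dimensional spaces every operator on a tensor product is a sum of
tensor products of operators. -/
theorem exists_incl_eq (f : (X.prod X).cc) : ∃ z, incl X z = f.val := by
  suffices h : f ∈ (LinearMap.range (incl X)).comap cc.valₗ from h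
  obtain ⟨S, hS⟩ := f.exists_finset
  rw [cc.eq_sum_single f hS]
  refine sum_mem fun p _ => ?_
  obtain ⟨i, j⟩ := p
  generalize f.val (i, j) = t
  obtain ⟨z, rfl⟩ := (homTensorHomEquiv ℂ (X.H i) (X.H j) (X.H i) (X.H j)).surjective t
  induction z using TensorProduct.induction_on with
  | zero => simp
  | add y z hy hz => rw [map_add, map_add]; exact add_mem hy hz
  | tmul a b =>
    refine ⟨X.single i a ⊗ₜ[ℂ] X.single j b, ?_⟩
    rw [incl_single_tmul_single, homTensorHomEquiv_apply, TensorProduct.homTensorHomMap_apply]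
    rfl

variable (X) in
/-- The isomorphism `c_c(X) ⊙ c_c(X) ≅ c_c(X × X)`. -/
def inclEquiv : X.cc ⊗[ℂ] X.cc ≃ₗ[ℂ] (X.prod X).cc :=
  LinearEquiv.ofBijective
    { toFun := fun z => cc.mk (incl X z) (finite_support_incl z)
      map_add' := fun _ _ => cc.val_injective (map_add _ _ _)
      map_smul' := fun _ _ => cc.val_injective (map_smul _ _ _) }
    ⟨fun _ _ h => incl_injective (congrArg cc.val h), fun f => by
      obtain ⟨z, hz⟩ := exists_incl_eq f
      exact ⟨z, cc.val_injective hz⟩⟩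

@[simp] theorem inclEquiv_val (z : X.cc ⊗[ℂ] X.cc) : (inclEquiv X z).val = incl X z := rfl

@[simp] theorem incl_inclEquiv_symm (f : (X.prod X).cc) : incl X ((inclEquiv X).symm f) = f.val :=
  congrArg cc.val ((inclEquiv X).apply_symm_apply f)

theorem incl_mul (y z : X.cc ⊗[ℂ] X.cc) : incl X (y * z) = incl X y * incl X z := by
  induction y using TensorProduct.induction_on with
  | zero => simp
  | add y y' hy hy' => rw [add_mul, map_add, map_add, add_mul, hy, hy']
  | tmul a b =>
    induction z using TensorProduct.induction_on with
    | zero => simp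
    | add y y' hy hy' => rw [mul_add, map_add, map_add, mul_add, hy, hy']
    | tmul c d =>
      rw [Algebra.TensorProduct.tmul_mul_tmul]
      exact funext fun p => TensorProduct.map_mul _ _ _ _

theorem incl_star (z : X.cc ⊗[ℂ] X.cc) : incl X (star z) = star (incl X z) := by
  induction z using TensorProduct.induction_on with
  | zero => simp
  | add y y' hy hy' => rw [star_add, map_add, map_add, star_add, hy, hy']
  | tmul a b =>
    rw [TensorProduct.star_tmul]
    exact funext fun p => (TensorProduct.adjoint_map _ _).symm

/-- The multiplication by an element of `ℓ(X)` from the left on `c_c(X)`. -/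
def ellMulLeft (f : X.Ell) : X.cc →ₗ[ℂ] X.cc where
  toFun a := cc.mk (f * a.val) (a.finite_support.subset fun i hi h => hi (by simp [h]))
  map_add' a b := cc.val_injective (mul_add _ _ _)
  map_smul' c a := cc.val_injective (mul_smul_comm _ _ _)

/-- The multiplication by an element of `ℓ(X)` from the right on `c_c(X)`. -/
def ellMulRight (f : X.Ell) : X.cc →ₗ[ℂ] X.cc where
  toFun a := cc.mk (a.val * f) (a.finite_support.subset fun i hi h => hi (by simp [h]))
  map_add' a b := cc.val_injective (add_mul _ _ _)
  map_smul' c a := cc.val_injective (smul_mul_assoc _ _ _)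

@[simp] theorem ellMulLeft_val (f : X.Ell) (a : X.cc) : (ellMulLeft f a).val = f * a.val := rfl
@[simp] theorem ellMulRight_val (f : X.Ell) (a : X.cc) : (ellMulRight f a).val = a.val * f := rfl

/-- An element of `ℓ(X × X)` as a multiplier of `c_c(X) ⊙ c_c(X)`. -/
def ofEll (f : (X.prod X).Ell) : Mult (X.cc ⊗[ℂ] X.cc) :=
  ⟨((inclEquiv X).symm.toLinearMap ∘ₗ ellMulLeft f ∘ₗ (inclEquiv X).toLinearMap,
    .op ((inclEquiv X).symm.toLinearMap ∘ₗ ellMulRight f ∘ₗ (inclEquiv X).toLinearMap)), by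
    refine ⟨fun y z => incl_injective ?_, fun y z => incl_injective ?_,
      fun y z => incl_injective ?_⟩ <;> simp [incl_mul, mul_assoc]⟩

theorem isMultiplicationBy_ofEll (f : (X.prod X).Ell) : IsMultiplicationBy (ofEll f) f := fun _ =>
  ⟨incl_inclEquiv_symm _, incl_inclEquiv_symm _⟩

namespace IsMultiplicationBy

variable {m n : Mult (X.cc ⊗[ℂ] X.cc)} {f g : (X.prod X).Ell}

theorem mult_ext (hm : IsMultiplicationBy m f) (hn : IsMultiplicationBy n f) : m = n := by
  refine Subtype.ext (Prod.ext (LinearMap.ext fun z => incl_injective ?_)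
    (MulOpposite.unop_injective (LinearMap.ext fun z => incl_injective ?_)))
  · exact (hm z).1.trans (hn z).1.symm
  · exact (hm z).2.trans (hn z).2.symm

/-- Applying the multiplier to the unit of an atom recovers the value of the function at that atom.
-/
theorem eq (hm : IsMultiplicationBy m f) (hn : IsMultiplicationBy m g) : f = g := by
  funext p
  have h := congrFun ((hm (X.single p.1 LinearMap.id ⊗ₜ[ℂ] X.single p.2 LinearMap.id)).1.symm.trans
    (hn _).1) p
  have e : incl X (X.single p.1 LinearMap.id ⊗ₜ[ℂ] X.single p.2 LinearMap.id) p = 1 := by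
    rw [incl_tmul, single_val_same, single_val_same, TensorProduct.map_id]
    rfl
  rwa [Pi.mul_apply, Pi.mul_apply, e, mul_one, mul_one] at h

theorem mul (hm : IsMultiplicationBy m f) (hn : IsMultiplicationBy n g) :
    IsMultiplicationBy (m * n) (f * g) := fun z => by
  constructor
  · exact ((hm (Mult.left n z)).1.trans (congrArg (f * ·) (hn z).1)).trans (mul_assoc _ _ _).symm
  · exact ((hn (Mult.right m z)).2.trans (congrArg (· * g) (hm z).2)).trans (mul_assoc _ _ _)

theorem add (hm : IsMultiplicationBy m f) (hn : IsMultiplicationBy n g) :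
    IsMultiplicationBy (m + n) (f + g) := fun z => by
  constructor
  · refine (map_add (incl X) (Mult.left m z) (Mult.left n z)).trans ?_
    rw [(hm z).1, (hn z).1, add_mul]
  · refine (map_add (incl X) (Mult.right m z) (Mult.right n z)).trans ?_
    rw [(hm z).2, (hn z).2, mul_add]

theorem smul (c : ℂ) (hm : IsMultiplicationBy m f) : IsMultiplicationBy (c • m) (c • f) :=
  fun z => by
  constructor
  · refine (map_smul (incl X) c (Mult.left m z)).trans ?_
    rw [(hm z).1, smul_mul_assoc]
  · refine (map_smul (incl X) c (Mult.right m z)).trans ?_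
    rw [(hm z).2, mul_smul_comm]

theorem star (hm : IsMultiplicationBy m f) : IsMultiplicationBy (star m) (star f) := fun z => by
  constructor
  · refine (incl_star (Mult.right m (Star.star z))).trans ?_
    rw [(hm _).2, incl_star, star_mul, star_star]
  · refine (incl_star (Mult.left m (Star.star z))).trans ?_
    rw [(hm _).1, incl_star, star_mul, star_star]

theorem of (z : X.cc ⊗[ℂ] X.cc) : IsMultiplicationBy (Mult.of z) (incl X z) := fun y =>
  ⟨incl_mul z y, incl_mul y z⟩

theorem one_tensor_of (b : X.cc) : IsMultiplicationBy (Mult.tensor 1 (Mult.of b))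
    (fun p => TensorProduct.map LinearMap.id (b.val p.2)) := fun z => by
  induction z using TensorProduct.induction_on with
  | zero => exact ⟨by simp [Mult.left], by simp [Mult.right]⟩
  | add y z hy hz =>
    constructor
    · refine (congrArg (incl X) (map_add _ y z)).trans ((map_add _ _ _).trans ?_)
      rw [map_add, mul_add]
      exact congrArg₂ (· + ·) hy.1 hz.1
    · refine (congrArg (incl X) (map_add _ y z)).trans ((map_add _ _ _).trans ?_)
      rw [map_add, add_mul]
      exact congrArg₂ (· + ·) hy.2 hz.2
  | tmul c d =>
    have e₁ : Mult.left (Mult.tensor 1 (Mult.of b)) (c ⊗ₜ[ℂ] d) = c ⊗ₜ[ℂ] (b * d) := rfl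
    have e₂ : Mult.right (Mult.tensor 1 (Mult.of b)) (c ⊗ₜ[ℂ] d) = c ⊗ₜ[ℂ] (d * b) := rfl
    rw [e₁, e₂]
    exact ⟨funext fun p => TensorProduct.map_comp LinearMap.id (b.val p.2) (c.val p.1) (d.val p.2),
      funext fun p => TensorProduct.map_comp (c.val p.1) (d.val p.2) LinearMap.id (b.val p.2)⟩

theorem of_tensor_one (b : X.cc) : IsMultiplicationBy (Mult.tensor (Mult.of b) 1)
    (fun p => TensorProduct.map (b.val p.1) LinearMap.id) := fun z => by
  induction z using TensorProduct.induction_on with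
  | zero => exact ⟨by simp [Mult.left], by simp [Mult.right]⟩
  | add y z hy hz =>
    constructor
    · refine (congrArg (incl X) (map_add _ y z)).trans ((map_add _ _ _).trans ?_)
      rw [map_add, mul_add]
      exact congrArg₂ (· + ·) hy.1 hz.1
    · refine (congrArg (incl X) (map_add _ y z)).trans ((map_add _ _ _).trans ?_)
      rw [map_add, add_mul]
      exact congrArg₂ (· + ·) hy.2 hz.2
  | tmul c d =>
    have e₁ : Mult.left (Mult.tensor (Mult.of b) 1) (c ⊗ₜ[ℂ] d) = (b * c) ⊗ₜ[ℂ] d := rfl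
    have e₂ : Mult.right (Mult.tensor (Mult.of b) 1) (c ⊗ₜ[ℂ] d) = (c * b) ⊗ₜ[ℂ] d := rfl
    rw [e₁, e₂]
    exact ⟨funext fun p => TensorProduct.map_comp (b.val p.1) LinearMap.id (c.val p.1) (d.val p.2),
      funext fun p => TensorProduct.map_comp (c.val p.1) (d.val p.2) (b.val p.1) LinearMap.id⟩

theorem of_eq_iff (hm : IsMultiplicationBy m f) {z : X.cc ⊗[ℂ] X.cc} :
    Mult.of z = m ↔ incl X z = f :=
  ⟨fun h => (of z).eq (h ▸ hm), fun h => (of z).mult_ext (h ▸ hm)⟩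

end IsMultiplicationBy

/-- The units e_p of the atoms p are central, so the value of m z at p can be computed from m(z e_p)
= (m e_p)z. Hence m is the multiplication by the function p ↦ (m e_p)(p). -/
theorem exists_isMultiplicationBy (m : Mult (X.cc ⊗[ℂ] X.cc)) : ∃ f, IsMultiplicationBy m f := by
  obtain ⟨h₁, h₂, h₃⟩ := m.2
  let e (p : (X.prod X).At) : X.cc ⊗[ℂ] X.cc := X.single p.1 LinearMap.id ⊗ₜ[ℂ] X.single p.2 LinearMap.id
  have he (p : (X.prod X).At) : incl X (e p) p = 1 := by
    rw [incl_tmul, single_val_same, single_val_same, TensorProduct.map_id]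
    rfl
  have hne {p q : (X.prod X).At} (h : q ≠ p) : incl X (e p) q = 0 := by
    rw [incl_single_tmul_single, single_val_of_ne h]
  have hcomm (p : (X.prod X).At) (z : X.cc ⊗[ℂ] X.cc) : e p * z = z * e p := by
    refine incl_injective (funext fun q => ?_)
    rw [incl_mul, incl_mul, Pi.mul_apply, Pi.mul_apply]
    by_cases h : q = p
    · subst h
      rw [he, mul_one, one_mul]
    · rw [hne h, zero_mul, mul_zero]
  have hmul (p : (X.prod X).At) (y z : X.cc ⊗[ℂ] X.cc) :
      incl X (y * z) p = incl X y p * incl X z p := by rw [incl_mul]; rfl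
  -- The compatibility (e_p m)e_p = e_p(m e_p) makes left and right multiplication come from the
  -- same function.
  have hr (p : (X.prod X).At) : incl X (Mult.right m (e p)) p = incl X (Mult.left m (e p)) p := by
    have := congrArg (fun z => incl X z p) (h₃ (e p) (e p))
    rwa [hmul, hmul, he, mul_one, one_mul] at this
  refine ⟨fun p => incl X (Mult.left m (e p)) p, fun z => ⟨funext fun p => ?_, funext fun p => ?_⟩⟩
  · have h := congrArg (fun z => incl X z p)
      ((h₁ z (e p)).symm.trans ((congrArg m.1.1 (hcomm p z).symm).trans (h₁ (e p) z)))
    dsimp only at h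
    rw [hmul, hmul, he, mul_one] at h
    exact h
  · have h := congrArg (fun z => incl X z p)
      ((h₂ (e p) z).symm.trans ((congrArg m.1.2.unop (hcomm p z)).trans (h₂ z (e p))))
    dsimp only at h
    rw [hmul, hmul, he, one_mul] at h
    exact h.trans (congrArg (incl X z p * ·) (hr p))

end QSet

/-! ## The Galois maps of an associative operation -/

section Slices

variable {H K L : Type*} [NormedAddCommGroup H] [InnerProductSpace ℂ H] [FiniteDimensional ℂ H]
  [NormedAddCommGroup K] [InnerProductSpace ℂ K] [FiniteDimensional ℂ K]
  [NormedAddCommGroup L] [InnerProductSpace ℂ L] [FiniteDimensional ℂ L]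

set_option linter.unusedSectionVars false

/-- The slice map `x ⊗ y ↦ ξ(y) x`, as a linear function of `ξ`. -/
def sliceRight (H : Type*) {K : Type*} [NormedAddCommGroup H] [InnerProductSpace ℂ H]
    [NormedAddCommGroup K] [InnerProductSpace ℂ K] :
    (K →ₗ[ℂ] ℂ) →ₗ[ℂ] H ⊗[ℂ] K →ₗ[ℂ] H where
  toFun ξ := (TensorProduct.rid ℂ H).toLinearMap ∘ₗ TensorProduct.map LinearMap.id ξ
  map_add' ξ η := by rw [TensorProduct.map_add_right, LinearMap.comp_add]
  map_smul' c ξ := by rw [TensorProduct.map_smul_right, LinearMap.comp_smul]; rfl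

@[simp] theorem sliceRight_tmul (ξ : K →ₗ[ℂ] ℂ) (x : H) (y : K) :
    sliceRight H ξ (x ⊗ₜ[ℂ] y) = ξ y • x := by
  simp [sliceRight]

theorem inner_sliceRight (w : H ⊗[ℂ] K) (x : H) (y : K) :
    inner ℂ (sliceRight H (innerₛₗ ℂ y) w) x = inner ℂ w (x ⊗ₜ[ℂ] y) := by
  induction w using TensorProduct.induction_on with
  | zero => simp
  | add v w hv hw => rw [map_add, inner_add_left, inner_add_left, hv, hw]
  | tmul u v =>
    rw [sliceRight_tmul, TensorProduct.inner_tmul, inner_smul_left, mul_comm]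
    simp

theorem sum_sliceRight_tmul (w : H ⊗[ℂ] K) :
    ∑ k, sliceRight H (innerₛₗ ℂ (stdOrthonormalBasis ℂ K k)) w ⊗ₜ[ℂ] stdOrthonormalBasis ℂ K k =
      w := by
  induction w using TensorProduct.induction_on with
  | zero => simp
  | add v w hv hw =>
    simp only [map_add, TensorProduct.add_tmul, Finset.sum_add_distrib]
    rw [hv, hw]
  | tmul x y =>
    simp only [sliceRight_tmul, TensorProduct.smul_tmul]
    rw [← TensorProduct.tmul_sum]
    congr 1
    exact (stdOrthonormalBasis ℂ K).sum_repr' y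

theorem eq_zero_of_sliceRight {w : H ⊗[ℂ] K} (h : ∀ ξ, sliceRight H ξ w = 0) : w = 0 := by
  rw [← sum_sliceRight_tmul w]
  simp [h]

/-- The map `(x ⊗ y) ⊗ z ↦ τ(y ⊗ z) x`. -/
def contractTail (H : Type*) {K L : Type*} [NormedAddCommGroup H] [InnerProductSpace ℂ H]
    [NormedAddCommGroup K] [InnerProductSpace ℂ K] [NormedAddCommGroup L] [InnerProductSpace ℂ L]
    (τ : K ⊗[ℂ] L →ₗ[ℂ] ℂ) : (H ⊗[ℂ] K) ⊗[ℂ] L →ₗ[ℂ] H :=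
  (TensorProduct.rid ℂ H).toLinearMap ∘ₗ TensorProduct.map LinearMap.id τ ∘ₗ
    (TensorProduct.assoc ℂ H K L).toLinearMap

@[simp] theorem contractTail_tmul (τ : K ⊗[ℂ] L →ₗ[ℂ] ℂ) (x : H) (y : K) (z : L) :
    contractTail H τ ((x ⊗ₜ[ℂ] y) ⊗ₜ[ℂ] z) = τ (y ⊗ₜ[ℂ] z) • x := by
  simp [contractTail]

theorem contractTail_tmul_right (τ : K ⊗[ℂ] L →ₗ[ℂ] ℂ) {ξ : K →ₗ[ℂ] ℂ} {z : L}
    (h : ∀ y, ξ y = τ (y ⊗ₜ[ℂ] z)) (w : H ⊗[ℂ] K) :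
    contractTail H τ (w ⊗ₜ[ℂ] z) = sliceRight H ξ w := by
  induction w using TensorProduct.induction_on with
  | zero => simp
  | add v w hv hw => rw [TensorProduct.add_tmul, map_add, map_add, hv, hw]
  | tmul x y => simp [h]

theorem adjoint_unitary_apply (t : H ≃ₗᵢ[ℂ] K) (y : K) :
    LinearMap.adjoint t.toLinearEquiv.toLinearMap y = t.symm y := by
  obtain ⟨x, rfl⟩ := t.surjective y
  rw [LinearIsometryEquiv.symm_apply_apply]
  exact LinearMap.congr_fun (QFun.adjoint_comp_unitary t) x

theorem adjoint_comp_unitary_apply (t : H ≃ₗᵢ[ℂ] K) (g : K →ₗ[ℂ] L) (x : L) :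
    LinearMap.adjoint (g ∘ₗ t.toLinearEquiv.toLinearMap) x = t.symm (LinearMap.adjoint g x) := by
  rw [LinearMap.adjoint_comp, LinearMap.comp_apply, adjoint_unitary_apply]

theorem adjoint_sliceRight (τ : K →ₗ[ℂ] ℂ) (x : H) :
    LinearMap.adjoint (sliceRight H τ) x = x ⊗ₜ[ℂ] LinearMap.adjoint τ 1 := by
  have h₁ : LinearMap.adjoint (TensorProduct.rid ℂ H).toLinearMap x = x ⊗ₜ[ℂ] (1 : ℂ) :=
    adjoint_unitary_apply (TensorProduct.ridIsometry ℂ H) x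
  change LinearMap.adjoint ((TensorProduct.rid ℂ H).toLinearMap ∘ₗ
    TensorProduct.map LinearMap.id τ) x = _
  rw [LinearMap.adjoint_comp, TensorProduct.adjoint_map, LinearMap.comp_apply, h₁,
    TensorProduct.map_tmul, LinearMap.adjoint_id]
  rfl

/-- Used for surjectivity of the Galois map: the vector τ†(1) of K ⊗ L is what the adjoint of τ
inserts next to `x`. -/
theorem adjoint_contractTail (τ : K ⊗[ℂ] L →ₗ[ℂ] ℂ) (x : H) :
    LinearMap.adjoint (𝕜 := ℂ) (E := (H ⊗[ℂ] K) ⊗[ℂ] L) (F := H) (contractTail H τ) x =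
      (TensorProduct.assoc ℂ H K L).symm (x ⊗ₜ[ℂ] LinearMap.adjoint τ 1) :=
  (adjoint_comp_unitary_apply (TensorProduct.assocIsometry ℂ H K L) (sliceRight H τ) x).trans
    (congrArg (TensorProduct.assoc ℂ H K L).symm (adjoint_sliceRight τ x))

end Slices

namespace QFun

variable {X : QSet.{u, v}}

/-- The comultiplication followed by the comultiplication of the first factor. -/
def iterate (F : QFun (X.prod X) X) (a : X.cc) : ((X.prod X).prod X).Ell :=
  (F.prod (id X)).pullback (F.pullback a.val)

theorem iterate_star (F : QFun (X.prod X) X) (a : X.cc) :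
    F.iterate (star a) = star (F.iterate a) := by
  rw [iterate, QSet.cc.val_star, map_star, map_star]
  rfl

/-- The map `a ⊗ b ↦ F⋆(a)(1 ⊗ b)`. -/
def galois (F : QFun (X.prod X) X) : X.cc ⊗[ℂ] X.cc →ₗ[ℂ] (X.prod X).Ell :=
  TensorProduct.lift <| LinearMap.mk₂ ℂ
    (fun a b => F.pullback a.val * fun p : X.At × X.At => TensorProduct.map LinearMap.id (b.val p.2))
    (fun _ _ _ => by rw [QSet.cc.val_add, map_add, add_mul])
    (fun _ _ _ => by rw [QSet.cc.val_smul, map_smul, smul_mul_assoc])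
    (fun _ _ _ => by
      rw [← mul_add]
      exact congrArg _ (funext fun _ => TensorProduct.map_add_right _ _ _))
    (fun _ _ _ => by
      rw [← mul_smul_comm]
      exact congrArg _ (funext fun _ => TensorProduct.map_smul_right _ _ _))

theorem galois_tmul (F : QFun (X.prod X) X) (a b : X.cc) :
    F.galois (a ⊗ₜ[ℂ] b) =
      F.pullback a.val * fun p : X.At × X.At => TensorProduct.map LinearMap.id (b.val p.2) :=
  rfl

/-- Applying Δ ⊗ ι to Δ(a)(1 ⊗ b) gives (Δ ⊗ ι)Δ(a)(1 ⊗ 1 ⊗ b). -/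
theorem pullback_galois (F : QFun (X.prod X) X) (a b : X.cc) (p : ((X.prod X).prod X).At) :
    (F.prod (id X)).pullback (F.galois (a ⊗ₜ[ℂ] b)) p =
      F.iterate a p ∘ₗ TensorProduct.map LinearMap.id (b.val p.2) := by
  rw [galois_tmul, map_mul]
  refine congrArg (F.iterate a p ∘ₗ ·) ?_
  refine (pullback_prod F (id X) 1 b.val p).trans ?_
  rw [map_one, pullback_id]
  rfl

/-- Functionals `τ` on `X ⊗ Y` that invert the operation `F` from the right. -/
structure HasInverter (F : QFun (X.prod X) X)
    (T : ∀ i j : X.At, Submodule ℂ (X.H i ⊗[ℂ] X.H j →ₗ[ℂ] ℂ)) : Prop where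
  intertwine : ∀ {i j k : X.At} {τ : X.H j ⊗[ℂ] X.H k →ₗ[ℂ] ℂ}, τ ∈ T j k → ∀ a : X.cc,
    contractTail (X.H i) τ ∘ₗ F.iterate a ((i, j), k) = a.val i ∘ₗ contractTail (X.H i) τ
  span_left : ∀ (i : X.At) (η : X.H i →ₗ[ℂ] ℂ), η ∈ Submodule.span ℂ {η : X.H i →ₗ[ℂ] ℂ |
    ∃ (j : X.At) (y : X.H j), ∃ τ ∈ T i j, ∀ x, η x = τ (x ⊗ₜ[ℂ] y)}
  span_right : ∀ (j : X.At) (η : X.H j →ₗ[ℂ] ℂ), η ∈ Submodule.span ℂ {η : X.H j →ₗ[ℂ] ℂ |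
    ∃ (i : X.At) (x : X.H i), ∃ τ ∈ T i j, ∀ y, η y = τ (x ⊗ₜ[ℂ] y)}

namespace HasInverter

variable {F : QFun (X.prod X) X} {T : ∀ i j : X.At, Submodule ℂ (X.H i ⊗[ℂ] X.H j →ₗ[ℂ] ℂ)}

/-- On a tensor a ⊗ b, `intertwine` moves a out of the contraction: the result is τ(y ⊗ b z) a x.
Thus Δ ⊗ ι followed by τ undoes the Galois map, up to the slice η = τ(y ⊗ ·). -/
theorem contractTail_galois (h : F.HasInverter T) {i j k : X.At} {τ : X.H j ⊗[ℂ] X.H k →ₗ[ℂ] ℂ} (hτ : τ ∈ T j k)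
    {η : X.H k →ₗ[ℂ] ℂ} (x : X.H i) (y : X.H j) (hη : ∀ z, η z = τ (y ⊗ₜ[ℂ] z)) (z : X.H k)
    (t : X.cc ⊗[ℂ] X.cc) :
    contractTail (X.H i) τ ((F.prod (id X)).pullback (F.galois t) ((i, j), k)
      ((x ⊗ₜ[ℂ] y) ⊗ₜ[ℂ] z)) = sliceRight (X.H i) η (QSet.incl X t (i, k) (x ⊗ₜ[ℂ] z)) := by
  induction t using TensorProduct.induction_on with
  | zero => simp
  | add s t hs ht =>
    simp only [map_add, Pi.add_apply, LinearMap.add_apply]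
    rw [hs, ht]
  | tmul a b =>
    rw [pullback_galois, LinearMap.comp_apply, TensorProduct.map_tmul]
    refine (LinearMap.congr_fun (h.intertwine hτ a) _).trans ?_
    rw [LinearMap.comp_apply, LinearMap.id_apply, contractTail_tmul, map_smul,
      QSet.incl_tmul, TensorProduct.map_tmul, sliceRight_tmul, hη]

/-- By `contractTail_galois` the slices of `t` by the functionals τ(y ⊗ ·) can be read off from its
image, and these functionals span the dual by `span_right`. -/
theorem galois_injective (h : F.HasInverter T) : Function.Injective F.galois := by
  refine (injective_iff_map_eq_zero _).2 fun t ht => QSet.incl_injective ?_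
  rw [map_zero]
  funext p
  obtain ⟨i, k⟩ := p
  refine TensorProduct.ext' fun x z => eq_zero_of_sliceRight fun η => ?_
  induction h.span_right k η using Submodule.span_induction with
  | mem η hη =>
    obtain ⟨j, y, τ, hτ, hη⟩ := hη
    rw [← h.contractTail_galois hτ x y hη z t, ht, map_zero]
    simp
  | zero => simp
  | add s t _ _ hs ht => rw [map_add, LinearMap.add_apply, hs, ht, add_zero]
  | smul c t _ ht => rw [map_smul, LinearMap.smul_apply, ht, smul_zero]

/-- The quantum form of the rule that x y = z and y y' = 1 imply z y' = x. The operator intertwines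
F⋆ because t† and the contraction by τ do so, and `mem_iff` applies. -/
theorem contractTail_mem (h : F.HasInverter T) {i j j' k : X.At} {τ : X.H j ⊗[ℂ] X.H j' →ₗ[ℂ] ℂ} (hτ : τ ∈ T j j')
    {t : X.H i ⊗[ℂ] X.H j →ₗ[ℂ] X.H k} (ht : t ∈ F.1 (i, j) k) :
    contractTail (X.H i) τ ∘ₗ TensorProduct.map (LinearMap.adjoint t) LinearMap.id ∈
      F.1 (k, j') i := by
  refine F.mem_iff.2 fun b => ?_
  have ht' := BinRel.map_mem_prod (R := F.1) (S := BinRel.id X) (i := (i, j)) ht (BinRel.id_mem_id j')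
  have h' := (F.prod (id X)).pullback_adjoint (F.pullback b.val) ht'
  rw [TensorProduct.adjoint_map, LinearMap.adjoint_id] at h'
  rw [← LinearMap.comp_assoc, ← h.intertwine hτ b, LinearMap.comp_assoc, LinearMap.comp_assoc]
  exact congrArg (contractTail (X.H i) τ ∘ₗ ·) h'

/-- For given y and z, a solution x of x y = z has the form z y'. The values of F at the atoms of z
and y' lie in finitely many atoms by `exists_finset_pullback`. -/
theorem finite_atoms (h : F.HasInverter T) (j k : X.At) : {i | F.1 (i, j) k ≠ ⊥}.Finite := by
  have hξ : ∀ ξ : X.H j →ₗ[ℂ] ℂ, {i | ∃ t ∈ F.1 (i, j) k,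
      sliceRight (X.H i) ξ ∘ₗ LinearMap.adjoint t ≠ 0}.Finite := by
    intro ξ
    induction h.span_left j ξ using Submodule.span_induction with
    | mem ξ hξ =>
      obtain ⟨j', y, τ, hτ, hξ⟩ := hξ
      obtain ⟨M, hM⟩ := F.exists_finset_pullback (k, j')
      refine M.finite_toSet.subset ?_
      rintro i ⟨t, ht, hne⟩
      by_contra hi
      have hV := h.contractTail_mem (i := i) hτ ht
      have h0 := F.pullback_spec (X.single i LinearMap.id).val hV
      -- Outside of `M` the pullback of the unit of the atom `i` vanishes at (k, j'), so the
      -- intertwining relation forces the operator to be zero.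
      rw [hM _ fun l hl => QSet.single_val_of_ne (fun e : l = i => hi (e ▸ hl)) _, QSet.single_val_same,
        LinearMap.comp_zero, LinearMap.id_comp] at h0
      refine hne (LinearMap.ext fun z => ?_)
      rw [LinearMap.comp_apply, ← contractTail_tmul_right τ hξ]
      exact LinearMap.congr_fun h0 (z ⊗ₜ[ℂ] y)
    | zero => simp
    | add s t _ _ hs ht =>
      refine (hs.union ht).subset ?_
      rintro i ⟨r, hr, hne⟩
      by_contra hi
      simp only [Set.mem_union, Set.mem_ofPred_eq, not_or, not_exists, not_and, not_not] at hi
      exact hne (by rw [map_add, LinearMap.add_comp, hi.1 r hr, hi.2 r hr, add_zero])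
    | smul c t _ ht =>
      refine ht.subset ?_
      rintro i ⟨r, hr, hne⟩
      exact ⟨r, hr, fun h0 => hne (by rw [map_smul, LinearMap.smul_comp, h0, smul_zero])⟩
  -- Finitely many coordinate functionals detect whether t† is zero.
  refine (Set.finite_iUnion fun m => hξ (innerₛₗ ℂ (stdOrthonormalBasis ℂ (X.H j) m))).subset ?_
  intro i hi
  obtain ⟨t, ht, hne⟩ := Submodule.exists_mem_ne_zero_of_ne_bot hi
  by_contra hc
  simp only [Set.mem_iUnion, Set.mem_ofPred_eq, not_exists, not_and, not_not] at hc
  have : LinearMap.adjoint t = 0 := LinearMap.ext fun z => by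
    rw [← sum_sliceRight_tmul (LinearMap.adjoint t z)]
    refine Finset.sum_eq_zero fun m _ => ?_
    rw [show sliceRight (X.H i) _ (LinearMap.adjoint t z) = 0 from
      LinearMap.congr_fun (hc m t ht) z, TensorProduct.zero_tmul]
  exact hne (by simpa using this)

/-- At (i, j) the pullback of a only sees the spaces F((i, j), k) with k in the support of a, and
for fixed j these are nonzero for finitely many i. -/
theorem finite_pullback (h : F.HasInverter T) (a : X.cc) (j : X.At) : {i | F.pullback a.val (i, j) ≠ 0}.Finite := by
  obtain ⟨S, hS⟩ := a.exists_finset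
  refine (S.finite_toSet.biUnion fun k _ => h.finite_atoms j k).subset fun i hi => ?_
  by_contra hc
  simp only [Set.mem_iUnion, Set.mem_ofPred_eq, not_exists, not_not, Finset.mem_coe] at hc
  refine hi (F.ext_of_comp (i, j) fun k t ht => ?_)
  rw [← F.pullback_spec a.val ht, LinearMap.comp_zero]
  by_cases hk : k ∈ S
  · rw [(Submodule.eq_bot_iff _).1 (hc k hk) t ht, LinearMap.comp_zero]
  · rw [hS k hk, LinearMap.zero_comp]

/-- In Δ(a)(1 ⊗ b) the factor b restricts the second atom to a finite set, and then
`finite_pullback` restricts the first. -/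
theorem finite_galois (h : F.HasInverter T) (t : X.cc ⊗[ℂ] X.cc) : {p | F.galois t p ≠ 0}.Finite := by
  induction t using TensorProduct.induction_on with
  | zero => simp
  | add y z hy hz =>
    refine (hy.union hz).subset fun p hp => ?_
    by_contra h
    simp only [Set.mem_union, Set.mem_ofPred_eq, not_or, not_not] at h
    exact hp (by simp [h.1, h.2])
  | tmul a b =>
    refine (b.finite_support.biUnion fun j _ => (h.finite_pullback a j).image
      fun i => (i, j)).subset fun p hp => ?_
    simp only [Set.mem_iUnion, Set.mem_image, Set.mem_ofPred_eq]
    refine ⟨p.2, fun h0 => hp ?_, p.1, fun h0 => hp ?_, rfl⟩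
    · rw [galois_tmul, Pi.mul_apply, h0, TensorProduct.map_zero_right, mul_zero]
    · rw [galois_tmul, Pi.mul_apply, h0, zero_mul]

end HasInverter

end QFun

theorem sliceRight_map {H H' K : Type*} [NormedAddCommGroup H] [InnerProductSpace ℂ H]
    [NormedAddCommGroup H'] [InnerProductSpace ℂ H'] [NormedAddCommGroup K] [InnerProductSpace ℂ K]
    (ξ : K →ₗ[ℂ] ℂ) (t : H →ₗ[ℂ] H') (w : H ⊗[ℂ] K) :
    sliceRight H' ξ (TensorProduct.map t LinearMap.id w) = t (sliceRight H ξ w) := by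
  induction w using TensorProduct.induction_on with
  | zero => simp
  | add v w hv hw => simp only [map_add, hv, hw]
  | tmul x y => simp [sliceRight]

theorem sliceRight_assoc_symm {H K L : Type*} [NormedAddCommGroup H] [InnerProductSpace ℂ H]
    [NormedAddCommGroup K] [InnerProductSpace ℂ K] [NormedAddCommGroup L] [InnerProductSpace ℂ L]
    (ξ : L →ₗ[ℂ] ℂ) (x : H) (w : K ⊗[ℂ] L) :
    sliceRight (H ⊗[ℂ] K) ξ ((TensorProduct.assoc ℂ H K L).symm (x ⊗ₜ[ℂ] w)) =
      x ⊗ₜ[ℂ] sliceRight K ξ w := by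
  induction w using TensorProduct.induction_on with
  | zero => simp
  | add v w hv hw => simp only [TensorProduct.tmul_add, map_add, hv, hw]
  | tmul y z => simp [sliceRight, TensorProduct.tmul_smul]

theorem adjoint_intertwine {E G : Type*} [NormedAddCommGroup E] [InnerProductSpace ℂ E]
    [FiniteDimensional ℂ E] [NormedAddCommGroup G] [InnerProductSpace ℂ G] [FiniteDimensional ℂ G]
    (c : E →ₗ[ℂ] G) (f : E →ₗ[ℂ] E) (g : G →ₗ[ℂ] G)
    (h : c ∘ₗ LinearMap.adjoint f = LinearMap.adjoint g ∘ₗ c) (x : G) :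
    f (LinearMap.adjoint c x) = LinearMap.adjoint c (g x) := by
  have := congrArg LinearMap.adjoint h
  rw [LinearMap.adjoint_comp, LinearMap.adjoint_comp, LinearMap.adjoint_adjoint,
    LinearMap.adjoint_adjoint] at this
  exact LinearMap.congr_fun this x

-- Slices of the comultiplication and surjectivity of the Galois map

namespace QSet

variable {X : QSet.{u, v}} {Y : QSet.{u', v'}} {Z : QSet.{u'', v''}}

/-- The slice `(ι ⊗ ω)(f)` of a function on `Y × Z` by the functional `ω(b) = ξ(b v)`. -/
def sliceEll (f : (Y.prod Z).Ell) (j : Z.At) (ξ : Z.H j →ₗ[ℂ] ℂ) (v : Z.H j) : Y.Ell := fun l =>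
  sliceRight (Y.H l) ξ ∘ₗ f (l, j) ∘ₗ (TensorProduct.mk ℂ (Y.H l) (Z.H j)).flip v

theorem sliceEll_apply (f : (Y.prod Z).Ell) (j : Z.At) (ξ : Z.H j →ₗ[ℂ] ℂ) (v : Z.H j) (l : Y.At)
    (x : Y.H l) : sliceEll f j ξ v l x = sliceRight (Y.H l) ξ (f (l, j) (x ⊗ₜ[ℂ] v)) := rfl

end QSet

namespace QFun

variable {X : QSet.{u, v}} {Y : QSet.{u', v'}} {Z : QSet.{u'', v''}}

/-- The function acts on the first leg and the slice on the second, so they commute; concretely, t ⊗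
1 lies in F × I and passes through the slice map. -/
theorem pullback_sliceEll (F : QFun Y X) (f : (X.prod Z).Ell) (j : Z.At) (ξ : Z.H j →ₗ[ℂ] ℂ)
    (v : Z.H j) : F.pullback (QSet.sliceEll f j ξ v) =
      QSet.sliceEll ((F.prod (id Z)).pullback f) j ξ v := by
  refine F.pullback_eq _ _ fun p l t ht => LinearMap.ext fun x => ?_
  have h := (F.prod (id Z)).pullback_spec f (BinRel.map_mem_prod ht (BinRel.id_mem_id j))
  have h' := LinearMap.congr_fun h (x ⊗ₜ[ℂ] v)
  rw [LinearMap.comp_apply, LinearMap.comp_apply, TensorProduct.map_tmul] at h'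
  rw [LinearMap.comp_apply, LinearMap.comp_apply, QSet.sliceEll_apply, QSet.sliceEll_apply,
    ← sliceRight_map ξ t, ← h']
  rfl

namespace HasInverter

variable {F : QFun (X.prod X) X} {T : ∀ i j : X.At, Submodule ℂ (X.H i ⊗[ℂ] X.H j →ₗ[ℂ] ℂ)}

/-- The slices of the comultiplication of `a`. -/
def slice (h : F.HasInverter T) (a : X.cc) (j : X.At) (ξ : X.H j →ₗ[ℂ] ℂ) : X.H j →ₗ[ℂ] X.cc where
  toFun v := QSet.cc.mk (QSet.sliceEll (F.pullback a.val) j ξ v)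
    ((h.finite_pullback a j).subset fun i hi h0 => hi (LinearMap.ext fun x => by
      rw [QSet.sliceEll_apply, h0]
      simp))
  map_add' v w := QSet.cc.ext fun i => LinearMap.ext fun x => by
    change QSet.sliceEll _ j ξ (v + w) i x =
      QSet.sliceEll _ j ξ v i x + QSet.sliceEll _ j ξ w i x
    simp only [QSet.sliceEll_apply, TensorProduct.tmul_add, map_add]
  map_smul' c v := QSet.cc.ext fun i => LinearMap.ext fun x => by
    change QSet.sliceEll _ j ξ (c • v) i x = c • QSet.sliceEll _ j ξ v i x
    simp only [QSet.sliceEll_apply, TensorProduct.tmul_smul, map_smul]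

theorem slice_val (h : F.HasInverter T) (a : X.cc) (j : X.At) (ξ : X.H j →ₗ[ℂ] ℂ) (v : X.H j) :
    (h.slice a j ξ v).val = QSet.sliceEll (F.pullback a.val) j ξ v := rfl

/-- The element `∑ D(vₘ) ⊗ |uₘ⟩⟨w|`, where `D(v)` is the slice of the comultiplication of `a`
given by `ξ` and `v`, as a linear function of `∑ uₘ ⊗ vₘ`. -/
def preimage (h : F.HasInverter T) (a : X.cc) {j j' : X.At} (ξ : X.H j' →ₗ[ℂ] ℂ) (w : X.H j) :
    X.H j ⊗[ℂ] X.H j' →ₗ[ℂ] X.cc ⊗[ℂ] X.cc :=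
  (TensorProduct.comm ℂ X.cc X.cc).toLinearMap ∘ₗ
    TensorProduct.map (X.single j ∘ₗ LinearMap.smulRightₗ (innerₛₗ ℂ w)) (h.slice a j' ξ)

theorem preimage_tmul (h : F.HasInverter T) (a : X.cc) {j j' : X.At} (ξ : X.H j' →ₗ[ℂ] ℂ)
    (w u : X.H j) (v : X.H j') : h.preimage a ξ w (u ⊗ₜ[ℂ] v) =
      h.slice a j' ξ v ⊗ₜ[ℂ] X.single j (ketBra u w) := rfl

/-- For ρ = u ⊗ v, `pullback_sliceEll` rewrites Δ of the slice D(v) as a slice of (Δ ⊗ ι)Δ(a), while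
|u⟩⟨w| supplies the vector u and the scalar ⟨w, y⟩. The formula is linear in ρ. -/
theorem galois_preimage (h : F.HasInverter T) (a : X.cc) {i j j' : X.At} (ξ : X.H j' →ₗ[ℂ] ℂ)
    (w : X.H j) (ρ : X.H j ⊗[ℂ] X.H j') (x : X.H i) (y : X.H j) :
    F.galois (h.preimage a ξ w ρ) (i, j) (x ⊗ₜ[ℂ] y) =
      (inner ℂ w y : ℂ) • sliceRight (X.H i ⊗[ℂ] X.H j) ξ (F.iterate a ((i, j), j')
        ((TensorProduct.assoc ℂ _ _ _).symm (x ⊗ₜ[ℂ] ρ))) := by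
  induction ρ using TensorProduct.induction_on with
  | zero => simp
  | add ρ σ hρ hσ =>
    simp only [TensorProduct.tmul_add, map_add, Pi.add_apply, LinearMap.add_apply, smul_add]
    rw [hρ, hσ]
  | tmul u v =>
    rw [preimage_tmul, galois_tmul, Pi.mul_apply, slice_val, pullback_sliceEll,
      QSet.single_val_same, TensorProduct.assoc_symm_tmul]
    change QSet.sliceEll (Y := X.prod X) (Z := X) ((F.prod (id X)).pullback (F.pullback a.val)) j' ξ v
      (i, j) (x ⊗ₜ[ℂ] ((inner ℂ w y : ℂ) • u)) = _
    rw [TensorProduct.tmul_smul, map_smul]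
    rfl

theorem galois_preimage_of_ne (h : F.HasInverter T) (a : X.cc) {i j j' k : X.At} (hk : k ≠ j)
    (ξ : X.H j' →ₗ[ℂ] ℂ) (w : X.H j) (ρ : X.H j ⊗[ℂ] X.H j') :
    F.galois (h.preimage a ξ w ρ) (i, k) = 0 := by
  induction ρ using TensorProduct.induction_on with
  | zero => simp
  | add ρ σ hρ hσ => rw [map_add, map_add, Pi.add_apply, hρ, hσ, add_zero]
  | tmul u v =>
    rw [preimage_tmul, galois_tmul, Pi.mul_apply, QSet.single_val_of_ne hk,
      TensorProduct.map_zero_right, mul_zero]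

/-- The adjoint of `intertwine`, applied to a*: the vector τ†(1) behaves like a pair of mutually
inverse elements, which cancel in (Δ ⊗ ι)Δ(a). -/
theorem iterate_adjoint (h : F.HasInverter T) (a : X.cc) {i j k : X.At}
    {τ : X.H j ⊗[ℂ] X.H k →ₗ[ℂ] ℂ} (hτ : τ ∈ T j k) (x : X.H i) :
    F.iterate a ((i, j), k) ((TensorProduct.assoc ℂ _ _ _).symm
      (x ⊗ₜ[ℂ] LinearMap.adjoint τ 1)) =
    (TensorProduct.assoc ℂ _ _ _).symm (a.val i x ⊗ₜ[ℂ] LinearMap.adjoint τ 1) := by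
  have h₁ := adjoint_intertwine (E := ((X.prod X).prod X).H ((i, j), k)) (contractTail (X.H i) τ)
    (F.iterate a ((i, j), k)) (a.val i)
    ((congrArg (fun f : ((X.prod X).prod X).Ell => contractTail (X.H i) τ ∘ₗ f ((i, j), k))
      (F.iterate_star a)).symm.trans (h.intertwine (i := i) hτ (star a))) x
  rw [adjoint_contractTail, adjoint_contractTail] at h₁
  exact h₁

/-- With ρ = τ†(1), `iterate_adjoint` collapses the formula of `galois_preimage`, and a ⊗ |p⟩⟨w| is
attained for p = (ι ⊗ ξ)τ†(1). -/
theorem galois_preimage_adjoint (h : F.HasInverter T) (a : X.cc) {j j' : X.At}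
    {τ : X.H j ⊗[ℂ] X.H j' →ₗ[ℂ] ℂ} (hτ : τ ∈ T j j') (ξ : X.H j' →ₗ[ℂ] ℂ) (w : X.H j) :
    F.galois (h.preimage a ξ w (LinearMap.adjoint τ 1)) =
      QSet.incl X (a ⊗ₜ[ℂ] X.single j (ketBra (sliceRight (X.H j) ξ (LinearMap.adjoint τ 1)) w)) := by
  funext p
  obtain ⟨i, k⟩ := p
  by_cases hk : k = j
  · subst hk
    refine TensorProduct.ext' fun x y => ?_
    rw [galois_preimage, h.iterate_adjoint a hτ, sliceRight_assoc_symm, QSet.incl_tmul,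
      TensorProduct.map_tmul, QSet.single_val_same, ketBra_apply, TensorProduct.tmul_smul]
  · rw [h.galois_preimage_of_ne a hk, QSet.incl_tmul, QSet.single_val_of_ne hk,
      TensorProduct.map_zero_right]

/-- Matrix units reduce the claim to tensors a ⊗ |p⟩⟨w|. The vectors p reached by
`galois_preimage_adjoint` span the atom, and the range is a subspace. -/
theorem incl_mem_range_galois (h : F.HasInverter T) (y : X.cc ⊗[ℂ] X.cc) :
    QSet.incl X y ∈ LinearMap.range F.galois := by
  induction y using TensorProduct.induction_on with
  | zero => simp
  | add y z hy hz => rw [map_add]; exact add_mem hy hz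
  | tmul a b =>
    have key : ∀ (j : X.At) (p w : X.H j),
        QSet.incl X (a ⊗ₜ[ℂ] X.single j (ketBra p w)) ∈ LinearMap.range F.galois := by
      intro j p w
      let L : X.H j →ₗ[ℂ] (X.prod X).Ell := QSet.incl X ∘ₗ TensorProduct.mk ℂ X.cc X.cc a ∘ₗ
        X.single j ∘ₗ LinearMap.smulRightₗ (innerₛₗ ℂ w)
      suffices hK : (LinearMap.range F.galois).comap L = ⊤ from
        (hK ▸ Submodule.mem_top : p ∈ (LinearMap.range F.galois).comap L)
      -- A vector x orthogonal to all attained p satisfies τ(x ⊗ y) = 0 for all y and τ. As the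
      -- functionals τ(· ⊗ y) span the dual by `span_left`, x is zero.
      refine (Submodule.orthogonal_eq_bot_iff).1 ((Submodule.eq_bot_iff _).2 fun x hx => ?_)
      have hτ : ∀ (j' : X.At) (y : X.H j'), ∀ τ ∈ T j j', τ (x ⊗ₜ[ℂ] y) = 0 := by
        intro j' y τ hτ
        have hm : sliceRight (X.H j) (innerₛₗ ℂ y) (LinearMap.adjoint τ 1) ∈
            (LinearMap.range F.galois).comap L :=
          ⟨_, h.galois_preimage_adjoint a hτ (innerₛₗ ℂ y) w⟩
        have h0 := (Submodule.mem_orthogonal _ _).1 hx _ hm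
        rw [inner_sliceRight, LinearMap.adjoint_inner_left] at h0
        simpa using h0
      have hη : ∀ η : X.H j →ₗ[ℂ] ℂ, η x = 0 := by
        intro η
        induction h.span_left j η using Submodule.span_induction with
        | mem η hη =>
          obtain ⟨j', y, τ, hτ', hη⟩ := hη
          rw [hη, hτ j' y τ hτ']
        | zero => simp
        | add s t _ _ hs ht => rw [LinearMap.add_apply, hs, ht, add_zero]
        | smul c t _ ht => rw [LinearMap.smul_apply, ht, smul_zero]
      exact inner_self_eq_zero.1 (hη (innerₛₗ ℂ x))
    obtain ⟨S, hS⟩ := b.exists_finset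
    rw [QSet.cc.eq_sum_single b hS, TensorProduct.tmul_sum, map_sum]
    refine sum_mem fun j _ => ?_
    rw [QSet.eq_sum_ketBra (b.val j)]
    simp only [map_sum, map_smul, TensorProduct.tmul_sum, TensorProduct.tmul_smul]
    exact sum_mem fun k _ => sum_mem fun l _ => Submodule.smul_mem _ _ (key j _ _)

theorem exists_galois_equiv (h : F.HasInverter T) : ∃ T₁ : X.cc ⊗[ℂ] X.cc →ₗ[ℂ] X.cc ⊗[ℂ] X.cc,
    (∀ z, QSet.incl X (T₁ z) = F.galois z) ∧ Function.Bijective T₁ := by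
  let T₁ : X.cc ⊗[ℂ] X.cc →ₗ[ℂ] X.cc ⊗[ℂ] X.cc := (QSet.inclEquiv X).symm.toLinearMap ∘ₗ
    { toFun := fun z => QSet.cc.mk (F.galois z) (h.finite_galois z)
      map_add' := fun _ _ => QSet.cc.val_injective (map_add _ _ _)
      map_smul' := fun _ _ => QSet.cc.val_injective (map_smul _ _ _) }
  have hT : ∀ z, QSet.incl X (T₁ z) = F.galois z := fun z => QSet.incl_inclEquiv_symm _
  refine ⟨T₁, hT, fun y z hyz => h.galois_injective ?_, fun y => ?_⟩
  · rw [← hT, ← hT, hyz]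
  · obtain ⟨z, hz⟩ := h.incl_mem_range_galois y
    exact ⟨z, QSet.incl_injective ((hT z).trans hz)⟩

end HasInverter

end QFun

-- The opposite operation and the functionals in C† ∘ F

namespace QFun

variable {X : QSet.{u, v}} {Y : QSet.{u', v'}} {Z : QSet.{u'', v''}}

theorem pullback_ofUnitary (e : X.At → Y.At) (t : ∀ i, X.H i ≃ₗᵢ[ℂ] Y.H (e i)) (b : Y.Ell) (i : X.At)
    (x : X.H i) : t i ((ofUnitary e t).pullback b i x) = b (e i) (t i x) :=
  (LinearMap.congr_fun ((ofUnitary e t).pullback_spec b (ofUnitary_mem e t i)) x).symm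

/-- The exchange of the factors of a product. -/
def swap (X : QSet.{u, v}) (Y : QSet.{u', v'}) : QFun (X.prod Y) (Y.prod X) :=
  ofUnitary (fun p => (p.2, p.1)) fun p => TensorProduct.commIsometry ℂ (X.H p.1) (Y.H p.2)

/-- The opposite operation. -/
def opp (F : QFun (X.prod X) X) : QFun (X.prod X) X := F.comp (swap X X)

theorem mem_opp {F : QFun (X.prod X) X} {i j k : X.At} {t : X.H i ⊗[ℂ] X.H j →ₗ[ℂ] X.H k} :
    t ∈ F.opp.1 (i, j) k ↔
      ∃ s ∈ F.1 (j, i) k, t = s ∘ₗ (TensorProduct.comm ℂ (X.H i) (X.H j)).toLinearMap := by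
  exact BinRel.mem_comp_ofMap (X := X.prod X) (Y := X.prod X) (K := F.1)
    (e := fun p : (X.prod X).At => ((p.2, p.1) : (X.prod X).At))
    (t := fun p => (TensorProduct.commIsometry ℂ (X.H p.1) (X.H p.2)).toLinearEquiv.toLinearMap)
    (i := (i, j)) (l := k) (s := t)

theorem pullback_opp (F : QFun (X.prod X) X) (b : X.Ell) (i j : X.At) (x : X.H i ⊗[ℂ] X.H j) :
    TensorProduct.comm ℂ (X.H i) (X.H j) (F.opp.pullback b (i, j) x) =
      F.pullback b (j, i) (TensorProduct.comm ℂ (X.H i) (X.H j) x) := by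
  rw [opp, pullback_comp]
  exact pullback_ofUnitary (X := X.prod X) (Y := X.prod X) (fun p => (p.2, p.1))
    (fun p => TensorProduct.commIsometry ℂ (X.H p.1) (X.H p.2)) (F.pullback b) (i, j) x

variable {F : QFun (X.prod X) X} {C : QFun QSet.one X}

/-- Associativity read through pullbacks: (Δ ⊗ ι)Δ(a) and (ι ⊗ Δ)Δ(a) are conjugate by the
associator. -/
theorem assoc_pullback
    (hA : F.comp (F.prod (id X)) = (F.comp ((id X).prod F)).comp (assoc X X X)) (a : X.Ell)
    (i j k : X.At) (x : (X.H i ⊗[ℂ] X.H j) ⊗[ℂ] X.H k) :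
    TensorProduct.assoc ℂ _ _ _ ((F.prod (id X)).pullback (F.pullback a) ((i, j), k) x) =
      ((id X).prod F).pullback (F.pullback a) (i, (j, k)) (TensorProduct.assoc ℂ _ _ _ x) := by
  rw [← pullback_comp, hA, pullback_comp, pullback_comp]
  exact pullback_ofUnitary (X := (X.prod X).prod X) (Y := X.prod (X.prod X)) (fun p => (p.1.1, (p.1.2, p.2)))
    (fun p => TensorProduct.assocIsometry ℂ (X.H p.1.1) (X.H p.1.2) (X.H p.2)) _ ((i, j), k) x

theorem rid_pullback (hR : F.comp ((id X).prod C) = runit X) (a : X.Ell) (i : X.At)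
    (x : X.H i ⊗[ℂ] ℂ) :
    TensorProduct.rid ℂ _ (((id X).prod C).pullback (F.pullback a) (i, ()) x) =
      a i (TensorProduct.rid ℂ _ x) := by
  rw [← pullback_comp, hR]
  exact pullback_ofUnitary (X := X.prod QSet.one) (Y := X) (fun p => p.1)
    (fun p => TensorProduct.ridIsometry ℂ (X.H p.1)) a (i, ()) x

theorem lid_pullback (hL : F.comp (C.prod (id X)) = lunit X) (a : X.Ell) (i : X.At)
    (x : ℂ ⊗[ℂ] X.H i) :
    TensorProduct.lid ℂ _ ((C.prod (id X)).pullback (F.pullback a) ((), i) x) =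
      a i (TensorProduct.lid ℂ _ x) := by
  rw [← pullback_comp, hL]
  exact pullback_ofUnitary (X := QSet.one.prod X) (Y := X) (fun p => p.2)
    (fun p => TensorProduct.lidIsometry ℂ (X.H p.2)) a ((), i) x

/-- The counit law with ι ⊗ C⋆ replaced by the operators ι ⊗ c† that intertwine it. -/
theorem rid_map_adjoint (hR : F.comp ((id X).prod C) = runit X) (a : X.Ell) {i l : X.At}
    {c : ℂ →ₗ[ℂ] X.H l} (hc : c ∈ C.1 () l) (x : X.H i ⊗[ℂ] X.H l) :
    TensorProduct.rid ℂ _ (TensorProduct.map LinearMap.id (LinearMap.adjoint c)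
        (F.pullback a (i, l) x)) =
      a i (TensorProduct.rid ℂ _ (TensorProduct.map LinearMap.id (LinearMap.adjoint c) x)) := by
  have h := ((id X).prod C).pullback_adjoint (F.pullback a)
    (BinRel.map_mem_prod (R := BinRel.id X) (S := C.1) (BinRel.id_mem_id i) hc)
  have h' := LinearMap.congr_fun h x
  rw [TensorProduct.adjoint_map, LinearMap.adjoint_id] at h'
  rw [← rid_pullback hR]
  exact congrArg (TensorProduct.rid ℂ (X.H i)) h'.symm

theorem lid_map_adjoint (hL : F.comp (C.prod (id X)) = lunit X) (a : X.Ell) {i l : X.At}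
    {c : ℂ →ₗ[ℂ] X.H l} (hc : c ∈ C.1 () l) (x : X.H l ⊗[ℂ] X.H i) :
    TensorProduct.lid ℂ _ (TensorProduct.map (LinearMap.adjoint c) LinearMap.id
        (F.pullback a (l, i) x)) =
      a i (TensorProduct.lid ℂ _ (TensorProduct.map (LinearMap.adjoint c) LinearMap.id x)) := by
  have h := (C.prod (id X)).pullback_adjoint (F.pullback a)
    (BinRel.map_mem_prod (R := C.1) (S := BinRel.id X) hc (BinRel.id_mem_id i))
  have h' := LinearMap.congr_fun h x
  rw [TensorProduct.adjoint_map, LinearMap.adjoint_id] at h'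
  rw [← lid_pullback hL]
  exact congrArg (TensorProduct.lid ℂ (X.H i)) h'.symm

variable (F C) in
/-- The functionals on `X ⊗ Y` that form the relation `F(x, y) = C`. -/
def inverter (i j : X.At) : Submodule ℂ (X.H i ⊗[ℂ] X.H j →ₗ[ℂ] ℂ) := C.1.dagger.comp F.1 (i, j) ()

theorem inverter_induction {i j : X.At} {P : (X.H i ⊗[ℂ] X.H j →ₗ[ℂ] ℂ) → Prop}
    (comp : ∀ (l : X.At) (c : ℂ →ₗ[ℂ] X.H l), c ∈ C.1 () l → ∀ s ∈ F.1 (i, j) l,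
      P (LinearMap.adjoint c ∘ₗ s))
    (zero : P 0) (add : ∀ s t, P s → P t → P (s + t)) (smul : ∀ (c : ℂ) t, P t → P (c • t))
    {τ : X.H i ⊗[ℂ] X.H j →ₗ[ℂ] ℂ} (hτ : τ ∈ inverter F C i j) : P τ := by
  unfold inverter at hτ
  induction hτ using Submodule.span_induction with
  | mem t ht =>
    obtain ⟨l, _, ⟨c, hc, rfl⟩, s, hs, rfl⟩ := ht
    exact comp l c hc s hs
  | zero => exact zero
  | add s t _ _ hs ht => exact add s t hs ht
  | smul c t _ ht => exact smul c t ht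

/-- For a generator τ = c†s, the operator s carries (ι ⊗ Δ)Δ(a) to Δ(a), and c† then carries Δ(a) to
a by the right unit law. -/
theorem sliceRight_inverter (hR : F.comp ((id X).prod C) = runit X) {j k : X.At}
    {τ : X.H j ⊗[ℂ] X.H k →ₗ[ℂ] ℂ} (hτ : τ ∈ inverter F C j k) (a : X.Ell) (i : X.At)
    (x : X.H i ⊗[ℂ] (X.H j ⊗[ℂ] X.H k)) :
    sliceRight (X.H i) τ (((id X).prod F).pullback (F.pullback a) (i, (j, k)) x) =
      a i (sliceRight (X.H i) τ x) := by
  refine inverter_induction (P := fun τ => sliceRight (X.H i) τ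
    (((id X).prod F).pullback (F.pullback a) (i, (j, k)) x) = a i (sliceRight (X.H i) τ x))
    (fun l c hc s hs => ?_) (by simp) (fun s t hs ht => ?_) (fun c t ht => ?_) hτ
  · have e : ∀ y : X.H i ⊗[ℂ] (X.H j ⊗[ℂ] X.H k), sliceRight (X.H i) (LinearMap.adjoint c ∘ₗ s) y =
        TensorProduct.rid ℂ _ (TensorProduct.map LinearMap.id (LinearMap.adjoint c)
          (TensorProduct.map LinearMap.id s y)) := fun y => by
      rw [← LinearMap.comp_apply (TensorProduct.map _ _), ← TensorProduct.map_comp,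
        LinearMap.id_comp]
      rfl
    have h := ((id X).prod F).pullback_spec (F.pullback a)
      (BinRel.map_mem_prod (R := BinRel.id X) (S := F.1) (i' := (j, k)) (BinRel.id_mem_id i) hs)
    rw [e, e, ← rid_map_adjoint hR a hc]
    exact congrArg (fun y => TensorProduct.rid ℂ _
      (TensorProduct.map LinearMap.id (LinearMap.adjoint c) y)) (LinearMap.congr_fun h x).symm
  · simp only [map_add, LinearMap.add_apply, hs, ht]
  · simp only [map_smul, LinearMap.smul_apply, ht]

/-- The mirror image of `sliceRight_inverter`, with τ on the first two legs and the left unit law.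
It serves the opposite operation. -/
theorem lid_map_inverter (hL : F.comp (C.prod (id X)) = lunit X) {j k : X.At}
    {τ : X.H j ⊗[ℂ] X.H k →ₗ[ℂ] ℂ} (hτ : τ ∈ inverter F C j k) (a : X.Ell) (i : X.At)
    (x : (X.H j ⊗[ℂ] X.H k) ⊗[ℂ] X.H i) :
    TensorProduct.lid ℂ _ (TensorProduct.map τ LinearMap.id
        ((F.prod (id X)).pullback (F.pullback a) ((j, k), i) x)) =
      a i (TensorProduct.lid ℂ _ (TensorProduct.map τ LinearMap.id x)) := by
  refine inverter_induction (P := fun τ => TensorProduct.lid ℂ _ (TensorProduct.map τ LinearMap.id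
        ((F.prod (id X)).pullback (F.pullback a) ((j, k), i) x)) =
      a i (TensorProduct.lid ℂ _ (TensorProduct.map τ LinearMap.id x)))
    (fun l c hc s hs => ?_) (by simp) (fun s t hs ht => ?_) (fun c t ht => ?_) hτ
  · have e : ∀ y : (X.H j ⊗[ℂ] X.H k) ⊗[ℂ] X.H i,
        TensorProduct.map (LinearMap.adjoint c ∘ₗ s) LinearMap.id y =
          TensorProduct.map (LinearMap.adjoint c) LinearMap.id
            (TensorProduct.map s LinearMap.id y) := fun y => by
      rw [← LinearMap.comp_apply (TensorProduct.map _ _), ← TensorProduct.map_comp,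
        LinearMap.id_comp]
    have h := (F.prod (id X)).pullback_spec (F.pullback a)
      (BinRel.map_mem_prod (R := F.1) (S := BinRel.id X) (i := (j, k)) hs (BinRel.id_mem_id i))
    rw [e, e, ← lid_map_adjoint hL a hc]
    exact congrArg (fun y => TensorProduct.lid ℂ _
      (TensorProduct.map (LinearMap.adjoint c) LinearMap.id y)) (LinearMap.congr_fun h x).symm
  · simp only [TensorProduct.map_add_left, map_add, LinearMap.add_apply, hs, ht]
  · simp only [TensorProduct.map_smul_left, map_smul, LinearMap.smul_apply, ht]

/-- Associativity moves the brackets so that τ meets the legs on which Δ acts, and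
`sliceRight_inverter` finishes; this is x = x(y y') = (x y)y'. The spanning conditions are sentences
4 and 5. -/
theorem hasInverter_inverter
    (hA : F.comp (F.prod (id X)) = (F.comp ((id X).prod F)).comp (assoc X X X))
    (hR : F.comp ((id X).prod C) = runit X) (hr : (rightInverseSentence F.1 C.1).IsTrue)
    (hl : (leftInverseSentence F.1 C.1).IsTrue) : F.HasInverter (inverter F C) where
  intertwine {i j k τ} hτ a := LinearMap.ext fun x => by
    refine (congrArg (sliceRight (X.H i) τ) (assoc_pullback hA a.val i j k x)).trans ?_
    exact sliceRight_inverter hR hτ a.val i _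
  span_left := (rightInverseSentence_iff F.1 C.1).1 hr
  span_right := (leftInverseSentence_iff F.1 C.1).1 hl

end QFun

-- Reversal of triple products

section Reverse

variable (H K L : Type*) [AddCommGroup H] [Module ℂ H] [AddCommGroup K] [Module ℂ K]
  [AddCommGroup L] [Module ℂ L]

/-- The reversal `(x ⊗ y) ⊗ z ↦ z ⊗ (y ⊗ x)`. -/
def tensorReverse : (H ⊗[ℂ] K) ⊗[ℂ] L ≃ₗ[ℂ] L ⊗[ℂ] (K ⊗[ℂ] H) :=
  (TensorProduct.comm ℂ (H ⊗[ℂ] K) L).trans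
    (TensorProduct.congr (LinearEquiv.refl ℂ L) (TensorProduct.comm ℂ H K))

variable {H K L}

@[simp] theorem tensorReverse_tmul (x : H) (y : K) (z : L) :
    tensorReverse H K L ((x ⊗ₜ[ℂ] y) ⊗ₜ[ℂ] z) = z ⊗ₜ[ℂ] (y ⊗ₜ[ℂ] x) := rfl

theorem comm_map_comp_comm {H' L' : Type*} [AddCommGroup H'] [Module ℂ H'] [AddCommGroup L']
    [Module ℂ L'] (s : K ⊗[ℂ] H →ₗ[ℂ] H') (c : L →ₗ[ℂ] L') (x : (H ⊗[ℂ] K) ⊗[ℂ] L) :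
    TensorProduct.comm ℂ H' L'
        (TensorProduct.map (s ∘ₗ (TensorProduct.comm ℂ H K).toLinearMap) c x) =
      TensorProduct.map c s (tensorReverse H K L x) := by
  induction x using TensorProduct.induction_on with
  | zero => simp
  | add x y hx hy => simp only [map_add, hx, hy]
  | tmul w z => rfl

theorem lid_map_reverse (τ : K ⊗[ℂ] L →ₗ[ℂ] ℂ) (x : (H ⊗[ℂ] K) ⊗[ℂ] L) :
    TensorProduct.lid ℂ H (TensorProduct.map (τ ∘ₗ (TensorProduct.comm ℂ L K).toLinearMap)
        LinearMap.id ((TensorProduct.assoc ℂ L K H).symm (tensorReverse H K L x))) =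
      TensorProduct.rid ℂ H (TensorProduct.map LinearMap.id τ (TensorProduct.assoc ℂ H K L x)) := by
  induction x using TensorProduct.induction_on with
  | zero => simp
  | add x y hx hy => simp only [map_add, hx, hy]
  | tmul w z =>
    induction w using TensorProduct.induction_on with
    | zero => simp
    | add x y hx hy => simp only [map_add, TensorProduct.add_tmul, hx, hy]
    | tmul x y => simp

end Reverse

namespace QFun

variable {X : QSet.{u, v}} {F : QFun (X.prod X) X} {C : QFun QSet.one X}

/-- Bracketing to the left for the opposite operation is bracketing to the right for the given one,
read backwards. The proof checks that the conjugated function satisfies the intertwining relations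
that characterize a pullback. -/
theorem reverse_iterate_opp (F : QFun (X.prod X) X) (a : X.cc) (i j k : X.At)
    (x : (X.H i ⊗[ℂ] X.H j) ⊗[ℂ] X.H k) :
    tensorReverse _ _ _ (F.opp.iterate a ((i, j), k) x) =
      ((id X).prod F).pullback (F.pullback a.val) (k, (j, i)) (tensorReverse _ _ _ x) := by
  let W := ((id X).prod F).pullback (F.pullback a.val)
  let V : ((X.prod X).prod X).Ell := fun p =>
    (tensorReverse (X.H p.1.1) (X.H p.1.2) (X.H p.2)).symm.toLinearMap ∘ₗ W (p.2, (p.1.2, p.1.1)) ∘ₗ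
      (tensorReverse (X.H p.1.1) (X.H p.1.2) (X.H p.2)).toLinearMap
  have hV : F.opp.iterate a = V := by
    refine (F.opp.prod (id X)).pullback_eq _ _ fun p q t ht => ?_
    obtain ⟨⟨i, j⟩, k⟩ := p
    obtain ⟨l, m⟩ := q
    induction ht using Submodule.span_induction with
    | mem t ht =>
      obtain ⟨r, hr, c, hc, rfl⟩ := ht
      obtain ⟨s, hs, rfl⟩ := mem_opp.1 hr
      refine LinearMap.ext fun x => (TensorProduct.comm ℂ (X.H l) (X.H m)).injective ?_
      have h := ((id X).prod F).pullback_spec (F.pullback a.val)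
        (BinRel.map_mem_prod (R := BinRel.id X) (S := F.1) (i' := (j, i)) hc hs)
      refine (pullback_opp F a.val l m _).trans ?_
      refine (congrArg (F.pullback a.val (m, l)) (comm_map_comp_comm s c x)).trans ?_
      refine (LinearMap.congr_fun h _).trans ?_
      refine Eq.trans ?_ (comm_map_comp_comm s c _).symm
      refine congrArg (TensorProduct.map c s) ?_
      exact ((tensorReverse (X.H i) (X.H j) (X.H k)).apply_symm_apply _).symm
    | zero => simp
    | add s t _ _ hs ht => rw [LinearMap.comp_add, LinearMap.add_comp, hs, ht]
    | smul c t _ ht => rw [LinearMap.comp_smul, LinearMap.smul_comp, ht]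
  rw [hV]
  exact (tensorReverse (X.H i) (X.H j) (X.H k)).apply_symm_apply _

/-- The flipped functionals do for the opposite operation what the original ones do for `F`: the
identity becomes (y' y)x = x, by associativity and the left unit law, and the two inverse sentences
exchange their roles. -/
theorem hasInverter_opp
    (hA : F.comp (F.prod (id X)) = (F.comp ((id X).prod F)).comp (assoc X X X))
    (hL : F.comp (C.prod (id X)) = lunit X) (hr : (rightInverseSentence F.1 C.1).IsTrue)
    (hl : (leftInverseSentence F.1 C.1).IsTrue) :
    F.opp.HasInverter fun i j => (inverter F C j i).comap
      (LinearMap.lcomp ℂ ℂ (TensorProduct.comm ℂ (X.H j) (X.H i)).toLinearMap) where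
  intertwine {i j k τ} hτ a := LinearMap.ext fun x => by
    have hτ : τ ∘ₗ (TensorProduct.comm ℂ (X.H k) (X.H j)).toLinearMap ∈ inverter F C k j := hτ
    refine (lid_map_reverse τ _).symm.trans ((?_ : _ = _).trans
      (congrArg (a.val i) (lid_map_reverse τ x)))
    rw [← lid_map_inverter hL hτ a.val]
    refine congrArg (fun y => TensorProduct.lid ℂ _ (TensorProduct.map _ LinearMap.id y)) ?_
    rw [reverse_iterate_opp, LinearEquiv.symm_apply_eq, assoc_pullback hA,
      LinearEquiv.apply_symm_apply]
  span_left i η := Submodule.span_mono (fun η h => by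
    obtain ⟨j, y, τ, hτ, h⟩ := h
    have e : (τ ∘ₗ (TensorProduct.comm ℂ (X.H i) (X.H j)).toLinearMap) ∘ₗ
        (TensorProduct.comm ℂ (X.H j) (X.H i)).toLinearMap = τ :=
      TensorProduct.ext' fun _ _ => rfl
    exact ⟨j, y, τ ∘ₗ (TensorProduct.comm ℂ (X.H i) (X.H j)).toLinearMap,
      (congrArg (· ∈ inverter F C j i) e).mpr hτ, h⟩) ((leftInverseSentence_iff F.1 C.1).1 hl i η)
  span_right i η := Submodule.span_mono (fun η h => by
    obtain ⟨j, y, τ, hτ, h⟩ := h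
    have e : (τ ∘ₗ (TensorProduct.comm ℂ (X.H j) (X.H i)).toLinearMap) ∘ₗ
        (TensorProduct.comm ℂ (X.H i) (X.H j)).toLinearMap = τ :=
      TensorProduct.ext' fun _ _ => rfl
    exact ⟨j, y, τ ∘ₗ (TensorProduct.comm ℂ (X.H j) (X.H i)).toLinearMap,
      (congrArg (· ∈ inverter F C i j) e).mpr hτ, h⟩) ((rightInverseSentence_iff F.1 C.1).1 hr i η)

end QFun

namespace QSet

variable {X : QSet.{u, v}}

theorem incl_comm (z : X.cc ⊗[ℂ] X.cc) (i j : X.At) (x : X.H i ⊗[ℂ] X.H j) :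
    incl X (TensorProduct.comm ℂ X.cc X.cc z) (i, j) x = TensorProduct.comm ℂ (X.H j) (X.H i)
      (incl X z (j, i) (TensorProduct.comm ℂ (X.H i) (X.H j) x)) := by
  induction z using TensorProduct.induction_on with
  | zero => simp
  | add y z hy hz => simp only [map_add, Pi.add_apply, LinearMap.add_apply, hy, hz]
  | tmul a b =>
    induction x using TensorProduct.induction_on with
    | zero => simp
    | add y z hy hz => simp only [map_add, hy, hz]
    | tmul x y => simp

end QSet

namespace QFun

variable {X : QSet.{u, v}} {F : QFun (X.prod X) X}

/-- With Δ' the comultiplication of the opposite operation, the element b* ⊗ a* is mapped to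
Δ'(b*)(1 ⊗ a*). The involution gives (1 ⊗ a)Δ'(b), and the flip gives (a ⊗ 1)Δ(b). All maps involved
are bijective. -/
theorem exists_galois_equiv_of_opp {T : ∀ i j : X.At, Submodule ℂ (X.H i ⊗[ℂ] X.H j →ₗ[ℂ] ℂ)}
    (h : F.opp.HasInverter T) : ∃ T₂ : X.cc ⊗[ℂ] X.cc →ₗ[ℂ] X.cc ⊗[ℂ] X.cc,
      (∀ a b, QSet.incl X (T₂ (a ⊗ₜ[ℂ] b)) =
        (fun p : X.At × X.At => TensorProduct.map (a.val p.1) LinearMap.id) * F.pullback b.val) ∧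
      Function.Bijective T₂ := by
  obtain ⟨T₁, h₁, hT₁⟩ := h.exists_galois_equiv
  let S : X.cc ⊗[ℂ] X.cc ≃ₗ⋆[ℂ] X.cc ⊗[ℂ] X.cc :=
    (TensorProduct.comm ℂ X.cc X.cc).trans (starLinearEquiv ℂ)
  let S' : X.cc ⊗[ℂ] X.cc ≃ₗ⋆[ℂ] X.cc ⊗[ℂ] X.cc :=
    (starLinearEquiv ℂ).trans (TensorProduct.comm ℂ X.cc X.cc)
  refine ⟨S'.toLinearMap.comp (T₁.comp S.toLinearMap), fun a b => funext fun p => ?_,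
    S'.bijective.comp (hT₁.comp S.bijective)⟩
  obtain ⟨i, j⟩ := p
  refine LinearMap.ext fun x => ?_
  change QSet.incl X (TensorProduct.comm ℂ X.cc X.cc (star (T₁ (star b ⊗ₜ[ℂ] star a)))) (i, j) x = _
  rw [QSet.incl_comm, QSet.incl_star, h₁, galois_tmul, star_mul, QSet.cc.val_star b, map_star,
    star_star]
  have e : star (fun p : X.At × X.At => TensorProduct.map LinearMap.id ((star a : X.cc).val p.2)
      : (X.prod X).Ell) = fun p : X.At × X.At => TensorProduct.map LinearMap.id (a.val p.2) := by
    funext p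
    refine (TensorProduct.adjoint_map _ _).trans ?_
    rw [LinearMap.adjoint_id]
    exact congrArg _ (star_star (a.val p.2))
  rw [e]
  change TensorProduct.comm ℂ (X.H j) (X.H i) (TensorProduct.map LinearMap.id (a.val i)
    (F.opp.pullback b.val (j, i) (TensorProduct.comm ℂ (X.H i) (X.H j) x))) =
      TensorProduct.map (a.val i) LinearMap.id (F.pullback b.val (i, j) x)
  rw [← TensorProduct.map_comm, pullback_opp]
  congr 2
  exact (TensorProduct.comm ℂ (X.H i) (X.H j)).symm_apply_apply x

end QFun

/-! ## The comultiplication of an operation -/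

namespace QSet

variable {X : QSet.{u, v}}

variable (X) in
/-- The inclusion of the threefold tensor product. -/
def incl₃ : X.cc ⊗[ℂ] (X.cc ⊗[ℂ] X.cc) →ₗ[ℂ] (X.prod (X.prod X)).Ell := inclOf (incl X)

theorem incl₃_injective : Function.Injective (incl₃ X) := inclOf_injective incl_injective

theorem incl₃_tmul (a : X.cc) (y : X.cc ⊗[ℂ] X.cc) (i j k : X.At) :
    incl₃ X (a ⊗ₜ[ℂ] y) (i, (j, k)) = TensorProduct.map (a.val i) (incl X y (j, k)) := rfl

theorem incl₃_assoc (y : X.cc ⊗[ℂ] X.cc) (q : X.cc) (i j k : X.At)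
    (w : (X.H i ⊗[ℂ] X.H j) ⊗[ℂ] X.H k) :
    incl₃ X (TensorProduct.assoc ℂ X.cc X.cc X.cc (y ⊗ₜ[ℂ] q)) (i, (j, k))
        (TensorProduct.assoc ℂ _ _ _ w) =
      TensorProduct.assoc ℂ _ _ _ (TensorProduct.map (incl X y (i, j)) (q.val k) w) := by
  induction y using TensorProduct.induction_on with
  | zero => simp
  | add y z hy hz =>
    simp only [TensorProduct.add_tmul, map_add, Pi.add_apply, LinearMap.add_apply,
      TensorProduct.map_add_left, hy, hz]
  | tmul a b =>
    rw [TensorProduct.assoc_tmul, incl₃_tmul, incl_tmul, incl_tmul]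
    exact TensorProduct.map_map_assoc _ _ _ w

end QSet

namespace QFun

variable {X : QSet.{u, v}} (F : QFun (X.prod X) X)

/-- The comultiplication `F⋆|c_c(X)`. -/
def comult : Comult X.cc where
  toFun a := QSet.ofEll (F.pullback a.val)
  map_smul' c a := (QSet.isMultiplicationBy_ofEll _).mult_ext <| by
    rw [QSet.cc.val_smul, map_smul]
    exact (QSet.isMultiplicationBy_ofEll _).smul c
  map_zero' := (QSet.isMultiplicationBy_ofEll _).mult_ext <| by
    rw [QSet.cc.val_zero, map_zero]
    exact fun z => ⟨by simp [Mult.left], by simp [Mult.right]⟩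
  map_add' a b := (QSet.isMultiplicationBy_ofEll _).mult_ext <| by
    rw [QSet.cc.val_add, map_add]
    exact (QSet.isMultiplicationBy_ofEll _).add (QSet.isMultiplicationBy_ofEll _)
  map_mul' a b := (QSet.isMultiplicationBy_ofEll _).mult_ext <| by
    rw [QSet.cc.val_mul, map_mul]
    exact (QSet.isMultiplicationBy_ofEll _).mul (QSet.isMultiplicationBy_ofEll _)
  map_star' a := (QSet.isMultiplicationBy_ofEll _).mult_ext <| by
    rw [QSet.cc.val_star, map_star]
    exact (QSet.isMultiplicationBy_ofEll _).star

theorem isRestriction_comult : QSet.IsRestriction F.comult F := fun _ =>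
  QSet.isMultiplicationBy_ofEll _

variable {F} {Δ : Comult X.cc} {T₁ T₂ : X.cc ⊗[ℂ] X.cc →ₗ[ℂ] X.cc ⊗[ℂ] X.cc}

theorem of_eq_mul_one_tensor_iff (hΔ : QSet.IsRestriction Δ F) {z : X.cc ⊗[ℂ] X.cc} {a b : X.cc} :
    Mult.of z = Δ a * Mult.tensor 1 (Mult.of b) ↔ QSet.incl X z =
      F.pullback a.val * fun p : X.At × X.At => TensorProduct.map LinearMap.id (b.val p.2) :=
  ((hΔ a).mul (QSet.IsMultiplicationBy.one_tensor_of b)).of_eq_iff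

theorem of_eq_tensor_one_mul_iff (hΔ : QSet.IsRestriction Δ F) {z : X.cc ⊗[ℂ] X.cc} {a b : X.cc} :
    Mult.of z = Mult.tensor (Mult.of a) 1 * Δ b ↔ QSet.incl X z =
      (fun p : X.At × X.At => TensorProduct.map (a.val p.1) LinearMap.id) * F.pullback b.val :=
  ((QSet.IsMultiplicationBy.of_tensor_one a).mul (hΔ b)).of_eq_iff

theorem incl₃_assoc_map (h₂ : ∀ a b, QSet.incl X (T₂ (a ⊗ₜ[ℂ] b)) =
      (fun p : X.At × X.At => TensorProduct.map (a.val p.1) LinearMap.id) * F.pullback b.val)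
    (a : X.cc) (z : X.cc ⊗[ℂ] X.cc) (i j k : X.At) (w : (X.H i ⊗[ℂ] X.H j) ⊗[ℂ] X.H k) :
    QSet.incl₃ X (TensorProduct.assoc ℂ X.cc X.cc X.cc
        (TensorProduct.map (T₂ ∘ₗ TensorProduct.mk ℂ X.cc X.cc a) LinearMap.id z)) (i, (j, k))
        (TensorProduct.assoc ℂ _ _ _ w) =
      TensorProduct.map (a.val i) LinearMap.id (TensorProduct.assoc ℂ _ _ _
        ((F.prod (id X)).pullback (QSet.incl X z) ((i, j), k) w)) := by
  induction z using TensorProduct.induction_on with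
  | zero => simp
  | add y z hy hz =>
    simp only [map_add, Pi.add_apply, LinearMap.add_apply, hy, hz]
  | tmul p q =>
    have h := pullback_prod F (id X) p.val q.val ((i, j), k)
    rw [pullback_id] at h
    refine (QSet.incl₃_assoc (T₂ (a ⊗ₜ[ℂ] p)) q i j k w).trans ?_
    rw [h₂, Pi.mul_apply]
    refine Eq.trans ?_ (congrArg (fun f => TensorProduct.map (a.val i) LinearMap.id
      (TensorProduct.assoc ℂ _ _ _ (f w))) h.symm)
    have e := TensorProduct.map_map_assoc (a.val i) (LinearMap.id (R := ℂ) (M := X.H j))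
      (LinearMap.id (R := ℂ) (M := X.H k)) (TensorProduct.map (F.pullback p.val (i, j)) (q.val k) w)
    rw [TensorProduct.map_id] at e
    refine Eq.trans (congrArg (TensorProduct.assoc ℂ _ _ _) ?_) e.symm
    rw [← LinearMap.comp_apply (TensorProduct.map _ _), ← TensorProduct.map_comp,
      LinearMap.id_comp]
    rfl

theorem incl₃_map (h₁ : ∀ a b, QSet.incl X (T₁ (a ⊗ₜ[ℂ] b)) =
      F.pullback a.val * fun p : X.At × X.At => TensorProduct.map LinearMap.id (b.val p.2))
    (c : X.cc) (z : X.cc ⊗[ℂ] X.cc) (i j k : X.At) (w : X.H i ⊗[ℂ] (X.H j ⊗[ℂ] X.H k)) :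
    QSet.incl₃ X (TensorProduct.map LinearMap.id (T₁ ∘ₗ (TensorProduct.mk ℂ X.cc X.cc).flip c) z)
        (i, (j, k)) w =
      ((id X).prod F).pullback (QSet.incl X z) (i, (j, k))
        (TensorProduct.map LinearMap.id (TensorProduct.map LinearMap.id (c.val k)) w) := by
  induction z using TensorProduct.induction_on with
  | zero => simp
  | add y z hy hz =>
    simp only [map_add, Pi.add_apply, LinearMap.add_apply, hy, hz]
  | tmul p q =>
    have h := pullback_prod (id X) F p.val q.val (i, (j, k))
    rw [pullback_id] at h
    refine Eq.trans ?_ (congrArg (fun f => f (TensorProduct.map LinearMap.id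
      (TensorProduct.map LinearMap.id (c.val k)) w)) h.symm)
    change TensorProduct.map (p.val i) (QSet.incl X (T₁ (q ⊗ₜ[ℂ] c)) (j, k)) w = _
    rw [h₁, Pi.mul_apply, ← LinearMap.comp_apply (TensorProduct.map _ _), ← TensorProduct.map_comp,
      LinearMap.comp_id]
    rfl

theorem incl₃_coassoc_left (h₁ : ∀ a b, QSet.incl X (T₁ (a ⊗ₜ[ℂ] b)) =
      F.pullback a.val * fun p : X.At × X.At => TensorProduct.map LinearMap.id (b.val p.2))
    (h₂ : ∀ a b, QSet.incl X (T₂ (a ⊗ₜ[ℂ] b)) =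
      (fun p : X.At × X.At => TensorProduct.map (a.val p.1) LinearMap.id) * F.pullback b.val)
    (a b c : X.cc) (i j k : X.At) (w : (X.H i ⊗[ℂ] X.H j) ⊗[ℂ] X.H k) :
    QSet.incl₃ X (TensorProduct.assoc ℂ X.cc X.cc X.cc (TensorProduct.map
        (T₂ ∘ₗ TensorProduct.mk ℂ X.cc X.cc a) LinearMap.id (T₁ (b ⊗ₜ[ℂ] c)))) (i, (j, k))
        (TensorProduct.assoc ℂ _ _ _ w) =
      TensorProduct.map (a.val i) LinearMap.id (TensorProduct.assoc ℂ _ _ _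
        (F.iterate b ((i, j), k) (TensorProduct.map LinearMap.id (c.val k) w))) := by
  rw [incl₃_assoc_map h₂, h₁, ← galois_tmul, pullback_galois]
  rfl

theorem incl₃_coassoc_right (h₁ : ∀ a b, QSet.incl X (T₁ (a ⊗ₜ[ℂ] b)) =
      F.pullback a.val * fun p : X.At × X.At => TensorProduct.map LinearMap.id (b.val p.2))
    (h₂ : ∀ a b, QSet.incl X (T₂ (a ⊗ₜ[ℂ] b)) =
      (fun p : X.At × X.At => TensorProduct.map (a.val p.1) LinearMap.id) * F.pullback b.val)
    (a b c : X.cc) (i j k : X.At) (w : (X.H i ⊗[ℂ] X.H j) ⊗[ℂ] X.H k) :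
    QSet.incl₃ X (TensorProduct.map LinearMap.id
        (T₁ ∘ₗ (TensorProduct.mk ℂ X.cc X.cc).flip c) (T₂ (a ⊗ₜ[ℂ] b))) (i, (j, k))
        (TensorProduct.assoc ℂ _ _ _ w) =
      TensorProduct.map (a.val i) LinearMap.id (((id X).prod F).pullback (F.pullback b.val)
        (i, (j, k)) (TensorProduct.assoc ℂ _ _ _ (TensorProduct.map LinearMap.id (c.val k) w))) := by
  have e := TensorProduct.map_map_assoc (LinearMap.id (R := ℂ) (M := X.H i)) (LinearMap.id (R := ℂ) (M := X.H j))
    (c.val k) w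
  rw [TensorProduct.map_id] at e
  rw [incl₃_map h₁, h₂, map_mul, e]
  have h := pullback_prod (id X) F a.val 1 (i, (j, k))
  rw [pullback_id, map_one] at h
  exact LinearMap.congr_fun h _

/-- Inside ℓ of the triple product, both sides are the iterated comultiplication of b, multiplied by
a on the first leg from the left and by c on the third leg from the right. `assoc_pullback`
identifies the two iterations. -/
theorem coassoc (h₁ : ∀ a b, QSet.incl X (T₁ (a ⊗ₜ[ℂ] b)) =
      F.pullback a.val * fun p : X.At × X.At => TensorProduct.map LinearMap.id (b.val p.2))
    (h₂ : ∀ a b, QSet.incl X (T₂ (a ⊗ₜ[ℂ] b)) =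
      (fun p : X.At × X.At => TensorProduct.map (a.val p.1) LinearMap.id) * F.pullback b.val)
    (hA : F.comp (F.prod (id X)) = (F.comp ((id X).prod F)).comp (assoc X X X)) (a b c : X.cc) :
    TensorProduct.assoc ℂ X.cc X.cc X.cc (TensorProduct.map
        (T₂ ∘ₗ TensorProduct.mk ℂ X.cc X.cc a) LinearMap.id (T₁ (b ⊗ₜ[ℂ] c))) =
      TensorProduct.map LinearMap.id
        (T₁ ∘ₗ (TensorProduct.mk ℂ X.cc X.cc).flip c) (T₂ (a ⊗ₜ[ℂ] b)) := by
  refine QSet.incl₃_injective (funext fun p => LinearMap.ext fun w => ?_)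
  obtain ⟨i, j, k⟩ := p
  obtain ⟨w, rfl⟩ := (TensorProduct.assoc ℂ (X.H i) (X.H j) (X.H k)).surjective w
  rw [incl₃_coassoc_left h₁ h₂, incl₃_coassoc_right h₁ h₂]
  exact congrArg _ (assoc_pullback hA b.val i j k _)

/-- At the atoms i, j, k, the coassociativity equation is used with a and c the units of i and k, so
that both factors disappear and the iterated comultiplications themselves are compared. -/
theorem assoc_of_coassoc (h₁ : ∀ a b, QSet.incl X (T₁ (a ⊗ₜ[ℂ] b)) =
      F.pullback a.val * fun p : X.At × X.At => TensorProduct.map LinearMap.id (b.val p.2))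
    (h₂ : ∀ a b, QSet.incl X (T₂ (a ⊗ₜ[ℂ] b)) =
      (fun p : X.At × X.At => TensorProduct.map (a.val p.1) LinearMap.id) * F.pullback b.val)
    (h : ∀ a b c : X.cc, TensorProduct.assoc ℂ X.cc X.cc X.cc (TensorProduct.map
        (T₂ ∘ₗ TensorProduct.mk ℂ X.cc X.cc a) LinearMap.id (T₁ (b ⊗ₜ[ℂ] c))) =
      TensorProduct.map LinearMap.id
        (T₁ ∘ₗ (TensorProduct.mk ℂ X.cc X.cc).flip c) (T₂ (a ⊗ₜ[ℂ] b))) :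
    F.comp (F.prod (id X)) = (F.comp ((id X).prod F)).comp (assoc X X X) := by
  refine ext_of_pullback fun b p => LinearMap.ext fun w => ?_
  obtain ⟨⟨i, j⟩, k⟩ := p
  rw [pullback_comp, pullback_comp, pullback_comp]
  refine (TensorProduct.assoc ℂ (X.H i) (X.H j) (X.H k)).injective ?_
  refine Eq.trans ?_ (pullback_ofUnitary (X := (X.prod X).prod X) (Y := X.prod (X.prod X))
    (fun p => (p.1.1, (p.1.2, p.2)))
    (fun p => TensorProduct.assocIsometry ℂ (X.H p.1.1) (X.H p.1.2) (X.H p.2)) _ ((i, j), k) w).symm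
  have e := congrArg (fun z => QSet.incl₃ X z (i, (j, k)) (TensorProduct.assoc ℂ _ _ _ w))
    (h (X.single i LinearMap.id) b (X.single k LinearMap.id))
  dsimp only at e
  rw [incl₃_coassoc_left h₁ h₂, incl₃_coassoc_right h₁ h₂, QSet.single_val_same,
    QSet.single_val_same, TensorProduct.map_id, TensorProduct.map_id] at e
  exact e

variable {C : QFun QSet.one X}

theorem isDiscreteQuantumGroup_comult
    (hA : F.comp (F.prod (id X)) = (F.comp ((id X).prod F)).comp (assoc X X X))
    (hL : F.comp (C.prod (id X)) = lunit X) (hR : F.comp ((id X).prod C) = runit X)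
    (hr : (rightInverseSentence F.1 C.1).IsTrue) (hl : (leftInverseSentence F.1 C.1).IsTrue) :
    QSet.IsDiscreteQuantumGroup F.comult := by
  obtain ⟨T₁, h₁, hT₁⟩ := (hasInverter_inverter hA hR hr hl).exists_galois_equiv
  obtain ⟨T₂, h₂, hT₂⟩ := exists_galois_equiv_of_opp (hasInverter_opp hA hL hr hl)
  exact ⟨T₁, T₂, fun a b => (of_eq_mul_one_tensor_iff F.isRestriction_comult).2 (h₁ _),
    fun a b => (of_eq_tensor_one_mul_iff F.isRestriction_comult).2 (h₂ a b),
    coassoc (fun a b => h₁ _) h₂ hA, hT₁, hT₂⟩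

end QFun

/-! ## Functions from `*`-homomorphisms -/

namespace QFun

variable {X : QSet.{u, v}} {Y : QSet.{u', v'}}

/-- The operators that intertwine a `*`-homomorphism. -/
def homRel (D : Y.cc →⋆ₙₐ[ℂ] X.Ell) : BinRel X Y := fun i k =>
  { carrier := {t | ∀ b : Y.cc, b.val k ∘ₗ t = t ∘ₗ D b i}
    add_mem' := fun hs ht b => by rw [LinearMap.comp_add, LinearMap.add_comp, hs b, ht b]
    zero_mem' := fun b => by simp
    smul_mem' := fun c t ht b => by rw [LinearMap.comp_smul, LinearMap.smul_comp, ht b] }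

variable (D : Y.cc →⋆ₙₐ[ℂ] X.Ell)

/-- The operator `t` with `⟨y, t x⟩ = ⟨w, D(|f⟩⟨y|) x⟩`. -/
def homOperator {i : X.At} {k : Y.At} (f : Y.H k) (w : X.H i) : X.H i →ₗ[ℂ] Y.H k :=
  ∑ m, (innerₛₗ ℂ w ∘ₗ D (Y.single k (ketBra f (stdOrthonormalBasis ℂ (Y.H k) m))) i).smulRight
    (stdOrthonormalBasis ℂ (Y.H k) m)

theorem homOperator_apply {i : X.At} {k : Y.At} (f : Y.H k) (w x : X.H i) : homOperator D f w x =
    ∑ m, (inner ℂ w (D (Y.single k (ketBra f (stdOrthonormalBasis ℂ (Y.H k) m))) i x) : ℂ) •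
      stdOrthonormalBasis ℂ (Y.H k) m := by
  simp [homOperator]

theorem sum_inner_smul_ketBra {H K : Type*} [NormedAddCommGroup H] [InnerProductSpace ℂ H]
    [NormedAddCommGroup K] [InnerProductSpace ℂ K] [FiniteDimensional ℂ K] (f : H) (y : K) :
    ∑ m, (inner ℂ y (stdOrthonormalBasis ℂ K m) : ℂ) • ketBra f (stdOrthonormalBasis ℂ K m) =
      ketBra f y := by
  ext x
  simp only [LinearMap.sum_apply, LinearMap.smul_apply, ketBra_apply, smul_smul]
  rw [← Finset.sum_smul, OrthonormalBasis.sum_inner_mul_inner]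

theorem inner_homOperator {i : X.At} {k : Y.At} (f y : Y.H k) (w x : X.H i) :
    inner ℂ y (homOperator D f w x) = inner ℂ w (D (Y.single k (ketBra f y)) i x) := by
  rw [homOperator_apply, inner_sum, ← sum_inner_smul_ketBra f y, map_sum, map_sum,
    Finset.sum_apply, LinearMap.sum_apply, inner_sum]
  refine Finset.sum_congr rfl fun m _ => ?_
  rw [map_smul, map_smul, Pi.smul_apply, LinearMap.smul_apply, inner_smul_right, inner_smul_right,
    mul_comm]

/-- Intertwining follows from |f⟩⟨b†y| = |f⟩⟨y| b and the multiplicativity of `D`. -/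
theorem homOperator_mem {i : X.At} {k : Y.At} (f : Y.H k) (w : X.H i) :
    homOperator D f w ∈ homRel D i k := fun b => LinearMap.ext fun x => by
  refine ext_inner_left ℂ fun y => ?_
  rw [LinearMap.comp_apply, LinearMap.comp_apply, ← LinearMap.adjoint_inner_left, inner_homOperator,
    inner_homOperator, ← LinearMap.comp_apply]
  have e : Y.single k (ketBra f (LinearMap.adjoint (b.val k) y)) = Y.single k (ketBra f y) * b := by
    rw [QSet.single_mul]
    congr 1
    ext z
    simp [LinearMap.adjoint_inner_left]
  rw [e, map_mul]
  rfl

/-- Summing over the basis vectors w = eₙ removes w and leaves Σ D(|f⟩⟨eₘ|)†D(|f⟩⟨eₘ|), which is D(Σ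
|eₘ⟩⟨eₘ|) because f is a unit vector. -/
theorem sum_adjoint_homOperator {i : X.At} {k : Y.At} {f : Y.H k} (hf : ‖f‖ = 1) :
    ∑ n, LinearMap.adjoint (homOperator D f (stdOrthonormalBasis ℂ (X.H i) n)) ∘ₗ
      homOperator D f (stdOrthonormalBasis ℂ (X.H i) n) = D (Y.single k LinearMap.id) i := by
  have hid : Y.single k LinearMap.id = ∑ m,
      star (Y.single k (ketBra f (stdOrthonormalBasis ℂ (Y.H k) m))) *
        Y.single k (ketBra f (stdOrthonormalBasis ℂ (Y.H k) m)) := by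
    rw [← (Finset.sum_congr rfl fun m _ => ?_ :
      ∑ m, Y.single k (ketBra (stdOrthonormalBasis ℂ (Y.H k) m) (stdOrthonormalBasis ℂ (Y.H k) m)) = _),
      ← map_sum]
    · congr 1
      ext x
      simp only [LinearMap.id_apply, LinearMap.sum_apply, ketBra_apply]
      exact ((stdOrthonormalBasis ℂ (Y.H k)).sum_repr' x).symm
    · rw [QSet.single_star, QSet.single_mul, QSet.single_val_same]
      congr 1
      ext x
      refine ext_inner_left ℂ fun y => ?_
      rw [LinearMap.comp_apply, LinearMap.adjoint_inner_right]
      simp only [ketBra_apply, inner_smul_left, inner_smul_right, inner_self_eq_norm_sq_to_K, hf,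
        inner_conj_symm]
      simp [mul_comm]
  ext x
  refine ext_inner_left ℂ fun y => ?_
  rw [LinearMap.sum_apply, inner_sum, hid, map_sum, Finset.sum_apply, LinearMap.sum_apply, inner_sum]
  have h₁ : ∀ n, inner ℂ y ((LinearMap.adjoint (homOperator D f (stdOrthonormalBasis ℂ (X.H i) n)) ∘ₗ
      homOperator D f (stdOrthonormalBasis ℂ (X.H i) n)) x) = ∑ m,
        inner ℂ (D (Y.single k (ketBra f (stdOrthonormalBasis ℂ (Y.H k) m))) i y)
          (stdOrthonormalBasis ℂ (X.H i) n) *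
        inner ℂ (stdOrthonormalBasis ℂ (X.H i) n)
          (D (Y.single k (ketBra f (stdOrthonormalBasis ℂ (Y.H k) m))) i x) := fun n => by
    rw [LinearMap.comp_apply, LinearMap.adjoint_inner_right,
      ← OrthonormalBasis.sum_inner_mul_inner (stdOrthonormalBasis ℂ (Y.H k))]
    refine Finset.sum_congr rfl fun m _ => ?_
    rw [inner_homOperator, ← inner_conj_symm, inner_homOperator, inner_conj_symm]
  rw [Finset.sum_congr rfl fun n _ => h₁ n, Finset.sum_comm]
  refine Finset.sum_congr rfl fun m _ => ?_
  rw [OrthonormalBasis.sum_inner_mul_inner, map_mul, map_star]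
  exact (LinearMap.adjoint_inner_right _ _ _).symm

/-- Univalence is Schur's lemma: s t† commutes with c_c(Y). Totality writes the identity, which lies
in the image of `D` at each atom, as a finite sum of operators t†t with t an intertwiner. -/
theorem isFunction_homRel (hD : ∀ i, ∃ b, D b i = 1) : (homRel D).IsFunction := by
  refine BinRel.IsFunction.mk' (fun i => ?_) fun i j k s hs t ht => ?_
  · obtain ⟨b, hb⟩ := hD i
    obtain ⟨S, hS⟩ := b.exists_finset
    -- The indicator of the support of b is a left unit for b, so it is mapped to the identity as
    -- well.
    have h : D (QSet.indicator S) i = 1 := by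
      have := congrArg (fun c => D c i) (QSet.indicator_mul hS)
      simp only [map_mul, Pi.mul_apply, hb, mul_one] at this
      exact this
    change (1 : X.H i →ₗ[ℂ] X.H i) ∈ _
    rw [← h, QSet.indicator, map_sum, Finset.sum_apply]
    refine sum_mem fun k _ => ?_
    obtain ⟨f, hf⟩ := exists_norm_eq (Y.H k) zero_le_one
    rw [← sum_adjoint_homOperator D hf]
    exact sum_mem fun n _ => BinRel.comp_mem_comp
      (BinRel.adjoint_mem_dagger (homOperator_mem D _ _)) (homOperator_mem D _ _)
  · refine BinRel.mem_id_of_comm fun b => ?_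
    have h := congrArg LinearMap.adjoint (ht (star b))
    rw [map_star, LinearMap.adjoint_comp, LinearMap.adjoint_comp] at h
    have e₁ : LinearMap.adjoint ((star b : Y.cc).val k) = b.val k := star_star (b.val k)
    have e₂ : LinearMap.adjoint ((star (D b)) i) = D b i := star_star (D b i)
    rw [e₁, e₂] at h
    rw [LinearMap.comp_assoc, h, ← LinearMap.comp_assoc, ← hs b, LinearMap.comp_assoc]

/-- The function dual to a nondegenerate `*`-homomorphism. -/
def ofHom (hD : ∀ i, ∃ b, D b i = 1) : QFun X Y := ⟨homRel D, isFunction_homRel D hD⟩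

theorem pullback_ofHom (hD : ∀ i, ∃ b, D b i = 1) (b : Y.cc) : (ofHom D hD).pullback b.val = D b :=
  (ofHom D hD).pullback_eq _ _ fun _ _ _ ht => ht b

end QFun

/-! ## The counit of a discrete quantum group -/

namespace QSet

variable {X : QSet.{u, v}}

theorem incl_map_mulLeft_left (c : X.cc) (z : X.cc ⊗[ℂ] X.cc) :
    incl X (TensorProduct.map (LinearMap.mulLeft ℂ c) LinearMap.id z) =
      (fun p : X.At × X.At => TensorProduct.map (c.val p.1) LinearMap.id) * incl X z :=
  (IsMultiplicationBy.of_tensor_one c z).1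

theorem incl_map_mulLeft_right (c : X.cc) (z : X.cc ⊗[ℂ] X.cc) :
    incl X (TensorProduct.map LinearMap.id (LinearMap.mulLeft ℂ c) z) =
      (fun p : X.At × X.At => TensorProduct.map LinearMap.id (c.val p.2)) * incl X z :=
  (IsMultiplicationBy.one_tensor_of c z).1

theorem incl_map_mulRight_right (c : X.cc) (z : X.cc ⊗[ℂ] X.cc) :
    incl X (TensorProduct.map LinearMap.id (LinearMap.mulRight ℂ c) z) =
      incl X z * fun p : X.At × X.At => TensorProduct.map LinearMap.id (c.val p.2) :=
  (IsMultiplicationBy.one_tensor_of c z).2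

theorem exists_functional [Nonempty X.At] : ∃ (a : X.cc) (φ : X.cc →ₗ[ℂ] ℂ), φ a = 1 := by
  obtain ⟨i⟩ := ‹Nonempty X.At›
  obtain ⟨x, hx⟩ := exists_norm_eq (X.H i) zero_le_one
  exact ⟨X.single i LinearMap.id, X.coeff i x x, by simp [inner_self_eq_norm_sq_to_K, hx]⟩

end QSet

theorem map_id_comp_mk_flip {A B : Type*} [AddCommGroup A] [Module ℂ A] [AddCommGroup B] [Module ℂ B]
    (f : A ⊗[ℂ] A →ₗ[ℂ] B) (q : A) (y : A ⊗[ℂ] A) :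
    TensorProduct.map LinearMap.id (f ∘ₗ (TensorProduct.mk ℂ A A).flip q) y =
      TensorProduct.map LinearMap.id f (TensorProduct.assoc ℂ A A A (y ⊗ₜ[ℂ] q)) := by
  induction y using TensorProduct.induction_on with
  | zero => simp
  | add y z hy hz => simp only [map_add, TensorProduct.add_tmul, hy, hz]
  | tmul a b => simp

namespace QFun

variable {X : QSet.{u, v}}

/-- The maps `T₁(a ⊗ b) = F⋆(a)(1 ⊗ b)` and `T₂(a ⊗ b) = (a ⊗ 1)F⋆(b)` are bijections
of `c_c(X) ⊙ c_c(X)`, and `F⋆` is coassociative. -/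
structure IsHopf (F : QFun (X.prod X) X) (T₁ T₂ : X.cc ⊗[ℂ] X.cc →ₗ[ℂ] X.cc ⊗[ℂ] X.cc) : Prop where
  incl_left : ∀ a b, QSet.incl X (T₁ (a ⊗ₜ[ℂ] b)) =
    F.pullback a.val * fun p : X.At × X.At => TensorProduct.map LinearMap.id (b.val p.2)
  incl_right : ∀ a b, QSet.incl X (T₂ (a ⊗ₜ[ℂ] b)) =
    (fun p : X.At × X.At => TensorProduct.map (a.val p.1) LinearMap.id) * F.pullback b.val
  coassoc : ∀ a b c : X.cc, TensorProduct.assoc ℂ X.cc X.cc X.cc (TensorProduct.map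
      (T₂ ∘ₗ TensorProduct.mk ℂ X.cc X.cc a) LinearMap.id (T₁ (b ⊗ₜ[ℂ] c))) =
    TensorProduct.map LinearMap.id
      (T₁ ∘ₗ (TensorProduct.mk ℂ X.cc X.cc).flip c) (T₂ (a ⊗ₜ[ℂ] b))
  bijective_left : Function.Bijective T₁
  bijective_right : Function.Bijective T₂

namespace IsHopf

variable {F : QFun (X.prod X) X} {T₁ T₂ : X.cc ⊗[ℂ] X.cc →ₗ[ℂ] X.cc ⊗[ℂ] X.cc}

/-- On p ⊗ q both sides are (c ⊗ 1)Δ(p)(1 ⊗ q). -/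
theorem map_mul_assoc (h : F.IsHopf T₁ T₂) (c : X.cc) (z : X.cc ⊗[ℂ] X.cc) :
    TensorProduct.map LinearMap.id (LinearMap.mul' ℂ X.cc) (TensorProduct.assoc ℂ X.cc X.cc X.cc
        (TensorProduct.map (T₂ ∘ₗ TensorProduct.mk ℂ X.cc X.cc c) LinearMap.id z)) =
      TensorProduct.map (LinearMap.mulLeft ℂ c) LinearMap.id (T₁ z) := by
  induction z using TensorProduct.induction_on with
  | zero => simp
  | add y z hy hz => simp only [map_add, hy, hz]
  | tmul p q =>
    rw [TensorProduct.map_tmul, LinearMap.id_apply, ← map_id_comp_mk_flip]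
    have e : LinearMap.mul' ℂ X.cc ∘ₗ (TensorProduct.mk ℂ X.cc X.cc).flip q =
      LinearMap.mulRight ℂ q := LinearMap.ext fun _ => rfl
    rw [e]
    refine QSet.incl_injective ?_
    rw [QSet.incl_map_mulRight_right, QSet.incl_map_mulLeft_left, h.incl_left]
    exact (congrArg (· * _) (h.incl_right c p)).trans (mul_assoc _ _ _)

/-- Coassociativity in the form (T₂ ⊗ ι)(ι ⊗ T₁) = (ι ⊗ T₁)(T₂ ⊗ ι), with the first argument held at
`c`. -/
theorem map_assoc_comm (h : F.IsHopf T₁ T₂) (c : X.cc) (z : X.cc ⊗[ℂ] X.cc) :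
    TensorProduct.assoc ℂ X.cc X.cc X.cc
        (TensorProduct.map (T₂ ∘ₗ TensorProduct.mk ℂ X.cc X.cc c) LinearMap.id (T₁ z)) =
      TensorProduct.map LinearMap.id T₁ (TensorProduct.assoc ℂ X.cc X.cc X.cc
        (TensorProduct.map (T₂ ∘ₗ TensorProduct.mk ℂ X.cc X.cc c) LinearMap.id z)) := by
  induction z using TensorProduct.induction_on with
  | zero => simp
  | add y z hy hz => simp only [map_add, hy, hz]
  | tmul p q =>
    rw [h.coassoc, map_id_comp_mk_flip]
    rfl

/-- The inverse of `T₁`. -/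
def inverseLeft (h : F.IsHopf T₁ T₂) : X.cc ⊗[ℂ] X.cc →ₗ[ℂ] X.cc ⊗[ℂ] X.cc :=
  (LinearEquiv.ofBijective T₁ h.bijective_left).symm.toLinearMap

/-- The inverse of `T₂`. -/
def inverseRight (h : F.IsHopf T₁ T₂) : X.cc ⊗[ℂ] X.cc →ₗ[ℂ] X.cc ⊗[ℂ] X.cc :=
  (LinearEquiv.ofBijective T₂ h.bijective_right).symm.toLinearMap

theorem inverseLeft_apply (h : F.IsHopf T₁ T₂) (z : X.cc ⊗[ℂ] X.cc) : h.inverseLeft (T₁ z) = z :=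
  (LinearEquiv.ofBijective T₁ h.bijective_left).symm_apply_apply z

theorem inverseRight_apply (h : F.IsHopf T₁ T₂) (z : X.cc ⊗[ℂ] X.cc) : h.inverseRight (T₂ z) = z :=
  (LinearEquiv.ofBijective T₂ h.bijective_right).symm_apply_apply z

/-- Let y = T₂(c ⊗ a) and a ⊗ b = T₁(z). By `map_assoc_comm`, y ⊗ b arises by ι ⊗ T₁ from (T₂ ⊗ ι)(c
⊗ z). Inverting T₁ and multiplying the last two legs gives (c ⊗ 1)T₁(z) = ca ⊗ b, by
`map_mul_assoc`. -/
theorem map_mul_inverse (h : F.IsHopf T₁ T₂) (y : X.cc ⊗[ℂ] X.cc) (b : X.cc) :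
    TensorProduct.map LinearMap.id (LinearMap.mul' ℂ X.cc ∘ₗ h.inverseLeft)
        (TensorProduct.assoc ℂ X.cc X.cc X.cc (y ⊗ₜ[ℂ] b)) =
      (LinearMap.mul' ℂ X.cc ∘ₗ h.inverseRight) y ⊗ₜ[ℂ] b := by
  obtain ⟨z, rfl⟩ := h.bijective_right.2 y
  rw [LinearMap.comp_apply, inverseRight_apply]
  induction z using TensorProduct.induction_on with
  | zero => simp
  | add y z hy hz => simp only [map_add, TensorProduct.add_tmul, hy, hz]
  | tmul c a =>
    obtain ⟨z, hz⟩ := h.bijective_left.2 (a ⊗ₜ[ℂ] b)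
    have h₁ := h.map_assoc_comm c z
    have h₂ := h.map_mul_assoc c z
    have e : LinearMap.mul' ℂ X.cc ∘ₗ h.inverseLeft ∘ₗ T₁ = LinearMap.mul' ℂ X.cc :=
      LinearMap.ext fun z => congrArg _ (h.inverseLeft_apply z)
    rw [hz] at h₁ h₂
    refine (congrArg (TensorProduct.map LinearMap.id (LinearMap.mul' ℂ X.cc ∘ₗ h.inverseLeft))
      h₁).trans (Eq.trans ?_ h₂)
    rw [← LinearMap.comp_apply, ← TensorProduct.map_comp, LinearMap.comp_assoc, e, LinearMap.id_comp]

/-- The left side has p as its first leg and the right side b as its second. This forces the two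
multiplications to be scalar multiples of b and of p, with one scalar depending on q: the counit. -/
theorem tmul_mul_inverse (h : F.IsHopf T₁ T₂) (p q b : X.cc) :
    p ⊗ₜ[ℂ] (LinearMap.mul' ℂ X.cc (h.inverseLeft (q ⊗ₜ[ℂ] b))) =
      LinearMap.mul' ℂ X.cc (h.inverseRight (p ⊗ₜ[ℂ] q)) ⊗ₜ[ℂ] b :=
  h.map_mul_inverse (p ⊗ₜ[ℂ] q) b

theorem right_comult (h : F.IsHopf T₁ T₂) (c a b : X.cc) :
    Mult.right (F.comult b) (T₂ (c ⊗ₜ[ℂ] a)) = T₂ (c ⊗ₜ[ℂ] (a * b)) := by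
  refine QSet.incl_injective ?_
  rw [(F.isRestriction_comult b _).2, h.incl_right, h.incl_right, QSet.cc.val_mul, map_mul, mul_assoc]

theorem right_comult_tmul (h : F.IsHopf T₁ T₂) (p q b : X.cc) :
    Mult.right (F.comult b) (p ⊗ₜ[ℂ] q) =
      TensorProduct.map LinearMap.id (LinearMap.mulLeft ℂ q) (T₂ (p ⊗ₜ[ℂ] b)) := by
  refine QSet.incl_injective ?_
  rw [(F.isRestriction_comult b _).2, QSet.incl_map_mulLeft_right, h.incl_right, ← mul_assoc]
  refine congrArg (· * _) (funext fun p => ?_)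
  exact TensorProduct.map_comp LinearMap.id (q.val _) (_ : X.H _ →ₗ[ℂ] X.H _) LinearMap.id

/-- By surjectivity every a ⊗ p is of the form T₁(z), and then ε(a)p is the product of z, whatever ε
is. -/
theorem eq_of_lid_map [Nonempty X.At] (h : F.IsHopf T₁ T₂) {ε ε' : X.cc →ₗ[ℂ] ℂ}
    (h₁ : ∀ z, TensorProduct.lid ℂ X.cc (TensorProduct.map ε LinearMap.id (T₁ z)) =
      LinearMap.mul' ℂ X.cc z)
    (h₂ : ∀ z, TensorProduct.lid ℂ X.cc (TensorProduct.map ε' LinearMap.id (T₁ z)) =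
      LinearMap.mul' ℂ X.cc z) : ε = ε' := by
  obtain ⟨p, φ, hφ⟩ := QSet.exists_functional (X := X)
  refine LinearMap.ext fun a => ?_
  obtain ⟨z, hz⟩ := h.bijective_left.2 (a ⊗ₜ[ℂ] p)
  have := congrArg φ ((h₁ z).trans (h₂ z).symm)
  rw [hz] at this
  simpa [hφ] using this

/-- Van Daele's construction: slicing `tmul_mul_inverse` defines ε, and inverting T₁ and T₂ gives
the counit identities. Multiplicativity is derived from these with the module property of ι ⊗ ε over
Δ. -/
theorem exists_counit [Nonempty X.At] (h : F.IsHopf T₁ T₂) : ∃ ε : X.cc →ₙₐ[ℂ] ℂ,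
    (∀ z, TensorProduct.lid ℂ X.cc (TensorProduct.map (ε : X.cc →ₗ[ℂ] ℂ) LinearMap.id (T₁ z)) =
      LinearMap.mul' ℂ X.cc z) ∧
    ∀ z, TensorProduct.rid ℂ X.cc (TensorProduct.map LinearMap.id (ε : X.cc →ₗ[ℂ] ℂ) (T₂ z)) =
      LinearMap.mul' ℂ X.cc z := by
  obtain ⟨p₀, φ, hφ⟩ := QSet.exists_functional (X := X)
  -- The identity `tmul_mul_inverse` is read at p = p₀ and sliced by φ, where φ(p₀) = 1.
  let ε : X.cc →ₗ[ℂ] ℂ :=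
    φ ∘ₗ LinearMap.mul' ℂ X.cc ∘ₗ h.inverseRight ∘ₗ TensorProduct.mk ℂ X.cc X.cc p₀
  have hL (q b : X.cc) : LinearMap.mul' ℂ X.cc (h.inverseLeft (q ⊗ₜ[ℂ] b)) = ε q • b := by
    have := congrArg (fun z => TensorProduct.lid ℂ X.cc (TensorProduct.map φ LinearMap.id z))
      (h.tmul_mul_inverse p₀ q b)
    simpa [hφ, ε] using this
  have hR (p q : X.cc) : LinearMap.mul' ℂ X.cc (h.inverseRight (p ⊗ₜ[ℂ] q)) = ε q • p := by
    have := congrArg (fun z => TensorProduct.rid ℂ X.cc (TensorProduct.map LinearMap.id φ z))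
      (h.tmul_mul_inverse p q p₀)
    rw [hL] at this
    simpa [hφ] using this.symm
  have h₁ (z : X.cc ⊗[ℂ] X.cc) : TensorProduct.lid ℂ X.cc (TensorProduct.map ε LinearMap.id z) =
      LinearMap.mul' ℂ X.cc (h.inverseLeft z) := by
    induction z using TensorProduct.induction_on with
    | zero => simp
    | add y z hy hz => simp only [map_add, hy, hz]
    | tmul q b => rw [hL]; rfl
  have h₂ (z : X.cc ⊗[ℂ] X.cc) : TensorProduct.rid ℂ X.cc (TensorProduct.map LinearMap.id ε z) =
      LinearMap.mul' ℂ X.cc (h.inverseRight z) := by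
    induction z using TensorProduct.induction_on with
    | zero => simp
    | add y z hy hz => simp only [map_add, hy, hz]
    | tmul q b => rw [hR]; rfl
  have h₂' (z : X.cc ⊗[ℂ] X.cc) : TensorProduct.rid ℂ X.cc (TensorProduct.map LinearMap.id ε (T₂ z)) =
      LinearMap.mul' ℂ X.cc z := by rw [h₂, inverseRight_apply]
  -- For y = T₂(c ⊗ a), multiplication by Δ(b) from the right yields T₂(c ⊗ ab), and ι ⊗ ε maps this
  -- to cab.
  have hΔ (b : X.cc) (y : X.cc ⊗[ℂ] X.cc) :
      TensorProduct.rid ℂ X.cc (TensorProduct.map LinearMap.id ε (Mult.right (F.comult b) y)) =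
        TensorProduct.rid ℂ X.cc (TensorProduct.map LinearMap.id ε y) * b := by
    obtain ⟨z, rfl⟩ := h.bijective_right.2 y
    rw [h₂']
    induction z using TensorProduct.induction_on with
    | zero => simp [Mult.right]
    | add y z hy hz =>
      have e : Mult.right (F.comult b) (T₂ (y + z)) =
          Mult.right (F.comult b) (T₂ y) + Mult.right (F.comult b) (T₂ z) := by
        rw [map_add]
        exact map_add (F.comult b).1.2.unop _ _
      rw [e, map_add, map_add, hy, hz, map_add, add_mul]
    | tmul c a =>
      rw [h.right_comult, h₂']
      exact (mul_assoc c a b).symm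
  -- For z = T₂(p ⊗ b) one has (1 ⊗ q)z = (p ⊗ q)Δ(b), to which the previous identity applies.
  -- Multiplicativity of ε is the case z = p₀ ⊗ r.
  have hq (q : X.cc) (z : X.cc ⊗[ℂ] X.cc) : TensorProduct.rid ℂ X.cc (TensorProduct.map LinearMap.id ε
      (TensorProduct.map LinearMap.id (LinearMap.mulLeft ℂ q) z)) =
        ε q • TensorProduct.rid ℂ X.cc (TensorProduct.map LinearMap.id ε z) := by
    obtain ⟨z, rfl⟩ := h.bijective_right.2 z
    induction z using TensorProduct.induction_on with
    | zero => simp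
    | add y z hy hz => simp only [map_add, hy, hz, smul_add]
    | tmul p b =>
      rw [← h.right_comult_tmul, hΔ, h₂']
      exact smul_mul_assoc (ε q) p b
  have hmul (q r : X.cc) : ε (q * r) = ε q * ε r := by
    have := congrArg φ (hq q (p₀ ⊗ₜ[ℂ] r))
    simp only [TensorProduct.map_tmul, LinearMap.id_apply, TensorProduct.rid_tmul, map_smul, hφ,
      smul_eq_mul, mul_one, LinearMap.mulLeft_apply] at this
    exact this
  refine ⟨{ ε with map_mul' := hmul, map_zero' := map_zero ε }, fun z => ?_, fun z => ?_⟩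
  · exact (h₁ (T₁ z)).trans (congrArg _ (h.inverseLeft_apply z))
  · exact h₂' z

end IsHopf

end QFun

-- Characters of c_c(X), and comultiplications as duals of functions

namespace QSet

variable {X : QSet.{u, v}}

theorem character_ketBra_mul (ε : X.cc →ₙₐ[ℂ] ℂ) {i : X.At} (x y x' y' : X.H i) :
    ε (X.single i (ketBra x y)) * ε (X.single i (ketBra x' y')) =
      inner ℂ y x' * ε (X.single i (ketBra x y')) := by
  rw [← map_mul, single_mul, single_val_same, ← smul_eq_mul, ← map_smul, ← map_smul]
  congr 2
  ext z
  simp [smul_smul, mul_comm]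

/-- A nonzero value can be cancelled from the product rule for rank-one operators. This expresses
ε(|x'⟩⟨y|) as ⟨y, x'⟩ for all x', and then ε(|y⟩⟨x|) as ⟨x, y⟩. -/
theorem character_ketBra_symm_of_ne (ε : X.cc →ₙₐ[ℂ] ℂ) {i : X.At} {x y : X.H i}
    (h : ε (X.single i (ketBra x y)) ≠ 0) :
    ε (X.single i (ketBra y x)) = conj (ε (X.single i (ketBra x y))) := by
  have hl : ∀ x', ε (X.single i (ketBra x' y)) = inner ℂ y x' := fun x' =>
    mul_left_cancel₀ h ((character_ketBra_mul ε x y x' y).trans (mul_comm _ _))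
  have hy : ε (X.single i (ketBra y y)) ≠ 0 := by
    rw [hl]
    rintro h0
    exact h (by rw [hl, inner_self_eq_zero.1 h0, inner_zero_left])
  have hr : ε (X.single i (ketBra y x)) = inner ℂ x y :=
    mul_right_cancel₀ hy (character_ketBra_mul ε y x y y)
  rw [hr, hl, inner_conj_symm]

/-- Characters of `c_c(X)` preserve the involution. -/
theorem character_star (ε : X.cc →ₙₐ[ℂ] ℂ) (a : X.cc) : ε (star a) = conj (ε a) := by
  have hketBra (i : X.At) (x y : X.H i) :
      ε (star (X.single i (ketBra x y))) = conj (ε (X.single i (ketBra x y))) := by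
    have e : star (X.single i (ketBra x y)) = X.single i (ketBra y x) := by
      rw [single_star]
      congr 1
      ext z
      refine ext_inner_left ℂ fun w => ?_
      rw [LinearMap.adjoint_inner_right]
      simp [inner_smul_left, inner_smul_right, mul_comm]
    rw [e]
    by_cases h : ε (X.single i (ketBra x y)) = 0
    · rw [h, map_zero]
      by_contra h'
      have := character_ketBra_symm_of_ne ε h'
      rw [h] at this
      exact h' ((map_eq_zero _).1 this.symm)
    · exact character_ketBra_symm_of_ne ε h
  obtain ⟨S, hS⟩ := a.exists_finset
  rw [cc.eq_sum_single a hS, star_sum, map_sum, map_sum, map_sum]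
  refine Finset.sum_congr rfl fun i _ => ?_
  rw [eq_sum_ketBra (a.val i)]
  simp only [map_sum, map_smul, star_sum, star_smul, hketBra, smul_eq_mul, map_mul]
  rfl

/-- Indicators of large finite sets act as local units; the proof asserts this for all larger sets,
so that sums of tensors can be treated. -/
theorem exists_indicator_mul (z : X.cc ⊗[ℂ] X.cc) : ∃ u : X.cc,
    TensorProduct.map (LinearMap.mulLeft ℂ u) LinearMap.id z = z := by
  classical
  suffices h : ∃ S : Finset X.At, ∀ S', S ⊆ S' →
      TensorProduct.map (LinearMap.mulLeft ℂ (indicator (X := X) S')) LinearMap.id z = z by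
    obtain ⟨S, hS⟩ := h
    exact ⟨_, hS S subset_rfl⟩
  induction z using TensorProduct.induction_on with
  | zero => exact ⟨∅, fun _ _ => map_zero _⟩
  | add y z hy hz =>
    obtain ⟨S, hS⟩ := hy
    obtain ⟨T, hT⟩ := hz
    exact ⟨S ∪ T, fun S' h => by
      rw [map_add, hS S' (Finset.union_subset_left h), hT S' (Finset.union_subset_right h)]⟩
  | tmul a b =>
    obtain ⟨S, hS⟩ := a.exists_finset
    refine ⟨S, fun S' h => ?_⟩
    rw [TensorProduct.map_tmul, LinearMap.mulLeft_apply,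
      indicator_mul fun i hi => hS i fun h' => hi (h h'), LinearMap.id_apply]

/-- A comultiplication as a homomorphism to `ℓ(X × X)`. -/
def comultHom (Δ : Comult X.cc) : X.cc →⋆ₙₐ[ℂ] (X.prod X).Ell where
  toFun a := (exists_isMultiplicationBy (Δ a)).choose
  map_smul' c a := (exists_isMultiplicationBy (Δ (c • a))).choose_spec.eq <| by
    rw [map_smul]
    exact (exists_isMultiplicationBy (Δ a)).choose_spec.smul c
  map_zero' := (exists_isMultiplicationBy (Δ 0)).choose_spec.eq <| by
    rw [map_zero]
    exact fun z => ⟨by simp [Mult.left], by simp [Mult.right]⟩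
  map_add' a b := (exists_isMultiplicationBy (Δ (a + b))).choose_spec.eq <| by
    rw [map_add]
    exact (exists_isMultiplicationBy (Δ a)).choose_spec.add
      (exists_isMultiplicationBy (Δ b)).choose_spec
  map_mul' a b := (exists_isMultiplicationBy (Δ (a * b))).choose_spec.eq <| by
    rw [map_mul]
    exact (exists_isMultiplicationBy (Δ a)).choose_spec.mul
      (exists_isMultiplicationBy (Δ b)).choose_spec
  map_star' a := (exists_isMultiplicationBy (Δ (star a))).choose_spec.eq <| by
    rw [map_star]
    exact (exists_isMultiplicationBy (Δ a)).choose_spec.star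

theorem isMultiplicationBy_comultHom (Δ : Comult X.cc) (a : X.cc) :
    IsMultiplicationBy (Δ a) (comultHom Δ a) :=
  (exists_isMultiplicationBy (Δ a)).choose_spec

/-- The unit of the atom p is T₁(z) by surjectivity, and z = (u ⊗ 1)z for a local unit u. Since
T₁((u ⊗ 1)z) = Δ(u)T₁(z), evaluation at p gives Δ(u)(p) = 1. -/
theorem comultHom_nondegenerate (Δ : Comult X.cc) {T₁ : X.cc ⊗[ℂ] X.cc →ₗ[ℂ] X.cc ⊗[ℂ] X.cc}
    (h₁ : ∀ a b, Mult.of (T₁ (a ⊗ₜ[ℂ] b)) = Δ a * Mult.tensor 1 (Mult.of b))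
    (hT : Function.Surjective T₁) (p : (X.prod X).At) : ∃ b, comultHom Δ b p = 1 := by
  have h₁' : ∀ a b, incl X (T₁ (a ⊗ₜ[ℂ] b)) = comultHom Δ a *
      fun p : X.At × X.At => TensorProduct.map LinearMap.id (b.val p.2) := fun a b =>
    ((isMultiplicationBy_comultHom Δ a).mul (IsMultiplicationBy.one_tensor_of b)).of_eq_iff.1 (h₁ a b)
  obtain ⟨z, hz⟩ := hT (X.single p.1 LinearMap.id ⊗ₜ[ℂ] X.single p.2 LinearMap.id)
  obtain ⟨u, hu⟩ := exists_indicator_mul z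
  have key : ∀ z, incl X (T₁ (TensorProduct.map (LinearMap.mulLeft ℂ u) LinearMap.id z)) =
      comultHom Δ u * incl X (T₁ z) := fun z => by
    induction z using TensorProduct.induction_on with
    | zero => simp
    | add y z hy hz => simp only [map_add, hy, hz, mul_add]
    | tmul a b =>
      rw [TensorProduct.map_tmul, LinearMap.mulLeft_apply, LinearMap.id_apply, h₁', h₁', map_mul,
        mul_assoc]
  have e : incl X (T₁ z) p = 1 := by
    rw [hz, incl_tmul, single_val_same, single_val_same, TensorProduct.map_id]
    rfl
  refine ⟨u, ?_⟩
  have := congrFun (key z) p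
  rw [hu, Pi.mul_apply, e, mul_one] at this
  exact this.symm

theorem exists_isRestriction {Δ : Comult X.cc} (hΔ : IsDiscreteQuantumGroup Δ) :
    ∃ F : QFun (X.prod X) X, IsRestriction Δ F ∧ ∃ T₁ T₂, F.IsHopf T₁ T₂ := by
  obtain ⟨T₁, T₂, h₁, h₂, hA, hT₁, hT₂⟩ := hΔ
  have hF := comultHom_nondegenerate Δ h₁ hT₁.2
  have hR : IsRestriction Δ (QFun.ofHom (comultHom Δ) hF) := fun a => by
    rw [QFun.pullback_ofHom]
    exact isMultiplicationBy_comultHom Δ a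
  exact ⟨_, hR, T₁, T₂, fun a b => (QFun.of_eq_mul_one_tensor_iff hR).1 (h₁ a b),
    fun a b => (QFun.of_eq_tensor_one_mul_iff hR).1 (h₂ a b), hA, hT₁, hT₂⟩

end QSet

namespace QFun

variable {X : QSet.{u, v}}

/-- A nonzero character, viewed with values in L(ℂ), is a nondegenerate *-homomorphism thanks to
`character_star`, hence dual to a function from the one-atom quantum set. -/
theorem exists_pullbackScalar_eq (ε : X.cc →ₙₐ[ℂ] ℂ) (hε : ∃ a, ε a ≠ 0) :
    ∃ C : QFun QSet.one X, C.pullbackScalar = ε := by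
  let D : X.cc →⋆ₙₐ[ℂ] QSet.one.Ell :=
    { toFun := fun a _ => ε a • LinearMap.id
      map_smul' := fun c a => by
        funext _
        rw [map_smul, smul_assoc]
        rfl
      map_zero' := by
        funext _
        rw [map_zero, zero_smul]
        rfl
      map_add' := fun a b => by
        funext _
        rw [map_add, add_smul]
        rfl
      map_mul' := fun a b => by
        funext _
        refine LinearMap.ext fun x => ?_
        rw [map_mul, mul_smul]
        rfl
      map_star' := fun a => by
        funext _
        rw [QSet.character_star]
        refine Eq.trans ?_ (LinearMap.adjoint.map_smulₛₗ (ε a) LinearMap.id).symm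
        rw [LinearMap.adjoint_id] }
  have hD : ∀ i, ∃ b, D b i = 1 := fun _ => by
    obtain ⟨a, ha⟩ := hε
    refine ⟨(ε a)⁻¹ • a, ?_⟩
    change ε ((ε a)⁻¹ • a) • LinearMap.id = _
    rw [map_smul, smul_eq_mul, inv_mul_cancel₀ ha, one_smul]
    rfl
  refine ⟨ofHom D hD, NonUnitalAlgHom.ext fun a => ?_⟩
  change (ofHom D hD).pullback a.val () 1 = _
  rw [pullback_ofHom]
  exact mul_one (ε a)

end QFun

-- Unit laws and counits

namespace QFun

variable {X : QSet.{u, v}} {Y : QSet.{u', v'}}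

theorem pullback_scalar (C : QFun QSet.one X) (a : X.cc) (c : ℂ) :
    (C.pullback a.val () : ℂ →ₗ[ℂ] ℂ) c = C.pullbackScalar a * c := by
  have h := (C.pullback a.val () : ℂ →ₗ[ℂ] ℂ).map_smul c 1
  rw [smul_eq_mul, smul_eq_mul, mul_one, mul_comm] at h
  exact h

theorem lid_pullback_incl (C : QFun QSet.one X) (z : X.cc ⊗[ℂ] X.cc) (i : X.At) (x : ℂ ⊗[ℂ] X.H i) :
    TensorProduct.lid ℂ _ ((C.prod (id X)).pullback (QSet.incl X z) ((), i) x) =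
      (TensorProduct.lid ℂ X.cc (TensorProduct.map (C.pullbackScalar : X.cc →ₗ[ℂ] ℂ)
        LinearMap.id z)).val i (TensorProduct.lid ℂ _ x) := by
  induction z using TensorProduct.induction_on with
  | zero => simp
  | add y z hy hz =>
    simp only [map_add, Pi.add_apply, LinearMap.add_apply, QSet.cc.val_add, hy, hz]
  | tmul a b =>
    have h := pullback_prod C (id X) a.val b.val ((), i)
    rw [pullback_id] at h
    refine (congrArg (fun f => TensorProduct.lid ℂ _ (f x)) h).trans ?_
    induction x using TensorProduct.induction_on with
    | zero => simp
    | add y z hy hz => simp only [map_add, hy, hz]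
    | tmul c y =>
      change (C.pullback a.val () : ℂ →ₗ[ℂ] ℂ) c • b.val i y =
        C.pullbackScalar a • b.val i (c • y)
      rw [pullback_scalar, map_smul, smul_smul]

theorem rid_pullback_incl (C : QFun QSet.one X) (z : X.cc ⊗[ℂ] X.cc) (i : X.At) (x : X.H i ⊗[ℂ] ℂ) :
    TensorProduct.rid ℂ _ (((id X).prod C).pullback (QSet.incl X z) (i, ()) x) =
      (TensorProduct.rid ℂ X.cc (TensorProduct.map LinearMap.id
        (C.pullbackScalar : X.cc →ₗ[ℂ] ℂ) z)).val i (TensorProduct.rid ℂ _ x) := by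
  induction z using TensorProduct.induction_on with
  | zero => simp
  | add y z hy hz =>
    simp only [map_add, Pi.add_apply, LinearMap.add_apply, QSet.cc.val_add, hy, hz]
  | tmul a b =>
    have h := pullback_prod (id X) C a.val b.val (i, ())
    rw [pullback_id] at h
    refine (congrArg (fun f => TensorProduct.rid ℂ _ (f x)) h).trans ?_
    induction x using TensorProduct.induction_on with
    | zero => simp
    | add y z hy hz => simp only [map_add, hy, hz]
    | tmul y c =>
      change (C.pullback b.val () : ℂ →ₗ[ℂ] ℂ) c • a.val i y =
        C.pullbackScalar b • a.val i (c • y)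
      rw [pullback_scalar, map_smul, smul_smul]

variable {F : QFun (X.prod X) X} {C : QFun QSet.one X}
  {T₁ T₂ : X.cc ⊗[ℂ] X.cc →ₗ[ℂ] X.cc ⊗[ℂ] X.cc}

theorem pullback_mul_one_tensor (C : QFun QSet.one X) (f : (X.prod X).Ell) (b : X.cc) (i : X.At) :
    (C.prod (id X)).pullback
        (f * fun p : X.At × X.At => TensorProduct.map LinearMap.id (b.val p.2)) ((), i) =
      (C.prod (id X)).pullback f ((), i) ∘ₗ TensorProduct.map LinearMap.id (b.val i) := by
  rw [map_mul]
  refine congrArg ((C.prod (id X)).pullback f ((), i) ∘ₗ ·) ?_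
  refine (pullback_prod C (id X) 1 b.val ((), i)).trans ?_
  rw [map_one, pullback_id]
  rfl

theorem pullback_tensor_one_mul (C : QFun QSet.one X) (f : (X.prod X).Ell) (b : X.cc) (i : X.At) :
    ((id X).prod C).pullback
        ((fun p : X.At × X.At => TensorProduct.map (b.val p.1) LinearMap.id) * f) (i, ()) =
      TensorProduct.map (b.val i) LinearMap.id ∘ₗ ((id X).prod C).pullback f (i, ()) := by
  rw [map_mul]
  refine congrArg (· ∘ₗ ((id X).prod C).pullback f (i, ())) ?_
  refine (pullback_prod (id X) C b.val 1 (i, ())).trans ?_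
  rw [map_one, pullback_id]
  rfl

theorem rid_map_left {H K : Type*} [AddCommGroup H] [Module ℂ H] [AddCommGroup K] [Module ℂ K]
    (f : H →ₗ[ℂ] K) (x : H ⊗[ℂ] ℂ) :
    TensorProduct.rid ℂ K (TensorProduct.map f LinearMap.id x) = f (TensorProduct.rid ℂ H x) := by
  induction x using TensorProduct.induction_on with
  | zero => simp
  | add y z hy hz => simp only [map_add, hy, hz]
  | tmul y c => simp

theorem lid_map_right {H K : Type*} [AddCommGroup H] [Module ℂ H] [AddCommGroup K] [Module ℂ K]
    (f : H →ₗ[ℂ] K) (x : ℂ ⊗[ℂ] H) :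
    TensorProduct.lid ℂ K (TensorProduct.map LinearMap.id f x) = f (TensorProduct.lid ℂ H x) := by
  induction x using TensorProduct.induction_on with
  | zero => simp
  | add y z hy hz => simp only [map_add, hy, hz]
  | tmul y c => simp

/-- The unit laws say that C⋆ ⊗ ι and ι ⊗ C⋆ undo Δ; the factors 1 ⊗ b and a ⊗ 1 pass through the
respective slice. -/
theorem isCounit_pullbackScalar {Δ : Comult X.cc} (hΔ : QSet.IsRestriction Δ F)
    (hL : F.comp (C.prod (id X)) = lunit X) (hR : F.comp ((id X).prod C) = runit X) :
    IsCounit Δ C.pullbackScalar := by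
  refine ⟨fun a b t ht => QSet.cc.ext fun i => ?_, fun a b t ht => QSet.cc.ext fun i => ?_⟩
  · rw [of_eq_mul_one_tensor_iff hΔ] at ht
    refine LinearMap.ext fun y => ?_
    obtain ⟨x, rfl⟩ := (TensorProduct.lid ℂ (X.H i)).surjective y
    rw [← lid_pullback_incl, ht, pullback_mul_one_tensor]
    refine (lid_pullback hL a.val i _).trans ?_
    exact congrArg (a.val i) (lid_map_right (b.val i) x)
  · rw [of_eq_tensor_one_mul_iff hΔ] at ht
    refine LinearMap.ext fun y => ?_
    obtain ⟨x, rfl⟩ := (TensorProduct.rid ℂ (X.H i)).surjective y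
    rw [← rid_pullback_incl, ht, pullback_tensor_one_mul]
    refine (rid_map_left (a.val i) _).trans ?_
    exact congrArg (a.val i) (rid_pullback hR b.val i x)

/-- At the atom i, the counit identity for a and the unit of i compares the pullbacks of a under
both functions, and `ext_of_pullback` applies. -/
theorem comp_prod_id_eq_lunit (h : F.IsHopf T₁ T₂)
    (hε : ∀ z, TensorProduct.lid ℂ X.cc (TensorProduct.map (C.pullbackScalar : X.cc →ₗ[ℂ] ℂ)
      LinearMap.id (T₁ z)) = LinearMap.mul' ℂ X.cc z) : F.comp (C.prod (id X)) = lunit X := by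
  refine ext_of_pullback fun a p => LinearMap.ext fun x => ?_
  obtain ⟨⟨⟩, i⟩ := p
  refine (TensorProduct.lid ℂ (X.H i)).injective ?_
  refine Eq.trans ?_ (pullback_ofUnitary (X := QSet.one.prod X) (Y := X) (fun p => p.2)
    (fun p => TensorProduct.lidIsometry ℂ (X.H p.2)) a.val ((), i) x).symm
  have e := lid_pullback_incl C (T₁ (a ⊗ₜ[ℂ] X.single i LinearMap.id)) i x
  rw [hε, h.incl_left, pullback_mul_one_tensor, QSet.single_val_same, TensorProduct.map_id,
    LinearMap.comp_id] at e
  rw [pullback_comp]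
  refine e.trans ?_
  rw [LinearMap.mul'_apply, QSet.cc.val_mul, Pi.mul_apply, QSet.single_val_same]
  rfl

theorem comp_id_prod_eq_runit (h : F.IsHopf T₁ T₂)
    (hε : ∀ z, TensorProduct.rid ℂ X.cc (TensorProduct.map LinearMap.id
      (C.pullbackScalar : X.cc →ₗ[ℂ] ℂ) (T₂ z)) = LinearMap.mul' ℂ X.cc z) :
    F.comp ((id X).prod C) = runit X := by
  refine ext_of_pullback fun a p => LinearMap.ext fun x => ?_
  obtain ⟨i, ⟨⟩⟩ := p
  refine (TensorProduct.rid ℂ (X.H i)).injective ?_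
  refine Eq.trans ?_ (pullback_ofUnitary (X := X.prod QSet.one) (Y := X) (fun p => p.1)
    (fun p => TensorProduct.ridIsometry ℂ (X.H p.1)) a.val (i, ()) x).symm
  have e := rid_pullback_incl C (T₂ (X.single i LinearMap.id ⊗ₜ[ℂ] a)) i x
  rw [hε, h.incl_right, pullback_tensor_one_mul, QSet.single_val_same, TensorProduct.map_id,
    LinearMap.id_comp] at e
  rw [pullback_comp]
  refine e.trans ?_
  rw [LinearMap.mul'_apply, QSet.cc.val_mul, Pi.mul_apply, QSet.single_val_same]
  rfl

/-- By totality the operators of a function have no common kernel. -/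
theorem eq_zero_of_forall_mem (F : QFun X Y) {i : X.At} {x : X.H i}
    (h : ∀ j, ∀ t ∈ F.1 i j, t x = 0) : x = 0 := by
  have e : ketBra x x = 0 := F.ext_of_comp i fun j t ht => LinearMap.ext fun y => by
    simp [h j t ht]
  have := LinearMap.congr_fun e x
  rw [ketBra_apply, LinearMap.zero_apply, smul_eq_zero] at this
  exact this.elim inner_self_eq_zero.1 fun h => h

theorem exists_mem_ne_zero (F : QFun X Y) (i : X.At) : ∃ j, ∃ t ∈ F.1 i j, t ≠ 0 := by
  obtain ⟨x, hx⟩ := exists_ne (0 : X.H i)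
  by_contra! h
  exact hx (F.eq_zero_of_forall_mem fun j t ht => by rw [h j t ht, LinearMap.zero_apply])

/-- Univalence makes t t† a scalar, which is nonzero if t is. -/
theorem adjoint_injective_of_mem (F : QFun X Y) {i : X.At} {j : Y.At} {t : X.H i →ₗ[ℂ] Y.H j}
    (ht : t ∈ F.1 i j) (hne : t ≠ 0) {y : Y.H j} (hy : LinearMap.adjoint t y = 0) : y = 0 := by
  have key : ∀ c : ℂ, t ∘ₗ LinearMap.adjoint t = c • LinearMap.id → c ≠ 0 → y = 0 := by
    intro c hc h0
    have := LinearMap.congr_fun hc y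
    rw [LinearMap.comp_apply, hy, map_zero, LinearMap.smul_apply, LinearMap.id_apply] at this
    exact (smul_eq_zero.1 this.symm).resolve_left h0
  have hz : t ∘ₗ LinearMap.adjoint t ≠ 0 := fun h0 => hne <| by
    have : LinearMap.adjoint t = 0 := LinearMap.ext fun y => by
      rw [LinearMap.zero_apply, ← inner_self_eq_zero (𝕜 := ℂ), LinearMap.adjoint_inner_left,
        ← LinearMap.comp_apply, h0, LinearMap.zero_apply, inner_zero_right]
    simpa using this
  obtain h0 | ⟨_, c, hc⟩ := ofMap_mem_cases (F.comp_adjoint_mem_id ht ht)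
  · exact absurd h0 hz
  · refine key c hc ?_
    rintro rfl
    exact hz (hc.trans (zero_smul _ _))

end QFun

theorem mem_of_forall_eq_zero {H : Type*} [AddCommGroup H] [Module ℂ H] [FiniteDimensional ℂ H]
    {W : Submodule ℂ (H →ₗ[ℂ] ℂ)} (h : ∀ x, (∀ η ∈ W, η x = 0) → x = 0) (η : H →ₗ[ℂ] ℂ) : η ∈ W := by
  have e : W.dualCoannihilator = ⊥ := (Submodule.eq_bot_iff _).2 fun x hx =>
    h x ((Submodule.mem_dualCoannihilator x).1 hx)
  have := Subspace.dualCoannihilator_dualAnnihilator_eq (W := W)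
  rw [e, Submodule.dualAnnihilator_bot] at this
  rw [← this]
  exact Submodule.mem_top

-- The inverse sentences from injectivity of the Galois maps

namespace QFun

variable {X : QSet.{u, v}} {F : QFun (X.prod X) X} {C : QFun QSet.one X}
  {T₁ T₂ : X.cc ⊗[ℂ] X.cc →ₗ[ℂ] X.cc ⊗[ℂ] X.cc}

/-- The value of the comultiplication at the indicator of an atom of `C` vanishes at all vectors
at which the relation `F(x, y) = C` vanishes. -/
theorem pullback_single_eq_zero {e : X.At} {c : ℂ →ₗ[ℂ] X.H e} (hc : c ∈ C.1 () e) (hne : c ≠ 0)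
    {i j : X.At} {w : X.H i ⊗[ℂ] X.H j}
    (hw : ∀ t ∈ C.1.dagger.comp F.1 (i, j) (), (t : X.H i ⊗[ℂ] X.H j →ₗ[ℂ] ℂ) w = 0) :
    F.pullback (X.single e LinearMap.id).val (i, j) w = 0 := by
  refine F.eq_zero_of_forall_mem (i := (i, j)) fun l s hs => ?_
  have h := LinearMap.congr_fun (F.pullback_spec (X.single e LinearMap.id).val hs) w
  refine h.symm.trans ?_
  by_cases hl : l = e
  · subst hl
    rw [QSet.single_val_same]
    -- For s in F with values in the atom e, the functional c†s lies in C† ∘ F and thus vanishes at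
    -- w; since c† is injective, s(w) = 0.
    exact C.adjoint_injective_of_mem hc hne
      (hw _ (BinRel.comp_mem_comp (BinRel.adjoint_mem_dagger hc) hs))
  · rw [QSet.single_val_of_ne hl]
    rfl

theorem eq_zero_of_ketBra {H : Type*} [NormedAddCommGroup H] [InnerProductSpace ℂ H] {x : H}
    (h : ketBra x x = 0) : x = 0 := by
  have := LinearMap.congr_fun h x
  rw [ketBra_apply, LinearMap.zero_apply, smul_eq_zero] at this
  exact this.elim inner_self_eq_zero.1 fun h => h

theorem exists_functional_single (e : X.At) : ∃ φ : X.cc →ₗ[ℂ] ℂ, φ (X.single e LinearMap.id) = 1 := by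
  obtain ⟨x, hx⟩ := exists_norm_eq (X.H e) zero_le_one
  exact ⟨X.coeff e x x, by simp [inner_self_eq_norm_sq_to_K, hx]⟩

/-- Otherwise some y ≠ 0 is annihilated by all functionals τ(x ⊗ ·). Then Δ(1_e)(x ⊗ y) = 0 for
every x, with e an atom of C, so T₁(1_e ⊗ |y⟩⟨y|) = 0, contrary to injectivity. -/
theorem leftInverse_of_isHopf (h : F.IsHopf T₁ T₂) (C : QFun QSet.one X) :
    (leftInverseSentence F.1 C.1).IsTrue := by
  obtain ⟨e, c, hc, hne⟩ := C.exists_mem_ne_zero ()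
  refine (leftInverseSentence_iff F.1 C.1).2 fun j η => mem_of_forall_eq_zero (fun y hy => ?_) η
  have hz : T₁ (X.single e LinearMap.id ⊗ₜ[ℂ] X.single j (ketBra y y)) = 0 := by
    refine QSet.incl_injective ?_
    rw [h.incl_left, map_zero]
    funext p
    obtain ⟨i, k⟩ := p
    rw [Pi.mul_apply]
    dsimp only
    by_cases hk : k = j
    · subst hk
      rw [QSet.single_val_same]
      refine TensorProduct.ext' fun x z => ?_
      change F.pullback (X.single e LinearMap.id).val (i, k) (x ⊗ₜ[ℂ] ketBra y y z) = 0
      rw [ketBra_apply, TensorProduct.tmul_smul, map_smul]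
      have hw : F.pullback (X.single e LinearMap.id).val (i, k) (x ⊗ₜ[ℂ] y) = 0 :=
        pullback_single_eq_zero hc hne fun t ht =>
          hy ((t : X.H i ⊗[ℂ] X.H k →ₗ[ℂ] ℂ) ∘ₗ TensorProduct.mk ℂ (X.H i) (X.H k) x)
            (Submodule.subset_span ⟨i, x, t, ht, fun _ => rfl⟩)
      rw [hw, smul_zero]
    · rw [QSet.single_val_of_ne hk, TensorProduct.map_zero_right, mul_zero]
      rfl
  have hz' := h.bijective_left.1 (hz.trans (map_zero T₁).symm)
  obtain ⟨φ, hφ⟩ := exists_functional_single (X := X) e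
  have := congrArg (fun z => TensorProduct.lid ℂ X.cc (TensorProduct.map φ LinearMap.id z)) hz'
  simp only [TensorProduct.map_tmul, hφ, LinearMap.id_apply, TensorProduct.lid_tmul, one_smul,
    map_zero] at this
  refine eq_zero_of_ketBra ?_
  rw [← QSet.single_val_same j (ketBra y y), this]
  rfl

theorem rightInverse_of_isHopf (h : F.IsHopf T₁ T₂) (C : QFun QSet.one X) :
    (rightInverseSentence F.1 C.1).IsTrue := by
  obtain ⟨e, c, hc, hne⟩ := C.exists_mem_ne_zero ()
  refine (rightInverseSentence_iff F.1 C.1).2 fun i η => mem_of_forall_eq_zero (fun x hx => ?_) η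
  -- In (a ⊗ 1)Δ(b) the factor a stands on the left, whereas the vanishing concerns Δ(1_e) applied
  -- after |x⟩⟨x| ⊗ 1. Taking adjoints exchanges the order.
  have hz : T₂ (star (X.single i (ketBra x x)) ⊗ₜ[ℂ] star (X.single e LinearMap.id)) = 0 := by
    refine QSet.incl_injective (star_injective ?_)
    rw [h.incl_right, map_zero, star_zero, star_mul, QSet.cc.val_star (X.single e LinearMap.id),
      map_star, star_star]
    have hs : star (fun p : X.At × X.At => TensorProduct.map
        ((star (X.single i (ketBra x x)) : X.cc).val p.1) LinearMap.id : (X.prod X).Ell) =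
        fun p : X.At × X.At => TensorProduct.map ((X.single i (ketBra x x)).val p.1) LinearMap.id := by
      funext p
      refine (TensorProduct.adjoint_map _ _).trans ?_
      rw [LinearMap.adjoint_id]
      exact congrArg (TensorProduct.map · _) (star_star ((X.single i (ketBra x x)).val p.1))
    rw [hs]
    funext p
    obtain ⟨k, j⟩ := p
    rw [Pi.mul_apply]
    dsimp only
    by_cases hk : k = i
    · subst hk
      rw [QSet.single_val_same]
      refine TensorProduct.ext' fun z y => ?_
      change F.pullback (X.single e LinearMap.id).val (k, j) (ketBra x x z ⊗ₜ[ℂ] y) = 0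
      rw [ketBra_apply, ← TensorProduct.smul_tmul', map_smul]
      have hw : F.pullback (X.single e LinearMap.id).val (k, j) (x ⊗ₜ[ℂ] y) = 0 :=
        pullback_single_eq_zero hc hne fun t ht =>
          hx ((t : X.H k ⊗[ℂ] X.H j →ₗ[ℂ] ℂ) ∘ₗ (TensorProduct.mk ℂ (X.H k) (X.H j)).flip y)
            (Submodule.subset_span ⟨j, y, t, ht, fun _ => rfl⟩)
      rw [hw, smul_zero]
    · rw [QSet.single_val_of_ne hk, TensorProduct.map_zero_left, mul_zero]
      rfl
  have hz' := congrArg star (h.bijective_right.1 (hz.trans (map_zero T₂).symm))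
  rw [TensorProduct.star_tmul, star_star, star_star, star_zero] at hz'
  obtain ⟨φ, hφ⟩ := exists_functional_single (X := X) e
  have := congrArg (fun z => TensorProduct.rid ℂ X.cc (TensorProduct.map LinearMap.id φ z)) hz'
  simp only [TensorProduct.map_tmul, hφ, LinearMap.id_apply, TensorProduct.rid_tmul, one_smul,
    map_zero] at this
  refine eq_zero_of_ketBra ?_
  rw [← QSet.single_val_same i (ketBra x x), this]
  rfl

end QFun

-- The correspondence

namespace QSet

variable {X : QSet.{u, v}}

theorem SatisfiesGroupAxioms.isDiscreteQuantumGroup {F : QFun (X.prod X) X} {C : QFun QSet.one X}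
    (h : SatisfiesGroupAxioms F C) : IsDiscreteQuantumGroup F.comult :=
  QFun.isDiscreteQuantumGroup_comult ((QFun.assocSentence_iff F).1 h.assoc)
    ((QFun.leftUnitSentence_iff F C).1 h.left_unit) ((QFun.rightUnitSentence_iff F C).1 h.right_unit)
    h.right_inverse h.left_inverse

theorem SatisfiesGroupAxioms.isCounit {F : QFun (X.prod X) X} {C : QFun QSet.one X}
    (h : SatisfiesGroupAxioms F C) : IsCounit F.comult C.pullbackScalar :=
  QFun.isCounit_pullbackScalar F.isRestriction_comult
    ((QFun.leftUnitSentence_iff F C).1 h.left_unit) ((QFun.rightUnitSentence_iff F C).1 h.right_unit)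

/-- A counit satisfies (ε ⊗ ι)T₁ = μ, with μ the multiplication, and surjectivity of T₁ leaves no
freedom for ε. -/
theorem IsDiscreteQuantumGroup.eq_of_isCounit [Nonempty X.At] {Δ : Comult X.cc}
    (hΔ : IsDiscreteQuantumGroup Δ) {ε ε' : X.cc →ₙₐ[ℂ] ℂ} (h : IsCounit Δ ε) (h' : IsCounit Δ ε') :
    ε = ε' := by
  obtain ⟨F, hF, T₁, T₂, hT⟩ := exists_isRestriction hΔ
  have key (δ : X.cc →ₙₐ[ℂ] ℂ) (hδ : IsCounit Δ δ) (z : X.cc ⊗[ℂ] X.cc) :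
      TensorProduct.lid ℂ X.cc (TensorProduct.map (δ : X.cc →ₗ[ℂ] ℂ) LinearMap.id (T₁ z)) =
        LinearMap.mul' ℂ X.cc z := by
    induction z using TensorProduct.induction_on with
    | zero => simp
    | add y z hy hz => simp only [map_add, hy, hz]
    | tmul a b => exact hδ.1 a b _ ((QFun.of_eq_mul_one_tensor_iff hF).2 (hT.incl_left a b))
  exact NonUnitalAlgHom.ext (LinearMap.congr_fun (hT.eq_of_lid_map (key ε h) (key ε' h')))

theorem _root_.QFun.eq_of_pullbackScalar {C C' : QFun QSet.one X}
    (h : C.pullbackScalar = C'.pullbackScalar) : C = C' :=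
  QFun.ext_of_pullback fun b _ => LinearMap.ext_ring (DFunLike.congr_fun h b)

theorem IsRestriction.eq_comult {F : QFun (X.prod X) X} {Δ : Comult X.cc} (h : IsRestriction Δ F) :
    F.comult = Δ :=
  NonUnitalStarAlgHom.ext fun a => (F.isRestriction_comult a).mult_ext (h a)

theorem _root_.QFun.comult_injective {F G : QFun (X.prod X) X} (h : F.comult = G.comult) : F = G :=
  QFun.ext_of_pullback fun b => congrFun <|
    (F.isRestriction_comult b).eq (h ▸ G.isRestriction_comult b)

theorem IsDiscreteQuantumGroup.exists_satisfiesGroupAxioms [Nonempty X.At] {Δ : Comult X.cc}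
    (hΔ : IsDiscreteQuantumGroup Δ) :
    ∃ (F : QFun (X.prod X) X) (C : QFun QSet.one X), SatisfiesGroupAxioms F C ∧ F.comult = Δ := by
  obtain ⟨F, hF, T₁, T₂, hT⟩ := exists_isRestriction hΔ
  obtain ⟨ε, h₁, h₂⟩ := hT.exists_counit
  -- If ε vanished, the counit identity would make all products zero, while the unit of an atom is a
  -- nonzero idempotent.
  have hε : ∃ a, ε a ≠ 0 := by
    by_contra! h0
    obtain ⟨i⟩ := ‹Nonempty X.At›
    obtain ⟨φ, hφ⟩ := QFun.exists_functional_single (X := X) i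
    have e : (ε : X.cc →ₗ[ℂ] ℂ) = 0 := LinearMap.ext h0
    have := h₁ (X.single i LinearMap.id ⊗ₜ[ℂ] X.single i LinearMap.id)
    rw [e, TensorProduct.map_zero_left, LinearMap.zero_apply, map_zero, LinearMap.mul'_apply,
      single_mul, single_val_same, LinearMap.comp_id] at this
    rw [← this, map_zero] at hφ
    exact zero_ne_one hφ
  obtain ⟨C, rfl⟩ := QFun.exists_pullbackScalar_eq ε hε
  exact ⟨F, C, {
    assoc := (QFun.assocSentence_iff F).2 (QFun.assoc_of_coassoc hT.incl_left hT.incl_right hT.coassoc)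
    right_unit := (QFun.rightUnitSentence_iff F C).2 (QFun.comp_id_prod_eq_runit hT h₂)
    left_unit := (QFun.leftUnitSentence_iff F C).2 (QFun.comp_prod_id_eq_lunit hT h₁)
    right_inverse := QFun.rightInverse_of_isHopf hT C
    left_inverse := QFun.leftInverse_of_isHopf hT C }, hF.eq_comult⟩

end QSet

end

theorem mainTheorem11 (X : QSet.{u, v}) [Nonempty X.At] :
    (∀ (F : QFun (X.prod X) X) (C : QFun QSet.one X),
      F.1.comp (F.1.prod (BinRel.id X)) =
        (F.1.comp ((BinRel.id X).prod F.1)).comp (BinRel.assoc X X X) →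
      F.1.comp (C.1.prod (BinRel.id X)) = BinRel.lunit X →
      F.1.comp ((BinRel.id X).prod C.1) = BinRel.runit X →
      (rightInverseSentence F.1 C.1).IsTrue →
      (leftInverseSentence F.1 C.1).IsTrue →
      ∃ Δ : Comult X.cc, QSet.IsRestriction Δ F ∧ QSet.IsDiscreteQuantumGroup Δ) ∧
    ∃ Φ : {p : QFun (X.prod X) X × QFun QSet.one X // QSet.SatisfiesGroupAxioms p.1 p.2} ≃
        {Δ : Comult X.cc // QSet.IsDiscreteQuantumGroup Δ},
      ∀ p, QSet.IsRestriction (Φ p).1 p.1.1 ∧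
        (∃! ε : X.cc →ₙₐ[ℂ] ℂ, IsCounit (Φ p).1 ε) ∧
        IsCounit (Φ p).1 p.1.2.pullbackScalar := by
  refine ⟨fun F C hA hL hR hr hl => ⟨F.comult, F.isRestriction_comult,
    QFun.isDiscreteQuantumGroup_comult (Subtype.ext hA) (Subtype.ext hL) (Subtype.ext hR) hr hl⟩, ?_⟩
  let Ψ : {p : QFun (X.prod X) X × QFun QSet.one X // QSet.SatisfiesGroupAxioms p.1 p.2} →
      {Δ : Comult X.cc // QSet.IsDiscreteQuantumGroup Δ} :=
    fun p => ⟨p.1.1.comult, p.2.isDiscreteQuantumGroup⟩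
  have hΨ : Function.Bijective Ψ := by
    refine ⟨fun p q hpq => ?_, fun Δ => ?_⟩
    · obtain ⟨⟨F, C⟩, h⟩ := p
      obtain ⟨⟨G, C'⟩, h'⟩ := q
      obtain rfl : F = G := QFun.comult_injective (congrArg Subtype.val hpq)
      -- Both constants give counits of the same comultiplication; uniqueness of the counit
      -- identifies them.
      obtain rfl : C = C' := QFun.eq_of_pullbackScalar
        (h.isDiscreteQuantumGroup.eq_of_isCounit h.isCounit h'.isCounit)
      rfl
    · obtain ⟨F, C, h, e⟩ := Δ.2.exists_satisfiesGroupAxioms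
      exact ⟨⟨(F, C), h⟩, Subtype.ext e⟩
  refine ⟨Equiv.ofBijective Ψ hΨ, fun p => ⟨p.1.1.isRestriction_comult, ?_, p.2.isCounit⟩⟩
  exact ⟨p.1.2.pullbackScalar, p.2.isCounit, fun ε hε =>
    (Ψ p).2.eq_of_isCounit hε p.2.isCounit⟩
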